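/- Let $\mathbb K$ be a field and $A$ a nonzero unital differential graded algebra over $\mathbb K$ (graded by $\mathbb Z$, with differential $d_A$ of degree $1$ and unit $e$). Let $W\in A^0$ be central with $d_AW=0$. Write $|a|$ for the degree, $\|a\|=|a|-1$, and $\bar A=A/\mathbb K e$. **Hochschild chains.** $\bar C_*(A)=A\otimes T(\bar A[1])$, where $a_0(a_1|\dots|a_l)$ has degree $|a_0|+\|a_1\|+\cdots+\|a_l\|$, with differential $$\begin{aligned} d(a_0(a_1|\dots|a_l)) &= d_Aa_0(a_1|\dots|a_l)+\sum_j(-1)^{\|a_0\|+\cdots+\|a_j\|}a_0(a_1|\dots|d_Aa_{j+1}|\dots|a_l)+(-1)^{|a_0|}a_0a_1(a_2|\dots|a_l)\\ &+\sum_j(-1)^{|a_0|+\|a_1\|+\cdots+\|a_{j+1}\|}a_0(a_1|\dots|a_{j+1}a_{j+2}|\dots|a_l)-(-1)^{\|a_l\|(|a_0|+\|a_1\|+\cdots+\|a_{l-1}\|)}a_la_0(a_1|\dots|a_{l-1}).\end{aligned}$$ The Connes operator is $B(a_0(a_1|\dots|a_l))=\sum_{0\le j\le l}(-1)^{(\|a_0\|+\cdots+\|a_j\|)(\|a_{j+1}\|+\cdots+\|a_l\|)}e(a_{j+1}|\dots|a_l|a_0|\dots|a_j)$.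 Put $L_W(a_0(a_1|\dots|a_l))=\sum_{0\le j\le l}(-1)^{\|a_0\|+\cdots+\|a_j\|}a_0(a_1|\dots|a_j|W|a_{j+1}|\dots|a_l)$. **The first complex.** Let $q,u$ be formal variables of degree $2$. The cyclic complex of the curved deformation $A_q$ of $A$ with curvature $qW$ is $CC_*(A_q)=\bar C_*(A)[[q,u]]$ with differential $d+qL_W-uB$. We consider $q^{-1}\mathbb K[q^{-1}]\hat\otimes_{\mathbb K[q]}CC_*(A_q)=(q^{-1}\bar C_*(A)[q^{-1}])[[u]]$. Here $q^{-1}V[q^{-1}]=V((q))/V[[q]]$, the completion is with respect to $u$ (in each degree), and the differential is again $d+qL_W-uB$. Write $\nabla_{u\partial_q}=u\partial_q+I_W$, where $I_W$ is $(q,u)$-linear with $$\begin{aligned} I_W(a_0(a_1|\dots|a_l)) &= Wa_0(a_1|\dots|a_l)\\ &-u\sum_{0\le j\le i\le l}(-1)^{(\|a_0\|+\cdots+\|a_j\|)(\|a_{j+1}\|+\cdots+\|a_l\|)+\|a_{j+1}\|+\cdots+\|a_i\|}e(a_{j+1}|\dots|a_i|W|a_{i+1}|\dots|a_l|a_0|\dots|a_j).\end{aligned}$$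 **The second complex.** Let $A_t=A[t,\epsilon]$, with $|t|=0$, $|\epsilon|=-1$, $\epsilon^2=0$, $t$ central and $\epsilon a=(-1)^{|a|}a\epsilon$. This is a dga over $\mathbb K[t]$ with differential $d_A+(t-W)\partial_\epsilon$, where $d_A$ is extended by $d_A(a\epsilon)=(d_Aa)\epsilon$, and $\partial_\epsilon(a)=0$, $\partial_\epsilon(a\epsilon)=(-1)^{|a|}a$ for $a\in A$ (both $\mathbb K[t]$-linearly). Let $CC_*(A_t)=\bar C_*(A_t)[[u]]$, with differential $d-uB$, where $\bar C_*(A_t)$, $d$ and $B$ are defined as above, but with tensor products over $\mathbb K[t]$ and using $\bar A_t=A_t/\mathbb K[t]e$. Write $\nabla_{u\partial_t}=u\partial_t+I_{\partial_\epsilon}$. Here $\partial_t$ is differentiation of chains with respect to $t$, for which chains with $a_0,\dots,a_l\in A[\epsilon]$ are constant. $I_{\partial_\epsilon}$ is $(t,u)$-linear with $$\begin{aligned} I_{\partial_\epsilon}(a_0(a_1|\dots|a_l)) &= (-1)^{\|a_l\|(|a_0|+\|a_1\|+\cdots+\|a_{l-1}\|)}(\partial_\epsilon a_l)a_0(a_1|\dots|a_{l-1})\\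 &-u\sum_{0\le j\le i<l}(-1)^{(\|a_0\|+\cdots+\|a_j\|)(\|a_{j+1}\|+\cdots+\|a_l\|)+\|a_{j+1}\|+\cdots+\|a_i\|}e(a_{j+1}|\dots|\partial_\epsilon a_{i+1}|\dots|a_l|a_0|\dots|a_j)\end{aligned}$$ (the first term is absent for $l=0$). **The shifted shuffle map.** Let $SH: q^{-1}\mathbb K[q^{-1}]\hat\otimes_{\mathbb K[q]}CC_*(A_q)\to CC_{*+2}(A_t)$ be the $u$-linear map which sends $a_0(a_1|\dots|a_l)q^{-k-1}$, for $k\ge 0$, to $(-1)^k$ times the sum of all chains obtained by inserting $k$ copies of $\epsilon$ into the word $(a_1|\dots|a_l)$, one for each choice of positions $0\le i_1\le\cdots\le i_k\le l$. **Theorem.** Both sides are complexes of graded $\mathbb K[u]$-modules. The maps $q$ (of degree $2$) and $\nabla_{u\partial_q}$ (of degree $0$) on the first, $t$ (of degree $0$) and $\nabla_{u\partial_t}$ (of degree $2$) on the second, and $SH$ (of degree $2$), are $u$-linear chain maps. Moreover: 1. $SH$ is a filtered quasi-isomorphism with respect to the $u$-filtration. This means that the map which it induces on $u=0$ reductions (the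 quotient complexes by the image of multiplication by $u$) is a quasi-isomorphism. 2. $SH\circ q=-\nabla_{u\partial_t}\circ SH$ holds strictly. 3. $SH\circ\nabla_{u\partial_q}$ and $t\circ SH$ are chain homotopic, by a $u$-linear chain homotopy. -/

import Mathlib

open scoped TensorProduct DirectSum Polynomial

set_option linter.unusedSimpArgs false
set_option linter.unusedTactic false
set_option linter.unusedSectionVars false

noncomputable section

namespace NCFourier

universe u v w

/-! ### Signs and gradings -/

/-- The sign `(-1)^p` attached to a parity `p`. -/
def sgn (p : ZMod 2) : ℤ := if p = 0 then 1 else -1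

theorem sgn_zero : sgn 0 = 1 := by decide

theorem sgn_add (p q : ZMod 2) : sgn (p + q) = sgn p * sgn q := by
  revert p q; decide

theorem sgn_add_one (p : ZMod 2) : sgn (p + 1) = -sgn p := by
  revert p; decide

theorem sgn_mul_self (p : ZMod 2) : sgn p * sgn p = 1 := by
  revert p; decide

section Grading

variable {R : Type u} [CommRing R] {A : Type v} [Ring A] [Algebra R A]
variable (𝒜 : ℤ → Submodule R A) [GradedAlgebra 𝒜]

/-- The projection of a graded algebra to its part of parity `p` (the sum of all `𝒜 n` with
`n ≡ p` modulo 2). -/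
def parityProj (p : ZMod 2) : A →ₗ[R] A :=
  (DirectSum.toModule R ℤ A fun n => if (n : ZMod 2) = p then (𝒜 n).subtype else 0) ∘ₗ
    (DirectSum.decomposeLinearEquiv 𝒜).toLinearMap

theorem parityProj_of_mem {n : ℤ} {a : A} (ha : a ∈ 𝒜 n) (p : ZMod 2) :
    parityProj 𝒜 p a = if (n : ZMod 2) = p then a else 0 := by
  have h : DirectSum.decompose 𝒜 a = DirectSum.lof R ℤ (fun i => 𝒜 i) n ⟨a, ha⟩ :=
    DirectSum.decompose_of_mem 𝒜 ha
  simp only [parityProj, LinearMap.comp_apply, LinearEquiv.coe_coe,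
    DirectSum.decomposeLinearEquiv_apply, h, DirectSum.toModule_lof]
  split_ifs <;> simp

theorem parityProj_one (p : ZMod 2) : parityProj 𝒜 p (1 : A) = if p = 0 then 1 else 0 := by
  rw [parityProj_of_mem 𝒜 (SetLike.GradedOne.one_mem (A := 𝒜)) p]
  simp [eq_comm]

/-- The map `a ↦ (-1)^{|a|} a`, on the external direct sum of the graded pieces. -/
def gradeInvAux : (⨁ n, 𝒜 n) →ₐ[R] A :=
  DirectSum.toAlgebra R (fun n => 𝒜 n) (fun n => sgn (n : ZMod 2) • (𝒜 n).subtype)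
    (by simp [sgn_zero])
    (by
      intro i j ai aj
      have : sgn ((i + j : ℤ) : ZMod 2) = sgn (i : ZMod 2) * sgn (j : ZMod 2) := by
        push_cast; exact sgn_add _ _
      change sgn ((i + j : ℤ) : ZMod 2) • ((ai : A) * (aj : A)) =
        (sgn (i : ZMod 2) • (ai : A)) * (sgn (j : ZMod 2) • (aj : A))
      rw [this, smul_mul_smul_comm])

/-- The grading automorphism `a ↦ (-1)^{|a|} a`. -/
def gradeInv : A →ₐ[R] A :=
  (gradeInvAux 𝒜).comp (DirectSum.decomposeAlgEquiv 𝒜).toAlgHom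

theorem gradeInv_of_mem {n : ℤ} {a : A} (ha : a ∈ 𝒜 n) :
    gradeInv 𝒜 a = sgn (n : ZMod 2) • a := by
  have h : DirectSum.decompose 𝒜 a = DirectSum.of (fun i => 𝒜 i) n ⟨a, ha⟩ :=
    DirectSum.decompose_of_mem 𝒜 ha
  change gradeInvAux 𝒜 (DirectSum.decompose 𝒜 a) = _
  rw [h]
  exact DirectSum.toAddMonoid_of
    (fun i : ℤ => (sgn (i : ZMod 2) • (𝒜 i).subtype).toAddMonoidHom) n ⟨a, ha⟩

/-- The structure of a differential graded algebra (with cohomological grading) on a graded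
algebra: a differential of degree `1` satisfying the graded Leibniz rule. -/
structure DGStructure where
  /-- The differential. -/
  d : A →ₗ[R] A
  d_mem : ∀ n : ℤ, ∀ a ∈ 𝒜 n, d a ∈ 𝒜 (n + 1)
  d_d : ∀ a, d (d a) = 0
  leibniz : ∀ n : ℤ, ∀ a ∈ 𝒜 n, ∀ b, d (a * b) = d a * b + sgn (n : ZMod 2) • (a * d b)

theorem DGStructure.d_one {𝒜 : ℤ → Submodule R A} [GradedAlgebra 𝒜] (D : DGStructure 𝒜) :
    D.d 1 = 0 := by
  have h := D.leibniz 0 1 (SetLike.GradedOne.one_mem (A := 𝒜)) 1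
  simpa [sgn_zero] using h

end Grading

/-! ### Sums over decompositions of a word -/

section Words

variable {X : Type u} {M : Type v} [AddCommMonoid M]

/-- `splitSum f xs` is the sum of `f ys zs` over all decompositions `xs = ys ++ zs`. -/
def splitSum (f : List X → List X → M) : List X → M
  | [] => f [] []
  | x :: xs => f [] (x :: xs) + splitSum (fun ys zs => f (x :: ys) zs) xs

/-- `elemSum f xs` is the sum of `f ys y zs` over all decompositions `xs = ys ++ y :: zs`. -/
def elemSum (f : List X → X → List X → M) : List X → M
  | [] => 0
  | x :: xs => f [] x xs + elemSum (fun ys y zs => f (x :: ys) y zs) xs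

theorem splitSum_append (f : List X → List X → M) (us : List X) (x : X) (vs : List X) :
    splitSum f (us ++ x :: vs) =
      splitSum (fun ys zs => f ys (zs ++ x :: vs)) us +
        splitSum (fun ys zs => f (us ++ x :: ys) zs) vs := by
  induction us generalizing f with
  | nil => simp [splitSum]
  | cons u us ih => simp [splitSum, ih, add_assoc]

theorem elemSum_append (f : List X → X → List X → M) (us : List X) (x : X) (vs : List X) :
    elemSum f (us ++ x :: vs) =
      elemSum (fun ys y zs => f ys y (zs ++ x :: vs)) us + f us x vs +
        elemSum (fun ys y zs => f (us ++ x :: ys) y zs) vs := by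
  induction us generalizing f with
  | nil => simp [elemSum]
  | cons u us ih => simp [elemSum, ih, add_assoc]

theorem splitSum_zero (xs : List X) : splitSum (fun _ _ => (0 : M)) xs = 0 := by
  induction xs with
  | nil => rfl
  | cons x xs ih => simp [splitSum, ih]

theorem elemSum_zero (xs : List X) : elemSum (fun _ _ _ => (0 : M)) xs = 0 := by
  induction xs with
  | nil => rfl
  | cons x xs ih => simp [elemSum, ih]

theorem splitSum_add (f g : List X → List X → M) (xs : List X) :
    splitSum (fun ys zs => f ys zs + g ys zs) xs = splitSum f xs + splitSum g xs := by
  induction xs generalizing f g with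
  | nil => rfl
  | cons x xs ih => simp only [splitSum, ih]; exact add_add_add_comm _ _ _ _

theorem elemSum_add (f g : List X → X → List X → M) (xs : List X) :
    elemSum (fun ys y zs => f ys y zs + g ys y zs) xs = elemSum f xs + elemSum g xs := by
  induction xs generalizing f g with
  | nil => simp [elemSum]
  | cons x xs ih => simp only [elemSum, ih]; exact add_add_add_comm _ _ _ _

theorem splitSum_map {N : Type w} [AddCommMonoid N] (φ : M →+ N) (f : List X → List X → M)
    (xs : List X) : splitSum (fun ys zs => φ (f ys zs)) xs = φ (splitSum f xs) := by
  induction xs generalizing f with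
  | nil => rfl
  | cons x xs ih => simp [splitSum, ih]

theorem elemSum_map {N : Type w} [AddCommMonoid N] (φ : M →+ N) (f : List X → X → List X → M)
    (xs : List X) : elemSum (fun ys y zs => φ (f ys y zs)) xs = φ (elemSum f xs) := by
  induction xs generalizing f with
  | nil => simp [elemSum]
  | cons x xs ih => simp [elemSum, ih]

end Words

/-! ### The normalized chains `A ⊗ T(Ā[1])` -/

section Chains

variable (R : Type u) [CommRing R] (A : Type v) [Ring A] [Algebra R A]

/-- The quotient `Ā = A / R e` by the line spanned by the unit. -/
abbrev ReducedPart : Type v := A ⧸ Submodule.span R {(1 : A)}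

/-- The space `A ⊗ T(Ā[1])` underlying the normalized Hochschild complex; all tensor products
are taken over the ground ring `R`. -/
abbrev Chains : Type (max u v) := A ⊗[R] TensorAlgebra R (ReducedPart R A)

variable {A}

/-- An element of `A`, seen as a one-letter word in `T(Ā[1])`. -/
def letter : A →ₗ[R] TensorAlgebra R (ReducedPart R A) :=
  TensorAlgebra.ι R ∘ₗ (Submodule.span R {(1 : A)}).mkQ

theorem letter_one : letter R (1 : A) = 0 := by
  have : (Submodule.span R {(1 : A)}).mkQ 1 = 0 := by
    rw [Submodule.mkQ_apply, Submodule.Quotient.mk_eq_zero]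
    exact Submodule.mem_span_singleton_self 1
  simp [letter, this]

/-- The word `(a₁|…|a_l)` associated to a list of elements with parities. The parities are
only used in order to write down signs. -/
def word (xs : List (ZMod 2 × A)) : TensorAlgebra R (ReducedPart R A) :=
  (xs.map fun x => letter R x.2).prod

theorem word_nil : word R ([] : List (ZMod 2 × A)) = 1 := rfl

theorem word_cons (x : ZMod 2 × A) (xs : List (ZMod 2 × A)) :
    word R (x :: xs) = letter R x.2 * word R xs := by simp [word]

theorem word_append (xs ys : List (ZMod 2 × A)) :
    word R (xs ++ ys) = word R xs * word R ys := by simp [word]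

/-- The reduced degree `‖a‖ = |a| - 1` (modulo 2) of an element with parity. -/
def rdeg {A : Type v} (x : ZMod 2 × A) : ZMod 2 := x.1 + 1

/-- The total reduced degree `‖a₁‖ + ⋯ + ‖a_l‖` (modulo 2) of a list of elements. -/
def wdeg {A : Type v} (xs : List (ZMod 2 × A)) : ZMod 2 := (xs.map rdeg).sum

theorem wdeg_nil {A : Type v} : wdeg ([] : List (ZMod 2 × A)) = 0 := rfl

theorem wdeg_cons {A : Type v} (x : ZMod 2 × A) (xs : List (ZMod 2 × A)) :
    wdeg (x :: xs) = rdeg x + wdeg xs := by simp [wdeg]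

theorem wdeg_append {A : Type v} (xs ys : List (ZMod 2 × A)) : wdeg (xs ++ ys) = wdeg xs + wdeg ys := by
  simp [wdeg]

theorem rdeg_mk {A : Type v} (p : ZMod 2) (a : A) : rdeg (p, a) = p + 1 := rfl

variable {R}
variable {M : Type w} [AddCommGroup M] [Module R M]

/-- A function of lists of elements with parities which is linear in each element, the parities
being fixed. -/
structure IsMultilin (R : Type u) [CommRing R] {A : Type v} [Ring A] [Algebra R A]
    {M : Type w} [AddCommGroup M] [Module R M] (G : List (ZMod 2 × A) → M) : Prop where
  add : ∀ us p a b vs, G (us ++ (p, a + b) :: vs) = G (us ++ (p, a) :: vs) + G (us ++ (p, b) :: vs)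
  smul : ∀ us p (r : R) a vs, G (us ++ (p, r • a) :: vs) = r • G (us ++ (p, a) :: vs)

/-- A function of lists is normalized if it vanishes when one of the elements is the unit. -/
def IsNormalized {A : Type v} [Ring A] {M : Type w} [AddCommGroup M]
    (G : List (ZMod 2 × A) → M) : Prop :=
  ∀ us vs, G (us ++ (0, 1) :: vs) = 0

variable (R A M) in
/-- The space of multilinear normalized functions of lists. -/
def Forms : Submodule R (List (ZMod 2 × A) → M) where
  carrier := {G | IsMultilin R G ∧ IsNormalized G}
  zero_mem' := ⟨⟨by simp, by simp⟩, fun _ _ => rfl⟩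
  add_mem' := by
    rintro G H ⟨hG, hG'⟩ ⟨hH, hH'⟩
    refine ⟨⟨fun us p a b vs => ?_, fun us p r a vs => ?_⟩, fun us vs => ?_⟩
    · simp only [Pi.add_apply, hG.add, hH.add]; exact add_add_add_comm _ _ _ _
    · simp only [Pi.add_apply, hG.smul, hH.smul, smul_add]
    · simp only [Pi.add_apply, hG' us vs, hH' us vs, add_zero]
  smul_mem' := by
    rintro r G ⟨hG, hG'⟩
    refine ⟨⟨fun us p a b vs => ?_, fun us p s a vs => ?_⟩, fun us vs => ?_⟩
    · simp only [Pi.smul_apply, hG.add, smul_add]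
    · simp only [Pi.smul_apply, hG.smul]; exact smul_comm r s _
    · simp only [Pi.smul_apply, hG' us vs, smul_zero]

theorem IsMultilin.zero {G : List (ZMod 2 × A) → M} (hG : IsMultilin R G) (us p vs) :
    G (us ++ (p, 0) :: vs) = 0 := by
  have h := hG.smul us p 0 0 vs
  rwa [zero_smul, zero_smul] at h

section Lift

variable (𝒜 : ℤ → Submodule R A) [GradedAlgebra 𝒜]

/-- Insertion of an element of `A` as the first element of the list, where the element is split
into its parts of parity `0` and `1`. -/
def insertElem : A →ₗ[R] Forms R A M →ₗ[R] Forms R A M :=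
  LinearMap.mk₂ R
    (fun a G => ⟨fun ys => ∑ p : ZMod 2, G.1 ((p, parityProj 𝒜 p a) :: ys), by
      refine ⟨⟨fun us q b c vs => ?_, fun us q r b vs => ?_⟩, fun us vs => ?_⟩
      · rw [← Finset.sum_add_distrib]
        exact Finset.sum_congr rfl fun p _ => G.2.1.add (_ :: us) q b c vs
      · rw [Finset.smul_sum]
        exact Finset.sum_congr rfl fun p _ => G.2.1.smul (_ :: us) q r b vs
      · exact Finset.sum_eq_zero fun p _ => G.2.2 (_ :: us) vs⟩)
    (fun a b G => by
      ext ys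
      simp only [map_add, Submodule.coe_add, Pi.add_apply, ← Finset.sum_add_distrib]
      exact Finset.sum_congr rfl fun p _ => G.2.1.add [] p _ _ ys)
    (fun r a G => by
      ext ys
      simp only [map_smul, Submodule.coe_smul, Pi.smul_apply, Finset.smul_sum]
      exact Finset.sum_congr rfl fun p _ => G.2.1.smul [] p r _ ys)
    (fun a G H => by
      ext ys
      simp only [Submodule.coe_add, Pi.add_apply, Finset.sum_add_distrib])
    (fun r a G => by
      ext ys
      simp only [Submodule.coe_smul, Pi.smul_apply, Finset.smul_sum])

theorem insertElem_apply (a : A) (G : Forms R A M) (ys : List (ZMod 2 × A)) :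
    (insertElem 𝒜 a G).1 ys = ∑ p : ZMod 2, G.1 ((p, parityProj 𝒜 p a) :: ys) := rfl

theorem insertElem_of_mem {n : ℤ} {a : A} (ha : a ∈ 𝒜 n) (G : Forms R A M)
    (ys : List (ZMod 2 × A)) : (insertElem 𝒜 a G).1 ys = G.1 (((n : ZMod 2), a) :: ys) := by
  rw [insertElem_apply, Finset.sum_eq_single (n : ZMod 2)]
  · rw [parityProj_of_mem 𝒜 ha, if_pos rfl]
  · intro p _ hp
    rw [parityProj_of_mem 𝒜 ha, if_neg hp.symm]
    exact G.2.1.zero [] p ys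
  · simp

theorem insertElem_one : insertElem (M := M) 𝒜 1 = 0 := by
  ext G ys
  rw [insertElem_of_mem 𝒜 (SetLike.GradedOne.one_mem (A := 𝒜))]
  simpa using G.2.2 [] ys

/-- The map of `Ā` induced by a linear map of `A` which vanishes on the unit. -/
def descend {N : Type w} [AddCommGroup N] [Module R N] (f : A →ₗ[R] N) (hf : f 1 = 0) :
    ReducedPart R A →ₗ[R] N :=
  Submodule.liftQ (Submodule.span R {(1 : A)}) f
    (by rw [Submodule.span_singleton_le_iff_mem, LinearMap.mem_ker]; exact hf)

/-- The descent of `insertElem` to `Ā`. -/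
def insertLetter : ReducedPart R A →ₗ[R] Module.End R (Forms R A M) :=
  descend (N := Forms R A M →ₗ[R] Forms R A M) (insertElem (M := M) 𝒜) (insertElem_one 𝒜)

/-- The (right) action of `T(Ā[1])` on forms by insertion of words. -/
def insertWord : TensorAlgebra R (ReducedPart R A) →ₐ[R] (Module.End R (Forms R A M))ᵐᵒᵖ :=
  TensorAlgebra.lift R ((MulOpposite.opLinearEquiv R).toLinearMap ∘ₗ insertLetter (M := M) 𝒜)

variable (R A M) in
/-- A formula which to `a₀(a₁|…|a_l)` (given as elements with parities) associates an element
of `M`, linear in each `aᵢ` and vanishing if one of `a₁,…,a_l` is the unit. -/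
structure ChainFormula where
  /-- The formula. -/
  toFun : ZMod 2 × A → List (ZMod 2 × A) → M
  head_add : ∀ p a b xs, toFun (p, a + b) xs = toFun (p, a) xs + toFun (p, b) xs
  head_smul : ∀ p (r : R) a xs, toFun (p, r • a) xs = r • toFun (p, a) xs
  multilin : ∀ x, IsMultilin R (toFun x)
  normalized : ∀ x, IsNormalized (toFun x)

/-- A formula as a linear map from `A` to forms. -/
def ChainFormula.toForms (F : ChainFormula R A M) (p : ZMod 2) : A →ₗ[R] Forms R A M where
  toFun a := ⟨F.toFun (p, a), F.multilin _, F.normalized _⟩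
  map_add' a b := by ext xs; exact F.head_add p a b xs
  map_smul' r a := by ext xs; exact F.head_smul p r a xs

/-- The linear map `A ⊗ T(Ā[1]) → M` given by a formula on homogeneous elements. -/
def ChainFormula.lift (F : ChainFormula R A M) : Chains R A →ₗ[R] M :=
  TensorProduct.lift (LinearMap.mk₂ R
    (fun a w => ((insertWord 𝒜 w).unop
      (∑ p : ZMod 2, F.toForms p (parityProj 𝒜 p a))).1 [])
    (fun a b w => by simp [Finset.sum_add_distrib])
    (fun r a w => by simp [Finset.smul_sum])
    (fun a w w' => by simp [Finset.sum_add_distrib])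
    (fun r a w => by simp [Finset.smul_sum]))

/-- On homogeneous elements, `F.lift` is indeed given by the formula. -/
theorem ChainFormula.lift_apply (F : ChainFormula R A M) {n : ℤ} {a : A} (ha : a ∈ 𝒜 n)
    (ws : List (ℤ × A)) (hws : ∀ w ∈ ws, w.2 ∈ 𝒜 w.1) :
    F.lift 𝒜 (a ⊗ₜ[R] word R (ws.map fun w => ((w.1 : ZMod 2), w.2))) =
      F.toFun ((n : ZMod 2), a) (ws.map fun w => ((w.1 : ZMod 2), w.2)) := by
  have key : ∀ (ws : List (ℤ × A)) (_ : ∀ w ∈ ws, w.2 ∈ 𝒜 w.1) (G : Forms R A M),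
      ((insertWord 𝒜 (word R (ws.map fun w => ((w.1 : ZMod 2), w.2)))).unop G).1 [] =
        G.1 (ws.map fun w => ((w.1 : ZMod 2), w.2)) := by
    intro ws
    induction ws with
    | nil => intro _ G; simp [word_nil]
    | cons w ws ih =>
      intro h G
      have h1 : insertWord (M := M) 𝒜 (letter R w.2) = MulOpposite.op (insertElem 𝒜 w.2) := by
        simp [insertWord, letter, insertLetter, descend]
      rw [List.map_cons, word_cons, map_mul, MulOpposite.unop_mul, Module.End.mul_apply, h1,
        ih (fun w' hw' => h w' (List.mem_cons_of_mem _ hw')), MulOpposite.unop_op,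
        insertElem_of_mem 𝒜 (h w List.mem_cons_self)]
  rw [ChainFormula.lift, TensorProduct.lift.tmul, LinearMap.mk₂_apply, key ws hws,
    Finset.sum_eq_single (n : ZMod 2)]
  · rw [parityProj_of_mem 𝒜 ha, if_pos rfl]; rfl
  · intro p _ hp
    rw [parityProj_of_mem 𝒜 ha, if_neg hp.symm, map_zero]
  · simp

end Lift


/-! ### Multilinearity of sums over decompositions -/

section SumForms

theorem splitSum_smul {X : Type v} (r : R) (f : List X → List X → M) (xs : List X) :
    splitSum (fun ys zs => r • f ys zs) xs = r • splitSum f xs :=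
  splitSum_map (DistribSMul.toAddMonoidHom M r) f xs

theorem elemSum_smul {X : Type v} (r : R) (f : List X → X → List X → M) (xs : List X) :
    elemSum (fun ys y zs => r • f ys y zs) xs = r • elemSum f xs :=
  elemSum_map (DistribSMul.toAddMonoidHom M r) f xs

theorem IsMultilin.splitSum {f : List (ZMod 2 × A) → List (ZMod 2 × A) → M}
    (h₁ : ∀ ys, IsMultilin R (f ys)) (h₂ : ∀ zs, IsMultilin R fun ys => f ys zs) :
    IsMultilin R (splitSum f) := by
  refine ⟨fun us p a b vs => ?_, fun us p r a vs => ?_⟩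
  · simp only [splitSum_append, fun ys zs => (h₁ ys).add zs p a b vs,
      fun ys zs => (h₂ zs).add us p a b ys, splitSum_add]
    abel
  · simp only [splitSum_append, fun ys zs => (h₁ ys).smul zs p r a vs,
      fun ys zs => (h₂ zs).smul us p r a ys, splitSum_smul, smul_add]

theorem IsNormalized.splitSum {f : List (ZMod 2 × A) → List (ZMod 2 × A) → M}
    (h₁ : ∀ ys, IsNormalized (f ys)) (h₂ : ∀ zs, IsNormalized fun ys => f ys zs) :
    IsNormalized (splitSum f) := by
  intro us vs
  have e₁ : ∀ ys zs, f ys (zs ++ (0, 1) :: vs) = 0 := fun ys zs => h₁ ys zs vs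
  have e₂ : ∀ ys zs, f (us ++ (0, 1) :: ys) zs = 0 := fun ys zs => h₂ zs us ys
  simp only [splitSum_append, e₁, e₂, splitSum_zero, add_zero]

theorem IsMultilin.elemSum {f : List (ZMod 2 × A) → ZMod 2 × A → List (ZMod 2 × A) → M}
    (h₁ : ∀ ys y, IsMultilin R (f ys y)) (h₂ : ∀ y zs, IsMultilin R fun ys => f ys y zs)
    (h₃ : ∀ ys p a b zs, f ys (p, a + b) zs = f ys (p, a) zs + f ys (p, b) zs)
    (h₄ : ∀ ys p (r : R) a zs, f ys (p, r • a) zs = r • f ys (p, a) zs) :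
    IsMultilin R (elemSum f) := by
  refine ⟨fun us p a b vs => ?_, fun us p r a vs => ?_⟩
  · simp only [elemSum_append, fun ys y zs => (h₁ ys y).add zs p a b vs,
      fun ys y zs => (h₂ y zs).add us p a b ys, h₃, elemSum_add]
    abel
  · simp only [elemSum_append, fun ys y zs => (h₁ ys y).smul zs p r a vs,
      fun ys y zs => (h₂ y zs).smul us p r a ys, h₄, elemSum_smul, smul_add]

theorem IsNormalized.elemSum {f : List (ZMod 2 × A) → ZMod 2 × A → List (ZMod 2 × A) → M}
    (h₁ : ∀ ys y, IsNormalized (f ys y)) (h₂ : ∀ y zs, IsNormalized fun ys => f ys y zs)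
    (h₃ : ∀ ys zs, f ys (0, 1) zs = 0) : IsNormalized (elemSum f) := by
  intro us vs
  have e₁ : ∀ ys y zs, f ys y (zs ++ (0, 1) :: vs) = 0 := fun ys y zs => h₁ ys y zs vs
  have e₂ : ∀ ys y zs, f (us ++ (0, 1) :: ys) y zs = 0 := fun ys y zs => h₂ y zs us ys
  simp only [elemSum_append, e₁, e₂, elemSum_zero, h₃, add_zero]

end SumForms

/-! ### Operations on normalized chains -/

section Operations

theorem word_add (us : List (ZMod 2 × A)) (p a b vs) :
    word R (us ++ (p, a + b) :: vs) = word R (us ++ (p, a) :: vs) + word R (us ++ (p, b) :: vs) := by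
  simp only [word_append, word_cons, map_add, add_mul, mul_add]

theorem word_smul (us : List (ZMod 2 × A)) (p) (r : R) (a vs) :
    word R (us ++ (p, r • a) :: vs) = r • word R (us ++ (p, a) :: vs) := by
  simp only [word_append, word_cons, map_smul, smul_mul_assoc, mul_smul_comm]

theorem word_one (us : List (ZMod 2 × A)) (vs) : word R (us ++ (0, 1) :: vs) = 0 := by
  simp only [word_append, word_cons, letter_one, zero_mul, mul_zero]

theorem wdeg_slot {A : Type v} (us : List (ZMod 2 × A)) (p a vs) :
    wdeg (us ++ (p, a) :: vs) = wdeg us + (p + 1 + wdeg vs) := by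
  simp only [wdeg_append, wdeg_cons, rdeg]

theorem IsMultilin.addForm {G H : List (ZMod 2 × A) → M} (hG : IsMultilin R G)
    (hH : IsMultilin R H) : IsMultilin R fun xs => G xs + H xs := by
  refine ⟨fun us p a b vs => ?_, fun us p r a vs => ?_⟩
  · simp only [hG.add, hH.add]; abel
  · simp only [hG.smul, hH.smul, smul_add]

theorem IsMultilin.subForm {G H : List (ZMod 2 × A) → M} (hG : IsMultilin R G)
    (hH : IsMultilin R H) : IsMultilin R fun xs => G xs - H xs := by
  refine ⟨fun us p a b vs => ?_, fun us p r a vs => ?_⟩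
  · simp only [hG.add, hH.add]; abel
  · simp only [hG.smul, hH.smul, smul_sub]

theorem IsNormalized.addForm {G H : List (ZMod 2 × A) → M} (hG : IsNormalized G)
    (hH : IsNormalized H) : IsNormalized fun xs => G xs + H xs := by
  intro us vs
  simp only [hG us vs, hH us vs, add_zero]

theorem IsMultilin.sgnForm {g : List (ZMod 2 × A) → ZMod 2} {G : List (ZMod 2 × A) → M}
    (hg : ∀ us p a b vs, g (us ++ (p, a) :: vs) = g (us ++ (p, b) :: vs))
    (hG : IsMultilin R G) : IsMultilin R fun xs => sgn (g xs) • G xs := by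
  refine ⟨fun us p a b vs => ?_, fun us p r a vs => ?_⟩
  · simp only [hG.add, smul_add, hg us p (a + b) 0 vs, hg us p a 0 vs, hg us p b 0 vs]
  · simp only [hG.smul, hg us p (r • a) 0 vs, hg us p a 0 vs, smul_comm _ r]

theorem IsNormalized.sgnForm (g : List (ZMod 2 × A) → ZMod 2) {G : List (ZMod 2 × A) → M}
    (hG : IsNormalized G) : IsNormalized fun xs => sgn (g xs) • G xs := by
  intro us vs
  simp only [hG us vs, smul_zero]

/-- For `zs` empty, the term `(-1)^{‖y‖(|x|+‖y₁‖+⋯+‖y_r‖)} y x (y₁|…|y_r)`; and zero otherwise.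
It is used for terms in which the last element `y` of a word is moved to the front. -/
def lastTerm (x : ZMod 2 × A) (ys : List (ZMod 2 × A)) (y : ZMod 2 × A) :
    List (ZMod 2 × A) → Chains R A
  | [] => sgn (rdeg y * (x.1 + wdeg ys)) • ((y.2 * x.2) ⊗ₜ[R] word R ys)
  | _ :: _ => 0

theorem lastTerm_slot (x : ZMod 2 × A) (ys y us z vs) :
    lastTerm (R := R) x ys y (us ++ z :: vs) = 0 := by
  cases us <;> rfl

/-- For `zs = z :: zs'`, the term `(-1)^{|x|+‖y₁‖+⋯+‖y_r‖+‖y‖} x(y₁|…|y_r|yz|zs')`; and zero if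
`zs` is empty. -/
def mergeTerm (x : ZMod 2 × A) (ys : List (ZMod 2 × A)) (y : ZMod 2 × A) :
    List (ZMod 2 × A) → Chains R A
  | [] => 0
  | z :: zs => sgn (x.1 + wdeg ys + rdeg y) •
      (x.2 ⊗ₜ[R] (word R ys * letter R (y.2 * z.2) * word R zs))

/-- For `as = a₁ :: as'`, the term `(-1)^{|a₀|} a₀a₁(as')`; and zero if `as` is empty. -/
def firstTerm (x : ZMod 2 × A) : List (ZMod 2 × A) → Chains R A
  | [] => 0
  | y :: ys => sgn x.1 • ((x.2 * y.2) ⊗ₜ[R] word R ys)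

theorem lastTerm_multilin (x : ZMod 2 × A) :
    IsMultilin R (elemSum (lastTerm (R := R) x)) := by
  refine IsMultilin.elemSum (fun ys y => ⟨fun us p a b vs => ?_, fun us p r a vs => ?_⟩)
    (fun y zs => ⟨fun us p a b vs => ?_, fun us p r a vs => ?_⟩)
    (fun ys p a b zs => ?_) (fun ys p r a zs => ?_)
  · simp only [lastTerm_slot, add_zero]
  · simp only [lastTerm_slot, smul_zero]
  · cases zs <;> simp only [lastTerm, word_add, wdeg_slot, TensorProduct.tmul_add, smul_add,
      add_zero]
  · cases zs <;> simp only [lastTerm, word_smul, wdeg_slot, TensorProduct.tmul_smul, smul_zero,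
      smul_comm _ r]
  · cases zs <;> simp only [lastTerm, rdeg, add_mul, TensorProduct.add_tmul, smul_add, add_zero]
  · cases zs <;> simp only [lastTerm, rdeg, smul_mul_assoc, ← TensorProduct.smul_tmul',
      smul_zero, smul_comm _ r]

theorem mergeTerm_multilin (x : ZMod 2 × A) :
    IsMultilin R (elemSum (mergeTerm (R := R) x)) := by
  refine IsMultilin.elemSum (fun ys y => ⟨fun us p a b vs => ?_, fun us p r a vs => ?_⟩)
    (fun y zs => ⟨fun us p a b vs => ?_, fun us p r a vs => ?_⟩)
    (fun ys p a b zs => ?_) (fun ys p r a zs => ?_)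
  · cases us <;> simp only [List.nil_append, List.cons_append, mergeTerm, word_add, mul_add,
      map_add, add_mul, TensorProduct.tmul_add, smul_add]
  · cases us <;> simp only [List.nil_append, List.cons_append, mergeTerm, word_smul,
      mul_smul_comm, map_smul, smul_mul_assoc, TensorProduct.tmul_smul, smul_comm _ r]
  · cases zs <;> simp only [mergeTerm, word_add, wdeg_slot, add_mul, TensorProduct.tmul_add,
      smul_add, add_zero]
  · cases zs <;> simp only [mergeTerm, word_smul, wdeg_slot, smul_mul_assoc,
      TensorProduct.tmul_smul, smul_zero, smul_comm _ r]
  · cases zs <;> simp only [mergeTerm, rdeg, map_add, mul_add, add_mul, TensorProduct.tmul_add,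
      smul_add, add_zero]
  · cases zs <;> simp only [mergeTerm, rdeg, map_smul, mul_smul_comm, smul_mul_assoc,
      TensorProduct.tmul_smul, smul_zero, smul_comm _ r]

theorem firstTerm_multilin (x : ZMod 2 × A) : IsMultilin R (firstTerm (R := R) x) := by
  refine ⟨fun us p a b vs => ?_, fun us p r a vs => ?_⟩
  · cases us <;> simp only [List.nil_append, List.cons_append, firstTerm, word_add, mul_add,
      TensorProduct.add_tmul, TensorProduct.tmul_add, smul_add]
  · cases us <;> simp only [List.nil_append, List.cons_append, firstTerm, word_smul,
      mul_smul_comm, ← TensorProduct.smul_tmul', TensorProduct.tmul_smul, smul_comm _ r]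

theorem firstTerm_one (x : ZMod 2 × A) (us vs) : firstTerm (R := R) x (us ++ (0, 1) :: vs) =
    if us = [] then sgn x.1 • (x.2 ⊗ₜ[R] word R vs) else 0 := by
  cases us <;> simp [firstTerm, word_one]

theorem mergeTerm_one (x : ZMod 2 × A) (us vs) :
    elemSum (mergeTerm (R := R) x) (us ++ (0, 1) :: vs) =
      (if us = [] then 0 else sgn (x.1 + wdeg us) • (x.2 ⊗ₜ[R] (word R us * word R vs))) -
        (if vs = [] then 0 else sgn (x.1 + wdeg us) • (x.2 ⊗ₜ[R] (word R us * word R vs))) := by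
  have e₁ : ∀ ys y zs, mergeTerm (R := R) x (us ++ (0, 1) :: ys) y zs = 0 := by
    intro ys y zs
    cases zs <;> simp [mergeTerm, word_one]
  have e₂ : mergeTerm (R := R) x us (0, 1) vs =
      -(if vs = [] then 0 else sgn (x.1 + wdeg us) • (x.2 ⊗ₜ[R] (word R us * word R vs))) := by
    cases vs with
    | nil => simp [mergeTerm]
    | cons v vs => simp [mergeTerm, rdeg, sgn_add_one, word_cons, mul_assoc]
  have e₃ : elemSum (fun ys y zs => mergeTerm (R := R) x ys y (zs ++ (0, 1) :: vs)) us =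
      if us = [] then 0 else sgn (x.1 + wdeg us) • (x.2 ⊗ₜ[R] (word R us * word R vs)) := by
    rcases List.eq_nil_or_concat us with rfl | ⟨us', w, rfl⟩
    · simp [elemSum]
    · rw [List.concat_eq_append, elemSum_append]
      have e₄ : ∀ ys y zs, mergeTerm (R := R) x ys y ((zs ++ [w]) ++ (0, 1) :: vs) = 0 := by
        intro ys y zs
        cases zs with
        | nil => simp [mergeTerm, word_cons, letter_one]
        | cons z zs => simp [mergeTerm, word_one, word_append, word_cons, letter_one]
      simp only [e₄, elemSum_zero]
      simp [elemSum, mergeTerm, word_append, word_cons, word_nil, wdeg_append, wdeg_cons,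
        wdeg_nil, add_assoc]
  rw [elemSum_append, e₃, e₂]
  simp only [e₁, elemSum_zero, add_zero, sub_eq_add_neg]

theorem lastTerm_one (x : ZMod 2 × A) (us vs) :
    elemSum (lastTerm (R := R) x) (us ++ (0, 1) :: vs) =
      if vs = [] then sgn (x.1 + wdeg us) • (x.2 ⊗ₜ[R] word R us) else 0 := by
  have e₁ : ∀ ys y zs, lastTerm (R := R) x (us ++ (0, 1) :: ys) y zs = 0 := by
    intro ys y zs
    cases zs <;> simp [lastTerm, word_one]
  rw [elemSum_append]
  simp only [e₁, lastTerm_slot, elemSum_zero, add_zero, zero_add]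
  cases vs <;> simp [lastTerm, rdeg]

/-- The formula for the part of the Hochschild differential which involves the multiplication:
`(-1)^{|a₀|} a₀a₁(a₂|…|a_l)`, plus the sum over `j` of
`(-1)^{|a₀|+‖a₁‖+⋯+‖a_{j+1}‖} a₀(a₁|…|a_{j+1}a_{j+2}|…|a_l)`, minus
`(-1)^{‖a_l‖(|a₀|+‖a₁‖+⋯+‖a_{l-1}‖)} a_la₀(a₁|…|a_{l-1})`. -/
def mulFormula : ChainFormula R A (Chains R A) where
  toFun x as := firstTerm x as + elemSum (mergeTerm x) as - elemSum (lastTerm x) as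
  head_add p a b xs := by
    have e₁ : firstTerm (R := R) (p, a + b) xs = firstTerm (p, a) xs + firstTerm (p, b) xs := by
      cases xs <;> simp only [firstTerm, add_mul, TensorProduct.add_tmul, smul_add, add_zero]
    have e₂ : mergeTerm (R := R) (p, a + b) = fun ys y zs =>
        mergeTerm (p, a) ys y zs + mergeTerm (p, b) ys y zs := by
      funext ys y zs
      cases zs <;> simp only [mergeTerm, TensorProduct.add_tmul, smul_add, add_zero]
    have e₃ : lastTerm (R := R) (p, a + b) = fun ys y zs =>
        lastTerm (p, a) ys y zs + lastTerm (p, b) ys y zs := by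
      funext ys y zs
      cases zs <;> simp only [lastTerm, mul_add, TensorProduct.add_tmul, smul_add, add_zero]
    rw [e₁, e₂, e₃, elemSum_add, elemSum_add]
    abel
  head_smul p r a xs := by
    have e₁ : firstTerm (R := R) (p, r • a) xs = r • firstTerm (p, a) xs := by
      cases xs <;> simp only [firstTerm, smul_mul_assoc, ← TensorProduct.smul_tmul', smul_zero,
        smul_comm _ r]
    have e₂ : mergeTerm (R := R) (p, r • a) = fun ys y zs =>
        r • mergeTerm (p, a) ys y zs := by
      funext ys y zs
      cases zs <;> simp only [mergeTerm, ← TensorProduct.smul_tmul', smul_zero, smul_comm _ r]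
    have e₃ : lastTerm (R := R) (p, r • a) = fun ys y zs =>
        r • lastTerm (p, a) ys y zs := by
      funext ys y zs
      cases zs <;> simp only [lastTerm, mul_smul_comm, ← TensorProduct.smul_tmul', smul_zero,
        smul_comm _ r]
    rw [e₁, e₂, e₃, elemSum_smul, elemSum_smul, smul_sub, smul_add]
  multilin x :=
    ((firstTerm_multilin x).addForm (mergeTerm_multilin x)).subForm (lastTerm_multilin x)
  normalized x := by
    intro us vs
    simp only [firstTerm_one, mergeTerm_one, lastTerm_one]
    by_cases hu : us = [] <;> by_cases hv : vs = [] <;> simp [hu, hv, word_nil, wdeg_nil]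

/-- The formula for the action `L_φ` of a linear map `φ : A → A` of odd degree with
`φ(e) = 0`: `a₀(a₁|…|a_l)` goes to `φ(a₀)(a₁|…|a_l)` plus the sum over `j` of
`(-1)^{‖a₀‖+⋯+‖a_j‖} a₀(a₁|…|φ(a_{j+1})|…|a_l)`. -/
def lieDerFormula (φ : A →ₗ[R] A) (hφ : φ 1 = 0) : ChainFormula R A (Chains R A) where
  toFun x as :=
    φ x.2 ⊗ₜ[R] word R as +
      elemSum (fun ys y zs =>
        sgn (rdeg x + wdeg ys) • (x.2 ⊗ₜ[R] (word R ys * letter R (φ y.2) * word R zs))) as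
  head_add p a b xs := by
    simp only [map_add, TensorProduct.add_tmul, smul_add, rdeg, elemSum_add]
    abel
  head_smul p r a xs := by
    simp only [map_smul, ← TensorProduct.smul_tmul', smul_comm _ r, rdeg, elemSum_smul, smul_add]
  multilin x := by
    refine IsMultilin.addForm ⟨fun us p a b vs => ?_, fun us p r a vs => ?_⟩
      (IsMultilin.elemSum (fun ys y => ⟨fun us p a b vs => ?_, fun us p r a vs => ?_⟩)
      (fun y zs => ⟨fun us p a b vs => ?_, fun us p r a vs => ?_⟩)
      (fun ys p a b zs => ?_) (fun ys p r a zs => ?_))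
    all_goals first
      | (simp only [word_add, wdeg_slot, rdeg, map_add, mul_add, add_mul, TensorProduct.tmul_add,
          TensorProduct.add_tmul, smul_add]; done)
      | (simp only [word_smul, wdeg_slot, rdeg, map_smul, smul_mul_assoc, mul_smul_comm,
          TensorProduct.tmul_smul, ← TensorProduct.smul_tmul', smul_comm _ r]; done)
  normalized x := by
    refine IsNormalized.addForm (fun us vs => ?_)
      (IsNormalized.elemSum (fun ys y us vs => ?_) (fun y zs us vs => ?_) (fun ys zs => ?_))
    all_goals simp only [word_one, hφ, map_zero, mul_zero, zero_mul, TensorProduct.tmul_zero,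
      smul_zero]

/-- The formula for the action `L_W` of an element `W` of even degree: the sum over `j` of
`(-1)^{‖a₀‖+⋯+‖a_j‖} a₀(a₁|…|a_j|W|a_{j+1}|…|a_l)`. -/
def lieElemFormula (W : A) : ChainFormula R A (Chains R A) where
  toFun x as :=
    splitSum (fun ys zs =>
      sgn (rdeg x + wdeg ys) • (x.2 ⊗ₜ[R] (word R ys * letter R W * word R zs))) as
  head_add p a b xs := by
    simp only [rdeg, map_add, add_mul, mul_add, TensorProduct.add_tmul, TensorProduct.tmul_add,
      smul_add, splitSum_add, elemSum_add]
  head_smul p r a xs := by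
    simp only [rdeg, map_smul, smul_mul_assoc, mul_smul_comm, ← TensorProduct.smul_tmul',
      TensorProduct.tmul_smul, smul_comm _ r, splitSum_smul, elemSum_smul]
  multilin x := by
    refine IsMultilin.splitSum (fun ys => ⟨fun us p a b vs => ?_, fun us p r a vs => ?_⟩)
      (fun zs => ⟨fun us p a b vs => ?_, fun us p r a vs => ?_⟩)
    all_goals first
      | (simp only [word_add, wdeg_slot, rdeg, map_add, mul_add, add_mul, TensorProduct.tmul_add,
          TensorProduct.add_tmul, smul_add]; done)
      | (simp only [word_smul, wdeg_slot, rdeg, map_smul, smul_mul_assoc, mul_smul_comm,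
          TensorProduct.tmul_smul, ← TensorProduct.smul_tmul', smul_comm _ r]; done)
  normalized x := by
    refine IsNormalized.splitSum (fun ys us vs => ?_) (fun zs us vs => ?_)
    all_goals simp only [word_one, letter_one, map_zero, mul_zero, zero_mul,
      TensorProduct.tmul_zero, smul_zero]

/-- The formula for `ι_W`, where `W` is an element of even degree: `W a₀(a₁|…|a_l)`. -/
def iotaElemFormula (W : A) : ChainFormula R A (Chains R A) where
  toFun x as := (W * x.2) ⊗ₜ[R] word R as
  head_add p a b xs := by
    simp only [rdeg, map_add, add_mul, mul_add, TensorProduct.add_tmul, TensorProduct.tmul_add,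
      smul_add, splitSum_add, elemSum_add]
  head_smul p r a xs := by
    simp only [rdeg, map_smul, smul_mul_assoc, mul_smul_comm, ← TensorProduct.smul_tmul',
      TensorProduct.tmul_smul, smul_comm _ r, splitSum_smul, elemSum_smul]
  multilin x := by
    refine ⟨fun us p a b vs => ?_, fun us p r a vs => ?_⟩
    all_goals first
      | (simp only [word_add, wdeg_slot, rdeg, map_add, mul_add, add_mul, TensorProduct.tmul_add,
          TensorProduct.add_tmul, smul_add]; done)
      | (simp only [word_smul, wdeg_slot, rdeg, map_smul, smul_mul_assoc, mul_smul_comm,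
          TensorProduct.tmul_smul, ← TensorProduct.smul_tmul', smul_comm _ r]; done)
  normalized x := by
    intro us vs
    all_goals simp only [word_one, letter_one, map_zero, mul_zero, zero_mul,
      TensorProduct.tmul_zero, smul_zero]

/-- The formula for the `u`-term (without the factor of `-u`) of `I_W`, where `W` is an element
of even degree: the sum over `j ≤ i` of
`(-1)^{(‖a₀‖+⋯+‖a_j‖)(‖a_{j+1}‖+⋯+‖a_l‖) + (‖a_{j+1}‖+⋯+‖a_i‖)}
e(a_{j+1}|…|a_i|W|a_{i+1}|…|a_l|a₀|…|a_j)`. -/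
def cyclicElemFormula (W : A) : ChainFormula R A (Chains R A) where
  toFun x as :=
    splitSum (fun ys zs => sgn ((rdeg x + wdeg ys) * wdeg zs) •
      splitSum (fun bs cs => sgn (wdeg bs) •
        ((1 : A) ⊗ₜ[R] (word R bs * letter R W * word R cs * letter R x.2 * word R ys))) zs) as
  head_add p a b xs := by
    simp only [rdeg, map_add, add_mul, mul_add, TensorProduct.add_tmul, TensorProduct.tmul_add,
      smul_add, splitSum_add, elemSum_add]
  head_smul p r a xs := by
    simp only [rdeg, map_smul, smul_mul_assoc, mul_smul_comm, ← TensorProduct.smul_tmul',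
      TensorProduct.tmul_smul, smul_comm _ r, splitSum_smul, elemSum_smul]
  multilin x := by
    refine IsMultilin.splitSum (fun ys => IsMultilin.sgnForm (fun us p a b vs => ?_)
      (IsMultilin.splitSum (fun bs => ⟨fun us p a b vs => ?_, fun us p r a vs => ?_⟩)
        (fun cs => ⟨fun us p a b vs => ?_, fun us p r a vs => ?_⟩)))
      (fun zs => IsMultilin.sgnForm (fun us p a b vs => ?_)
        ⟨fun us p a b vs => ?_, fun us p r a vs => ?_⟩)
    all_goals first
      | (simp only [wdeg_slot]; done)
      | (simp only [word_add, wdeg_slot, rdeg, mul_add, add_mul, TensorProduct.tmul_add,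
          smul_add, splitSum_add]; done)
      | (simp only [word_smul, wdeg_slot, rdeg, smul_mul_assoc, mul_smul_comm,
          TensorProduct.tmul_smul, smul_comm _ r, splitSum_smul]; done)
  normalized x := by
    refine IsNormalized.splitSum (fun ys => IsNormalized.sgnForm _
      (IsNormalized.splitSum (fun bs us vs => ?_) (fun cs us vs => ?_)))
      (fun zs => IsNormalized.sgnForm _ (fun us vs => ?_))
    all_goals simp only [word_one, mul_zero, zero_mul, TensorProduct.tmul_zero, smul_zero,
      splitSum_zero]

/-- The formula for `ι_φ`, where `φ : A → A` is a linear map of degree `1` with `φ(e) = 0`: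
`(-1)^{‖a_l‖(|a₀|+‖a₁‖+⋯+‖a_{l-1}‖)} φ(a_l) a₀(a₁|…|a_{l-1})` (zero for `l = 0`). -/
def iotaDerFormula (φ : A →ₗ[R] A) (hφ : φ 1 = 0) : ChainFormula R A (Chains R A) where
  toFun x as := elemSum (fun ys y zs => lastTerm x ys (y.1, φ y.2) zs) as
  head_add p a b xs := by
    have e : ∀ ys y zs, lastTerm (R := R) (p, a + b) ys y zs =
        lastTerm (p, a) ys y zs + lastTerm (p, b) ys y zs := by
      intro ys y zs
      cases zs <;> simp only [lastTerm, mul_add, TensorProduct.add_tmul, smul_add, add_zero]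
    simp only [e, elemSum_add]
  head_smul p r a xs := by
    have e : ∀ ys y zs, lastTerm (R := R) (p, r • a) ys y zs = r • lastTerm (p, a) ys y zs := by
      intro ys y zs
      cases zs <;> simp only [lastTerm, mul_smul_comm, ← TensorProduct.smul_tmul', smul_zero,
        smul_comm _ r]
    simp only [e, elemSum_smul]
  multilin x := by
    refine IsMultilin.elemSum (fun ys y => ⟨fun us p a b vs => ?_, fun us p r a vs => ?_⟩)
      (fun y zs => ⟨fun us p a b vs => ?_, fun us p r a vs => ?_⟩)
      (fun ys p a b zs => ?_) (fun ys p r a zs => ?_)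
    · simp only [lastTerm_slot, add_zero]
    · simp only [lastTerm_slot, smul_zero]
    · cases zs <;> simp only [lastTerm, word_add, wdeg_slot, TensorProduct.tmul_add, smul_add,
        add_zero]
    · cases zs <;> simp only [lastTerm, word_smul, wdeg_slot, TensorProduct.tmul_smul, smul_zero,
        smul_comm _ r]
    · cases zs <;> simp only [lastTerm, rdeg, map_add, add_mul, TensorProduct.add_tmul, smul_add,
        add_zero]
    · cases zs <;> simp only [lastTerm, rdeg, map_smul, smul_mul_assoc,
        ← TensorProduct.smul_tmul', smul_zero, smul_comm _ r]
  normalized x := by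
    refine IsNormalized.elemSum (fun ys y us vs => ?_) (fun y zs us vs => ?_) (fun ys zs => ?_)
    · exact lastTerm_slot _ _ _ _ _ _
    · cases zs <;> simp only [lastTerm, word_one, TensorProduct.tmul_zero, smul_zero]
    · cases zs <;> simp only [lastTerm, hφ, zero_mul, TensorProduct.zero_tmul, smul_zero]

/-- The formula for the `u`-term (without the factor of `-u`) of `I_φ`, where `φ : A → A` is a
linear map of degree `1` with `φ(e) = 0`: the sum over `j ≤ i < l` of
`(-1)^{(‖a₀‖+⋯+‖a_j‖)(‖a_{j+1}‖+⋯+‖a_l‖) + (‖a_{j+1}‖+⋯+‖a_i‖)}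
e(a_{j+1}|…|φ(a_{i+1})|…|a_l|a₀|…|a_j)`. -/
def cyclicDerFormula (φ : A →ₗ[R] A) (hφ : φ 1 = 0) : ChainFormula R A (Chains R A) where
  toFun x as :=
    splitSum (fun ys zs => sgn ((rdeg x + wdeg ys) * wdeg zs) •
      elemSum (fun bs c cs => sgn (wdeg bs) •
        ((1 : A) ⊗ₜ[R]
          (word R bs * letter R (φ c.2) * word R cs * letter R x.2 * word R ys))) zs) as
  head_add p a b xs := by
    simp only [rdeg, map_add, add_mul, mul_add, TensorProduct.add_tmul, TensorProduct.tmul_add,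
      smul_add, splitSum_add, elemSum_add]
  head_smul p r a xs := by
    simp only [rdeg, map_smul, smul_mul_assoc, mul_smul_comm, ← TensorProduct.smul_tmul',
      TensorProduct.tmul_smul, smul_comm _ r, splitSum_smul, elemSum_smul]
  multilin x := by
    refine IsMultilin.splitSum (fun ys => IsMultilin.sgnForm (fun us p a b vs => ?_)
      (IsMultilin.elemSum (fun bs c => ⟨fun us p a b vs => ?_, fun us p r a vs => ?_⟩)
        (fun c cs => ⟨fun us p a b vs => ?_, fun us p r a vs => ?_⟩)
        (fun bs p a b cs => ?_) (fun bs p r a cs => ?_)))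
      (fun zs => IsMultilin.sgnForm (fun us p a b vs => ?_)
        ⟨fun us p a b vs => ?_, fun us p r a vs => ?_⟩)
    all_goals first
      | (simp only [wdeg_slot]; done)
      | (simp only [word_add, wdeg_slot, map_add, mul_add, add_mul, TensorProduct.tmul_add,
          smul_add, elemSum_add]; done)
      | (simp only [word_smul, wdeg_slot, map_smul, smul_mul_assoc, mul_smul_comm,
          TensorProduct.tmul_smul, smul_comm _ r, elemSum_smul]; done)
  normalized x := by
    refine IsNormalized.splitSum (fun ys => IsNormalized.sgnForm _
      (IsNormalized.elemSum (fun bs c us vs => ?_) (fun c cs us vs => ?_) (fun bs cs => ?_)))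
      (fun zs => IsNormalized.sgnForm _ (fun us vs => ?_))
    all_goals simp only [word_one, hφ, map_zero, mul_zero, zero_mul, TensorProduct.tmul_zero,
      smul_zero, elemSum_zero]

/-- The formula for the Connes operator: the sum over `j` of
`(-1)^{(‖a₀‖+⋯+‖a_j‖)(‖a_{j+1}‖+⋯+‖a_l‖)} e(a_{j+1}|…|a_l|a₀|…|a_j)`. -/
def connesFormula : ChainFormula R A (Chains R A) where
  toFun x as :=
    splitSum (fun ys zs => sgn ((rdeg x + wdeg ys) * wdeg zs) •
      ((1 : A) ⊗ₜ[R] (word R zs * letter R x.2 * word R ys))) as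
  head_add p a b xs := by
    simp only [rdeg, map_add, add_mul, mul_add, TensorProduct.add_tmul, TensorProduct.tmul_add,
      smul_add, splitSum_add, elemSum_add]
  head_smul p r a xs := by
    simp only [rdeg, map_smul, smul_mul_assoc, mul_smul_comm, ← TensorProduct.smul_tmul',
      TensorProduct.tmul_smul, smul_comm _ r, splitSum_smul, elemSum_smul]
  multilin x := by
    refine IsMultilin.splitSum (fun ys => ⟨fun us p a b vs => ?_, fun us p r a vs => ?_⟩)
      (fun zs => ⟨fun us p a b vs => ?_, fun us p r a vs => ?_⟩)
    all_goals first
      | (simp only [word_add, wdeg_slot, rdeg, map_add, mul_add, add_mul, TensorProduct.tmul_add,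
          TensorProduct.add_tmul, smul_add]; done)
      | (simp only [word_smul, wdeg_slot, rdeg, map_smul, smul_mul_assoc, mul_smul_comm,
          TensorProduct.tmul_smul, ← TensorProduct.smul_tmul', smul_comm _ r]; done)
  normalized x := by
    refine IsNormalized.splitSum (fun ys us vs => ?_) (fun zs us vs => ?_)
    all_goals simp only [word_one, letter_one, map_zero, mul_zero, zero_mul,
      TensorProduct.tmul_zero, smul_zero]


end Operations

end Chains

/-! ### The Hochschild and cyclic operators -/

section Operators

variable {R : Type u} [CommRing R] {A : Type v} [Ring A] [Algebra R A]
variable (𝒜 : ℤ → Submodule R A) [GradedAlgebra 𝒜]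

/-- The degree `n` part of the normalized chains: it is spanned by the `a₀(a₁|…|a_l)` with
`aᵢ` homogeneous and `|a₀| + ‖a₁‖ + ⋯ + ‖a_l‖ = n`, where `‖a‖ = |a| - 1`. -/
def chainsDeg (n : ℤ) : Submodule R (Chains R A) :=
  Submodule.span R {x | ∃ (m : ℤ) (a : A) (ws : List (ℤ × A)), a ∈ 𝒜 m ∧
    (∀ w ∈ ws, w.2 ∈ 𝒜 w.1) ∧ m + (ws.map fun w => w.1 - 1).sum = n ∧
    x = a ⊗ₜ[R] word R (ws.map fun w => ((w.1 : ZMod 2), w.2))}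

variable {𝒜} in
/-- The differential of the normalized Hochschild complex. -/
def DGStructure.hochschild (D : DGStructure 𝒜) : Chains R A →ₗ[R] Chains R A :=
  (lieDerFormula D.d D.d_one).lift 𝒜 + mulFormula.lift 𝒜

/-- The Connes operator. -/
def connes : Chains R A →ₗ[R] Chains R A := connesFormula.lift 𝒜

/-- The operator `L_W` on chains, for `W` an element of even degree. -/
def lieElem (W : A) : Chains R A →ₗ[R] Chains R A := (lieElemFormula W).lift 𝒜

/-- The operator `ι_W` on chains, for `W` an element of even degree. -/
def iotaElem (W : A) : Chains R A →ₗ[R] Chains R A := (iotaElemFormula W).lift 𝒜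

/-- The operator `J_W` on chains, for `W` an element of even degree, such that
`I_W = ι_W - u J_W`. -/
def cyclicElem (W : A) : Chains R A →ₗ[R] Chains R A := (cyclicElemFormula W).lift 𝒜

/-- The operator `ι_φ` on chains, for `φ` a map of degree `1`. -/
def iotaDer (φ : A →ₗ[R] A) (hφ : φ 1 = 0) : Chains R A →ₗ[R] Chains R A :=
  (iotaDerFormula φ hφ).lift 𝒜

/-- The operator `J_φ` on chains, for `φ` a map of degree `1`, such that
`I_φ = ι_φ - u J_φ`. -/
def cyclicDer (φ : A →ₗ[R] A) (hφ : φ 1 = 0) : Chains R A →ₗ[R] Chains R A :=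
  (cyclicDerFormula φ hφ).lift 𝒜

variable {𝒜} in
/-- A central cocycle of degree zero in a differential graded algebra. -/
structure CentralCocycle (D : DGStructure 𝒜) where
  /-- The underlying element. -/
  val : A
  mem : val ∈ 𝒜 0
  d_val : D.d val = 0
  central : ∀ a, val * a = a * val

end Operators

/-! ### The dga `A_t = A[t,ε]` -/

section Koszul

/-- The map of polynomials obtained by applying a linear map to the coefficients. -/
def polyMap {K : Type u} [CommRing K] {A : Type v} [Ring A] [Algebra K A] (f : A →ₗ[K] A) :
    A[X] →ₗ[K] A[X] :=
  Polynomial.lsum fun k => (Polynomial.monomial k).restrictScalars K ∘ₗ f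

theorem polyMap_coeff {K : Type u} [CommRing K] {A : Type v} [Ring A] [Algebra K A]
    (f : A →ₗ[K] A) (p : A[X]) (k : ℕ) : (polyMap f p).coeff k = f (p.coeff k) := by
  induction p using Polynomial.induction_on' with
  | add p q hp hq => simp only [map_add, Polynomial.coeff_add, hp, hq]
  | monomial n a =>
    simp only [polyMap, Polynomial.lsum_apply, LinearMap.comp_apply,
      LinearMap.coe_restrictScalars]
    rw [Polynomial.sum_monomial_index]
    · simp only [Polynomial.coeff_monomial]; split_ifs <;> simp
    · simp

theorem polyMap_map_mul {K : Type u} [CommRing K] {A : Type v} [Ring A] [Algebra K A]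
    (f : A →ₗ[K] A) (r : K[X]) (p : A[X]) :
    polyMap f (r.map (algebraMap K A) * p) = r.map (algebraMap K A) * polyMap f p := by
  ext k
  simp only [polyMap_coeff, Polynomial.coeff_mul, map_sum, Polynomial.coeff_map,
    ← Algebra.smul_def, map_smul]

variable {K : Type u} [Field K] {A : Type v} [Ring A] [Algebra K A]
variable (𝒜 : ℤ → Submodule K A) [GradedAlgebra 𝒜]

/-- The algebra `A[t,ε]`, where `|t| = 0` and `|ε| = -1`. Its elements are written as `c + eε`,
with `c` and `e` polynomials in `t`. -/
@[ext] structure KoszulAlg (𝒜 : ℤ → Submodule K A) : Type v where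
  /-- The `ε`-independent part. -/
  c : A[X]
  /-- The coefficient of `ε`. -/
  e : A[X]

namespace KoszulAlg

instance : Zero (KoszulAlg 𝒜) := ⟨⟨0, 0⟩⟩

instance : Add (KoszulAlg 𝒜) := ⟨fun x y => ⟨x.c + y.c, x.e + y.e⟩⟩

instance : Neg (KoszulAlg 𝒜) := ⟨fun x => ⟨-x.c, -x.e⟩⟩

@[simp] theorem zero_c : (0 : KoszulAlg 𝒜).c = 0 := rfl
@[simp] theorem zero_e : (0 : KoszulAlg 𝒜).e = 0 := rfl
@[simp] theorem add_c (x y : KoszulAlg 𝒜) : (x + y).c = x.c + y.c := rfl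
@[simp] theorem add_e (x y : KoszulAlg 𝒜) : (x + y).e = x.e + y.e := rfl
@[simp] theorem neg_c (x : KoszulAlg 𝒜) : (-x).c = -x.c := rfl
@[simp] theorem neg_e (x : KoszulAlg 𝒜) : (-x).e = -x.e := rfl

instance : AddCommGroup (KoszulAlg 𝒜) where
  add_assoc x y z := by ext1 <;> simp [add_assoc]
  zero_add x := by ext1 <;> simp
  add_zero x := by ext1 <;> simp
  add_comm x y := by ext1 <;> simp [add_comm]
  neg_add_cancel x := by ext1 <;> simp
  nsmul := nsmulRec
  zsmul := zsmulRec

instance : Module K (KoszulAlg 𝒜) where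
  smul r x := ⟨r • x.c, r • x.e⟩
  one_smul x := KoszulAlg.ext (one_smul K x.c) (one_smul K x.e)
  mul_smul r s x := KoszulAlg.ext (mul_smul r s x.c) (mul_smul r s x.e)
  smul_zero r := KoszulAlg.ext (smul_zero r) (smul_zero r)
  smul_add r x y := KoszulAlg.ext (smul_add r x.c y.c) (smul_add r x.e y.e)
  add_smul r s x := KoszulAlg.ext (add_smul r s x.c) (add_smul r s x.e)
  zero_smul x := KoszulAlg.ext (zero_smul K x.c) (zero_smul K x.e)

@[simp] theorem smul_c (r : K) (x : KoszulAlg 𝒜) : (r • x).c = r • x.c := rfl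
@[simp] theorem smul_e (r : K) (x : KoszulAlg 𝒜) : (r • x).e = r • x.e := rfl

/-- The automorphism `a ↦ (-1)^{|a|} a` of `A[t]`. -/
def sigma : A[X] →+* A[X] := Polynomial.mapRingHom (gradeInv 𝒜 : A →+* A)

theorem sigma_coeff (p : A[X]) (k : ℕ) : (sigma 𝒜 p).coeff k = gradeInv 𝒜 (p.coeff k) := by
  simp [sigma]

theorem sigma_map (r : K[X]) :
    sigma 𝒜 (r.map (algebraMap K A)) = r.map (algebraMap K A) := by
  ext k
  simp [sigma]

theorem map_comm (r : K[X]) (p : A[X]) :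
    r.map (algebraMap K A) * p = p * r.map (algebraMap K A) := by
  ext k
  rw [Polynomial.coeff_mul, ← Finset.Nat.sum_antidiagonal_swap, Polynomial.coeff_mul]
  simp [Algebra.commutes]

/-- The product is determined by `ε a = (-1)^{|a|} a ε` and `ε² = 0`. -/
instance : Mul (KoszulAlg 𝒜) :=
  ⟨fun x y => ⟨x.c * y.c, x.c * y.e + x.e * sigma 𝒜 y.c⟩⟩

instance : One (KoszulAlg 𝒜) := ⟨⟨1, 0⟩⟩

@[simp] theorem mul_c (x y : KoszulAlg 𝒜) : (x * y).c = x.c * y.c := rfl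
@[simp] theorem mul_e (x y : KoszulAlg 𝒜) :
    (x * y).e = x.c * y.e + x.e * sigma 𝒜 y.c := rfl
@[simp] theorem one_c : (1 : KoszulAlg 𝒜).c = 1 := rfl
@[simp] theorem one_e : (1 : KoszulAlg 𝒜).e = 0 := rfl

instance : Ring (KoszulAlg 𝒜) :=
  { (inferInstance : AddCommGroup (KoszulAlg 𝒜)), (inferInstance : Mul (KoszulAlg 𝒜)),
    (inferInstance : One (KoszulAlg 𝒜)) with
    left_distrib := fun x y z => by
      ext1 <;> simp only [mul_c, mul_e, add_c, add_e, map_add, mul_add]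
      abel
    right_distrib := fun x y z => by
      ext1 <;> simp only [mul_c, mul_e, add_c, add_e, add_mul]
      abel
    zero_mul := fun x => by ext1 <;> simp
    mul_zero := fun x => by ext1 <;> simp
    mul_assoc := fun x y z => by
      ext1 <;> simp only [mul_c, mul_e, map_mul, add_mul, mul_add, mul_assoc, add_assoc]
    one_mul := fun x => by ext1 <;> simp
    mul_one := fun x => by ext1 <;> simp }

/-- The structure of `A[t,ε]` as an algebra over `K[t]`. -/
instance : Algebra K[X] (KoszulAlg 𝒜) where
  smul r x := ⟨r.map (algebraMap K A) * x.c, r.map (algebraMap K A) * x.e⟩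
  algebraMap :=
    { toFun := fun r => ⟨r.map (algebraMap K A), 0⟩
      map_one' := by ext1 <;> simp
      map_mul' := fun r s => by ext1 <;> simp
      map_zero' := by ext1 <;> simp
      map_add' := fun r s => by ext1 <;> simp }
  commutes' r x := by
    ext1
    · exact map_comm r x.c
    · change r.map (algebraMap K A) * x.e + 0 * _ =
        x.c * 0 + x.e * sigma 𝒜 (r.map (algebraMap K A))
      rw [sigma_map, map_comm, zero_mul, mul_zero, zero_add, add_zero]
  smul_def' r x := by
    ext1
    · rfl
    · change r.map (algebraMap K A) * x.e = r.map (algebraMap K A) * x.e + 0 * _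
      rw [zero_mul, add_zero]

@[simp] theorem poly_smul_c (r : K[X]) (x : KoszulAlg 𝒜) :
    (r • x).c = r.map (algebraMap K A) * x.c := rfl
@[simp] theorem poly_smul_e (r : K[X]) (x : KoszulAlg 𝒜) :
    (r • x).e = r.map (algebraMap K A) * x.e := rfl

instance : IsScalarTower K K[X] (KoszulAlg 𝒜) := ⟨fun r s x => by
  have h : (r • s).map (algebraMap K A) = r • s.map (algebraMap K A) := by
    ext k
    simp [Algebra.smul_def]
  ext1 <;> simp only [poly_smul_c, poly_smul_e, smul_c, smul_e, h, smul_mul_assoc]⟩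

instance : SMulCommClass K[X] K (KoszulAlg 𝒜) := ⟨fun s r x => by
  ext1 <;> simp [mul_smul_comm]⟩

/-! The grading of `A[t,ε]`. -/

/-- The degree `n` part of `A[t,ε]`. -/
def gr (n : ℤ) : Submodule K[X] (KoszulAlg 𝒜) where
  carrier := {x | ∀ k, x.c.coeff k ∈ 𝒜 n ∧ x.e.coeff k ∈ 𝒜 (n + 1)}
  zero_mem' k := by simp
  add_mem' hx hy k := by
    simpa using ⟨add_mem (hx k).1 (hy k).1, add_mem (hx k).2 (hy k).2⟩
  smul_mem' r x hx k := by
    simp only [poly_smul_c, poly_smul_e, Polynomial.coeff_mul, Polynomial.coeff_map,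
      ← Algebra.smul_def]
    exact ⟨sum_mem fun p _ => Submodule.smul_mem _ _ (hx _).1,
      sum_mem fun p _ => Submodule.smul_mem _ _ (hx _).2⟩

theorem gradeInv_mem {n : ℤ} {a : A} (ha : a ∈ 𝒜 n) : gradeInv 𝒜 a ∈ 𝒜 n := by
  rw [gradeInv_of_mem 𝒜 ha]
  exact zsmul_mem ha _

instance : SetLike.GradedMonoid (gr 𝒜) where
  one_mem k := by
    simp only [one_c, one_e, Polynomial.coeff_one, Polynomial.coeff_zero, zero_mem, and_true]
    split_ifs
    · exact SetLike.GradedOne.one_mem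
    · exact zero_mem _
  mul_mem m n x y hx hy k := by
    simp only [mul_c, mul_e, Polynomial.coeff_add, Polynomial.coeff_mul, sigma_coeff]
    refine ⟨sum_mem fun p _ => SetLike.GradedMul.mul_mem (hx _).1 (hy _).1, add_mem
      (sum_mem fun p _ => ?_) (sum_mem fun p _ => ?_)⟩
    · rw [add_assoc]
      exact SetLike.GradedMul.mul_mem (hx _).1 (hy _).2
    · rw [add_right_comm]
      exact SetLike.GradedMul.mul_mem (hx _).2 (gradeInv_mem 𝒜 (hy _).1)

/-- The projection of `A[t,ε]` to its degree `n` part. -/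
def proj (n : ℤ) : KoszulAlg 𝒜 →+ KoszulAlg 𝒜 where
  toFun x := ⟨polyMap (GradedAlgebra.proj 𝒜 n) x.c, polyMap (GradedAlgebra.proj 𝒜 (n + 1)) x.e⟩
  map_zero' := by ext1 <;> simp
  map_add' x y := by ext1 <;> simp

theorem proj_of_mem {m : ℤ} {x : KoszulAlg 𝒜} (hx : x ∈ gr 𝒜 m) (n : ℤ) :
    proj 𝒜 n x = if m = n then x else 0 := by
  have h : ∀ (m n : ℤ) (a : A), a ∈ 𝒜 m → GradedAlgebra.proj 𝒜 n a = if m = n then a else 0 := by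
    intro m n a ha
    split_ifs with hmn
    · subst hmn
      exact DirectSum.decompose_of_mem_same 𝒜 ha
    · exact DirectSum.decompose_of_mem_ne 𝒜 ha hmn
  ext k
  · change (polyMap (GradedAlgebra.proj 𝒜 n) x.c).coeff k = _
    rw [polyMap_coeff, h m n _ (hx k).1]
    split_ifs <;> simp
  · change (polyMap (GradedAlgebra.proj 𝒜 (n + 1)) x.e).coeff k = _
    rw [polyMap_coeff, h (m + 1) (n + 1) _ (hx k).2]
    simp only [add_left_inj]
    split_ifs <;> simp

theorem homogeneous_induction {P : KoszulAlg 𝒜 → Prop} (h₀ : P 0)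
    (h_add : ∀ x y, P x → P y → P (x + y)) (h_mem : ∀ n, ∀ x ∈ gr 𝒜 n, P x)
    (x : KoszulAlg 𝒜) : P x := by
  have hc : ∀ p : A[X], P ⟨p, 0⟩ := by
    intro p
    induction p using Polynomial.induction_on' with
    | add p q hp hq =>
      have := h_add _ _ hp hq
      rwa [show (⟨p, 0⟩ + ⟨q, 0⟩ : KoszulAlg 𝒜) = ⟨p + q, 0⟩ by ext1 <;> simp] at this
    | monomial k a =>
      induction a using DirectSum.Decomposition.inductionOn 𝒜 with
      | zero => rwa [Polynomial.monomial_zero_right]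
      | @homogeneous n a =>
        refine h_mem n _ fun l => ?_
        simp only [Polynomial.coeff_monomial, Polynomial.coeff_zero, zero_mem, and_true]
        split_ifs
        exacts [a.2, zero_mem _]
      | add a b ha hb =>
        have := h_add _ _ ha hb
        rwa [show (⟨Polynomial.monomial k a, 0⟩ + ⟨Polynomial.monomial k b, 0⟩ : KoszulAlg 𝒜) =
          ⟨Polynomial.monomial k (a + b), 0⟩ by ext1 <;> simp] at this
  have he : ∀ p : A[X], P ⟨0, p⟩ := by
    intro p
    induction p using Polynomial.induction_on' with
    | add p q hp hq =>
      have := h_add _ _ hp hq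
      rwa [show (⟨0, p⟩ + ⟨0, q⟩ : KoszulAlg 𝒜) = ⟨0, p + q⟩ by ext1 <;> simp] at this
    | monomial k a =>
      induction a using DirectSum.Decomposition.inductionOn 𝒜 with
      | zero => rwa [Polynomial.monomial_zero_right]
      | @homogeneous n a =>
        refine h_mem (n - 1) _ fun l => ?_
        simp only [Polynomial.coeff_monomial, Polynomial.coeff_zero, zero_mem, true_and,
          sub_add_cancel]
        split_ifs
        exacts [a.2, zero_mem _]
      | add a b ha hb =>
        have := h_add _ _ ha hb
        rwa [show (⟨0, Polynomial.monomial k a⟩ + ⟨0, Polynomial.monomial k b⟩ : KoszulAlg 𝒜) =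
          ⟨0, Polynomial.monomial k (a + b)⟩ by ext1 <;> simp] at this
  have := h_add _ _ (hc x.c) (he x.e)
  rwa [show (⟨x.c, 0⟩ + ⟨0, x.e⟩ : KoszulAlg 𝒜) = x by ext1 <;> simp] at this

theorem isInternal : DirectSum.IsInternal (gr 𝒜) := by
  constructor
  · rw [injective_iff_map_eq_zero]
    intro x hx
    have key : ∀ (n : ℤ) (x : ⨁ n, gr 𝒜 n),
        proj 𝒜 n (DirectSum.coeAddMonoidHom (gr 𝒜) x) = x n := by
      intro n x
      induction x using DirectSum.induction_on with
      | zero => simp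
      | of m x =>
        rw [DirectSum.coeAddMonoidHom_of, proj_of_mem 𝒜 x.2]
        split_ifs with h
        · subst h
          rw [DirectSum.of_eq_same]
        · rw [DirectSum.of_eq_of_ne _ _ _ (Ne.symm h)]
          rfl
      | add x y hx hy => rw [map_add, map_add, hx, hy]; rfl
    ext1 n
    apply Subtype.ext
    rw [← key n x, hx, map_zero]
    rfl
  · intro x
    induction x using homogeneous_induction with
    | h₀ => exact ⟨0, map_zero _⟩
    | h_add x y hx hy =>
      obtain ⟨a, rfl⟩ := hx
      obtain ⟨b, rfl⟩ := hy
      exact ⟨a + b, map_add _ _ _⟩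
    | h_mem n x hx => exact ⟨DirectSum.of (fun n => gr 𝒜 n) n ⟨x, hx⟩, DirectSum.coeAddMonoidHom_of _ _ _⟩

instance : GradedAlgebra (gr 𝒜) :=
  { (inferInstance : SetLike.GradedMonoid (gr 𝒜)),
    (isInternal 𝒜).chooseDecomposition with }

/-! The structure maps of `A[t,ε]`. -/

/-- The inclusion of `A` into `A[t,ε]`. -/
def incl : A →ₗ[K] KoszulAlg 𝒜 where
  toFun a := ⟨Polynomial.C a, 0⟩
  map_add' a b := by ext1 <;> simp
  map_smul' r a := by ext1 <;> simp [Polynomial.smul_C]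

/-- The element `ε`. -/
def eps : KoszulAlg 𝒜 := ⟨0, 1⟩

/-- The derivation `∂_ε`, which maps `bε` to `(-1)^{|b|} b`. -/
def depsilon : KoszulAlg 𝒜 →ₗ[K[X]] KoszulAlg 𝒜 where
  toFun x := ⟨sigma 𝒜 x.e, 0⟩
  map_add' x y := by ext1 <;> simp
  map_smul' r x := by ext1 <;> simp [sigma_map]

theorem depsilon_one : depsilon 𝒜 1 = 0 := by ext1 <;> simp [depsilon]

/-- The derivation `∂_t`. -/
def dt : KoszulAlg 𝒜 →ₗ[K] KoszulAlg 𝒜 where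
  toFun x := ⟨Polynomial.derivative x.c, Polynomial.derivative x.e⟩
  map_add' x y := by ext1 <;> simp
  map_smul' r x := by ext1 <;> simp [Polynomial.derivative_smul]

theorem dt_one : dt 𝒜 1 = 0 := by ext1 <;> simp [dt]

theorem dt_smul (r : K[X]) (x : KoszulAlg 𝒜) :
    dt 𝒜 (r • x) = r • dt 𝒜 x + Polynomial.derivative r • x := by
  ext1 <;> simp [dt, Polynomial.derivative_map, add_comm]

variable {𝒜} in
/-- The map of `A[t,ε]` which is `d_A` on the coefficients. -/
def dCoeff (D : DGStructure 𝒜) : KoszulAlg 𝒜 →ₗ[K[X]] KoszulAlg 𝒜 where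
  toFun x := ⟨polyMap D.d x.c, polyMap D.d x.e⟩
  map_add' x y := by ext1 <;> simp
  map_smul' r x := by ext1 <;> simp [polyMap_map_mul]

theorem zsmul_c (z : ℤ) (x : KoszulAlg 𝒜) : (z • x).c = z • x.c :=
  map_zsmul (⟨⟨KoszulAlg.c, rfl⟩, fun _ _ => rfl⟩ : KoszulAlg 𝒜 →+ A[X]) z x

theorem zsmul_e (z : ℤ) (x : KoszulAlg 𝒜) : (z • x).e = z • x.e :=
  map_zsmul (⟨⟨KoszulAlg.e, rfl⟩, fun _ _ => rfl⟩ : KoszulAlg 𝒜 →+ A[X]) z x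

theorem sigma_of_mem {n : ℤ} {p : A[X]} (hp : ∀ k, p.coeff k ∈ 𝒜 n) :
    sigma 𝒜 p = sgn (n : ZMod 2) • p := by
  ext k
  rw [sigma_coeff, gradeInv_of_mem 𝒜 (hp k), Polynomial.coeff_smul]

theorem gradeInv_gradeInv (a : A) : gradeInv 𝒜 (gradeInv 𝒜 a) = a := by
  induction a using DirectSum.Decomposition.inductionOn 𝒜 with
  | zero => simp
  | @homogeneous n a =>
    rw [gradeInv_of_mem 𝒜 a.2, map_zsmul, gradeInv_of_mem 𝒜 a.2, smul_smul, sgn_mul_self,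
      one_smul]
  | add a b ha hb => simp only [map_add, ha, hb]

theorem sigma_sigma (p : A[X]) : sigma 𝒜 (sigma 𝒜 p) = p := by
  ext k
  rw [sigma_coeff, sigma_coeff, gradeInv_gradeInv]

theorem sgn_cast_add_one (n : ℤ) : sgn ((n + 1 : ℤ) : ZMod 2) = -sgn (n : ZMod 2) := by
  push_cast
  exact sgn_add_one _

section DG

variable {𝒜} (D : DGStructure 𝒜)

theorem d_gradeInv (a : A) : D.d (gradeInv 𝒜 a) = -gradeInv 𝒜 (D.d a) := by
  induction a using DirectSum.Decomposition.inductionOn 𝒜 with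
  | zero => simp
  | @homogeneous n a =>
    rw [gradeInv_of_mem 𝒜 a.2, map_zsmul, gradeInv_of_mem 𝒜 (D.d_mem n _ a.2),
      sgn_cast_add_one, neg_smul, neg_neg]
  | add a b ha hb => simp only [map_add, ha, hb, neg_add]

theorem polyMap_sigma (p : A[X]) :
    polyMap D.d (sigma 𝒜 p) = -sigma 𝒜 (polyMap D.d p) := by
  ext k
  simp only [polyMap_coeff, sigma_coeff, Polynomial.coeff_neg, d_gradeInv]

theorem polyMap_mul {n : ℤ} {p : A[X]} (hp : ∀ k, p.coeff k ∈ 𝒜 n) (q : A[X]) :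
    polyMap D.d (p * q) = polyMap D.d p * q + sgn (n : ZMod 2) • (p * polyMap D.d q) := by
  ext k
  simp only [polyMap_coeff, Polynomial.coeff_mul, Polynomial.coeff_add, Polynomial.coeff_smul,
    map_sum, Finset.smul_sum, ← Finset.sum_add_distrib]
  exact Finset.sum_congr rfl fun i _ => D.leibniz n _ (hp _) _

theorem polyMap_polyMap (p : A[X]) : polyMap D.d (polyMap D.d p) = 0 := by
  ext k
  simp only [polyMap_coeff, D.d_d, Polynomial.coeff_zero]

variable {D} (W : CentralCocycle D)

/-- The element `t - W` of `A[t]`. -/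
def tw : A[X] := Polynomial.X - Polynomial.C W.val

theorem tw_mem (k : ℕ) : (tw W).coeff k ∈ 𝒜 0 := by
  rw [tw, Polynomial.coeff_sub, Polynomial.coeff_X, Polynomial.coeff_C]
  refine sub_mem ?_ ?_ <;> split_ifs
  exacts [SetLike.GradedOne.one_mem, zero_mem _, W.mem, zero_mem _]

theorem tw_comm (p : A[X]) : tw W * p = p * tw W := by
  have h : Polynomial.C W.val * p = p * Polynomial.C W.val := by
    ext k
    rw [Polynomial.coeff_C_mul, Polynomial.coeff_mul_C, W.central]
  rw [tw, sub_mul, mul_sub, h, Polynomial.X_mul]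

theorem polyMap_tw_mul (p : A[X]) : polyMap D.d (tw W * p) = tw W * polyMap D.d p := by
  have h : polyMap D.d (tw W) = 0 := by
    ext k
    rw [polyMap_coeff, tw, Polynomial.coeff_sub, Polynomial.coeff_X, Polynomial.coeff_C]
    split_ifs <;> simp [D.d_one, W.d_val]
  rw [polyMap_mul D (tw_mem W), h, zero_mul, zero_add, Int.cast_zero, sgn_zero, one_smul]

theorem sigma_tw : sigma 𝒜 (tw W) = tw W := by
  rw [sigma_of_mem 𝒜 (tw_mem W), Int.cast_zero, sgn_zero, one_smul]

/-- Left multiplication with `t - W`, where `W` is a central cocycle. -/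
def mulTW : KoszulAlg 𝒜 →ₗ[K[X]] KoszulAlg 𝒜 where
  toFun x := ⟨tw W * x.c, tw W * x.e⟩
  map_add' x y := by ext1 <;> simp [mul_add]
  map_smul' r x := by
    ext1 <;> simp only [poly_smul_c, poly_smul_e, RingHom.id_apply] <;>
      rw [← mul_assoc, ← map_comm, mul_assoc]

/-- The differential `d_A + (t - W) ∂_ε` on `A[t,ε]`. -/
def dKoszul : KoszulAlg 𝒜 →ₗ[K[X]] KoszulAlg 𝒜 := dCoeff D + mulTW W ∘ₗ depsilon 𝒜

theorem dKoszul_c (x : KoszulAlg 𝒜) :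
    (dKoszul W x).c = polyMap D.d x.c + tw W * sigma 𝒜 x.e := rfl

theorem dKoszul_e (x : KoszulAlg 𝒜) : (dKoszul W x).e = polyMap D.d x.e := by
  change polyMap D.d x.e + tw W * 0 = _
  rw [mul_zero, add_zero]

/-- The dga structure of `A_t = A[t,ε]`. -/
def dgStructure : DGStructure (gr 𝒜) where
  d := dKoszul W
  d_mem n x hx k := by
    rw [dKoszul_c, dKoszul_e, Polynomial.coeff_add, polyMap_coeff, polyMap_coeff,
      Polynomial.coeff_mul]
    refine ⟨add_mem (D.d_mem n _ (hx k).1) (sum_mem fun p _ => ?_), D.d_mem _ _ (hx k).2⟩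
    rw [sigma_coeff, ← zero_add (n + 1)]
    refine SetLike.GradedMul.mul_mem (tw_mem W _) (gradeInv_mem 𝒜 ?_)
    exact (hx _).2
  d_d x := by
    ext1
    · rw [dKoszul_c, dKoszul_c, dKoszul_e, map_add, polyMap_polyMap, polyMap_tw_mul,
        polyMap_sigma, mul_neg, zero_add, neg_add_cancel]
      rfl
    · rw [dKoszul_e, dKoszul_e, polyMap_polyMap]
      rfl
  leibniz n x hx y := by
    have hc : ∀ k, x.c.coeff k ∈ 𝒜 n := fun k => (hx k).1
    have he : ∀ k, x.e.coeff k ∈ 𝒜 (n + 1) := fun k => (hx k).2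
    have hl : ∀ p q : A[X], tw W * (p * q) = p * (tw W * q) := fun p q => by
      rw [← mul_assoc, tw_comm, mul_assoc]
    ext1
    · simp only [dKoszul_c, mul_c, mul_e, add_c, map_add, map_mul, sigma_sigma,
        polyMap_mul D hc, zsmul_c, sigma_of_mem 𝒜 hc, mul_add, add_mul, smul_add,
        smul_mul_assoc, mul_smul_comm, hl, mul_assoc]
      abel
    · simp only [dKoszul_c, dKoszul_e, mul_c, mul_e, add_e, map_add, map_mul, sigma_sigma,
        polyMap_mul D hc, polyMap_mul D he, polyMap_sigma, sigma_tw, zsmul_e,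
        sigma_of_mem 𝒜 he, sgn_cast_add_one, mul_add, add_mul, smul_add, smul_mul_assoc,
        mul_smul_comm, mul_neg, neg_mul, smul_neg, neg_smul, hl, mul_assoc]
      abel

end DG

end KoszulAlg

end Koszul

/-! ### Differentiation with respect to `t`, and the shuffle maps, on chains -/

section ChainsT

variable {K : Type u} [Field K] {A : Type v} [Ring A] [Algebra K A]

/-- The first order jets `x + y τ` (`τ² = 0`) of elements of a `K[t]`-module `V`. A derivation
of `V` along `∂_t` is the same as a `K[t]`-linear section of `Jet V → V`. -/
@[ext] structure Jet (V : Type w) : Type w where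
  /-- The value. -/
  val : V
  /-- The first derivative. -/
  der : V

namespace Jet

variable {V : Type w} [AddCommGroup V] [Module K[X] V]

instance : Zero (Jet V) := ⟨⟨0, 0⟩⟩

instance : Add (Jet V) := ⟨fun x y => ⟨x.val + y.val, x.der + y.der⟩⟩

instance : Neg (Jet V) := ⟨fun x => ⟨-x.val, -x.der⟩⟩

@[simp] theorem zero_val : (0 : Jet V).val = 0 := rfl
@[simp] theorem zero_der : (0 : Jet V).der = 0 := rfl
@[simp] theorem add_val (x y : Jet V) : (x + y).val = x.val + y.val := rfl
@[simp] theorem add_der (x y : Jet V) : (x + y).der = x.der + y.der := rfl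
@[simp] theorem neg_val (x : Jet V) : (-x).val = -x.val := rfl
@[simp] theorem neg_der (x : Jet V) : (-x).der = -x.der := rfl

instance : AddCommGroup (Jet V) where
  add_assoc x y z := by ext1 <;> simp [add_assoc]
  zero_add x := by ext1 <;> simp
  add_zero x := by ext1 <;> simp
  add_comm x y := by ext1 <;> simp [add_comm]
  neg_add_cancel x := by ext1 <;> simp
  nsmul := nsmulRec
  zsmul := zsmulRec

instance : SMul K[X] (Jet V) :=
  ⟨fun r x => ⟨r • x.val, r • x.der + Polynomial.derivative r • x.val⟩⟩

@[simp] theorem smul_val (r : K[X]) (x : Jet V) : (r • x).val = r • x.val := rfl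
@[simp] theorem smul_der (r : K[X]) (x : Jet V) :
    (r • x).der = r • x.der + Polynomial.derivative r • x.val := rfl

/-- The action of `K[t]` on jets is given by the Leibniz rule. -/
instance : Module K[X] (Jet V) where
  one_smul x := by ext1 <;> simp
  mul_smul r s x := by
    ext1
    · simp [mul_smul]
    · simp only [smul_der, smul_val, Polynomial.derivative_mul, add_smul, smul_add, mul_smul]
      rw [smul_comm (Polynomial.derivative r) s]
      abel
  smul_zero r := by ext1 <;> simp
  smul_add r x y := by
    ext1
    · simp
    · simp only [smul_der, add_der, add_val, smul_add]; abel
  add_smul r s x := by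
    ext1
    · simp [add_smul]
    · simp only [smul_der, add_der, add_val, add_smul, map_add]; abel
  zero_smul x := by ext1 <;> simp

end Jet

variable (𝒜 : ℤ → Submodule K A) [GradedAlgebra 𝒜]

namespace KoszulAlg

/-- The formula for differentiation with respect to `t`, which sends `a₀(a₁|…|a_l)` to
`(∂_t a₀)(a₁|…|a_l)` plus the sum over `j` of `a₀(a₁|…|∂_t a_{j+1}|…|a_l)`. Together with the
identity map, it is a formula with values in jets. -/
def dtFormula : ChainFormula K[X] (KoszulAlg 𝒜) (Jet (Chains K[X] (KoszulAlg 𝒜))) where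
  toFun x as := ⟨x.2 ⊗ₜ[K[X]] word K[X] as,
    dt 𝒜 x.2 ⊗ₜ[K[X]] word K[X] as + elemSum (fun ys y zs =>
      x.2 ⊗ₜ[K[X]] (word K[X] ys * letter K[X] (dt 𝒜 y.2) * word K[X] zs)) as⟩
  head_add p a b xs := by
    ext1
    · simp only [Jet.add_val, TensorProduct.add_tmul]
    · simp only [Jet.add_der, map_add, TensorProduct.add_tmul, elemSum_add]; abel
  head_smul p r a xs := by
    ext1
    · simp only [Jet.smul_val, TensorProduct.smul_tmul']
    · simp only [Jet.smul_der, dt_smul, TensorProduct.add_tmul, ← TensorProduct.smul_tmul',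
        elemSum_smul, smul_add]
      abel
  multilin x := by
    refine ⟨fun us p a b vs => ?_, fun us p r a vs => ?_⟩
    · ext1
      · simp only [Jet.add_val, word_add, TensorProduct.tmul_add]
      · simp only [Jet.add_der, elemSum_append, word_add, map_add, mul_add, add_mul,
          TensorProduct.tmul_add, elemSum_add]
        abel
    · ext1
      · simp only [Jet.smul_val, word_smul, TensorProduct.tmul_smul]
      · simp only [Jet.smul_der, elemSum_append, word_smul, dt_smul, map_add, map_smul, mul_add,
          add_mul, smul_mul_assoc, mul_smul_comm, TensorProduct.tmul_add,
          TensorProduct.tmul_smul, elemSum_smul, smul_add]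
        rw [show word K[X] (us ++ (p, a) :: vs) =
          word K[X] us * letter K[X] a * word K[X] vs by
            simp only [word_append, word_cons, mul_assoc]]
        abel
  normalized x := by
    intro us vs
    ext1
    · simp only [word_one, TensorProduct.tmul_zero, Jet.zero_val]
    · simp only [elemSum_append, word_one, dt_one, map_zero, mul_zero, zero_mul,
        TensorProduct.tmul_zero, elemSum_zero, add_zero, Jet.zero_der]

/-- Differentiation with respect to `t`, acting on chains. -/
def chainsDt : Chains K[X] (KoszulAlg 𝒜) →ₗ[K] Chains K[X] (KoszulAlg 𝒜) where
  toFun x := ((dtFormula 𝒜).lift (gr 𝒜) x).der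
  map_add' x y := by rw [map_add, Jet.add_der]
  map_smul' r x := by
    rw [← algebraMap_smul K[X] r x, map_smul, Jet.smul_der, ← Polynomial.C_eq_algebraMap,
      Polynomial.derivative_C, zero_smul, add_zero]
    exact algebraMap_smul K[X] r _

/-- The sum of all words obtained by inserting `k` copies of the letter `ε` into the word
`(a₁|…|a_l)`, where the `aᵢ` are elements of `A`. -/
def epsShuffle : ℕ → List (ZMod 2 × A) → TensorAlgebra K[X] (ReducedPart K[X] (KoszulAlg 𝒜))
  | 0, [] => 1
  | 0, y :: ys => letter K[X] (incl 𝒜 y.2) * epsShuffle 0 ys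
  | k + 1, [] => letter K[X] (eps 𝒜) * epsShuffle k []
  | k + 1, y :: ys => letter K[X] (eps 𝒜) * epsShuffle k (y :: ys) +
      letter K[X] (incl 𝒜 y.2) * epsShuffle (k + 1) ys

theorem incl_smul (r : K) (a : A) :
    incl 𝒜 (r • a) = (Polynomial.C r : K[X]) • incl 𝒜 a := by
  ext1
  · change Polynomial.C (r • a) = (Polynomial.C r).map (algebraMap K A) * Polynomial.C a
    rw [Polynomial.map_C, ← Polynomial.C_mul, Algebra.smul_def]
  · change 0 = (Polynomial.C r).map (algebraMap K A) * 0
    rw [mul_zero]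

theorem letter_incl_smul (r : K) (a : A) : letter K[X] (incl 𝒜 (r • a)) =
    (Polynomial.C r : K[X]) • letter K[X] (incl 𝒜 a) := by
  rw [incl_smul, map_smul]

theorem incl_one : incl 𝒜 1 = 1 := by ext1 <;> simp [incl]

theorem epsShuffle_add (k : ℕ) (us : List (ZMod 2 × A)) (p a b vs) :
    epsShuffle 𝒜 k (us ++ (p, a + b) :: vs) =
      epsShuffle 𝒜 k (us ++ (p, a) :: vs) + epsShuffle 𝒜 k (us ++ (p, b) :: vs) := by
  induction k generalizing us with
  | zero =>
    induction us with
    | nil => simp only [List.nil_append, epsShuffle, map_add, add_mul]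
    | cons u us ih => simp only [List.cons_append, epsShuffle, ih, mul_add]
  | succ k ihk =>
    induction us with
    | nil =>
      have := ihk []
      simp only [List.nil_append] at this
      simp only [List.nil_append, epsShuffle, map_add, add_mul, this, mul_add]
      abel
    | cons u us ih =>
      have := ihk (u :: us)
      simp only [List.cons_append] at this
      simp only [List.cons_append, epsShuffle, ih, this, mul_add]
      abel

theorem epsShuffle_smul (k : ℕ) (us : List (ZMod 2 × A)) (p) (r : K) (a vs) :
    epsShuffle 𝒜 k (us ++ (p, r • a) :: vs) =
      (Polynomial.C r : K[X]) • epsShuffle 𝒜 k (us ++ (p, a) :: vs) := by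
  induction k generalizing us with
  | zero =>
    induction us with
    | nil => simp only [List.nil_append, epsShuffle, letter_incl_smul, smul_mul_assoc]
    | cons u us ih => simp only [List.cons_append, epsShuffle, ih, mul_smul_comm]
  | succ k ihk =>
    induction us with
    | nil =>
      have := ihk []
      simp only [List.nil_append] at this
      simp only [List.nil_append, epsShuffle, letter_incl_smul, smul_mul_assoc, this,
        mul_smul_comm, smul_add]
    | cons u us ih =>
      have := ihk (u :: us)
      simp only [List.cons_append] at this
      simp only [List.cons_append, epsShuffle, ih, this, mul_smul_comm, smul_add]

theorem epsShuffle_one (k : ℕ) (us vs : List (ZMod 2 × A)) :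
    epsShuffle 𝒜 k (us ++ (0, 1) :: vs) = 0 := by
  induction k generalizing us with
  | zero =>
    induction us with
    | nil => simp only [List.nil_append, epsShuffle, incl_one, letter_one, zero_mul]
    | cons u us ih => simp only [List.cons_append, epsShuffle, ih, mul_zero]
  | succ k ihk =>
    induction us with
    | nil =>
      have := ihk []
      simp only [List.nil_append] at this
      simp only [List.nil_append, epsShuffle, incl_one, letter_one, zero_mul, this, mul_zero,
        add_zero]
    | cons u us ih =>
      have := ihk (u :: us)
      simp only [List.cons_append] at this
      simp only [List.cons_append, epsShuffle, ih, this, mul_zero, add_zero]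

/-- The formula for the shuffle map on the coefficient of `q^{-k}`: it maps `a₀(a₁|…|a_l)` to
`(-1)^k` times the sum of all `a₀(…)`, where the dots stand for `k` copies of `ε` inserted into
`(a₁|…|a_l)`. -/
def shuffleFormula (k : ℕ) : ChainFormula K A (Chains K[X] (KoszulAlg 𝒜)) where
  toFun x as := (-1 : ℤ) ^ k • (incl 𝒜 x.2 ⊗ₜ[K[X]] epsShuffle 𝒜 k as)
  head_add p a b xs := by simp only [map_add, TensorProduct.add_tmul, smul_add]
  head_smul p r a xs := by
    simp only [map_smul, ← TensorProduct.smul_tmul']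
    exact smul_comm _ r _
  multilin x := by
    refine ⟨fun us p a b vs => ?_, fun us p r a vs => ?_⟩
    · simp only [epsShuffle_add, TensorProduct.tmul_add, smul_add]
    · simp only [epsShuffle_smul, TensorProduct.tmul_smul]
      rw [Polynomial.C_eq_algebraMap, algebraMap_smul]
      exact smul_comm _ r _
  normalized x := by
    intro us vs
    simp only [epsShuffle_one, TensorProduct.tmul_zero, smul_zero]

/-- The shuffle map on the coefficient of `q^{-k}`. -/
def shuffle (k : ℕ) : Chains K A →ₗ[K] Chains K[X] (KoszulAlg 𝒜) :=
  (shuffleFormula 𝒜 k).lift 𝒜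

end KoszulAlg

end ChainsT

/-! ### Graded modules with a formal variable `u` -/

section UModules

variable {K : Type u} [Field K]

/-- The data of a graded module with an operator `u` and a differential. -/
structure UComplex (K : Type u) [Field K] (V : Type v) [AddCommGroup V] [Module K V] where
  /-- The graded pieces. -/
  deg : ℤ → Submodule K V
  /-- Multiplication by `u`. -/
  u : V →ₗ[K] V
  /-- The differential. -/
  d : V →ₗ[K] V

namespace UComplex

variable {V : Type v} [AddCommGroup V] [Module K V] {V' : Type w} [AddCommGroup V'] [Module K V']

/-- The data form a complex over `K[u]`, where `u` has degree `2` and the differential has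
degree `1`. -/
structure IsComplex (C : UComplex K V) : Prop where
  u_mem : ∀ n, ∀ x ∈ C.deg n, C.u x ∈ C.deg (n + 2)
  d_mem : ∀ n, ∀ x ∈ C.deg n, C.d x ∈ C.deg (n + 1)
  d_u : ∀ x, C.d (C.u x) = C.u (C.d x)
  d_d : ∀ x, C.d (C.d x) = 0

/-- The `u`-linear map `f` is a chain map of degree `k`. -/
structure IsChainMap (C : UComplex K V) (C' : UComplex K V') (k : ℤ) (f : V →ₗ[K] V') :
    Prop where
  map_mem : ∀ n, ∀ x ∈ C.deg n, f x ∈ C'.deg (n + k)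
  map_u : ∀ x, f (C.u x) = C'.u (f x)
  map_d : ∀ x, f (C.d x) = C'.d (f x)

/-- The `u`-linear chain maps `f` and `g` of even degree `k` are chain homotopic, by a homotopy
which is also `u`-linear. -/
def Homotopic (C : UComplex K V) (C' : UComplex K V') (k : ℤ) (f g : V →ₗ[K] V') : Prop :=
  ∃ h : V →ₗ[K] V', (∀ n, ∀ x ∈ C.deg n, h x ∈ C'.deg (n + k - 1)) ∧
    (∀ x, h (C.u x) = C'.u (h x)) ∧ ∀ x, f x - g x = C'.d (h x) + h (C.d x)

/-- The elements of degree `n` which become cocycles in the `u = 0` reduction `C / uC`. -/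
def redCocycles (C : UComplex K V) (n : ℤ) : Submodule K V :=
  C.deg n ⊓ ((C.deg (n - 1)).map C.u).comap C.d

/-- The elements of degree `n` which become coboundaries in the `u = 0` reduction `C / uC`. -/
def redCoboundaries (C : UComplex K V) (n : ℤ) : Submodule K V :=
  (C.deg (n - 1)).map C.d ⊔ (C.deg (n - 2)).map C.u

/-- A `u`-linear chain map of degree `k` is a filtered quasi-isomorphism if it induces a
quasi-isomorphism between the `u = 0` reductions. This means that the induced map on the
cohomology of the reductions is injective and surjective in each degree. -/
structure IsFilteredQuasiIso (C : UComplex K V) (C' : UComplex K V') (k : ℤ)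
    (f : V →ₗ[K] V') : Prop where
  chainMap : IsChainMap C C' k f
  injective : ∀ n, ∀ x ∈ C.redCocycles n, f x ∈ C'.redCoboundaries (n + k) →
    x ∈ C.redCoboundaries n
  surjective : ∀ n, ∀ y ∈ C'.redCocycles (n + k), ∃ x ∈ C.redCocycles n,
    f x - y ∈ C'.redCoboundaries (n + k)

end UComplex

variable (K) in
/-- Multiplication by `u` on the space `V[[u]]` of power series, where a power series is
represented by the sequence of its coefficients. -/
def uMul (V : Type v) [AddCommGroup V] [Module K V] : (ℕ → V) →ₗ[K] (ℕ → V) where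
  toFun f i := if i = 0 then 0 else f (i - 1)
  map_add' f g := by funext i; dsimp only [Pi.add_apply]; split_ifs <;> simp
  map_smul' r f := by
    funext i; dsimp only [Pi.smul_apply, RingHom.id_apply]; split_ifs <;> simp

/-- The `u`-linear extension `V[[u]] → V'[[u]]` of a map `V → V'`. -/
def uExtend {V : Type v} [AddCommGroup V] [Module K V] {V' : Type w} [AddCommGroup V']
    [Module K V'] (φ : V →ₗ[K] V') : (ℕ → V) →ₗ[K] (ℕ → V') :=
  φ.compLeft ℕ

/-- The degree `n` part of `V[[u]]`: the coefficient of `u^i` must have degree `n - 2i`. -/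
def uDeg {V : Type v} [AddCommGroup V] [Module K V] (deg : ℤ → Submodule K V) (n : ℤ) :
    Submodule K (ℕ → V) where
  carrier := {f | ∀ i : ℕ, f i ∈ deg (n - 2 * i)}
  zero_mem' _ := zero_mem _
  add_mem' hf hg i := add_mem (hf i) (hg i)
  smul_mem' r _ hf i := Submodule.smul_mem _ r (hf i)

end UModules

/-! ### The two cyclic complexes -/

section Cyclic

variable {K : Type u} [Field K] {A : Type v} [Ring A] [Algebra K A]

/-- The space `q⁻¹V[q⁻¹] = V((q)) / V[[q]]` for `V = A ⊗ T(Ā[1])`. An element is represented by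
the function which to `k ≥ 0` associates the coefficient of `q^{-k-1}`. -/
abbrev PolarChains (K : Type u) [Field K] (A : Type v) [Ring A] [Algebra K A] :
    Type (max u v) := ℕ →₀ Chains K A

/-- The space `q⁻¹K[q⁻¹] ⊗̂ V[[q,u]] = (q⁻¹V[q⁻¹])[[u]]` for `V = A ⊗ T(Ā[1])`, where the tensor
product is over `K[q]` and completed with respect to `u`. Indeed, before completion the tensor
product consists of polynomials in `q⁻¹` without constant term and with coefficients in `V[[u]]`;
completion allows power series in `u` whose coefficients are polynomials in `q⁻¹` of unbounded
order. -/
abbrev CyclicQ (K : Type u) [Field K] (A : Type v) [Ring A] [Algebra K A] :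
    Type (max u v) := ℕ → PolarChains K A

/-- The space `(A_t ⊗ T(Ā_t[1]))[[u]]`, where all tensor products are over `K[t]`. -/
abbrev CyclicT {K : Type u} [Field K] {A : Type v} [Ring A] [Algebra K A]
    (𝒜 : ℤ → Submodule K A) [GradedAlgebra 𝒜] : Type (max u v) :=
  ℕ → Chains K[X] (KoszulAlg 𝒜)

/-- Multiplication by `q` on `q⁻¹V[q⁻¹]`; it annihilates the multiples of `q⁻¹`. -/
def qMul : PolarChains K A →ₗ[K] PolarChains K A :=
  Finsupp.lcomapDomain Nat.succ Nat.succ_injective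

/-- Differentiation with respect to `q`, which sends `v q^{-k-1}` to `-(k+1) v q^{-k-2}`. -/
def qDer : PolarChains K A →ₗ[K] PolarChains K A :=
  Finsupp.lsum K fun k : ℕ => -((k : K) + 1) • Finsupp.lsingle (k + 1)

/-- The `q`-linear extension of an operator on chains. -/
def qExtend (φ : Chains K A →ₗ[K] Chains K A) : PolarChains K A →ₗ[K] PolarChains K A :=
  Finsupp.mapRange.linearMap φ

variable (𝒜 : ℤ → Submodule K A) [GradedAlgebra 𝒜]

/-- The degree `n` part of `q⁻¹V[q⁻¹]`, where `|q| = 2`. -/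
def polarDeg (n : ℤ) : Submodule K (PolarChains K A) where
  carrier := {f | ∀ k : ℕ, f k ∈ chainsDeg 𝒜 (n + 2 * (k + 1))}
  zero_mem' _ := zero_mem _
  add_mem' hf hg k := add_mem (hf k) (hg k)
  smul_mem' r _ hf k := Submodule.smul_mem _ r (hf k)

variable {𝒜}
variable {D : DGStructure 𝒜} (W : CentralCocycle D)

/-- The complex `q⁻¹K[q⁻¹] ⊗̂ CC(A_q)`. Its differential is the sum of the Hochschild differential
of `A`, the curvature term `q L_W`, and `-u` times the Connes operator. -/
def cyclicComplexQ : UComplex K (CyclicQ K A) where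
  deg := uDeg (polarDeg 𝒜)
  u := uMul K (PolarChains K A)
  d := uExtend (qExtend D.hochschild + qMul ∘ₗ qExtend (lieElem 𝒜 W.val)) -
    uMul K _ ∘ₗ uExtend (qExtend (connes 𝒜))

/-- The complex `CC(A_t)`. Its differential is the sum of the Hochschild differential of `A_t`
and `-u` times the Connes operator. -/
def cyclicComplexT : UComplex K (CyclicT 𝒜) where
  deg := uDeg fun n => (chainsDeg (KoszulAlg.gr 𝒜) n).restrictScalars K
  u := uMul K (Chains K[X] (KoszulAlg 𝒜))
  d := uExtend ((KoszulAlg.dgStructure W).hochschild.restrictScalars K) -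
    uMul K _ ∘ₗ uExtend ((connes (KoszulAlg.gr 𝒜)).restrictScalars K)

variable (K A) in
/-- Multiplication by `q` on the cyclic complex. -/
def mulQ : CyclicQ K A →ₗ[K] CyclicQ K A := uExtend qMul

variable (𝒜) in
/-- Multiplication by `t` on the cyclic complex. -/
def mulT : CyclicT 𝒜 →ₗ[K] CyclicT 𝒜 :=
  uExtend ((LinearMap.lsmul K[X] (Chains K[X] (KoszulAlg 𝒜)) Polynomial.X).restrictScalars K)

/-- The connection `∇_{u∂_q} = u∂_q + I_W`, with `I_W = ι_W - u J_W`. -/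
def connectionQ : CyclicQ K A →ₗ[K] CyclicQ K A :=
  uMul K _ ∘ₗ uExtend qDer +
    (uExtend (qExtend (iotaElem 𝒜 W.val)) -
      uMul K _ ∘ₗ uExtend (qExtend (cyclicElem 𝒜 W.val)))

variable (𝒜) in
/-- The connection `∇_{u∂_t} = u∂_t + I_{∂_ε}`, with `I_{∂_ε} = ι_{∂_ε} - u J_{∂_ε}`. -/
def connectionT : CyclicT 𝒜 →ₗ[K] CyclicT 𝒜 :=
  uMul K _ ∘ₗ uExtend (KoszulAlg.chainsDt 𝒜) +
    (uExtend ((iotaDer (KoszulAlg.gr 𝒜) (KoszulAlg.depsilon 𝒜)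
        (KoszulAlg.depsilon_one 𝒜)).restrictScalars K) -
      uMul K _ ∘ₗ uExtend ((cyclicDer (KoszulAlg.gr 𝒜) (KoszulAlg.depsilon 𝒜)
        (KoszulAlg.depsilon_one 𝒜)).restrictScalars K))

variable (𝒜) in
/-- The `u`-linear map `SH`, which is the shuffle map applied after shifting powers of `q`:
`SH(a₀(a₁|…|a_l) q^{-k-1})` equals `(-1)^k` times the sum of all chains obtained from
`a₀(a₁|…|a_l)` by inserting `k` copies of `ε` to the right of `a₀`. -/
def shiftedShuffle : CyclicQ K A →ₗ[K] CyclicT 𝒜 :=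
  uExtend (Finsupp.lsum K fun k : ℕ => KoszulAlg.shuffle 𝒜 k)

end Cyclic

end NCFourier

end

/-!
# The Fourier transform for a curved deformation and its shifted shuffle map

All operators on chains are obtained from operators which act on functions of lists of homogeneous
elements by precomposition: `derF`, `mergeF` and `barF` for the bar differential, `hochF` for the
Hochschild differential, `rotF` for the sum over cyclic rotations, `shF` for shuffles with copies of
one letter. Only the parities of the elements matter for the signs. Chains are spanned by words of
homogeneous elements (`chains_ext`), so that each identity between operators becomes an identity
between sums over lists, which is proved by recursion. Rotation turns the Hochschild differential
into the bar differential (`rotF_barM`), and terms which only differ by a rotation cancel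
(`rotF_endsF`); this gives `d² = 0` and `dB + Bd = 0`.

*Cartan formulas.* The odd derivation `∂_ε` of `A[t,ε]` anticommutes with the differential, and
differentiation with respect to `t` changes the Hochschild differential by the Lie action of `∂_ε`
(`chainsDt_hochschild`), because `t` enters only through `(t - W) ∂_ε`. Together with the formulas for
`ι_φ` and its cyclic counterpart (`hochschild_iotaDer`, `hochschild_cyclicDer`), this shows that
`∇_{u∂_t}` is a chain map. There is another pair of such operators `ι_ε`, `J_ε`, for the odd element
`ε`, which supercommutes with all elements (`hochschild_iotaElem`, `hochschild_cyclicOdd`). As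
`dε = t - W`, the operator `ι_ε + u J_ε`, composed with the shuffle map, is a homotopy between `t ∘ SH`
and `SH ∘ ∇_{u∂_q}` (`shuffleHomotopy_spec`).

*Shuffles.* In the differential of a shuffle, products of `ε` with neighbouring letters cancel, and
the differential of each letter `ε` inserts `-W`, since `t` is zero in the reduced algebra. Hence `SH`
intertwines `d + qL_W` with `d` (`hochschild_shuffle`), and it is compatible with the Connes operators
(`connes_shuffle`). Removing `ε` from the end of a shuffle leads to `SH ∘ q = -∇_{u∂_t} ∘ SH`
(`iotaDer_shuffle`, `cyclicDer_shuffle`). The shuffle map is injective, even after `K[t]`-linear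
extension (`polyShuffle_injective`). Therefore the first side is a complex, and `∇_{u∂_q}` is a chain
map, because the corresponding identities hold on the second side.

*The reduction `u = 0`.* Choose a linear functional `l` on `A` with `l(1) = 1`, which vanishes outside
degree zero. Define an operator `s` on the chains of `A[t,ε]`, which looks for the first letter of the
form `bε` with `l(b) = 0`, and splits it into `b|ε` (`contract`). The chain map `1 - (ds + sd)` simplifies
words. The submodule `Z` (`shuffleSpan`) spanned over `K[t]` by shuffles, and by their products with
`ε` in the first element, is a subcomplex annihilated by `s`, and each chain is mapped to `Z` by some
iterate of `1 - (ds + sd)` (`exists_iterate_mem_shuffleSpan`); this is an induction on words,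
formulated in terms of submodules which are closed under the relevant operations
(`IsAbsorbing.eq_top`). Hence cocycles, and coboundaries lying in `Z`, can be studied within `Z`. As a
module, `Z` consists of two copies of polynomials in `t` with coefficients in the chains of the first
side, and its differential maps the copy with `ε` to the other one by `t - W`. Division by
`t - W` (`exists_eq_shiftSub_add`) leaves only the constant polynomials, which form the image of the
shuffle map.
-/

noncomputable section

namespace NCFourier

universe u v w

/-! ### Calculus of sums over decompositions of a list -/

section ListSums

variable {X : Type u} {M : Type v} [AddCommGroup M]

theorem splitSum_congr {f g : List X → List X → M} {xs : List X}
    (h : ∀ ys zs, ys ++ zs = xs → f ys zs = g ys zs) : splitSum f xs = splitSum g xs := by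
  induction xs generalizing f g with
  | nil => exact h [] [] rfl
  | cons x xs ih =>
    simp only [splitSum]
    rw [h [] (x :: xs) rfl, ih fun ys zs e => h (x :: ys) zs (by simp [e])]

theorem elemSum_congr {f g : List X → X → List X → M} {xs : List X}
    (h : ∀ ys y zs, ys ++ y :: zs = xs → f ys y zs = g ys y zs) : elemSum f xs = elemSum g xs := by
  induction xs generalizing f g with
  | nil => rfl
  | cons x xs ih =>
    simp only [elemSum]
    rw [h [] x xs rfl, ih fun ys y zs e => h (x :: ys) y zs (by simp [e])]

theorem splitSum_mem {S : Type*} [SetLike S M] [AddSubmonoidClass S M] (s : S)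
    {f : List X → List X → M} {xs : List X}
    (h : ∀ ys zs, ys ++ zs = xs → f ys zs ∈ s) : splitSum f xs ∈ s := by
  induction xs generalizing f with
  | nil => exact h [] [] rfl
  | cons x xs ih =>
    exact add_mem (h [] (x :: xs) rfl) (ih fun ys zs e => h (x :: ys) zs (by simp [e]))

theorem elemSum_mem {S : Type*} [SetLike S M] [AddSubmonoidClass S M] (s : S)
    {f : List X → X → List X → M} {xs : List X}
    (h : ∀ ys y zs, ys ++ y :: zs = xs → f ys y zs ∈ s) : elemSum f xs ∈ s := by
  induction xs generalizing f with
  | nil => exact zero_mem s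
  | cons x xs ih =>
    exact add_mem (h [] x xs rfl) (ih fun ys y zs e => h (x :: ys) y zs (by simp [e]))

theorem splitSum_zsmul (r : ℤ) (f : List X → List X → M) (xs : List X) :
    splitSum (fun ys zs => r • f ys zs) xs = r • splitSum f xs :=
  splitSum_map (DistribSMul.toAddMonoidHom M r) f xs

theorem elemSum_zsmul (r : ℤ) (f : List X → X → List X → M) (xs : List X) :
    elemSum (fun ys y zs => r • f ys y zs) xs = r • elemSum f xs :=
  elemSum_map (DistribSMul.toAddMonoidHom M r) f xs

theorem splitSum_neg (f : List X → List X → M) (xs : List X) :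
    splitSum (fun ys zs => -f ys zs) xs = -splitSum f xs :=
  splitSum_map (negAddMonoidHom : M →+ M) f xs

theorem splitSum_sub (f g : List X → List X → M) (xs : List X) :
    splitSum (fun ys zs => f ys zs - g ys zs) xs = splitSum f xs - splitSum g xs := by
  simp only [sub_eq_add_neg, splitSum_add, splitSum_neg]

/-- A sum over all cuts, with the cut at the very end of the list singled out. -/
theorem splitSum_eq_last (f : List X → List X → M) (xs : List X) :
    splitSum f xs = f xs [] + elemSum (fun ys y zs => f ys (y :: zs)) xs := by
  induction xs generalizing f with
  | nil => simp [splitSum, elemSum]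
  | cons x xs ih => simp only [splitSum, elemSum, ih]; abel

/-- A sum over all cuts, with the cut at the very beginning of the list singled out. -/
theorem splitSum_eq_first (f : List X → List X → M) (xs : List X) :
    splitSum f xs = f [] xs + elemSum (fun ys y zs => f (ys ++ [y]) zs) xs := by
  induction xs generalizing f with
  | nil => simp [splitSum, elemSum]
  | cons x xs ih => simp only [splitSum, elemSum, ih, List.nil_append, List.cons_append]

/-- The value of `f` on the head and the tail of a list; zero for the empty list. -/
def headF (f : X → List X → M) : List X → M
  | [] => 0
  | x :: xs => f x xs

@[simp] theorem headF_nil (f : X → List X → M) : headF f [] = 0 := rfl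

@[simp] theorem headF_cons (f : X → List X → M) (x xs) : headF f (x :: xs) = f x xs := rfl

theorem headF_map {N : Type*} [AddCommGroup N] (g : M →+ N) (f : X → List X → M) (xs) :
    headF (fun x xs => g (f x xs)) xs = g (headF f xs) := by
  cases xs <;> simp

theorem headF_zsmul (r : ℤ) (f : X → List X → M) (xs) :
    headF (fun x xs => r • f x xs) xs = r • headF f xs := by
  cases xs <;> simp

theorem headF_add (f g : X → List X → M) (xs) :
    headF (fun x xs => f x xs + g x xs) xs = headF f xs + headF g xs := by
  cases xs <;> simp

/-- The value of `f` on the initial part and the last element of a list; zero for the empty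
list. -/
def lastF (f : List X → X → M) (xs : List X) : M :=
  elemSum (fun ys y zs => if zs = [] then f ys y else 0) xs

@[simp] theorem lastF_nil (f : List X → X → M) : lastF f [] = 0 := rfl

@[simp] theorem lastF_concat (f : List X → X → M) (xs x) : lastF f (xs ++ [x]) = f xs x := by
  simp [lastF, elemSum_append, elemSum_zero, elemSum]

/-- The head of the second part, summed over all cuts. -/
theorem splitSum_lastF (f : List X → List X → X → M) (xs : List X) :
    splitSum (fun ys zs => lastF (fun zs' z => f ys zs' z) zs) xs =
      lastF (fun as a => splitSum (fun ys zs => f ys zs a) as) xs := by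
  rcases List.eq_nil_or_concat xs with rfl | ⟨xs, x, rfl⟩
  · rfl
  · rw [List.concat_eq_append, lastF_concat, splitSum_append]
    have h : ∀ (us zs : List X) , lastF (f us) (zs ++ [x]) = f us zs x := fun us zs =>
      lastF_concat _ _ _
    simp only [splitSum]
    rw [show lastF (f (xs ++ [x])) [] = 0 from rfl, add_zero]
    exact splitSum_congr fun ys zs _ => h ys zs

theorem splitSum_headF (f : X → List X → List X → M) (xs : List X) :
    splitSum (fun ys zs => headF (fun y ys' => f y ys' zs) ys) xs =
      headF (fun a as => splitSum (fun ys zs => f a ys zs) as) xs := by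
  cases xs <;> simp [splitSum]

end ListSums

/-! ### The bar differential on functions of lists -/

section BarCalculus

variable {R : Type u} [CommRing R] {A : Type v} [Ring A] [Algebra R A]
variable {M : Type w} [AddCommGroup M]

theorem sgn_eq_or (p : ZMod 2) : sgn p = 1 ∨ sgn p = -1 := by
  revert p; decide

theorem sgn_one : sgn 1 = -1 := by decide

theorem zmod_add_self (p : ZMod 2) : p + p = 0 := by
  revert p; decide

/-- A function of lists which is additive in each element, the parities being fixed. -/
def SlotAdd (G : List (ZMod 2 × A) → M) : Prop :=
  ∀ us p a b vs, G (us ++ (p, a + b) :: vs) = G (us ++ (p, a) :: vs) + G (us ++ (p, b) :: vs)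

theorem SlotAdd.cons {G : List (ZMod 2 × A) → M} (hG : SlotAdd G) (y) :
    SlotAdd fun L => G (y :: L) := fun us p a b vs => hG (y :: us) p a b vs

theorem SlotAdd.zero {G : List (ZMod 2 × A) → M} (hG : SlotAdd G) (us p vs) :
    G (us ++ (p, 0) :: vs) = 0 := by
  have := hG us p 0 0 vs
  rw [add_zero] at this
  exact left_eq_add.mp this

theorem SlotAdd.neg {G : List (ZMod 2 × A) → M} (hG : SlotAdd G) (us p a vs) :
    G (us ++ (p, -a) :: vs) = -G (us ++ (p, a) :: vs) := by
  have := hG us p a (-a) vs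
  rw [add_neg_cancel, hG.zero] at this
  exact (neg_eq_of_add_eq_zero_right this.symm).symm

theorem SlotAdd.sgn_smul {G : List (ZMod 2 × A) → M} (hG : SlotAdd G) (us p) (q : ZMod 2) (a vs) :
    G (us ++ (p, sgn q • a) :: vs) = sgn q • G (us ++ (p, a) :: vs) := by
  rcases sgn_eq_or q with h | h <;> simp [h, hG.neg]

/-- The product of two elements with parities. -/
def mulL (y z : ZMod 2 × A) : ZMod 2 × A := (y.1 + z.1, y.2 * z.2)

/-- The action of an odd map on an element with parity. -/
def oddL (φ : A →ₗ[R] A) (y : ZMod 2 × A) : ZMod 2 × A := (y.1 + 1, φ y.2)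

theorem rdeg_mulL (y z : ZMod 2 × A) : rdeg (mulL y z) = rdeg y + rdeg z + 1 := by
  simp only [rdeg, mulL]; rw [show y.1 + 1 + (z.1 + 1) + 1 = y.1 + z.1 + 1 + (1 + 1) by ring,
    zmod_add_self, add_zero]

theorem rdeg_oddL (φ : A →ₗ[R] A) (y : ZMod 2 × A) : rdeg (oddL φ y) = rdeg y + 1 := rfl

theorem mulL_assoc (x y z : ZMod 2 × A) : mulL (mulL x y) z = mulL x (mulL y z) := by
  simp [mulL, add_assoc, mul_assoc]

/-- The sum of `(-1)^{‖a₁‖+⋯+‖a_j‖} G(a₁|…|φ(a_{j+1})|…|a_l)`, for an odd map `φ`. -/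
def derF (φ : A →ₗ[R] A) (G : List (ZMod 2 × A) → M) : List (ZMod 2 × A) → M
  | [] => 0
  | y :: ys => G (oddL φ y :: ys) + sgn (rdeg y) • derF φ (fun L => G (y :: L)) ys

/-- The sum of `(-1)^{‖a₁‖+⋯+‖a_j‖} G(a₁|…|a_j a_{j+1}|…|a_l)`. -/
def mergeF (G : List (ZMod 2 × A) → M) : List (ZMod 2 × A) → M
  | [] => 0
  | y :: ys => sgn (rdeg y) • (headF (fun z zs => G (mulL y z :: zs)) ys +
      mergeF (fun L => G (y :: L)) ys)

/-- The bar differential, acting on functions of lists by precomposition. -/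
def barF (δ : A →ₗ[R] A) (G : List (ZMod 2 × A) → M) (L : List (ZMod 2 × A)) : M :=
  derF δ G L - mergeF G L

theorem derF_cons (φ : A →ₗ[R] A) (G : List (ZMod 2 × A) → M) (y ys) : derF φ G (y :: ys) =
    G (oddL φ y :: ys) + sgn (rdeg y) • derF φ (fun L => G (y :: L)) ys := rfl

theorem mergeF_cons (G : List (ZMod 2 × A) → M) (y ys) : mergeF G (y :: ys) =
    sgn (rdeg y) • (headF (fun z zs => G (mulL y z :: zs)) ys +
      mergeF (fun L => G (y :: L)) ys) := rfl

theorem derF_add (φ : A →ₗ[R] A) (G H : List (ZMod 2 × A) → M) (ys) :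
    derF φ (fun L => G L + H L) ys = derF φ G ys + derF φ H ys := by
  induction ys generalizing G H with
  | nil => simp [derF]
  | cons y ys ih => simp only [derF, ih, smul_add]; abel

theorem mergeF_add (G H : List (ZMod 2 × A) → M) (ys) :
    mergeF (fun L => G L + H L) ys = mergeF G ys + mergeF H ys := by
  induction ys generalizing G H with
  | nil => simp [mergeF]
  | cons y ys ih =>
    simp only [mergeF, ih, smul_add]
    rw [headF_add]; simp only [smul_add]; abel

theorem derF_map {N : Type*} [AddCommGroup N] (f : M →+ N) (φ : A →ₗ[R] A)
    (G : List (ZMod 2 × A) → M) (ys) :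
    derF φ (fun L => f (G L)) ys = f (derF φ G ys) := by
  induction ys generalizing G with
  | nil => simp [derF]
  | cons y ys ih => simp only [derF, ih, map_add, map_zsmul]

theorem mergeF_map {N : Type*} [AddCommGroup N] (f : M →+ N) (G : List (ZMod 2 × A) → M) (ys) :
    mergeF (fun L => f (G L)) ys = f (mergeF G ys) := by
  induction ys generalizing G with
  | nil => simp [mergeF]
  | cons y ys ih => simp only [mergeF_cons, ih, headF_map, map_add, map_zsmul]

theorem barF_map {N : Type*} [AddCommGroup N] (f : M →+ N) (δ : A →ₗ[R] A)
    (G : List (ZMod 2 × A) → M) (ys) : barF δ (fun L => f (G L)) ys = f (barF δ G ys) := by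
  simp only [barF, derF_map, mergeF_map, map_sub]

theorem derF_zsmul (φ : A →ₗ[R] A) (r : ℤ) (G : List (ZMod 2 × A) → M) (ys) :
    derF φ (fun L => r • G L) ys = r • derF φ G ys :=
  derF_map (DistribSMul.toAddMonoidHom M r) φ G ys

theorem mergeF_zsmul (r : ℤ) (G : List (ZMod 2 × A) → M) (ys) :
    mergeF (fun L => r • G L) ys = r • mergeF G ys :=
  mergeF_map (DistribSMul.toAddMonoidHom M r) G ys

theorem derF_sub (φ : A →ₗ[R] A) (G H : List (ZMod 2 × A) → M) (ys) :
    derF φ (fun L => G L - H L) ys = derF φ G ys - derF φ H ys := by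
  have h := derF_add φ G (fun L => (-1 : ℤ) • H L) ys
  rw [derF_zsmul] at h
  simpa [sub_eq_add_neg] using h

theorem mergeF_sub (G H : List (ZMod 2 × A) → M) (ys) :
    mergeF (fun L => G L - H L) ys = mergeF G ys - mergeF H ys := by
  have h := mergeF_add G (fun L => (-1 : ℤ) • H L) ys
  rw [mergeF_zsmul] at h
  simpa [sub_eq_add_neg] using h

theorem barF_add (δ : A →ₗ[R] A) (G H : List (ZMod 2 × A) → M) (ys) :
    barF δ (fun L => G L + H L) ys = barF δ G ys + barF δ H ys := by
  simp only [barF, derF_add, mergeF_add]; abel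

theorem barF_sub (δ : A →ₗ[R] A) (G H : List (ZMod 2 × A) → M) (ys) :
    barF δ (fun L => G L - H L) ys = barF δ G ys - barF δ H ys := by
  simp only [barF, derF_sub, mergeF_sub]; abel

theorem barF_zsmul (δ : A →ₗ[R] A) (r : ℤ) (G : List (ZMod 2 × A) → M) (ys) :
    barF δ (fun L => r • G L) ys = r • barF δ G ys :=
  barF_map (DistribSMul.toAddMonoidHom M r) δ G ys

theorem derF_zero (φ : A →ₗ[R] A) (ys) : derF φ (fun _ => (0 : M)) ys = 0 := by
  simpa using derF_zsmul φ 0 (fun _ => (0 : M)) ys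

@[simp] theorem barF_nil (δ : A →ₗ[R] A) (G : List (ZMod 2 × A) → M) : barF δ G [] = 0 := by
  simp [barF, derF, mergeF]

theorem barF_cons (δ : A →ₗ[R] A) (G : List (ZMod 2 × A) → M) (y ys) : barF δ G (y :: ys) =
    G (oddL δ y :: ys) - sgn (rdeg y) • headF (fun z zs => G (mulL y z :: zs)) ys +
      sgn (rdeg y) • barF δ (fun L => G (y :: L)) ys := by
  simp only [barF, derF, mergeF, smul_add, smul_sub]; abel

theorem derF_derF_add {φ ψ : A →ₗ[R] A} (h : ∀ a, φ (ψ a) + ψ (φ a) = 0)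
    {G : List (ZMod 2 × A) → M} (hG : SlotAdd G) (ys) :
    derF φ (derF ψ G) ys + derF ψ (derF φ G) ys = 0 := by
  induction ys generalizing G with
  | nil => simp [derF]
  | cons y ys ih =>
    have e : ∀ (φ ψ : A →ₗ[R] A), derF φ (derF ψ G) (y :: ys) =
        G (oddL ψ (oddL φ y) :: ys) - sgn (rdeg y) • derF ψ (fun L => G (oddL φ y :: L)) ys +
          sgn (rdeg y) • derF φ (fun L => G (oddL ψ y :: L)) ys +
          derF φ (derF ψ fun L => G (y :: L)) ys := by
      intro φ ψ
      rw [derF_cons, derF_cons]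
      simp only [derF_cons, derF_add, derF_zsmul, rdeg_oddL, sgn_add_one, smul_add, smul_smul,
        sgn_mul_self, one_smul, neg_smul]
      abel
    have h1 := hG [] (y.1 + 1 + 1) (φ (ψ y.2)) (ψ (φ y.2)) ys
    rw [h, hG.zero] at h1
    have h2 := ih (hG.cons y)
    rw [e, e]
    simp only [List.nil_append] at h1
    calc _ = (G (oddL φ (oddL ψ y) :: ys) + G (oddL ψ (oddL φ y) :: ys)) +
        (derF φ (derF ψ fun L => G (y :: L)) ys + derF ψ (derF φ fun L => G (y :: L)) ys) := by
          abel
      _ = 0 := by rw [h2, add_zero]; exact h1.symm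

theorem derF_derF_self {δ : A →ₗ[R] A} (h : ∀ a, δ (δ a) = 0)
    {G : List (ZMod 2 × A) → M} (hG : SlotAdd G) (ys) : derF δ (derF δ G) ys = 0 := by
  induction ys generalizing G with
  | nil => simp [derF]
  | cons y ys ih =>
    have h1 := hG.zero [] (y.1 + 1 + 1) ys
    rw [← h y.2] at h1
    rw [derF_cons, derF_cons]
    simp only [derF_cons, derF_add, derF_zsmul, rdeg_oddL, sgn_add_one, smul_add, smul_smul,
        sgn_mul_self, one_smul, neg_smul, ih (hG.cons y)]
    rw [show G (oddL δ (oddL δ y) :: ys) = 0 from h1]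
    abel

theorem mergeF_mergeF (G : List (ZMod 2 × A) → M) (ys) : mergeF (mergeF G) ys = 0 := by
  induction ys generalizing G with
  | nil => simp [mergeF]
  | cons y ys ih =>
    rw [mergeF_cons]
    simp only [mergeF_cons, mergeF_zsmul, mergeF_add, ih, add_zero]
    cases ys with
    | nil => simp [mergeF]
    | cons z zs =>
      simp only [headF_cons, mergeF_cons, rdeg_mulL, sgn_add_one, mulL_assoc, smul_add, smul_smul, sgn_add]
      rcases sgn_eq_or (rdeg y) with e | e <;> rcases sgn_eq_or (rdeg z) with e' | e' <;>
        simp [e, e', sgn_one] <;> abel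

/-- The graded Leibniz rule for an odd map, where the first factor is an element with parity. -/
def IsLeibniz (φ : A →ₗ[R] A) (y : ZMod 2 × A) : Prop :=
  ∀ b, φ (y.2 * b) = φ y.2 * b + sgn y.1 • (y.2 * φ b)

theorem derF_mergeF_add {φ : A →ₗ[R] A} {G : List (ZMod 2 × A) → M} (hG : SlotAdd G)
    {ys : List (ZMod 2 × A)} (hys : ∀ y ∈ ys, IsLeibniz φ y) :
    derF φ (mergeF G) ys + mergeF (derF φ G) ys = 0 := by
  induction ys generalizing G with
  | nil => simp [derF, mergeF]
  | cons y ys ih =>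
    have h2 := ih (hG.cons y) fun z hz => hys z (List.mem_cons_of_mem _ hz)
    rw [derF_cons, mergeF_cons]
    simp only [mergeF_cons, derF_cons, derF_zsmul, derF_add, mergeF_add, mergeF_zsmul, rdeg_oddL,
      sgn_add_one, smul_add, neg_smul]
    cases ys with
    | nil => simp [derF, mergeF]
    | cons z zs =>
      simp only [headF_cons, derF_cons, rdeg_mulL, rdeg_oddL, sgn_add_one, smul_add, neg_smul,
        mergeF_cons, derF_zsmul, derF_add, headF_add, headF_zsmul, mergeF_zsmul, mergeF_add]
        at h2 ⊢
      rw [sgn_add]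
      have h3 : G (oddL φ (mulL y z) :: zs) = G (mulL (oddL φ y) z :: zs) +
          -sgn (rdeg y) • G (mulL y (oddL φ z) :: zs) := by
        have := hys y List.mem_cons_self z.2
        have h4 : oddL φ (mulL y z) = (y.1 + z.1 + 1, φ y.2 * z.2 + sgn y.1 • (y.2 * φ z.2)) := by
          simp only [oddL, mulL, this]
        rw [h4]
        have := hG [] (y.1 + z.1 + 1) (φ y.2 * z.2) (sgn y.1 • (y.2 * φ z.2)) zs
        have h5 := hG.sgn_smul [] (y.1 + z.1 + 1) y.1 (y.2 * φ z.2) zs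
        simp only [List.nil_append] at this h5
        rw [this, h5]
        simp only [mulL, oddL, rdeg, sgn_add_one, neg_neg, ← add_assoc, add_right_comm y.1 z.1 1]
      rw [h3]
      rcases sgn_eq_or (rdeg y) with e | e <;> rcases sgn_eq_or (rdeg z) with e' | e' <;>
        simp only [e, e', one_smul, neg_smul, neg_neg, smul_neg, neg_add, mul_one, mul_neg] at h2 ⊢ <;>
        rw [← h2] <;> abel

theorem barF_barF {δ : A →ₗ[R] A} (h : ∀ a, δ (δ a) = 0) {G : List (ZMod 2 × A) → M}
    (hG : SlotAdd G) {ys : List (ZMod 2 × A)} (hys : ∀ y ∈ ys, IsLeibniz δ y) :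
    barF δ (barF δ G) ys = 0 := by
  have h1 := derF_mergeF_add hG hys
  have h2 : barF δ G = fun L => derF δ G L - mergeF G L := rfl
  rw [h2, barF]
  simp only [derF_sub, mergeF_sub, derF_derF_self h hG, mergeF_mergeF]
  calc _ = -(derF δ (mergeF G) ys + mergeF (derF δ G) ys) := by abel
    _ = 0 := by rw [h1, neg_zero]

theorem derF_barF_add {φ δ : A →ₗ[R] A} (h : ∀ a, φ (δ a) + δ (φ a) = 0)
    {G : List (ZMod 2 × A) → M} (hG : SlotAdd G) {ys : List (ZMod 2 × A)}
    (hys : ∀ y ∈ ys, IsLeibniz φ y) : derF φ (barF δ G) ys + barF δ (derF φ G) ys = 0 := by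
  have h1 := derF_mergeF_add hG hys
  have h2 := derF_derF_add h hG ys
  have h3 : barF δ G = fun L => derF δ G L - mergeF G L := rfl
  rw [h3, barF, derF_sub]
  calc _ = (derF φ (derF δ G) ys + derF δ (derF φ G) ys) -
      (derF φ (mergeF G) ys + mergeF (derF φ G) ys) := by abel
    _ = 0 := by rw [h1, h2, sub_zero]

end BarCalculus

/-! ### Homogeneous words -/

section Homogeneous

variable {R : Type u} [CommRing R] {A : Type v} [Ring A] [Algebra R A]
variable (𝒜 : ℤ → Submodule R A)

/-- The element with parity `x` is homogeneous of degree `m`, and the parity is that of `m`. -/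
def IsHom (x : ZMod 2 × A) (m : ℤ) : Prop := x.1 = (m : ZMod 2) ∧ x.2 ∈ 𝒜 m

/-- The element with parity `x` is homogeneous of some degree. -/
def Homog (x : ZMod 2 × A) : Prop := ∃ m, IsHom 𝒜 x m

/-- All elements of the list are homogeneous, and the sum of their reduced degrees is `n`. -/
def ListDeg : List (ZMod 2 × A) → ℤ → Prop
  | [], n => n = 0
  | x :: xs, n => ∃ m, IsHom 𝒜 x m ∧ ListDeg xs (n - (m - 1))

variable {𝒜}

theorem ListDeg.cons {x : ZMod 2 × A} {xs m n} (hx : IsHom 𝒜 x m) (h : ListDeg 𝒜 xs n) :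
    ListDeg 𝒜 (x :: xs) (m - 1 + n) := ⟨m, hx, by simpa using h⟩

theorem listDeg_append {xs ys : List (ZMod 2 × A)} {n : ℤ} :
    ListDeg 𝒜 (xs ++ ys) n ↔ ∃ m, ListDeg 𝒜 xs m ∧ ListDeg 𝒜 ys (n - m) := by
  induction xs generalizing n with
  | nil => simp [ListDeg]
  | cons x xs ih =>
    simp only [List.cons_append, ListDeg, ih]
    constructor
    · rintro ⟨m, hx, k, h1, h2⟩
      exact ⟨m - 1 + k, ⟨m, hx, by simpa using h1⟩, by
        rwa [show n - (m - 1 + k) = n - (m - 1) - k by ring]⟩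
    · rintro ⟨k, ⟨m, hx, h1⟩, h2⟩
      exact ⟨m, hx, k - (m - 1), h1, by
        rwa [show n - (m - 1) - (k - (m - 1)) = n - k by ring]⟩

theorem ListDeg.append {xs ys : List (ZMod 2 × A)} {m n} (h : ListDeg 𝒜 xs m)
    (h' : ListDeg 𝒜 ys n) : ListDeg 𝒜 (xs ++ ys) (m + n) :=
  listDeg_append.mpr ⟨m, h, by simpa using h'⟩

theorem ListDeg.homog {xs : List (ZMod 2 × A)} {n} (h : ListDeg 𝒜 xs n) :
    ∀ x ∈ xs, Homog 𝒜 x := by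
  induction xs generalizing n with
  | nil => simp
  | cons x xs ih =>
    obtain ⟨m, hx, h⟩ := h
    intro y hy
    rcases List.mem_cons.mp hy with rfl | hy
    exacts [⟨m, hx⟩, ih h y hy]

theorem exists_listDeg {xs : List (ZMod 2 × A)} (h : ∀ x ∈ xs, Homog 𝒜 x) :
    ∃ n, ListDeg 𝒜 xs n := by
  induction xs with
  | nil => exact ⟨0, rfl⟩
  | cons x xs ih =>
    obtain ⟨m, hx⟩ := h x List.mem_cons_self
    obtain ⟨n, hn⟩ := ih fun y hy => h y (List.mem_cons_of_mem _ hy)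
    exact ⟨_, hn.cons hx⟩

theorem exists_degList {xs : List (ZMod 2 × A)} {n} (h : ListDeg 𝒜 xs n) :
    ∃ ws : List (ℤ × A), (∀ w ∈ ws, w.2 ∈ 𝒜 w.1) ∧ (ws.map fun w => w.1 - 1).sum = n ∧
      xs = ws.map fun w => ((w.1 : ZMod 2), w.2) := by
  induction xs generalizing n with
  | nil => exact ⟨[], by simp, by simpa using (show n = 0 from h).symm, rfl⟩
  | cons x xs ih =>
    obtain ⟨m, hx, h⟩ := h
    obtain ⟨ws, h1, h2, h3⟩ := ih h
    refine ⟨(m, x.2) :: ws, ?_, by simp [h2], ?_⟩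
    · intro w hw
      rcases List.mem_cons.mp hw with rfl | hw
      exacts [hx.2, h1 w hw]
    · rw [List.map_cons, ← h3, ← hx.1]

theorem listDeg_map {ws : List (ℤ × A)} (h : ∀ w ∈ ws, w.2 ∈ 𝒜 w.1) :
    ListDeg 𝒜 (ws.map fun w => ((w.1 : ZMod 2), w.2)) (ws.map fun w => w.1 - 1).sum := by
  induction ws with
  | nil => rfl
  | cons w ws ih =>
    simp only [List.map_cons, List.sum_cons]
    exact (ih fun w' hw' => h w' (List.mem_cons_of_mem _ hw')).cons ⟨rfl, h w List.mem_cons_self⟩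

theorem IsHom.oddL {φ : A →ₗ[R] A} (hφ : ∀ n, ∀ a ∈ 𝒜 n, φ a ∈ 𝒜 (n + 1)) {x : ZMod 2 × A} {m}
    (h : IsHom 𝒜 x m) : IsHom 𝒜 (oddL φ x) (m + 1) :=
  ⟨by simp [NCFourier.oddL, h.1], hφ _ _ h.2⟩

variable [GradedAlgebra 𝒜]

theorem IsHom.mulL {x y : ZMod 2 × A} {m n} (h : IsHom 𝒜 x m) (h' : IsHom 𝒜 y n) :
    IsHom 𝒜 (mulL x y) (m + n) :=
  ⟨by simp [NCFourier.mulL, h.1, h'.1], SetLike.GradedMul.mul_mem h.2 h'.2⟩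

theorem isHom_one : IsHom 𝒜 (0, (1 : A)) 0 := ⟨by simp, SetLike.GradedOne.one_mem⟩

theorem Homog.mulL {x y : ZMod 2 × A} (h : Homog 𝒜 x) (h' : Homog 𝒜 y) :
    Homog 𝒜 (mulL x y) :=
  let ⟨_, h⟩ := h; let ⟨_, h'⟩ := h'; ⟨_, h.mulL h'⟩

theorem Homog.oddL {φ : A →ₗ[R] A} (hφ : ∀ n, ∀ a ∈ 𝒜 n, φ a ∈ 𝒜 (n + 1)) {x : ZMod 2 × A}
    (h : Homog 𝒜 x) : Homog 𝒜 (oddL φ x) :=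
  let ⟨_, h⟩ := h; ⟨_, h.oddL hφ⟩

theorem homog_one : Homog 𝒜 (0, (1 : A)) := ⟨0, isHom_one⟩

theorem mem_chainsDeg {x : ZMod 2 × A} {xs m n k} (hx : IsHom 𝒜 x m) (h : ListDeg 𝒜 xs n)
    (hk : m + n = k) : x.2 ⊗ₜ[R] word R xs ∈ chainsDeg 𝒜 k := by
  obtain ⟨ws, h1, h2, rfl⟩ := exists_degList h
  exact Submodule.subset_span ⟨m, x.2, ws, hx.2, h1, by rw [h2, hk], rfl⟩

/-- To show that a linear map sends the chains of degree `n` to a submodule, it suffices to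
look at homogeneous words. -/
theorem chainsDeg_le {n : ℤ} {S : Submodule R (Chains R A)}
    (h : ∀ x xs m k, IsHom 𝒜 x m → ListDeg 𝒜 xs k → m + k = n →
      x.2 ⊗ₜ[R] word R xs ∈ S) : chainsDeg 𝒜 n ≤ S := by
  refine Submodule.span_le.mpr ?_
  rintro _ ⟨m, a, ws, ha, hws, hn, rfl⟩
  exact h (m, a) _ m _ ⟨rfl, ha⟩ (listDeg_map hws) hn

theorem ChainFormula.lift_homog {M : Type w} [AddCommGroup M] [Module R M]
    (F : ChainFormula R A M) {x : ZMod 2 × A} {xs} (hx : Homog 𝒜 x) (h : ∀ y ∈ xs, Homog 𝒜 y) :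
    F.lift 𝒜 (x.2 ⊗ₜ[R] word R xs) = F.toFun x xs := by
  obtain ⟨m, hx⟩ := hx
  obtain ⟨n, h⟩ := exists_listDeg h
  obtain ⟨ws, h1, -, rfl⟩ := exists_degList h
  rw [F.lift_apply 𝒜 hx.2 ws h1, ← hx.1]

variable (𝒜)

theorem span_word_of_span {S : Set (ZMod 2 × A)}
    (hS : Submodule.span R (Prod.snd '' S) = ⊤) :
    Submodule.span R {w : TensorAlgebra R (ReducedPart R A) |
      ∃ xs : List (ZMod 2 × A), (∀ y ∈ xs, y ∈ S) ∧ w = word R xs} = ⊤ := by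
  rw [eq_top_iff]
  rintro t -
  induction t using TensorAlgebra.induction with
  | algebraMap r =>
    rw [Algebra.algebraMap_eq_smul_one]
    exact Submodule.smul_mem _ _ (Submodule.subset_span ⟨[], by simp, rfl⟩)
  | ι m =>
    obtain ⟨a, rfl⟩ := Submodule.mkQ_surjective _ m
    change letter R a ∈ _
    have ha : a ∈ Submodule.span R (Prod.snd '' S) := hS ▸ Submodule.mem_top
    induction ha using Submodule.span_induction with
    | mem a ha =>
      obtain ⟨x, hx, rfl⟩ := ha
      exact Submodule.subset_span ⟨[x], by simpa using hx, by simp [word]⟩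
    | zero => rw [map_zero]; exact zero_mem _
    | add a b _ _ ha hb => rw [map_add]; exact add_mem ha hb
    | smul r a _ ha => rw [map_smul]; exact Submodule.smul_mem _ _ ha
  | mul a b ha hb =>
    have := Submodule.mul_mem_mul ha hb
    rw [Submodule.span_mul_span] at this
    refine Submodule.span_mono ?_ this
    rintro _ ⟨_, ⟨xs, hx, rfl⟩, _, ⟨ys, hy, rfl⟩, rfl⟩
    refine ⟨xs ++ ys, ?_, (word_append R xs ys).symm⟩
    intro y h
    rcases List.mem_append.mp h with h | h
    exacts [hx y h, hy y h]
  | add a b ha hb => exact add_mem ha hb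

/-- If a set of letters spans the algebra, the words in these letters span the chains. -/
theorem span_chains_of_span {S : Set (ZMod 2 × A)}
    (hS : Submodule.span R (Prod.snd '' S) = ⊤) :
    Submodule.span R {c : Chains R A | ∃ (x : ZMod 2 × A) (xs : List (ZMod 2 × A)),
      x ∈ S ∧ (∀ y ∈ xs, y ∈ S) ∧ c = x.2 ⊗ₜ[R] word R xs} = ⊤ := by
  rw [eq_top_iff]
  rintro c -
  induction c using TensorProduct.induction_on with
  | zero => exact zero_mem _
  | tmul a t =>
    have ht : t ∈ (⊤ : Submodule R (TensorAlgebra R (ReducedPart R A))) := trivial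
    rw [← span_word_of_span hS] at ht
    induction ht using Submodule.span_induction with
    | mem t ht =>
      obtain ⟨xs, hxs, rfl⟩ := ht
      have ha : a ∈ Submodule.span R (Prod.snd '' S) := hS ▸ Submodule.mem_top
      induction ha using Submodule.span_induction with
      | mem a ha =>
        obtain ⟨x, hx, rfl⟩ := ha
        exact Submodule.subset_span ⟨x, xs, hx, hxs, rfl⟩
      | zero => rw [TensorProduct.zero_tmul]; exact zero_mem _
      | add a b _ _ ha hb => rw [TensorProduct.add_tmul]; exact add_mem ha hb
      | smul r a _ ha => rw [← TensorProduct.smul_tmul']; exact Submodule.smul_mem _ _ ha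
    | zero => rw [TensorProduct.tmul_zero]; exact zero_mem _
    | add s t _ _ hs ht => rw [TensorProduct.tmul_add]; exact add_mem hs ht
    | smul r t _ ht => rw [TensorProduct.tmul_smul]; exact Submodule.smul_mem _ _ ht
  | add a b ha hb => exact add_mem ha hb

theorem span_homog : Submodule.span R (Prod.snd '' {x : ZMod 2 × A | Homog 𝒜 x}) = ⊤ := by
  rw [eq_top_iff]
  rintro a -
  induction a using DirectSum.Decomposition.inductionOn 𝒜 with
  | zero => exact zero_mem _
  | @homogeneous n a => exact Submodule.subset_span ⟨((n : ZMod 2), (a : A)), ⟨n, rfl, a.2⟩, rfl⟩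
  | add a b ha hb => exact add_mem ha hb

theorem span_word_homog :
    Submodule.span R {w : TensorAlgebra R (ReducedPart R A) |
      ∃ xs : List (ZMod 2 × A), (∀ y ∈ xs, Homog 𝒜 y) ∧ w = word R xs} = ⊤ :=
  span_word_of_span (span_homog 𝒜)

theorem span_chains_homog :
    Submodule.span R {c : Chains R A | ∃ (x : ZMod 2 × A) (xs : List (ZMod 2 × A)),
      Homog 𝒜 x ∧ (∀ y ∈ xs, Homog 𝒜 y) ∧ c = x.2 ⊗ₜ[R] word R xs} = ⊤ :=
  span_chains_of_span (span_homog 𝒜)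

variable {𝒜}

/-- Two linear maps on chains which agree on homogeneous words are equal. -/
theorem chains_ext {M : Type w} [AddCommGroup M] [Module R M] {f g : Chains R A →ₗ[R] M}
    (h : ∀ x xs, Homog 𝒜 x → (∀ y ∈ xs, Homog 𝒜 y) →
      f (x.2 ⊗ₜ[R] word R xs) = g (x.2 ⊗ₜ[R] word R xs)) : f = g := by
  refine LinearMap.ext_on (span_chains_homog 𝒜) ?_
  rintro _ ⟨x, xs, hx, hxs, rfl⟩
  exact h x xs hx hxs

end Homogeneous

/-! ### The Hochschild differential -/

section Hochschild

variable {R : Type u} [CommRing R] {A : Type v} [Ring A] [Algebra R A]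
variable {M : Type w} [AddCommGroup M]

theorem derF_eq_elemSum (φ : A →ₗ[R] A) (G : List (ZMod 2 × A) → M) (xs) :
    derF φ G xs = elemSum (fun ys y zs => sgn (wdeg ys) • G (ys ++ oddL φ y :: zs)) xs := by
  induction xs generalizing G with
  | nil => rfl
  | cons x xs ih =>
    simp only [derF_cons, elemSum, wdeg_nil, sgn_zero, one_smul, List.nil_append, wdeg_cons,
      sgn_add, ← smul_smul, elemSum_zsmul, ih, List.cons_append]

theorem mergeF_eq_elemSum (G : List (ZMod 2 × A) → M) (xs) :
    mergeF G xs = elemSum (fun ys y zs => sgn (wdeg ys + rdeg y) •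
      headF (fun z zs => G (ys ++ mulL y z :: zs)) zs) xs := by
  induction xs generalizing G with
  | nil => rfl
  | cons x xs ih =>
    simp only [mergeF_cons, elemSum, wdeg_nil, zero_add, List.nil_append, wdeg_cons, add_assoc,
      sgn_add (rdeg x), ← smul_smul, elemSum_zsmul, ih, List.cons_append, smul_add]

/-- The Hochschild differential, acting on functions of a first element and a list by
precomposition. -/
def hochF (δ : A →ₗ[R] A) (F : ZMod 2 × A → List (ZMod 2 × A) → M) (x : ZMod 2 × A)
    (xs : List (ZMod 2 × A)) : M :=
  barF δ (headF F) (x :: xs) -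
    lastF (fun ys y => sgn (rdeg y * (x.1 + wdeg ys)) • F (mulL y x) ys) xs

theorem hochF_eq (δ : A →ₗ[R] A) (F : ZMod 2 × A → List (ZMod 2 × A) → M) (x xs) :
    hochF δ F x xs = F (oddL δ x) xs - sgn (rdeg x) • headF (fun z zs => F (mulL x z) zs) xs +
      sgn (rdeg x) • barF δ (F x) xs -
      lastF (fun ys y => sgn (rdeg y * (x.1 + wdeg ys)) • F (mulL y x) ys) xs := by
  rw [hochF, barF_cons]; rfl

theorem sgn_fst (x : ZMod 2 × A) : sgn x.1 = -sgn (rdeg x) := by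
  rw [rdeg, sgn_add_one, neg_neg]

variable {𝒜 : ℤ → Submodule R A} [GradedAlgebra 𝒜]

theorem elemSum_lastTerm (x : ZMod 2 × A) (xs : List (ZMod 2 × A)) :
    elemSum (lastTerm (R := R) x) xs =
      lastF (fun ys y => sgn (rdeg y * (x.1 + wdeg ys)) • ((y.2 * x.2) ⊗ₜ[R] word R ys)) xs := by
  refine elemSum_congr fun ys y zs _ => ?_
  cases zs <;> simp [lastTerm]

theorem lastF_map {X : Type*} {N : Type*} [AddCommGroup N] (g : M →+ N) (f : List X → X → M)
    (xs) : lastF (fun ys y => g (f ys y)) xs = g (lastF f xs) := by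
  rcases List.eq_nil_or_concat xs with rfl | ⟨xs, x, rfl⟩
  · simp
  · simp only [List.concat_eq_append, lastF_concat]

theorem DGStructure.map_hochschild [Module R M] (D : DGStructure 𝒜) (f : Chains R A →ₗ[R] M)
    {x : ZMod 2 × A} {xs} (hx : Homog 𝒜 x) (h : ∀ y ∈ xs, Homog 𝒜 y) :
    f (D.hochschild (x.2 ⊗ₜ[R] word R xs)) =
      hochF D.d (fun x xs => f (x.2 ⊗ₜ[R] word R xs)) x xs := by
  have e : D.hochschild (x.2 ⊗ₜ[R] word R xs) =
      hochF D.d (fun x xs => x.2 ⊗ₜ[R] word R xs) x xs := by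
    rw [hochschild, LinearMap.add_apply, ChainFormula.lift_homog _ hx h,
      ChainFormula.lift_homog _ hx h]
    simp only [lieDerFormula, mulFormula, elemSum_lastTerm, hochF_eq, barF]
    have e1 : elemSum (fun ys y zs => sgn (rdeg x + wdeg ys) •
        (x.2 ⊗ₜ[R] (word R ys * letter R (D.d y.2) * word R zs))) xs =
        sgn (rdeg x) • derF D.d (fun xs => x.2 ⊗ₜ[R] word R xs) xs := by
      rw [derF_eq_elemSum, ← elemSum_zsmul]
      simp only [sgn_add, ← smul_smul, word_append, word_cons, oddL, mul_assoc]
    have e2 : elemSum (mergeTerm (R := R) x) xs =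
        -sgn (rdeg x) • mergeF (fun xs => x.2 ⊗ₜ[R] word R xs) xs := by
      rw [mergeF_eq_elemSum, ← elemSum_zsmul]
      refine elemSum_congr fun ys y zs _ => ?_
      cases zs with
      | nil => simp [mergeTerm]
      | cons z zs =>
        simp only [mergeTerm, headF_cons, add_assoc, sgn_add x.1, sgn_fst, ← smul_smul,
          word_append, word_cons, mulL, mul_assoc]
    have e3 : firstTerm (R := R) x xs =
        -sgn (rdeg x) • headF (fun z zs => (mulL x z).2 ⊗ₜ[R] word R zs) xs := by
      cases xs <;> simp [firstTerm, sgn_fst, mulL]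
    rw [e1, e2, e3]
    simp only [oddL, mulL, smul_sub, neg_smul]
    abel
  rw [e, hochF_eq, hochF_eq]
  simp only [map_sub, map_add, map_zsmul]
  congr 1
  · congr 1
    · congr 2
      exact (headF_map f.toAddMonoidHom _ _).symm
    · congr 1
      exact (barF_map f.toAddMonoidHom _ _ _).symm
  · rw [← LinearMap.toAddMonoidHom_coe, ← lastF_map]
    simp only [map_zsmul]

theorem barF_congr {δ : A →ₗ[R] A} (hδ : ∀ n, ∀ a ∈ 𝒜 n, δ a ∈ 𝒜 (n + 1))
    {G H : List (ZMod 2 × A) → M} (h : ∀ L, (∀ y ∈ L, Homog 𝒜 y) → G L = H L) {xs}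
    (hxs : ∀ y ∈ xs, Homog 𝒜 y) : barF δ G xs = barF δ H xs := by
  induction xs generalizing G H with
  | nil => simp
  | cons y ys ih =>
    have h1 : Homog 𝒜 y := hxs y List.mem_cons_self
    have h2 : ∀ z ∈ ys, Homog 𝒜 z := fun z hz => hxs z (List.mem_cons_of_mem _ hz)
    rw [barF_cons, barF_cons, h _ (List.forall_mem_cons.mpr ⟨h1.oddL hδ, h2⟩),
      ih (fun L hL => h _ (List.forall_mem_cons.mpr ⟨h1, hL⟩)) h2]
    congr 3
    cases ys with
    | nil => rfl
    | cons z zs =>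
      exact h _ (List.forall_mem_cons.mpr ⟨h1.mulL (h2 z List.mem_cons_self),
        fun w hw => h2 w (List.mem_cons_of_mem _ hw)⟩)

theorem hochF_congr {δ : A →ₗ[R] A} (hδ : ∀ n, ∀ a ∈ 𝒜 n, δ a ∈ 𝒜 (n + 1))
    {F F' : ZMod 2 × A → List (ZMod 2 × A) → M}
    (h : ∀ x xs, Homog 𝒜 x → (∀ y ∈ xs, Homog 𝒜 y) → F x xs = F' x xs) {x xs}
    (hx : Homog 𝒜 x) (hxs : ∀ y ∈ xs, Homog 𝒜 y) : hochF δ F x xs = hochF δ F' x xs := by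
  rw [hochF, hochF]
  congr 1
  · refine barF_congr hδ (fun L hL => ?_) (List.forall_mem_cons.mpr ⟨hx, hxs⟩)
    cases L with
    | nil => rfl
    | cons y ys => exact h _ _ (hL y List.mem_cons_self) fun z hz => hL z (List.mem_cons_of_mem _ hz)
  · rcases List.eq_nil_or_concat xs with rfl | ⟨ys, y, rfl⟩
    · rfl
    · rw [List.concat_eq_append] at hxs ⊢
      rw [lastF_concat, lastF_concat, h _ _ ((hxs y (by simp)).mulL hx)
        fun z hz => hxs z (by simp [hz])]

/-- The bar differential on a list with a last element singled out. -/
theorem barF_concat (δ : A →ₗ[R] A) (G : List (ZMod 2 × A) → M) (xs a) :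
    barF δ G (xs ++ [a]) = barF δ (fun L => G (L ++ [a])) xs +
      sgn (wdeg xs) • (G (xs ++ [oddL δ a]) - lastF (fun ys y => G (ys ++ [mulL y a])) xs) := by
  induction xs generalizing G with
  | nil => simp [barF_cons, wdeg_nil, sgn_zero]
  | cons x xs ih =>
    rw [List.cons_append, barF_cons, barF_cons, ih]
    have e : lastF (fun ys y => G (ys ++ [mulL y a])) (x :: xs) =
        if xs = [] then G [mulL x a] else lastF (fun ys y => G (x :: (ys ++ [mulL y a]))) xs := by
      rcases List.eq_nil_or_concat xs with rfl | ⟨ys, y, rfl⟩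
      · simpa using lastF_concat (fun ys y => G (ys ++ [mulL y a])) [] x
      · rw [List.concat_eq_append, ← List.cons_append, lastF_concat, lastF_concat]; simp
    rw [e]
    cases xs with
    | nil => simp [wdeg_nil, wdeg_cons, sgn_zero, smul_sub, sub_eq_add_neg]; abel
    | cons y ys =>
      simp only [headF_cons, List.cons_append, wdeg_cons, sgn_add, smul_add, smul_sub, smul_smul,
        reduceCtorEq, if_false]
      abel

theorem wdeg_oddL (φ : A →ₗ[R] A) (x : ZMod 2 × A) (xs) :
    wdeg (oddL φ x :: xs) = wdeg (x :: xs) + 1 := by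
  simp only [wdeg_cons, rdeg_oddL]; ring

/-- The terms of the bar differential of a word `L` all have parity `‖L‖ + 1`. -/
theorem barF_sgn (δ : A →ₗ[R] A) (s : ZMod 2 → ℤ) (G : List (ZMod 2 × A) → M) (xs) :
    barF δ (fun L => s (wdeg L) • G L) xs = s (wdeg xs + 1) • barF δ G xs := by
  induction xs generalizing G s with
  | nil => simp
  | cons x xs ih =>
    have h := ih (fun p => s (rdeg x + p)) fun L => G (x :: L)
    simp only [barF_cons, wdeg_oddL, smul_add, smul_sub]
    simp only [wdeg_cons] at h ⊢
    rw [h]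
    cases xs with
    | nil => simp [smul_smul, mul_comm, add_assoc]
    | cons y ys =>
      simp only [headF_cons, rdeg_mulL, smul_smul, mul_comm (s _), wdeg_cons, add_assoc]
      rw [show rdeg x + (rdeg y + (1 + wdeg ys)) = rdeg x + (rdeg y + (wdeg ys + 1)) by ring]

end Hochschild

/-! ### The square of the Hochschild differential -/

section HochschildSq

variable {R : Type u} [CommRing R] {A : Type v} [Ring A] [Algebra R A]
variable {M : Type w} [AddCommGroup M]

/-- The part of the Hochschild differential which moves the last element of a word to the front,
acting on functions of lists by precomposition. -/
def wrapF (G : List (ZMod 2 × A) → M) : List (ZMod 2 × A) → M :=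
  headF fun x xs => lastF (fun ys y => sgn (rdeg y * (x.1 + wdeg ys)) • G (mulL y x :: ys)) xs

@[simp] theorem wrapF_singleton (G : List (ZMod 2 × A) → M) (x) : wrapF G [x] = 0 := rfl

@[simp] theorem wrapF_concat (G : List (ZMod 2 × A) → M) (x xs y) : wrapF G (x :: (xs ++ [y])) =
    sgn (rdeg y * (x.1 + wdeg xs)) • G (mulL y x :: xs) := by
  rw [wrapF, headF_cons, lastF_concat]

theorem headF_hochF (δ : A →ₗ[R] A) (F : ZMod 2 × A → List (ZMod 2 × A) → M) :
    headF (hochF δ F) = fun L => barF δ (headF F) L - wrapF (headF F) L := by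
  funext L
  cases L with
  | nil => simp [wrapF]
  | cons x xs => rfl

theorem wrapF_sub (G H : List (ZMod 2 × A) → M) (L) :
    wrapF (fun L => G L - H L) L = wrapF G L - wrapF H L := by
  cases L with
  | nil => simp [wrapF]
  | cons x xs =>
    rcases List.eq_nil_or_concat xs with rfl | ⟨ys, y, rfl⟩
    · simp
    · simp only [List.concat_eq_append, wrapF_concat, smul_sub]

/-- The bar differential anticommutes with the wrap-around term up to the square of the latter. -/
theorem barF_wrapF {δ : A →ₗ[R] A} {G : List (ZMod 2 × A) → M} (hG : SlotAdd G) (x xs)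
    (hxs : ∀ y ∈ xs, IsLeibniz δ y) :
    barF δ (wrapF G) (x :: xs) + wrapF (barF δ G) (x :: xs) = wrapF (wrapF G) (x :: xs) := by
  rcases List.eq_nil_or_concat xs with rfl | ⟨ys, a, rfl⟩
  · simp only [wrapF_singleton, barF_cons, headF_nil, barF_nil]; simp
  rw [List.concat_eq_append] at hxs ⊢
  have ha : IsLeibniz δ a := hxs a (by simp)
  rw [wrapF_concat, wrapF_concat, ← List.cons_append, barF_concat]
  -- the terms in which the last element is not touched
  have e1 : (fun L => wrapF G (L ++ [a])) = fun L => sgn (rdeg a * (wdeg L + 1)) •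
      headF (fun y ys => G (mulL a y :: ys)) L := by
    funext L
    cases L with
    | nil => simp
    | cons y ys =>
      rw [List.cons_append, wrapF_concat, headF_cons, wdeg_cons]
      congr 3
      rw [rdeg]; grind
  rw [e1, barF_sgn δ (fun p => sgn (rdeg a * (p + 1)))]
  have e2 : barF δ (headF fun y ys => G (mulL a y :: ys)) (x :: ys) =
      sgn a.1 • (barF δ G (mulL a x :: ys) - G (mulL (oddL δ a) x :: ys)) := by
    rw [barF_cons, barF_cons]
    have e3 : G (oddL δ (mulL a x) :: ys) =
        G (mulL (oddL δ a) x :: ys) + sgn a.1 • G (mulL a (oddL δ x) :: ys) := by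
      have h1 : oddL δ (mulL a x) = (a.1 + x.1 + 1, δ a.2 * x.2 + sgn a.1 • (a.2 * δ x.2)) := by
        simp only [oddL, mulL, ha x.2]
      have h2 := hG [] (a.1 + x.1 + 1) (δ a.2 * x.2) (sgn a.1 • (a.2 * δ x.2)) ys
      have h3 := hG.sgn_smul [] (a.1 + x.1 + 1) a.1 (a.2 * δ x.2) ys
      simp only [List.nil_append] at h2 h3
      rw [h1, h2, h3]
      simp only [mulL, oddL, add_assoc, add_comm x.1 1]
    rw [e3]
    have h4 : rdeg (mulL a x) = rdeg x + a.1 := by rw [rdeg_mulL]; simp only [rdeg]; grind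
    have h5 : (fun z zs => G (mulL (mulL a x) z :: zs)) = fun z zs => G (mulL a (mulL x z) :: zs) := by
      simp only [mulL_assoc]
    rw [h4, h5]
    simp only [headF_cons, sgn_add]
    rcases sgn_eq_or a.1 with e | e <;> rw [e] <;> simp <;> abel
  rw [e2]
  have e4 : wrapF G (x :: ys ++ [oddL δ a]) =
      sgn ((rdeg a + 1) * (x.1 + wdeg ys)) • G (mulL (oddL δ a) x :: ys) := by
    rw [List.cons_append, wrapF_concat, rdeg_oddL]
  rw [e4]
  have e5 : -sgn (wdeg (x :: ys)) • lastF (fun us y => wrapF G (us ++ [mulL y a])) (x :: ys) =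
      sgn (rdeg a * (x.1 + wdeg ys)) • wrapF G (mulL a x :: ys) := by
    rcases List.eq_nil_or_concat ys with rfl | ⟨zs, c, rfl⟩
    · have := lastF_concat (fun us y => wrapF G (us ++ [mulL y a])) [] x
      simp only [List.nil_append] at this
      simp [this]
    · rw [List.concat_eq_append, ← List.cons_append, lastF_concat, List.cons_append (bs := [mulL c a]),
        wrapF_concat, wrapF_concat, mulL_assoc, smul_smul, smul_smul, ← sgn_add_one, ← sgn_add, ← sgn_add]
      congr 2
      simp only [wdeg_cons, wdeg_append, wdeg_nil, rdeg_mulL, mulL]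
      simp only [rdeg]; grind
  have s1 : sgn (rdeg a * (wdeg (x :: ys) + 1 + 1)) * sgn a.1 =
      -sgn (rdeg a * (x.1 + wdeg ys)) := by
    rw [← sgn_add, ← sgn_add_one]; congr 1; simp only [rdeg, wdeg_cons]; grind
  have s2 : sgn (wdeg (x :: ys)) * sgn ((rdeg a + 1) * (x.1 + wdeg ys)) =
      -sgn (rdeg a * (x.1 + wdeg ys)) := by
    rw [← sgn_add, ← sgn_add_one]; congr 1; simp only [rdeg, wdeg_cons]; grind
  rw [smul_smul, s1, smul_sub (sgn (wdeg (x :: ys))), smul_smul, s2, ← e5]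
  simp only [neg_smul, smul_sub]
  abel

theorem hochF_hochF {δ : A →ₗ[R] A} (h : ∀ a, δ (δ a) = 0)
    {F : ZMod 2 × A → List (ZMod 2 × A) → M} (hF : SlotAdd (headF F)) {x xs}
    (hx : IsLeibniz δ x) (hxs : ∀ y ∈ xs, IsLeibniz δ y) : hochF δ (hochF δ F) x xs = 0 := by
  have h1 := barF_wrapF hF x xs hxs
  have h2 : barF δ (barF δ (headF F)) (x :: xs) = 0 :=
    barF_barF h hF (List.forall_mem_cons.mpr ⟨hx, hxs⟩)
  have h3 : hochF δ (hochF δ F) x xs =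
      barF δ (headF (hochF δ F)) (x :: xs) - wrapF (headF (hochF δ F)) (x :: xs) := rfl
  have h4 : barF δ (fun L => barF δ (headF F) L - wrapF (headF F) L) (x :: xs) =
    barF δ (barF δ (headF F)) (x :: xs) - barF δ (wrapF (headF F)) (x :: xs) := barF_sub _ _ _ _
  have h5 : wrapF (fun L => barF δ (headF F) L - wrapF (headF F) L) (x :: xs) =
    wrapF (barF δ (headF F)) (x :: xs) - wrapF (wrapF (headF F)) (x :: xs) := wrapF_sub _ _ _
  rw [h3, headF_hochF, h4, h5, h2, ← h1]
  abel

variable {𝒜 : ℤ → Submodule R A} [GradedAlgebra 𝒜]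

theorem DGStructure.isLeibniz (D : DGStructure 𝒜) {x : ZMod 2 × A} (hx : Homog 𝒜 x) :
    IsLeibniz D.d x := by
  obtain ⟨m, h1, h2⟩ := hx
  intro b
  rw [D.leibniz m _ h2, h1]

theorem slotAdd_chain : SlotAdd (headF fun (x : ZMod 2 × A) xs => x.2 ⊗ₜ[R] word R xs) := by
  intro us p a b vs
  cases us with
  | nil => simp only [List.nil_append, headF_cons, TensorProduct.add_tmul]
  | cons u us => simp only [List.cons_append, headF_cons, word_add, TensorProduct.tmul_add]

theorem DGStructure.hochschild_hochschild (D : DGStructure 𝒜) (c : Chains R A) :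
    D.hochschild (D.hochschild c) = 0 := by
  suffices h : D.hochschild ∘ₗ D.hochschild = 0 from LinearMap.congr_fun h c
  refine chains_ext (𝒜 := 𝒜) fun x xs hx hxs => ?_
  have h1 : ∀ (y : ZMod 2 × A) ys, Homog 𝒜 y → (∀ z ∈ ys, Homog 𝒜 z) →
      D.hochschild (y.2 ⊗ₜ[R] word R ys) = hochF D.d (fun x xs => x.2 ⊗ₜ[R] word R xs) y ys :=
    fun y ys hy hys => D.map_hochschild LinearMap.id hy hys
  rw [LinearMap.comp_apply, D.map_hochschild _ hx hxs, hochF_congr D.d_mem h1 hx hxs]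
  exact hochF_hochF D.d_d (slotAdd_chain (R := R)) (D.isLeibniz hx) fun y hy => D.isLeibniz (hxs y hy)

end HochschildSq

/-! ### Cyclic rotations of words -/

section Rotations

variable {R : Type u} [CommRing R] {A : Type v} [Ring A] [Algebra R A]
variable {M : Type w} [AddCommGroup M]

/-- The bar differential is a coderivation for the deconcatenation of words. -/
theorem barF_splitSum (δ : A →ₗ[R] A) (F : List (ZMod 2 × A) → List (ZMod 2 × A) → M) (xs) :
    barF δ (splitSum F) xs = splitSum (fun ys zs => barF δ (fun Y => F Y zs) ys +
      sgn (wdeg ys) • barF δ (F ys) zs) xs := by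
  induction xs generalizing F with
  | nil => simp [splitSum]
  | cons x xs ih =>
    have h := ih fun Y => F (x :: Y)
    rw [barF_cons]
    simp only [splitSum, barF_nil, wdeg_nil, sgn_zero, one_smul, zero_add, barF_cons, wdeg_cons,
      sgn_add, ← smul_smul, splitSum_add, splitSum_sub, splitSum_zsmul, splitSum_headF, barF_add,
      h, headF_add, smul_add] at h ⊢
    abel

/-- The sum over all rotations `zs x ys` of the word `x ys zs`, with Koszul signs. -/
def rotF (H : List (ZMod 2 × A) → ZMod 2 × A → List (ZMod 2 × A) → M) (x : ZMod 2 × A)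
    (xs : List (ZMod 2 × A)) : M :=
  splitSum (fun ys zs => sgn ((rdeg x + wdeg ys) * wdeg zs) • H zs x ys) xs

/-- The bar differential on functions of a word `zs x ys` with a marked letter `x`. -/
def barM (δ : A →ₗ[R] A) (H : List (ZMod 2 × A) → ZMod 2 × A → List (ZMod 2 × A) → M)
    (zs : List (ZMod 2 × A)) (x : ZMod 2 × A) (ys : List (ZMod 2 × A)) : M :=
  barF δ (fun Z => H Z x ys) zs + sgn (wdeg zs) • (H zs (oddL δ x) ys -
    sgn (rdeg x) • headF (fun c cs => H zs (mulL x c) cs) ys + sgn (rdeg x) • barF δ (H zs x) ys) -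
  sgn (wdeg zs) • lastF (fun zs' z => H zs' (mulL z x) ys) zs

theorem barF_append_cons (δ : A →ₗ[R] A) (G : List (ZMod 2 × A) → M) (zs x ys) :
    barF δ G (zs ++ x :: ys) = barM δ (fun zs x ys => G (zs ++ x :: ys)) zs x ys := by
  induction zs generalizing G with
  | nil => simp [barM, barF_cons, wdeg_nil, sgn_zero]
  | cons z zs ih =>
    rw [List.cons_append, barF_cons, ih]
    have e : lastF (fun zs' w => G (zs' ++ mulL w x :: ys)) (z :: zs) =
        if zs = [] then G (mulL z x :: ys)
        else lastF (fun zs' w => G (z :: (zs' ++ mulL w x :: ys))) zs := by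
      rcases List.eq_nil_or_concat zs with rfl | ⟨us, u, rfl⟩
      · simpa using lastF_concat (fun zs' w => G (zs' ++ mulL w x :: ys)) [] z
      · rw [List.concat_eq_append, ← List.cons_append, lastF_concat, lastF_concat]; simp
    simp only [barM, e, barF_cons, wdeg_cons, sgn_add, ← smul_smul, List.cons_append]
    cases zs with
    | nil => simp [wdeg_nil, sgn_zero]; abel
    | cons w ws =>
      simp only [reduceCtorEq, if_false, headF_cons, List.cons_append, smul_add, smul_sub]
      abel

theorem lastF_zsmul (r : ℤ) (f : List (ZMod 2 × A) → ZMod 2 × A → M) (xs) :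
    lastF (fun ys y => r • f ys y) xs = r • lastF f xs :=
  lastF_map (DistribSMul.toAddMonoidHom M r) f xs

theorem lastF_congr {f g : List (ZMod 2 × A) → ZMod 2 × A → M} {xs}
    (h : ∀ ys y, ys ++ [y] = xs → f ys y = g ys y) : lastF f xs = lastF g xs := by
  rcases List.eq_nil_or_concat xs with rfl | ⟨xs, x, rfl⟩
  · simp
  · rw [List.concat_eq_append, lastF_concat, lastF_concat, h _ _ (List.concat_eq_append).symm]

theorem headF_congr {f g : ZMod 2 × A → List (ZMod 2 × A) → M} {xs}
    (h : ∀ y ys, y :: ys = xs → f y ys = g y ys) : headF f xs = headF g xs := by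
  cases xs with
  | nil => simp
  | cons x xs => exact h x xs rfl

/-- Rotation of words intertwines the Hochschild differential with the bar differential. -/
theorem rotF_barM (δ : A →ₗ[R] A)
    (H : List (ZMod 2 × A) → ZMod 2 × A → List (ZMod 2 × A) → M) (x xs) :
    rotF (barM δ H) x xs = hochF δ (rotF H) x xs := by
  have e1 : barF δ (rotF H x) xs = splitSum (fun ys zs =>
      sgn ((rdeg x + (wdeg ys + 1)) * wdeg zs) • barF δ (H zs x) ys +
      sgn (wdeg ys + (rdeg x + wdeg ys) * (wdeg zs + 1)) • barF δ (fun Z => H Z x ys) zs) xs := by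
    change barF δ (splitSum _) xs = _
    rw [barF_splitSum]
    refine splitSum_congr fun ys zs _ => ?_
    rw [barF_sgn δ (fun p => sgn ((rdeg x + p) * wdeg zs)),
      barF_sgn δ (fun p => sgn ((rdeg x + wdeg ys) * p)), smul_smul, sgn_add]
  have e2 : headF (fun z zs => rotF H (mulL x z) zs) xs = splitSum (fun ys zs =>
      headF (fun c cs => sgn ((rdeg x + wdeg ys + 1) * wdeg zs) • H zs (mulL x c) cs) ys) xs := by
    refine Eq.trans ?_ (Eq.trans (splitSum_headF (fun c cs zs =>
      sgn ((rdeg x + (rdeg c + wdeg cs) + 1) * wdeg zs) • H zs (mulL x c) cs) xs).symm ?_)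
    · simp only [rotF, rdeg_mulL]
      refine headF_congr fun y ys _ => splitSum_congr fun us vs _ => ?_
      congr 2; ring
    · refine splitSum_congr fun ys zs _ => headF_congr fun c cs h => ?_
      rw [← h, wdeg_cons]
  have e3 : lastF (fun ys y => sgn (rdeg y * (x.1 + wdeg ys)) • rotF H (mulL y x) ys) xs =
      splitSum (fun ys zs => lastF (fun zs' z =>
        sgn ((rdeg x + wdeg ys) * wdeg zs + wdeg zs) • H zs' (mulL z x) ys) zs) xs := by
    refine Eq.trans ?_ (Eq.trans (splitSum_lastF (fun ys zs' z =>
      sgn ((rdeg x + wdeg ys) * (wdeg zs' + rdeg z) + (wdeg zs' + rdeg z)) •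
        H zs' (mulL z x) ys) xs).symm ?_)
    · refine lastF_congr fun as a _ => ?_
      rw [rotF, ← splitSum_zsmul]
      refine splitSum_congr fun ys zs h => ?_
      rw [smul_smul, ← sgn_add, ← h, rdeg_mulL, wdeg_append]
      congr 2
      simp only [rdeg]; grind
    · refine splitSum_congr fun ys zs _ => lastF_congr fun zs' z h => ?_
      rw [← h, wdeg_append, wdeg_cons, wdeg_nil, add_zero]
  rw [hochF_eq, e1, e2, e3]
  simp only [rotF, ← splitSum_zsmul, ← splitSum_add, ← splitSum_sub]
  refine splitSum_congr fun ys zs _ => ?_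
  simp only [barM, smul_add, smul_sub, smul_smul, headF_zsmul, lastF_zsmul, ← sgn_add, rdeg_oddL]
  rw [show rdeg x + (rdeg x + (wdeg ys + 1)) * wdeg zs =
      (rdeg x + wdeg ys) * wdeg zs + (wdeg zs + rdeg x) by grind,
    show rdeg x + (wdeg ys + (rdeg x + wdeg ys) * (wdeg zs + 1)) =
      (rdeg x + wdeg ys) * wdeg zs by grind,
    show rdeg x + (rdeg x + wdeg ys + 1) * wdeg zs =
      (rdeg x + wdeg ys) * wdeg zs + (wdeg zs + rdeg x) by grind,
    show (rdeg x + 1 + wdeg ys) * wdeg zs =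
      (rdeg x + wdeg ys) * wdeg zs + wdeg zs by grind]
  abel

theorem rotF_sub (H H' : List (ZMod 2 × A) → ZMod 2 × A → List (ZMod 2 × A) → M) (x xs) :
    rotF (fun zs x ys => H zs x ys - H' zs x ys) x xs = rotF H x xs - rotF H' x xs := by
  simp only [rotF, smul_sub, splitSum_sub]

theorem rotF_add (H H' : List (ZMod 2 × A) → ZMod 2 × A → List (ZMod 2 × A) → M) (x xs) :
    rotF (fun zs x ys => H zs x ys + H' zs x ys) x xs = rotF H x xs + rotF H' x xs := by
  simp only [rotF, smul_add, splitSum_add]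

theorem rotF_map {N : Type*} [AddCommGroup N] (f : M →+ N)
    (H : List (ZMod 2 × A) → ZMod 2 × A → List (ZMod 2 × A) → M) (x xs) :
    rotF (fun zs x ys => f (H zs x ys)) x xs = f (rotF H x xs) := by
  rw [rotF, rotF, ← splitSum_map]
  simp only [map_zsmul]

theorem rotF_congr {H H' : List (ZMod 2 × A) → ZMod 2 × A → List (ZMod 2 × A) → M} {x xs}
    (h : ∀ ys zs, ys ++ zs = xs → H zs x ys = H' zs x ys) : rotF H x xs = rotF H' x xs :=
  splitSum_congr fun ys zs e => by rw [h ys zs e]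

/-- The difference of the two ways of making one of the two outer letters of a word the first
element of a chain. -/
def endsF (F : ZMod 2 × A → List (ZMod 2 × A) → M) (L : List (ZMod 2 × A)) : M :=
  headF F L - lastF (fun ys y => sgn (rdeg y * wdeg ys) • F y ys) L

/-- The sum over all rotations telescopes. -/
theorem rotF_endsF (F : ZMod 2 × A → List (ZMod 2 × A) → M) (x xs) :
    rotF (fun zs x ys => endsF F (zs ++ x :: ys)) x xs = 0 := by
  simp only [endsF]
  rw [rotF_sub]
  have e1 : rotF (fun zs x ys => headF F (zs ++ x :: ys)) x xs = F x xs +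
      elemSum (fun ys z zs => sgn ((rdeg x + wdeg ys) * (rdeg z + wdeg zs)) •
        F z (zs ++ x :: ys)) xs := by
    rw [rotF, splitSum_eq_last]
    simp [wdeg_nil, sgn_zero, wdeg_cons]
  have e2 : rotF (fun zs x ys => lastF (fun ys y => sgn (rdeg y * wdeg ys) • F y ys)
      (zs ++ x :: ys)) x xs = F x xs +
      elemSum (fun ys z zs => sgn ((rdeg x + wdeg ys) * (rdeg z + wdeg zs)) •
        F z (zs ++ x :: ys)) xs := by
    rw [rotF, splitSum_eq_first]
    congr 1
    · rw [lastF_concat, smul_smul, wdeg_nil, add_zero, sgn_mul_self, one_smul]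
    · refine elemSum_congr fun ys z zs _ => ?_
      rw [← List.cons_append, ← List.append_assoc, lastF_concat, smul_smul, ← sgn_add]
      congr 2
      simp only [wdeg_append, wdeg_cons, wdeg_nil]; grind
  rw [e1, e2, sub_self]

/-! ### Rotations with an odd map applied to a letter in front of the marked one -/

theorem derF_concat (φ : A →ₗ[R] A) (G : List (ZMod 2 × A) → M) (xs a) :
    derF φ G (xs ++ [a]) = derF φ (fun L => G (L ++ [a])) xs +
      sgn (wdeg xs) • G (xs ++ [oddL φ a]) := by
  rw [derF_eq_elemSum, derF_eq_elemSum, elemSum_append]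
  simp [elemSum]

theorem derF_sgn (φ : A →ₗ[R] A) (s : ZMod 2 → ℤ) (G : List (ZMod 2 × A) → M) (xs) :
    derF φ (fun L => s (wdeg L) • G L) xs = s (wdeg xs + 1) • derF φ G xs := by
  rw [derF_eq_elemSum, derF_eq_elemSum, ← elemSum_zsmul]
  refine elemSum_congr fun ys y zs h => ?_
  rw [← h, smul_smul, smul_smul, mul_comm]
  simp only [wdeg_append, wdeg_cons, rdeg_oddL]
  congr 3; ring

/-- The commutation of the bar differential with an odd derivation which only acts on the letters
in front of the marked one. The failure of anticommutativity comes from the last of these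
letters. -/
theorem derF_barM_add {φ δ : A →ₗ[R] A} (h : ∀ a, φ (δ a) + δ (φ a) = 0)
    {G : List (ZMod 2 × A) → M} (hG : SlotAdd G) {zs : List (ZMod 2 × A)}
    (hzs : ∀ y ∈ zs, IsLeibniz φ y) (x ys) :
    derF φ (fun Z => barF δ G (Z ++ x :: ys)) zs +
      barM δ (fun zs x ys => derF φ (fun Z => G (Z ++ x :: ys)) zs) zs x ys =
    lastF (fun zs' z => sgn (rdeg z) • G (zs' ++ mulL (oddL φ z) x :: ys)) zs := by
  have hG' : SlotAdd fun Z => G (Z ++ x :: ys) := fun us p a b vs => by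
    simpa using hG us p a b (vs ++ x :: ys)
  have h1 := derF_barF_add h hG' hzs
  have e1 : barF δ (fun Z => derF φ (fun Z => G (Z ++ x :: ys)) Z) zs =
      -derF φ (barF δ fun Z => G (Z ++ x :: ys)) zs := by
    rw [eq_neg_iff_add_eq_zero, add_comm]; exact h1
  simp only [barF_append_cons]
  simp only [barM, derF_add, derF_sub]
  rw [derF_sgn φ sgn, derF_sgn φ sgn, derF_add, derF_sub, derF_zsmul, derF_zsmul, e1]
  have e2 : headF (fun c cs => derF φ (fun Z => G (Z ++ mulL x c :: cs)) zs) ys =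
      derF φ (fun Z => headF (fun c cs => G (Z ++ mulL x c :: cs)) ys) zs := by
    cases ys <;> simp [derF_zero]
  have e3 : barF δ (fun L => derF φ (fun Z => G (Z ++ x :: L)) zs) ys =
      derF φ (fun Z => barF δ (fun L => G (Z ++ x :: L)) ys) zs := by
    clear h1 e1 hzs hG' e2
    induction zs generalizing G with
    | nil =>
      exact barF_map (0 : M →+ M) δ (fun _ => 0) ys
    | cons z zs ih =>
      simp only [derF_cons, List.cons_append, barF_add, barF_zsmul, ih (hG.cons z)]
  have e4 : derF φ (fun Z => lastF (fun zs' z => G (zs' ++ mulL z x :: ys)) Z) zs =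
      lastF (fun zs' z => derF φ (fun Z => G (Z ++ mulL z x :: ys)) zs' +
        sgn (wdeg zs') • G (zs' ++ mulL (oddL φ z) x :: ys)) zs := by
    rcases List.eq_nil_or_concat zs with rfl | ⟨us, u, rfl⟩
    · rfl
    · rw [List.concat_eq_append, derF_concat]; simp
  have e5 : lastF (fun zs' z => derF φ (fun Z => G (Z ++ mulL z x :: ys)) zs' +
        sgn (wdeg zs') • G (zs' ++ mulL (oddL φ z) x :: ys)) zs =
      lastF (fun zs' z => derF φ (fun Z => G (Z ++ mulL z x :: ys)) zs') zs +
      sgn (wdeg zs) • lastF (fun zs' z => sgn (rdeg z) • G (zs' ++ mulL (oddL φ z) x :: ys)) zs := by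
    rcases List.eq_nil_or_concat zs with rfl | ⟨us, u, rfl⟩
    · simp
    · rw [List.concat_eq_append]
      simp only [lastF_concat, wdeg_append, wdeg_cons, wdeg_nil, add_zero, sgn_add, smul_smul,
        mul_assoc, sgn_mul_self, mul_one]
  rw [e2, e3, e4, e5]
  simp only [sgn_add_one, neg_smul, smul_add, smul_sub]
  rcases sgn_eq_or (wdeg zs) with h | h <;> rcases sgn_eq_or (rdeg x) with h' | h' <;>
    simp only [h, h', one_smul, neg_smul, neg_neg] <;> abel

/-- The products of `φ(z)` with the marked letter, where `z` is the letter in front of it in the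
rotated word, add up to the rotations of the words in which `φ` of the last letter has been
multiplied to the first one. -/
theorem rotF_lastF (φ : A →ₗ[R] A)
    (H : List (ZMod 2 × A) → ZMod 2 × A → List (ZMod 2 × A) → M) (x xs) :
    rotF (fun zs x ys => lastF (fun zs' z => sgn (rdeg z) • H zs' (mulL (oddL φ z) x) ys) zs) x xs =
      lastF (fun as a => sgn (rdeg a * (x.1 + wdeg as)) • rotF H (mulL (oddL φ a) x) as) xs := by
  refine Eq.trans (splitSum_congr fun ys zs _ => ?_) ((splitSum_lastF (fun ys zs' z =>
    sgn ((rdeg x + wdeg ys) * (wdeg zs' + rdeg z)) • sgn (rdeg z) •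
      H zs' (mulL (oddL φ z) x) ys) xs).trans ?_)
  · rw [← lastF_zsmul]
    refine lastF_congr fun zs' z h => ?_
    rw [← h, wdeg_append, wdeg_cons, wdeg_nil, add_zero]
  · refine lastF_congr fun as a _ => ?_
    rw [rotF, ← splitSum_zsmul]
    refine splitSum_congr fun ys zs h => ?_
    rw [smul_smul, smul_smul, ← sgn_add, ← sgn_add, ← h, rdeg_mulL, rdeg_oddL, wdeg_append]
    congr 2
    simp only [rdeg]; grind

/-- The telescoping of rotations in the presence of an odd map. -/
theorem rotF_derF_endsF (φ : A →ₗ[R] A) (F : ZMod 2 × A → List (ZMod 2 × A) → M) (x xs) :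
    rotF (fun zs x ys => derF φ (fun Z => endsF F (Z ++ x :: ys)) zs) x xs =
      rotF (fun zs x ys => lastF (fun L y => sgn (rdeg y * wdeg L) • F (oddL φ y) L)
        (zs ++ x :: ys)) x xs - F (oddL φ x) xs - sgn (rdeg x) • derF φ (F x) xs := by
  simp only [endsF, derF_sub]
  rw [rotF_sub]
  have e1 : rotF (fun zs x ys => derF φ (fun Z => headF F (Z ++ x :: ys)) zs) x xs =
      elemSum (fun ys z zs => sgn ((rdeg x + wdeg ys) * (rdeg z + wdeg zs)) •
        F (oddL φ z) (zs ++ x :: ys)) xs +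
      elemSum (fun ys z zs => sgn ((rdeg x + wdeg ys) * (rdeg z + wdeg zs) + rdeg z) •
        derF φ (fun Z => F z (Z ++ x :: ys)) zs) xs := by
    rw [rotF, splitSum_eq_last, ← elemSum_add]
    simp [derF, wdeg_cons, sgn_add _ (rdeg _), smul_smul]
  have e2 : rotF (fun zs x ys => derF φ (fun Z => lastF (fun L y => sgn (rdeg y * wdeg L) • F y L)
      (Z ++ x :: ys)) zs) x xs = sgn (rdeg x) • derF φ (F x) xs +
      elemSum (fun ys z zs => sgn ((rdeg x + wdeg ys) * (rdeg z + wdeg zs) + rdeg z) •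
        derF φ (fun Z => F z (Z ++ x :: ys)) zs) xs := by
    rw [rotF, splitSum_eq_first]
    congr 1
    · simp only [lastF_concat]
      rw [derF_sgn φ (fun p => sgn (rdeg x * p)), smul_smul, ← sgn_add]
      congr 2
      rw [wdeg_nil]; grind
    · refine elemSum_congr fun ys z zs _ => ?_
      simp only [← List.cons_append, ← List.append_assoc, lastF_concat]
      simp only [wdeg_append]
      rw [derF_sgn φ (fun p => sgn (rdeg z * (p + wdeg (x :: ys)))), smul_smul, ← sgn_add]
      congr 2
      simp only [wdeg_cons, wdeg_nil]; grind
  have e3 : rotF (fun zs x ys => lastF (fun L y => sgn (rdeg y * wdeg L) • F (oddL φ y) L)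
      (zs ++ x :: ys)) x xs = F (oddL φ x) xs +
      elemSum (fun ys z zs => sgn ((rdeg x + wdeg ys) * (rdeg z + wdeg zs)) •
        F (oddL φ z) (zs ++ x :: ys)) xs := by
    rw [rotF, splitSum_eq_first]
    congr 1
    · rw [lastF_concat, smul_smul, wdeg_nil, add_zero, sgn_mul_self, one_smul]
    · refine elemSum_congr fun ys z zs _ => ?_
      rw [← List.cons_append, ← List.append_assoc, lastF_concat, smul_smul, ← sgn_add]
      congr 2
      simp only [wdeg_append, wdeg_cons, wdeg_nil]; grind
  rw [e1, e2, e3]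
  abel

/-! ### Rotations with a letter inserted in front of the marked one -/

/-- The sum over all insertions of the letter `z` into a word. -/
def insF (z : ZMod 2 × A) (G : List (ZMod 2 × A) → M) (xs : List (ZMod 2 × A)) : M :=
  splitSum (fun bs cs => G (bs ++ z :: cs)) xs

/-- The sum over all insertions of the letter `z` into a word, with Koszul signs for an odd `‖z‖`. -/
def insOddF (z : ZMod 2 × A) (G : List (ZMod 2 × A) → M) (xs : List (ZMod 2 × A)) : M :=
  splitSum (fun bs cs => sgn (wdeg bs) • G (bs ++ z :: cs)) xs

theorem insF_nil (z : ZMod 2 × A) (G : List (ZMod 2 × A) → M) : insF z G [] = G [z] := rfl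

theorem insF_cons (z : ZMod 2 × A) (G : List (ZMod 2 × A) → M) (y ys) :
    insF z G (y :: ys) = G (z :: y :: ys) + insF z (fun L => G (y :: L)) ys := rfl

theorem insOddF_nil (z : ZMod 2 × A) (G : List (ZMod 2 × A) → M) : insOddF z G [] = G [z] := by
  simp [insOddF, splitSum, wdeg_nil, sgn_zero]

theorem insOddF_cons (z : ZMod 2 × A) (G : List (ZMod 2 × A) → M) (y ys) :
    insOddF z G (y :: ys) =
      G (z :: y :: ys) + sgn (rdeg y) • insOddF z (fun L => G (y :: L)) ys := by
  simp only [insOddF, splitSum, wdeg_nil, sgn_zero, one_smul, List.nil_append, wdeg_cons, sgn_add,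
    ← smul_smul, splitSum_zsmul, List.cons_append]

theorem insF_add (z : ZMod 2 × A) (G H : List (ZMod 2 × A) → M) (xs) :
    insF z (fun L => G L + H L) xs = insF z G xs + insF z H xs := splitSum_add _ _ _

theorem insF_sub (z : ZMod 2 × A) (G H : List (ZMod 2 × A) → M) (xs) :
    insF z (fun L => G L - H L) xs = insF z G xs - insF z H xs := splitSum_sub _ _ _

theorem insF_zsmul (z : ZMod 2 × A) (r : ℤ) (G : List (ZMod 2 × A) → M) (xs) :
    insF z (fun L => r • G L) xs = r • insF z G xs := splitSum_zsmul _ _ _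

theorem insF_sgn {z : ZMod 2 × A} (hz : rdeg z = 0) (s : ZMod 2 → ℤ) (G : List (ZMod 2 × A) → M)
    (xs) : insF z (fun L => s (wdeg L) • G L) xs = s (wdeg xs) • insF z G xs := by
  rw [insF, insF, ← splitSum_zsmul]
  refine splitSum_congr fun ys zs h => ?_
  simp only [← h, wdeg_append, wdeg_cons, hz, zero_add]

theorem insF_headF (z : ZMod 2 × A) (f : ZMod 2 × A → List (ZMod 2 × A) → M) (xs) :
    insF z (headF f) xs = f z xs + headF (fun y ys => insF z (f y) ys) xs := by
  cases xs with
  | nil => simp [insF_nil]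
  | cons x xs => simp [insF_cons]

theorem insF_lastF (z : ZMod 2 × A) (f : List (ZMod 2 × A) → ZMod 2 × A → M) (xs) :
    insF z (lastF f) xs = f xs z + lastF (fun ys y => insF z (fun L => f L y) ys) xs := by
  rw [insF, splitSum_eq_last, lastF_concat]
  congr 1
  rcases List.eq_nil_or_concat xs with rfl | ⟨us, u, rfl⟩
  · rfl
  · rw [List.concat_eq_append, elemSum_append, lastF_concat, insF, splitSum_eq_last, add_comm]
    have e : ∀ ys zs y, lastF f (ys ++ z :: y :: (zs ++ [u])) = f (ys ++ z :: y :: zs) u := by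
      intro ys zs y
      rw [← lastF_concat f (ys ++ z :: y :: zs) u]; simp
    simp only [elemSum, add_zero, e]
    have := lastF_concat f (us ++ [z]) u
    simp only [List.append_assoc, List.cons_append, List.nil_append] at this
    simp only [this, zero_add, add_comm]

/-- The letter `z` supercommutes with `y`. -/
def SuperComm (z y : ZMod 2 × A) : Prop := z.2 * y.2 = sgn y.1 • (y.2 * z.2)

/-- The bar differential on words into which a supercentral letter `z` is inserted: only the
differential of `z` contributes. -/
theorem insF_barF {δ : A →ₗ[R] A} {z : ZMod 2 × A} (hz : rdeg z = 0)
    {G : List (ZMod 2 × A) → M} (hG : SlotAdd G) {xs : List (ZMod 2 × A)}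
    (hxs : ∀ y ∈ xs, SuperComm z y) :
    insF z (barF δ G) xs = barF δ (insF z G) xs + insOddF (oddL δ z) G xs := by
  induction xs generalizing G with
  | nil => simp [insF_nil, insOddF_nil, barF_cons]
  | cons y ys ih =>
    have h1 := ih (hG.cons y) fun w hw => hxs w (List.mem_cons_of_mem _ hw)
    have h2 : G (mulL z y :: ys) = -sgn (rdeg y) • G (mulL y z :: ys) := by
      have := hG.sgn_smul [] (y.1 + z.1) y.1 (y.2 * z.2) ys
      rw [List.nil_append, List.nil_append] at this
      rw [← sgn_fst]
      simp only [mulL]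
      rw [← this, hxs y List.mem_cons_self, add_comm]
    rw [insF_cons, barF_cons, barF_cons, insOddF_cons, barF_cons]
    simp only [barF_cons δ G y, insF_add, insF_sub, insF_zsmul, insF_headF, h1, hz, sgn_zero,
      one_smul, headF_cons, h2, insF_cons, barF_add, headF_add, smul_add]
    rw [show (barF δ fun L => insF z (fun L => G (y :: L)) L) =
      barF δ (insF z fun L => G (y :: L)) from rfl]
    simp only [neg_smul]
    abel

/-- Insertion of an even letter `z`, which supercommutes with the letters of `zs`, in front of the
marked letter `x`. The products of `z` with its neighbours in `zs` cancel pairwise; the product of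
`z` with `x`, when `z` is inserted directly in front of it, has no counterpart and appears as the
last term. -/
theorem insF_barM {δ : A →ₗ[R] A} {z : ZMod 2 × A} (hz : rdeg z = 0)
    {G : List (ZMod 2 × A) → M} (hG : SlotAdd G) {zs : List (ZMod 2 × A)}
    (hzs : ∀ y ∈ zs, SuperComm z y) (x ys) :
    insF z (fun Z => barF δ G (Z ++ x :: ys)) zs =
      barM δ (fun zs x ys => insF z (fun Z => G (Z ++ x :: ys)) zs) zs x ys +
      insOddF (oddL δ z) (fun Z => G (Z ++ x :: ys)) zs -
      sgn (wdeg zs) • G (zs ++ mulL z x :: ys) := by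
  have hG' : SlotAdd fun Z => G (Z ++ x :: ys) := fun us p a b vs => by
    simpa using hG us p a b (vs ++ x :: ys)
  have h1 := insF_barF (δ := δ) hz hG' hzs
  simp only [barF_append_cons]
  simp only [barM, insF_add, insF_sub]
  rw [insF_sgn hz sgn, insF_sgn hz sgn, insF_add, insF_sub, insF_zsmul, insF_zsmul, h1]
  have e2 : headF (fun c cs => insF z (fun Z => G (Z ++ mulL x c :: cs)) zs) ys =
      insF z (fun Z => headF (fun c cs => G (Z ++ mulL x c :: cs)) ys) zs := by
    cases ys <;> simp [insF, splitSum_zero]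
  have e3 : barF δ (fun L => insF z (fun Z => G (Z ++ x :: L)) zs) ys =
      insF z (fun Z => barF δ (fun L => G (Z ++ x :: L)) ys) zs := by
    clear h1 hzs hG' e2
    induction zs generalizing G with
    | nil => rfl
    | cons w zs ih =>
      simp only [insF_cons, List.cons_append, barF_add, ih (hG.cons w)]
  rw [e2, e3]
  have e4 := insF_lastF z (fun zs' w => G (zs' ++ mulL w x :: ys)) zs
  rw [show insF z (fun Z => lastF (fun zs' w => G (zs' ++ mulL w x :: ys)) Z) zs = _ from e4]
  simp only [smul_add, smul_sub]
  rw [show (fun Z => insF z (fun Z => G (Z ++ x :: ys)) Z) = insF z (fun Z => G (Z ++ x :: ys))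
    from rfl]
  abel

/-- The telescoping of rotations in the presence of an inserted letter. -/
theorem rotF_insF_endsF {z : ZMod 2 × A} (hz : rdeg z = 0)
    (F : ZMod 2 × A → List (ZMod 2 × A) → M) (x xs) :
    rotF (fun zs x ys => insF z (fun Z => endsF F (Z ++ x :: ys)) zs) x xs =
      rotF (fun zs x ys => F z (zs ++ x :: ys)) x xs - insF z (F x) xs := by
  simp only [endsF, insF_sub]
  rw [rotF_sub]
  have e1 : rotF (fun zs x ys => insF z (fun Z => headF F (Z ++ x :: ys)) zs) x xs =
      rotF (fun zs x ys => F z (zs ++ x :: ys)) x xs +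
      elemSum (fun ys y zs => sgn ((rdeg x + wdeg ys) * (rdeg y + wdeg zs)) •
        insF z (fun Z => F y (Z ++ x :: ys)) zs) xs := by
    have h : ∀ ys zs, insF z (fun Z => headF F (Z ++ x :: ys)) zs = F z (zs ++ x :: ys) +
        headF (fun y zs' => insF z (fun Z => F y (Z ++ x :: ys)) zs') zs := by
      intro ys zs
      cases zs <;> simp [insF_nil, insF_cons]
    rw [rotF_congr (H' := fun zs x ys => F z (zs ++ x :: ys) +
        headF (fun y zs' => insF z (fun Z => F y (Z ++ x :: ys)) zs') zs) fun ys zs _ => h ys zs,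
      rotF_add]
    congr 1
    rw [rotF, splitSum_eq_last]
    simp [wdeg_cons]
  have e2 : rotF (fun zs x ys => insF z (fun Z =>
      lastF (fun ys y => sgn (rdeg y * wdeg ys) • F y ys) (Z ++ x :: ys)) zs) x xs =
      insF z (F x) xs + elemSum (fun ys y zs => sgn ((rdeg x + wdeg ys) * (rdeg y + wdeg zs)) •
        insF z (fun Z => F y (Z ++ x :: ys)) zs) xs := by
    rw [rotF, splitSum_eq_first]
    congr 1
    · simp only [lastF_concat]
      rw [insF_sgn hz (fun p => sgn (rdeg x * p)), smul_smul, ← sgn_add, wdeg_nil, add_zero,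
        zmod_add_self, sgn_zero, one_smul]
    · refine elemSum_congr fun ys y zs _ => ?_
      simp only [← List.cons_append, ← List.append_assoc, lastF_concat]
      simp only [wdeg_append]
      rw [insF_sgn hz (fun p => sgn (rdeg y * (p + wdeg (x :: ys)))), smul_smul, ← sgn_add]
      congr 2
      simp only [wdeg_cons, wdeg_nil]; grind
  rw [e1, e2]
  abel

end Rotations

/-! ### The Connes operator -/

section Connes

variable {R : Type u} [CommRing R] {A : Type v} [Ring A] [Algebra R A]
variable {M : Type w} [AddCommGroup M] [Module R M]
variable {𝒜 : ℤ → Submodule R A} [GradedAlgebra 𝒜]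

theorem rotF_zero (x : ZMod 2 × A) (xs) :
    rotF (fun _ _ _ => (0 : M)) x xs = 0 := by
  simp only [rotF, smul_zero, splitSum_zero]

theorem map_connes (f : Chains R A →ₗ[R] M) {x : ZMod 2 × A} {xs} (hx : Homog 𝒜 x)
    (h : ∀ y ∈ xs, Homog 𝒜 y) : f (connes 𝒜 (x.2 ⊗ₜ[R] word R xs)) =
      rotF (fun zs x ys => f (1 ⊗ₜ[R] word R (zs ++ x :: ys))) x xs := by
  rw [connes, ChainFormula.lift_homog _ hx h]
  refine Eq.trans ?_ (rotF_map f.toAddMonoidHom (fun zs x ys => 1 ⊗ₜ[R] word R (zs ++ x :: ys))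
    x xs).symm
  simp only [connesFormula, rotF, word_append, word_cons, mul_assoc, LinearMap.toAddMonoidHom_coe]

theorem connes_one_tmul (t : TensorAlgebra R (ReducedPart R A)) :
    connes 𝒜 (1 ⊗ₜ[R] t) = 0 := by
  suffices h : connes 𝒜 ∘ₗ TensorProduct.mk R A _ 1 = 0 from LinearMap.congr_fun h t
  refine LinearMap.ext_on (span_word_homog 𝒜) ?_
  rintro _ ⟨xs, hxs, rfl⟩
  have h := map_connes (LinearMap.id : Chains R A →ₗ[R] _) (homog_one (𝒜 := 𝒜)) hxs
  rw [LinearMap.id_apply] at h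
  exact h.trans ((rotF_congr (H' := fun _ _ _ => 0) fun ys zs _ => by
    rw [word_one, TensorProduct.tmul_zero]; rfl).trans (rotF_zero _ _))

theorem connes_connes (c : Chains R A) : connes 𝒜 (connes 𝒜 c) = 0 := by
  suffices h : connes 𝒜 ∘ₗ connes 𝒜 = 0 from LinearMap.congr_fun h c
  refine chains_ext (𝒜 := 𝒜) fun x xs hx hxs => ?_
  rw [LinearMap.comp_apply, map_connes _ hx hxs]
  simp only [connes_one_tmul, rotF_zero, LinearMap.zero_apply]

theorem hochF_one {δ : A →ₗ[R] A} (h : δ 1 = 0) (F : A → List (ZMod 2 × A) → M) (hF : ∀ L, F 0 L = 0)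
    (L : List (ZMod 2 × A)) : hochF δ (fun x xs => F x.2 xs) (0, 1) L =
      endsF (fun x xs => F x.2 xs) L - barF δ (F 1) L := by
  rw [hochF_eq, endsF]
  simp only [oddL, h, hF, mulL, one_mul, mul_one, rdeg, zero_add, sgn_one, neg_smul, one_smul]
  abel

theorem DGStructure.hochschild_one_tmul (D : DGStructure 𝒜) {L} (hL : ∀ y ∈ L, Homog 𝒜 y) :
    D.hochschild (1 ⊗ₜ[R] word R L) = endsF (fun x xs => x.2 ⊗ₜ[R] word R xs) L -
      barF D.d (fun L => 1 ⊗ₜ[R] word R L) L := by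
  have h := D.map_hochschild LinearMap.id (homog_one (𝒜 := 𝒜)) hL
  simp only [LinearMap.id_apply] at h
  rw [h]
  exact hochF_one D.d_one (fun a xs => a ⊗ₜ[R] word R xs) (fun _ => TensorProduct.zero_tmul _ _) L

/-- The Hochschild and Connes operators anticommute: on the sum over all rotations, the terms of
the Hochschild differential which involve the first element telescope. -/
theorem DGStructure.hochschild_connes (D : DGStructure 𝒜) (c : Chains R A) :
    D.hochschild (connes 𝒜 c) = -connes 𝒜 (D.hochschild c) := by
  suffices h : D.hochschild ∘ₗ connes 𝒜 = -(connes 𝒜 ∘ₗ D.hochschild) from LinearMap.congr_fun h c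
  refine chains_ext (𝒜 := 𝒜) fun x xs hx hxs => ?_
  rw [LinearMap.neg_apply, LinearMap.comp_apply, LinearMap.comp_apply, map_connes _ hx hxs,
    D.map_hochschild _ hx hxs]
  have h1 : ∀ (y : ZMod 2 × A) ys, Homog 𝒜 y → (∀ z ∈ ys, Homog 𝒜 z) →
      connes 𝒜 (y.2 ⊗ₜ[R] word R ys) = rotF (fun zs x ys => 1 ⊗ₜ[R] word R (zs ++ x :: ys)) y ys :=
    fun y ys hy hys => map_connes LinearMap.id hy hys
  rw [hochF_congr D.d_mem h1 hx hxs, ← rotF_barM]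
  have h2 := fun ys zs (e : ys ++ zs = xs) => D.hochschild_one_tmul (L := zs ++ x :: ys)
    (by subst e; simp only [List.mem_append, List.mem_cons] at hxs ⊢; rintro y (h | rfl | h)
        exacts [hxs y (.inr h), hx, hxs y (.inl h)])
  rw [rotF_congr (H' := fun zs x ys => endsF (fun x xs => x.2 ⊗ₜ[R] word R xs) (zs ++ x :: ys) -
    barF D.d (fun L => 1 ⊗ₜ[R] word R L) (zs ++ x :: ys)) h2, rotF_sub, rotF_endsF, zero_sub]
  simp only [barF_append_cons]

end Connes

/-! ### The Cartan formula for an odd derivation -/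

section CartanDer

variable {R : Type u} [CommRing R] {A : Type v} [Ring A] [Algebra R A]
variable {M : Type w} [AddCommGroup M] [Module R M]
variable {𝒜 : ℤ → Submodule R A} [GradedAlgebra 𝒜]
variable (φ : A →ₗ[R] A) (hφ : φ 1 = 0)

theorem map_iotaDer (f : Chains R A →ₗ[R] M) {x : ZMod 2 × A} {xs} (hx : Homog 𝒜 x)
    (h : ∀ y ∈ xs, Homog 𝒜 y) : f (iotaDer 𝒜 φ hφ (x.2 ⊗ₜ[R] word R xs)) =
      lastF (fun ys y => sgn (rdeg y * (x.1 + wdeg ys)) •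
        f ((mulL (oddL φ y) x).2 ⊗ₜ[R] word R ys)) xs := by
  rw [iotaDer, ChainFormula.lift_homog _ hx h]
  have e : (iotaDerFormula φ hφ).toFun x xs = lastF (fun ys y => sgn (rdeg y * (x.1 + wdeg ys)) •
      ((mulL (oddL φ y) x).2 ⊗ₜ[R] word R ys)) xs := by
    refine elemSum_congr fun ys y zs _ => ?_
    cases zs <;> simp [lastTerm, mulL, oddL, rdeg]
  rw [e, ← LinearMap.toAddMonoidHom_coe, ← lastF_map]
  simp only [map_zsmul]

theorem map_cyclicDer (f : Chains R A →ₗ[R] M) {x : ZMod 2 × A} {xs} (hx : Homog 𝒜 x)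
    (h : ∀ y ∈ xs, Homog 𝒜 y) : f (cyclicDer 𝒜 φ hφ (x.2 ⊗ₜ[R] word R xs)) =
      rotF (fun zs x ys => derF φ (fun Z => f (1 ⊗ₜ[R] word R (Z ++ x :: ys))) zs) x xs := by
  rw [cyclicDer, ChainFormula.lift_homog _ hx h]
  have e : (cyclicDerFormula φ hφ).toFun x xs =
      rotF (fun zs x ys => derF φ (fun Z => 1 ⊗ₜ[R] word R (Z ++ x :: ys)) zs) x xs := by
    refine splitSum_congr fun ys zs _ => ?_
    simp only [derF_eq_elemSum, word_append, word_cons, mul_assoc, oddL]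
  rw [e, ← LinearMap.toAddMonoidHom_coe, ← rotF_map]
  simp only [← derF_map]

theorem map_lieDer (f : Chains R A →ₗ[R] M) {x : ZMod 2 × A} {xs} (hx : Homog 𝒜 x)
    (h : ∀ y ∈ xs, Homog 𝒜 y) : f ((lieDerFormula φ hφ).lift 𝒜 (x.2 ⊗ₜ[R] word R xs)) =
      f (φ x.2 ⊗ₜ[R] word R xs) + sgn (rdeg x) • derF φ (fun L => f (x.2 ⊗ₜ[R] word R L)) xs := by
  rw [ChainFormula.lift_homog _ hx h]
  simp only [lieDerFormula, map_add]
  congr 1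
  rw [← LinearMap.toAddMonoidHom_coe, derF_map, ← map_zsmul, derF_eq_elemSum, ← elemSum_zsmul]
  simp only [sgn_add, ← smul_smul, word_append, word_cons, oddL, mul_assoc]

theorem cyclicDer_one_tmul (t : TensorAlgebra R (ReducedPart R A)) :
    cyclicDer 𝒜 φ hφ (1 ⊗ₜ[R] t) = 0 := by
  suffices h : cyclicDer 𝒜 φ hφ ∘ₗ TensorProduct.mk R A _ 1 = 0 from LinearMap.congr_fun h t
  refine LinearMap.ext_on (span_word_homog 𝒜) ?_
  rintro _ ⟨xs, hxs, rfl⟩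
  have h := map_cyclicDer φ hφ (LinearMap.id : Chains R A →ₗ[R] _) (homog_one (𝒜 := 𝒜)) hxs
  rw [LinearMap.id_apply] at h
  exact h.trans ((rotF_congr (H' := fun _ _ _ => 0) fun ys zs _ => by
    simp only [LinearMap.id_apply, word_one, TensorProduct.tmul_zero, derF_zero]).trans
    (rotF_zero _ _))

theorem cyclicDer_connes (c : Chains R A) : cyclicDer 𝒜 φ hφ (connes 𝒜 c) = 0 := by
  suffices h : cyclicDer 𝒜 φ hφ ∘ₗ connes 𝒜 = 0 from LinearMap.congr_fun h c
  refine chains_ext (𝒜 := 𝒜) fun x xs hx hxs => ?_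
  rw [LinearMap.comp_apply, map_connes _ hx hxs]
  simp only [cyclicDer_one_tmul, rotF_zero, LinearMap.zero_apply]

theorem connes_cyclicDer (c : Chains R A) : connes 𝒜 (cyclicDer 𝒜 φ hφ c) = 0 := by
  suffices h : connes 𝒜 ∘ₗ cyclicDer 𝒜 φ hφ = 0 from LinearMap.congr_fun h c
  refine chains_ext (𝒜 := 𝒜) fun x xs hx hxs => ?_
  rw [LinearMap.comp_apply, map_cyclicDer _ _ _ hx hxs]
  simp only [connes_one_tmul, derF_zero, rotF_zero, LinearMap.zero_apply]

theorem derF_congr {φ : A →ₗ[R] A} (hφ : ∀ n, ∀ a ∈ 𝒜 n, φ a ∈ 𝒜 (n + 1))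
    {G H : List (ZMod 2 × A) → M} (h : ∀ L, (∀ y ∈ L, Homog 𝒜 y) → G L = H L) {xs}
    (hxs : ∀ y ∈ xs, Homog 𝒜 y) : derF φ G xs = derF φ H xs := by
  rw [derF_eq_elemSum, derF_eq_elemSum]
  refine elemSum_congr fun ys y zs e => ?_
  subst e
  rw [h]
  simp only [List.mem_append, List.mem_cons] at hxs ⊢
  rintro w (hw | rfl | hw)
  exacts [hxs w (.inl hw), (hxs y (.inr (.inl rfl))).oddL hφ, hxs w (.inr (.inr hw))]

theorem slotAdd_one_tmul : SlotAdd (fun L : List (ZMod 2 × A) => (1 : A) ⊗ₜ[R] word R L) := fun us p a b vs => by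
  simp only [word_add, TensorProduct.tmul_add]

/-- The Cartan homotopy formula for an odd derivation `φ` which anticommutes with the
differential. -/
theorem DGStructure.hochschild_cyclicDer (D : DGStructure 𝒜)
    (hφ_mem : ∀ n, ∀ a ∈ 𝒜 n, φ a ∈ 𝒜 (n + 1)) (hφ_leib : ∀ y, Homog 𝒜 y → IsLeibniz φ y)
    (hφ_d : ∀ a, φ (D.d a) + D.d (φ a) = 0) (c : Chains R A) :
    D.hochschild (cyclicDer 𝒜 φ hφ c) - cyclicDer 𝒜 φ hφ (D.hochschild c) =
      iotaDer 𝒜 φ hφ (connes 𝒜 c) - connes 𝒜 (iotaDer 𝒜 φ hφ c) -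
        (lieDerFormula φ hφ).lift 𝒜 c := by
  suffices h : D.hochschild ∘ₗ cyclicDer 𝒜 φ hφ - cyclicDer 𝒜 φ hφ ∘ₗ D.hochschild =
      iotaDer 𝒜 φ hφ ∘ₗ connes 𝒜 - connes 𝒜 ∘ₗ iotaDer 𝒜 φ hφ - (lieDerFormula φ hφ).lift 𝒜 from
    LinearMap.congr_fun h c
  refine chains_ext (𝒜 := 𝒜) fun x xs hx hxs => ?_
  simp only [LinearMap.sub_apply, LinearMap.comp_apply]
  rw [map_cyclicDer φ hφ _ hx hxs, map_connes _ hx hxs, map_iotaDer φ hφ _ hx hxs,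
    D.map_hochschild _ hx hxs]
  have h0 := map_lieDer φ hφ LinearMap.id hx hxs
  simp only [LinearMap.id_apply] at h0
  rw [h0]
  have h1 : ∀ (y : ZMod 2 × A) ys, Homog 𝒜 y → (∀ z ∈ ys, Homog 𝒜 z) →
      cyclicDer 𝒜 φ hφ (y.2 ⊗ₜ[R] word R ys) =
        rotF (fun zs x ys => derF φ (fun Z => 1 ⊗ₜ[R] word R (Z ++ x :: ys)) zs) y ys :=
    fun y ys hy hys => map_cyclicDer φ hφ LinearMap.id hy hys
  have h2 : ∀ (y : ZMod 2 × A) ys, Homog 𝒜 y → (∀ z ∈ ys, Homog 𝒜 z) →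
      connes 𝒜 (y.2 ⊗ₜ[R] word R ys) = rotF (fun zs x ys => 1 ⊗ₜ[R] word R (zs ++ x :: ys)) y ys :=
    fun y ys hy hys => map_connes LinearMap.id hy hys
  have hrot : ∀ {ys zs}, ys ++ zs = xs → (∀ y ∈ ys, Homog 𝒜 y) ∧ ∀ y ∈ zs, Homog 𝒜 y := by
    intro ys zs e; subst e
    exact ⟨fun y hy => hxs y (List.mem_append_left _ hy), fun y hy => hxs y (List.mem_append_right _ hy)⟩
  have happ : ∀ {Z ys}, (∀ y ∈ Z, Homog 𝒜 y) → (∀ y ∈ ys, Homog 𝒜 y) → ∀ y ∈ Z ++ x :: ys,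
      Homog 𝒜 y := by
    intro Z ys h1 h2 y hy
    rcases List.mem_append.mp hy with h | h
    · exact h1 y h
    · exact List.forall_mem_cons.mpr ⟨hx, h2⟩ y h
  rw [hochF_congr D.d_mem h1 hx hxs, ← rotF_barM]
  -- the terms `d J`
  have e1 : rotF (fun zs x ys => derF φ (fun Z => D.hochschild (1 ⊗ₜ[R] word R (Z ++ x :: ys))) zs)
      x xs = rotF (fun zs x ys => derF φ (fun Z => endsF (fun x xs => x.2 ⊗ₜ[R] word R xs)
        (Z ++ x :: ys)) zs) x xs - rotF (fun zs x ys => derF φ (fun Z =>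
        barF D.d (fun L => 1 ⊗ₜ[R] word R L) (Z ++ x :: ys)) zs) x xs := by
    rw [← rotF_sub]
    refine rotF_congr fun ys zs e => ?_
    rw [← derF_sub]
    exact derF_congr hφ_mem (fun Z hZ => D.hochschild_one_tmul (happ hZ (hrot e).1)) (hrot e).2
  -- the terms `ι B`
  have e2 : rotF (fun zs x ys => iotaDer 𝒜 φ hφ (1 ⊗ₜ[R] word R (zs ++ x :: ys))) x xs =
      rotF (fun zs x ys => lastF (fun L y => sgn (rdeg y * wdeg L) •
        ((oddL φ y).2 ⊗ₜ[R] word R L)) (zs ++ x :: ys)) x xs := by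
    refine rotF_congr fun ys zs e => ?_
    have h := map_iotaDer φ hφ LinearMap.id (homog_one (𝒜 := 𝒜)) (happ (hrot e).2 (hrot e).1)
    simp only [LinearMap.id_apply] at h
    rw [h]
    simp only [mulL, zero_add, mul_one]
  -- the terms `B ι`
  have e3 : lastF (fun ys y => sgn (rdeg y * (x.1 + wdeg ys)) •
        connes 𝒜 ((mulL (oddL φ y) x).2 ⊗ₜ[R] word R ys)) xs =
      rotF (fun zs x ys => lastF (fun zs' z => sgn (rdeg z) •
        ((1 : A) ⊗ₜ[R] word R (zs' ++ mulL (oddL φ z) x :: ys))) zs) x xs := by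
    refine Eq.trans (lastF_congr fun ys y e => ?_) (rotF_lastF φ (fun zs x ys =>
      (1 : A) ⊗ₜ[R] word R (zs ++ x :: ys)) x xs).symm
    rw [h2 _ _ (((hrot e).2 y (by simp)).oddL hφ_mem |>.mulL hx) (hrot e).1]
  rw [e1, e2, e3, rotF_derF_endsF]
  have e4 : rotF (fun zs x ys => lastF (fun zs' z => sgn (rdeg z) •
        ((1 : A) ⊗ₜ[R] word R (zs' ++ mulL (oddL φ z) x :: ys))) zs) x xs =
      rotF (fun zs x ys => derF φ (fun Z =>
        barF D.d (fun L => 1 ⊗ₜ[R] word R L) (Z ++ x :: ys)) zs) x xs +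
      rotF (barM D.d fun zs x ys => derF φ (fun Z => 1 ⊗ₜ[R] word R (Z ++ x :: ys)) zs) x xs := by
    rw [← rotF_add]
    refine rotF_congr fun ys zs e => ?_
    exact (derF_barM_add hφ_d slotAdd_one_tmul (fun y hy => hφ_leib y ((hrot e).2 y hy)) x ys).symm
  rw [e4]
  simp only [oddL]
  abel

end CartanDer

/-! ### The contraction with an odd derivation -/

section IotaDer

variable {R : Type u} [CommRing R] {A : Type v} [Ring A] [Algebra R A]
variable {M : Type w} [AddCommGroup M]

/-- The operator `ι_φ`, acting on functions of lists by precomposition. -/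
def iotaF (φ : A →ₗ[R] A) (G : List (ZMod 2 × A) → M) : List (ZMod 2 × A) → M :=
  headF fun x xs => lastF (fun ys y => sgn (rdeg y * (x.1 + wdeg ys)) •
    G (mulL (oddL φ y) x :: ys)) xs

@[simp] theorem iotaF_singleton (φ : A →ₗ[R] A) (G : List (ZMod 2 × A) → M) (x) :
    iotaF φ G [x] = 0 := rfl

@[simp] theorem iotaF_concat (φ : A →ₗ[R] A) (G : List (ZMod 2 × A) → M) (x xs y) :
    iotaF φ G (x :: (xs ++ [y])) =
      sgn (rdeg y * (x.1 + wdeg xs)) • G (mulL (oddL φ y) x :: xs) := by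
  rw [iotaF, headF_cons, lastF_concat]

theorem iotaF_sub (φ : A →ₗ[R] A) (G H : List (ZMod 2 × A) → M) (L) :
    iotaF φ (fun L => G L - H L) L = iotaF φ G L - iotaF φ H L := by
  cases L with
  | nil => simp [iotaF]
  | cons x xs =>
    rcases List.eq_nil_or_concat xs with rfl | ⟨ys, y, rfl⟩
    · simp
    · simp only [List.concat_eq_append, iotaF_concat, smul_sub]

/-- The effect of multiplying the first element of a word by `a` on the bar differential. -/
theorem barF_headF_mulL {δ : A →ₗ[R] A} {G : List (ZMod 2 × A) → M} (hG : SlotAdd G)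
    {a : ZMod 2 × A} (ha : IsLeibniz δ a) (x ys) :
    barF δ (headF fun y ys => G (mulL a y :: ys)) (x :: ys) =
      sgn a.1 • (barF δ G (mulL a x :: ys) - G (mulL (oddL δ a) x :: ys)) := by
  rw [barF_cons, barF_cons]
  have e3 : G (oddL δ (mulL a x) :: ys) =
      G (mulL (oddL δ a) x :: ys) + sgn a.1 • G (mulL a (oddL δ x) :: ys) := by
    have h1 : oddL δ (mulL a x) = (a.1 + x.1 + 1, δ a.2 * x.2 + sgn a.1 • (a.2 * δ x.2)) := by
      simp only [oddL, mulL, ha x.2]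
    have h2 := hG [] (a.1 + x.1 + 1) (δ a.2 * x.2) (sgn a.1 • (a.2 * δ x.2)) ys
    have h3 := hG.sgn_smul [] (a.1 + x.1 + 1) a.1 (a.2 * δ x.2) ys
    simp only [List.nil_append] at h2 h3
    rw [h1, h2, h3]
    simp only [mulL, oddL, add_assoc, add_comm x.1 1]
  rw [e3]
  have h4 : rdeg (mulL a x) = rdeg x + a.1 := by rw [rdeg_mulL]; simp only [rdeg]; grind
  have h5 : (fun z zs => G (mulL (mulL a x) z :: zs)) = fun z zs => G (mulL a (mulL x z) :: zs) := by
    simp only [mulL_assoc]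
  rw [h4, h5]
  simp only [headF_cons, sgn_add]
  rcases sgn_eq_or a.1 with e | e <;> rw [e] <;> simp <;> abel

/-- The bar differential commutes with `ι_φ` up to terms in which two letters at the end of the
word are moved to its front. -/
theorem barF_iotaF {φ δ : A →ₗ[R] A} (h : ∀ a, φ (δ a) + δ (φ a) = 0)
    {G : List (ZMod 2 × A) → M} (hG : SlotAdd G) (x xs) (hφ : ∀ y ∈ xs, IsLeibniz φ y)
    (hδ : ∀ y ∈ xs, IsLeibniz δ (oddL φ y)) :
    barF δ (iotaF φ G) (x :: xs) - iotaF φ (barF δ G) (x :: xs) =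
      wrapF (iotaF φ G) (x :: xs) - iotaF φ (wrapF G) (x :: xs) := by
  rcases List.eq_nil_or_concat xs with rfl | ⟨ys, a, rfl⟩
  · simp only [iotaF_singleton, wrapF_singleton, barF_cons, headF_nil, barF_nil]; simp
  rw [List.concat_eq_append] at hφ hδ ⊢
  rw [iotaF_concat, iotaF_concat, wrapF_concat, ← List.cons_append, barF_concat]
  have e1 : (fun L => iotaF φ G (L ++ [a])) = fun L => sgn (rdeg a * (wdeg L + 1)) •
      headF (fun y ys => G (mulL (oddL φ a) y :: ys)) L := by
    funext L
    cases L with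
    | nil => simp
    | cons y ys =>
      rw [List.cons_append, iotaF_concat, headF_cons, wdeg_cons]
      congr 3
      rw [rdeg]; grind
  rw [e1, barF_sgn δ (fun p => sgn (rdeg a * (p + 1))), barF_headF_mulL hG (hδ a (by simp))]
  have e4 : iotaF φ G (x :: ys ++ [oddL δ a]) =
      -sgn ((rdeg a + 1) * (x.1 + wdeg ys)) • G (mulL (oddL δ (oddL φ a)) x :: ys) := by
    rw [List.cons_append, iotaF_concat, rdeg_oddL, neg_smul, ← smul_neg]
    have h1 := hG.neg [] (a.1 + 1 + 1 + x.1) (δ (φ a.2) * x.2) ys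
    simp only [List.nil_append] at h1
    simp only [mulL, oddL]
    rw [← h1, ← neg_mul, eq_neg_of_add_eq_zero_left (h a.2)]
  rw [e4]
  have e5 : sgn (wdeg (x :: ys)) • lastF (fun us y => iotaF φ G (us ++ [mulL y a])) (x :: ys) =
      iotaF φ (wrapF G) (x :: (ys ++ [a])) - sgn (rdeg a * (x.1 + wdeg ys)) •
        iotaF φ G (mulL a x :: ys) := by
    rcases List.eq_nil_or_concat ys with rfl | ⟨zs, c, rfl⟩
    · have := lastF_concat (fun us y => iotaF φ G (us ++ [mulL y a])) [] x
      simp only [List.nil_append] at this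
      have h2 := iotaF_concat φ (wrapF G) x [] a
      rw [List.nil_append] at h2
      simp [this, h2]
    · rw [List.concat_eq_append, ← List.cons_append, lastF_concat,
        List.cons_append (bs := [mulL c a]), iotaF_concat, iotaF_concat, iotaF_concat,
        wrapF_concat]
      have hc : G (mulL (oddL φ (mulL c a)) x :: zs) = G (mulL (oddL φ c) (mulL a x) :: zs) +
          sgn c.1 • G (mulL c (mulL (oddL φ a) x) :: zs) := by
        have h2 := hG [] (c.1 + a.1 + 1 + x.1) (φ c.2 * a.2 * x.2) (sgn c.1 • (c.2 * φ a.2 * x.2)) zs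
        have h3 := hG.sgn_smul [] (c.1 + a.1 + 1 + x.1) c.1 (c.2 * φ a.2 * x.2) zs
        simp only [List.nil_append] at h2 h3
        rw [h3] at h2
        have h4 := hφ c (by simp) a.2
        simp only [mulL, oddL, h4, add_mul, smul_mul_assoc, mul_assoc] at h2 ⊢
        rw [show c.1 + a.1 + 1 + x.1 = c.1 + 1 + (a.1 + x.1) by ring] at h2 ⊢
        rw [show c.1 + (a.1 + 1 + x.1) = c.1 + 1 + (a.1 + x.1) by ring, h2]
      rw [hc]
      simp only [smul_add, smul_smul, ← sgn_add, List.cons_append]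
      have s1 : wdeg (x :: (zs ++ [c])) + (rdeg (mulL c a) * (x.1 + wdeg zs) + c.1) =
          rdeg a * (x.1 + wdeg (zs ++ [c])) + rdeg c * ((mulL (oddL φ a) x).1 + wdeg zs) := by
        simp only [wdeg_cons, wdeg_append, wdeg_nil, rdeg_mulL, mulL, oddL]
        simp only [rdeg]; grind
      have s2 : sgn (wdeg (x :: (zs ++ [c])) + rdeg (mulL c a) * (x.1 + wdeg zs)) =
          -sgn (rdeg a * (x.1 + wdeg (zs ++ [c])) + rdeg c * ((mulL a x).1 + wdeg zs)) := by
        rw [← sgn_add_one]; congr 1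
        simp only [wdeg_cons, wdeg_append, wdeg_nil, rdeg_mulL, mulL, oddL]
        simp only [rdeg]; grind
      rw [s1, s2]
      simp only [neg_smul]
      abel
  have s1 : sgn (rdeg a * (wdeg (x :: ys) + 1 + 1)) * sgn (oddL φ a).1 =
      sgn (rdeg a * (x.1 + wdeg ys)) := by
    rw [← sgn_add]; congr 1; simp only [rdeg, wdeg_cons, oddL]; grind
  have s2 : sgn (wdeg (x :: ys)) * -sgn ((rdeg a + 1) * (x.1 + wdeg ys)) =
      sgn (rdeg a * (x.1 + wdeg ys)) := by
    rw [mul_neg, ← sgn_add, ← sgn_add_one]; congr 1; simp only [rdeg, wdeg_cons]; grind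
  rw [smul_smul, s1, smul_sub (sgn (wdeg (x :: ys))), smul_smul, s2, e5,
    iotaF_concat φ (wrapF G)]
  simp only [smul_sub]
  abel

variable {𝒜 : ℤ → Submodule R A} [GradedAlgebra 𝒜]

/-- The operator `ι_φ` commutes with the Hochschild differential, for an odd derivation `φ` which
anticommutes with `d_A`. -/
theorem DGStructure.hochschild_iotaDer (D : DGStructure 𝒜) (φ : A →ₗ[R] A) (hφ : φ 1 = 0)
    (hφ_mem : ∀ n, ∀ a ∈ 𝒜 n, φ a ∈ 𝒜 (n + 1)) (hφ_leib : ∀ y, Homog 𝒜 y → IsLeibniz φ y)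
    (hφ_d : ∀ a, φ (D.d a) + D.d (φ a) = 0) (c : Chains R A) :
    D.hochschild (iotaDer 𝒜 φ hφ c) = iotaDer 𝒜 φ hφ (D.hochschild c) := by
  suffices h : D.hochschild ∘ₗ iotaDer 𝒜 φ hφ = iotaDer 𝒜 φ hφ ∘ₗ D.hochschild from
    LinearMap.congr_fun h c
  refine chains_ext (𝒜 := 𝒜) fun x xs hx hxs => ?_
  rw [LinearMap.comp_apply, LinearMap.comp_apply, D.map_hochschild _ hx hxs,
    map_iotaDer φ hφ _ hx hxs]
  set F : ZMod 2 × A → List (ZMod 2 × A) → Chains R A := fun x xs => x.2 ⊗ₜ[R] word R xs with hF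
  have h1 : ∀ (y : ZMod 2 × A) ys, Homog 𝒜 y → (∀ z ∈ ys, Homog 𝒜 z) →
      iotaDer 𝒜 φ hφ (y.2 ⊗ₜ[R] word R ys) = (fun y ys => iotaF φ (headF F) (y :: ys)) y ys :=
    fun y ys hy hys => map_iotaDer φ hφ LinearMap.id hy hys
  rw [hochF_congr D.d_mem h1 hx hxs]
  have h2 : lastF (fun ys y => sgn (rdeg y * (x.1 + wdeg ys)) •
      D.hochschild ((mulL (oddL φ y) x).2 ⊗ₜ[R] word R ys)) xs =
      iotaF φ (fun L => barF D.d (headF F) L - wrapF (headF F) L) (x :: xs) := by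
    rw [← headF_hochF]
    refine lastF_congr fun ys y e => ?_
    subst e
    have := D.map_hochschild LinearMap.id (((hxs y (by simp)).oddL hφ_mem).mulL hx)
      (fun z hz => hxs z (List.mem_append_left _ hz))
    simp only [LinearMap.id_apply] at this
    rw [this]
    rfl
  have h3 : hochF D.d (fun y ys => iotaF φ (headF F) (y :: ys)) x xs =
      barF D.d (iotaF φ (headF F)) (x :: xs) - wrapF (iotaF φ (headF F)) (x :: xs) := by
    have h4 : headF (fun y ys => iotaF φ (headF F) (y :: ys)) = iotaF φ (headF F) := by
      funext L; cases L <;> rfl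
    have h5 : hochF D.d (fun y ys => iotaF φ (headF F) (y :: ys)) x xs =
      barF D.d (headF fun y ys => iotaF φ (headF F) (y :: ys)) (x :: xs) -
        wrapF (headF fun y ys => iotaF φ (headF F) (y :: ys)) (x :: xs) := rfl
    rw [h5, h4]
  have h6 := barF_iotaF hφ_d (slotAdd_chain (R := R) (A := A)) x xs
    (fun y hy => hφ_leib y (hxs y hy)) (fun y hy => D.isLeibniz ((hxs y hy).oddL hφ_mem))
  rw [h2, h3, iotaF_sub]
  rw [sub_eq_sub_iff_add_eq_add] at h6 ⊢
  rw [← hF] at h6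
  rw [add_comm, h6, add_comm]

end IotaDer

/-! ### The Cartan formula for multiplication with an odd supercentral element -/

section CartanElem

variable {R : Type u} [CommRing R] {A : Type v} [Ring A] [Algebra R A]
variable {M : Type w} [AddCommGroup M] [Module R M]
variable {𝒜 : ℤ → Submodule R A} [GradedAlgebra 𝒜]

theorem map_iotaElem (W : A) (f : Chains R A →ₗ[R] M) {x : ZMod 2 × A} {xs} (hx : Homog 𝒜 x)
    (h : ∀ y ∈ xs, Homog 𝒜 y) : f (iotaElem 𝒜 W (x.2 ⊗ₜ[R] word R xs)) =
      f ((W * x.2) ⊗ₜ[R] word R xs) := by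
  rw [iotaElem, ChainFormula.lift_homog _ hx h]; rfl

theorem iotaElem_tmul (W a : A) (w : TensorAlgebra R (ReducedPart R A)) :
    iotaElem 𝒜 W (a ⊗ₜ[R] w) = (W * a) ⊗ₜ[R] w := by
  suffices h : iotaElem 𝒜 W = TensorProduct.map (LinearMap.mulLeft R W) LinearMap.id by
    rw [h]; rfl
  exact chains_ext (𝒜 := 𝒜) fun x xs hx hxs => map_iotaElem W LinearMap.id hx hxs

theorem map_lieElem (W : A) (f : Chains R A →ₗ[R] M) {x : ZMod 2 × A} {xs} (hx : Homog 𝒜 x)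
    (h : ∀ y ∈ xs, Homog 𝒜 y) (p : ZMod 2) : f (lieElem 𝒜 W (x.2 ⊗ₜ[R] word R xs)) =
      sgn (rdeg x) • insOddF (p, W) (fun L => f (x.2 ⊗ₜ[R] word R L)) xs := by
  rw [lieElem, ChainFormula.lift_homog _ hx h]
  have e : (lieElemFormula W).toFun x xs =
      sgn (rdeg x) • insOddF (p, W) (fun L => x.2 ⊗ₜ[R] word R L) xs := by
    rw [insOddF, ← splitSum_zsmul]
    simp only [lieElemFormula, sgn_add, smul_smul, word_append, word_cons, mul_assoc]
  rw [e, map_zsmul, insOddF, insOddF, ← LinearMap.toAddMonoidHom_coe, ← splitSum_map]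
  simp only [map_zsmul]

theorem map_cyclicElem (W : A) (f : Chains R A →ₗ[R] M) {x : ZMod 2 × A} {xs} (hx : Homog 𝒜 x)
    (h : ∀ y ∈ xs, Homog 𝒜 y) (p : ZMod 2) : f (cyclicElem 𝒜 W (x.2 ⊗ₜ[R] word R xs)) =
      rotF (fun zs x ys => insOddF (p, W) (fun Z => f (1 ⊗ₜ[R] word R (Z ++ x :: ys))) zs) x xs := by
  rw [cyclicElem, ChainFormula.lift_homog _ hx h]
  have e : (cyclicElemFormula W).toFun x xs = rotF (fun zs x ys =>
      insOddF (p, W) (fun Z => 1 ⊗ₜ[R] word R (Z ++ x :: ys)) zs) x xs := by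
    refine splitSum_congr fun ys zs _ => ?_
    simp only [insOddF, word_append, word_cons, mul_assoc]
  rw [e, ← LinearMap.toAddMonoidHom_coe, ← rotF_map]
  simp only [insOddF, ← splitSum_map, map_zsmul]

/-- The formula for the cyclic operator `J'_z`, for an element `z` of odd degree: the sum over
`j ≤ i` of `(-1)^{(‖a₀‖+⋯+‖a_j‖)(‖a_{j+1}‖+⋯+‖a_l‖)}
e(a_{j+1}|…|a_i|z|a_{i+1}|…|a_l|a₀|…|a_j)`. -/
def cyclicOddFormula (z : A) : ChainFormula R A (Chains R A) where
  toFun x as :=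
    splitSum (fun ys zs => sgn ((rdeg x + wdeg ys) * wdeg zs) •
      splitSum (fun bs cs =>
        ((1 : A) ⊗ₜ[R] (word R bs * letter R z * word R cs * letter R x.2 * word R ys))) zs) as
  head_add p a b xs := by
    simp only [rdeg, map_add, add_mul, mul_add, TensorProduct.tmul_add, smul_add, splitSum_add]
  head_smul p r a xs := by
    simp only [rdeg, map_smul, smul_mul_assoc, mul_smul_comm, TensorProduct.tmul_smul,
      smul_comm _ r, splitSum_smul]
  multilin x := by
    refine IsMultilin.splitSum (fun ys => IsMultilin.sgnForm (fun us p a b vs => ?_)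
      (IsMultilin.splitSum (fun bs => ⟨fun us p a b vs => ?_, fun us p r a vs => ?_⟩)
        (fun cs => ⟨fun us p a b vs => ?_, fun us p r a vs => ?_⟩)))
      (fun zs => IsMultilin.sgnForm (fun us p a b vs => ?_)
        ⟨fun us p a b vs => ?_, fun us p r a vs => ?_⟩)
    all_goals first
      | (simp only [wdeg_slot]; done)
      | (simp only [word_add, mul_add, add_mul, TensorProduct.tmul_add, splitSum_add]; done)
      | (simp only [word_smul, smul_mul_assoc, mul_smul_comm, TensorProduct.tmul_smul,
          smul_comm _ r, splitSum_smul]; done)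
  normalized x := by
    refine IsNormalized.splitSum (fun ys => IsNormalized.sgnForm _
      (IsNormalized.splitSum (fun bs us vs => ?_) (fun cs us vs => ?_)))
      (fun zs => IsNormalized.sgnForm _ (fun us vs => ?_))
    all_goals simp only [word_one, mul_zero, zero_mul, TensorProduct.tmul_zero, smul_zero,
      splitSum_zero]

variable (𝒜) in
/-- The cyclic operator `J'_z` on chains, for an element `z` of odd degree. -/
def cyclicOdd (z : A) : Chains R A →ₗ[R] Chains R A := (cyclicOddFormula z).lift 𝒜

theorem map_cyclicOdd (z : ZMod 2 × A) (f : Chains R A →ₗ[R] M) {x : ZMod 2 × A} {xs}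
    (hx : Homog 𝒜 x) (h : ∀ y ∈ xs, Homog 𝒜 y) :
    f (cyclicOdd 𝒜 z.2 (x.2 ⊗ₜ[R] word R xs)) =
      rotF (fun zs x ys => insF z (fun Z => f (1 ⊗ₜ[R] word R (Z ++ x :: ys))) zs) x xs := by
  rw [cyclicOdd, ChainFormula.lift_homog _ hx h]
  have e : (cyclicOddFormula z.2).toFun x xs = rotF (fun zs x ys =>
      insF z (fun Z => 1 ⊗ₜ[R] word R (Z ++ x :: ys)) zs) x xs := by
    refine splitSum_congr fun ys zs _ => ?_
    simp only [insF, word_append, word_cons, mul_assoc]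
  rw [e, ← LinearMap.toAddMonoidHom_coe, ← rotF_map]
  simp only [insF, ← splitSum_map]

theorem insF_zero (z : ZMod 2 × A) (xs) : insF z (fun _ => (0 : M)) xs = 0 := splitSum_zero _

theorem cyclicOdd_one_tmul (z : A) (t : TensorAlgebra R (ReducedPart R A)) :
    cyclicOdd 𝒜 z (1 ⊗ₜ[R] t) = 0 := by
  suffices h : cyclicOdd 𝒜 z ∘ₗ TensorProduct.mk R A _ 1 = 0 from LinearMap.congr_fun h t
  refine LinearMap.ext_on (span_word_homog 𝒜) ?_
  rintro _ ⟨xs, hxs, rfl⟩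
  have h := map_cyclicOdd (0, z) (LinearMap.id : Chains R A →ₗ[R] _) (homog_one (𝒜 := 𝒜)) hxs
  rw [LinearMap.id_apply] at h
  exact h.trans ((rotF_congr (H' := fun _ _ _ => 0) fun ys zs _ => by
    simp only [LinearMap.id_apply, word_one, TensorProduct.tmul_zero, insF_zero]).trans
    (rotF_zero _ _))

theorem cyclicOdd_connes (z : A) (c : Chains R A) : cyclicOdd 𝒜 z (connes 𝒜 c) = 0 := by
  suffices h : cyclicOdd 𝒜 z ∘ₗ connes 𝒜 = 0 from LinearMap.congr_fun h c
  refine chains_ext (𝒜 := 𝒜) fun x xs hx hxs => ?_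
  rw [LinearMap.comp_apply, map_connes _ hx hxs]
  simp only [cyclicOdd_one_tmul, rotF_zero, LinearMap.zero_apply]

theorem connes_cyclicOdd (z : A) (c : Chains R A) : connes 𝒜 (cyclicOdd 𝒜 z c) = 0 := by
  suffices h : connes 𝒜 ∘ₗ cyclicOdd 𝒜 z = 0 from LinearMap.congr_fun h c
  refine chains_ext (𝒜 := 𝒜) fun x xs hx hxs => ?_
  rw [LinearMap.comp_apply, map_cyclicOdd (0, z) _ hx hxs]
  simp only [connes_one_tmul, insF_zero, rotF_zero, LinearMap.zero_apply]

theorem insF_congr {z : ZMod 2 × A} (hz : Homog 𝒜 z) {G H : List (ZMod 2 × A) → M}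
    (h : ∀ L, (∀ y ∈ L, Homog 𝒜 y) → G L = H L) {xs} (hxs : ∀ y ∈ xs, Homog 𝒜 y) :
    insF z G xs = insF z H xs := by
  refine splitSum_congr fun ys zs e => ?_
  subst e
  refine h _ fun y hy => ?_
  rcases List.mem_append.mp hy with h | h
  · exact hxs y (List.mem_append_left _ h)
  · exact List.forall_mem_cons.mpr ⟨hz, fun w hw => hxs w (List.mem_append_right _ hw)⟩ y h

/-- The homotopy formula for left multiplication with a supercentral element of odd degree. -/
theorem DGStructure.hochschild_cyclicOdd (D : DGStructure 𝒜) {z : ZMod 2 × A} (hz : Homog 𝒜 z)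
    (hz1 : z.1 = 1) (hc : ∀ y, Homog 𝒜 y → SuperComm z y) {x : ZMod 2 × A} {xs}
    (hx : Homog 𝒜 x) (hxs : ∀ y ∈ xs, Homog 𝒜 y) :
    D.hochschild (cyclicOdd 𝒜 z.2 (x.2 ⊗ₜ[R] word R xs)) +
        cyclicOdd 𝒜 z.2 (D.hochschild (x.2 ⊗ₜ[R] word R xs)) =
      iotaElem 𝒜 z.2 (connes 𝒜 (x.2 ⊗ₜ[R] word R xs)) +
        connes 𝒜 (iotaElem 𝒜 z.2 (x.2 ⊗ₜ[R] word R xs)) -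
        cyclicElem 𝒜 (D.d z.2) (x.2 ⊗ₜ[R] word R xs) -
        insF z (fun L => x.2 ⊗ₜ[R] word R L) xs := by
  have hz0 : rdeg z = 0 := by rw [rdeg, hz1, zmod_add_self]
  rw [map_cyclicOdd z _ hx hxs, map_connes _ hx hxs, D.map_hochschild _ hx hxs,
    map_iotaElem _ _ hx hxs]
  have h0 := map_cyclicElem (D.d z.2) LinearMap.id hx hxs (z.1 + 1)
  simp only [LinearMap.id_apply] at h0
  rw [h0]
  have h1 : ∀ (y : ZMod 2 × A) ys, Homog 𝒜 y → (∀ z ∈ ys, Homog 𝒜 z) →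
      cyclicOdd 𝒜 z.2 (y.2 ⊗ₜ[R] word R ys) =
        rotF (fun zs x ys => insF z (fun Z => 1 ⊗ₜ[R] word R (Z ++ x :: ys)) zs) y ys :=
    fun y ys hy hys => map_cyclicOdd z LinearMap.id hy hys
  have hrot : ∀ {ys zs}, ys ++ zs = xs → (∀ y ∈ ys, Homog 𝒜 y) ∧ ∀ y ∈ zs, Homog 𝒜 y := by
    intro ys zs e; subst e
    exact ⟨fun y hy => hxs y (List.mem_append_left _ hy), fun y hy => hxs y (List.mem_append_right _ hy)⟩
  have happ : ∀ {Z ys}, (∀ y ∈ Z, Homog 𝒜 y) → (∀ y ∈ ys, Homog 𝒜 y) → ∀ y ∈ Z ++ x :: ys,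
      Homog 𝒜 y := by
    intro Z ys h1 h2 y hy
    rcases List.mem_append.mp hy with h | h
    · exact h1 y h
    · exact List.forall_mem_cons.mpr ⟨hx, h2⟩ y h
  rw [hochF_congr D.d_mem h1 hx hxs, ← rotF_barM]
  have e1 : rotF (fun zs x ys => insF z (fun Z => D.hochschild (1 ⊗ₜ[R] word R (Z ++ x :: ys))) zs)
      x xs = rotF (fun zs x ys => insF z (fun Z => endsF (fun x xs => x.2 ⊗ₜ[R] word R xs)
        (Z ++ x :: ys)) zs) x xs - rotF (fun zs x ys => insF z (fun Z =>
        barF D.d (fun L => (1 : A) ⊗ₜ[R] word R L) (Z ++ x :: ys)) zs) x xs := by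
    rw [← rotF_sub]
    refine rotF_congr fun ys zs e => ?_
    rw [← insF_sub]
    exact insF_congr hz (fun Z hZ => D.hochschild_one_tmul (happ hZ (hrot e).1)) (hrot e).2
  have e2 : rotF (fun zs x ys => insF z (fun Z =>
        barF D.d (fun L => (1 : A) ⊗ₜ[R] word R L) (Z ++ x :: ys)) zs) x xs =
      rotF (barM D.d fun zs x ys => insF z (fun Z => (1 : A) ⊗ₜ[R] word R (Z ++ x :: ys)) zs) x xs +
      rotF (fun zs x ys => insOddF (z.1 + 1, D.d z.2)
        (fun Z => (1 : A) ⊗ₜ[R] word R (Z ++ x :: ys)) zs) x xs -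
      rotF (fun zs x ys => sgn (wdeg zs) • (1 : A) ⊗ₜ[R] word R (zs ++ mulL z x :: ys)) x xs := by
    rw [← rotF_add, ← rotF_sub]
    refine rotF_congr fun ys zs e => ?_
    exact insF_barM hz0 slotAdd_one_tmul (fun y hy => hc y ((hrot e).2 y hy)) x ys
  have e3 : rotF (fun zs x ys => sgn (wdeg zs) • (1 : A) ⊗ₜ[R] word R (zs ++ mulL z x :: ys)) x xs =
      connes 𝒜 ((z.2 * x.2) ⊗ₜ[R] word R xs) := by
    have h := map_connes LinearMap.id (hz.mulL hx) hxs
    simp only [LinearMap.id_apply] at h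
    refine Eq.trans (splitSum_congr fun ys zs _ => ?_) h.symm
    rw [smul_smul, ← sgn_add, rdeg_mulL, hz0]
    congr 2; grind
  rw [e1, e2, e3, rotF_insF_endsF hz0]
  simp only [iotaElem_tmul, mul_one]
  abel

/-- Left multiplication with a supercentral element `z` is, up to the multiplication with the
differential of `z`, a chain map of odd degree. -/
theorem DGStructure.hochschild_iotaElem (D : DGStructure 𝒜) {z : ZMod 2 × A} (hz : Homog 𝒜 z)
    (hz1 : z.1 = 1) (hc : ∀ y, Homog 𝒜 y → SuperComm z y) (c : Chains R A) :
    D.hochschild (iotaElem 𝒜 z.2 c) + iotaElem 𝒜 z.2 (D.hochschild c) =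
      iotaElem 𝒜 (D.d z.2) c := by
  suffices h : D.hochschild ∘ₗ iotaElem 𝒜 z.2 + iotaElem 𝒜 z.2 ∘ₗ D.hochschild =
      iotaElem 𝒜 (D.d z.2) from LinearMap.congr_fun h c
  refine chains_ext (𝒜 := 𝒜) fun x xs hx hxs => ?_
  rw [LinearMap.add_apply, LinearMap.comp_apply, LinearMap.comp_apply, D.map_hochschild _ hx hxs]
  simp only [iotaElem_tmul]
  have h := D.map_hochschild LinearMap.id (hz.mulL hx) hxs
  simp only [LinearMap.id_apply] at h
  rw [show z.2 * x.2 = (mulL z x).2 from rfl, h, hochF_eq, hochF_eq]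
  have e1 : (oddL D.d (mulL z x)).2 = D.d z.2 * x.2 - z.2 * D.d x.2 := by
    simp only [oddL, mulL]
    rw [D.isLeibniz hz, hz1, sgn_one, neg_one_smul, sub_eq_add_neg]
  have e2 : rdeg (mulL z x) = rdeg x + 1 := by rw [rdeg_mulL, rdeg, hz1, zmod_add_self, zero_add]
  have e3 : lastF (fun ys y => sgn (rdeg y * ((mulL z x).1 + wdeg ys)) •
      (mulL y (mulL z x)).2 ⊗ₜ[R] word R ys) xs =
      -lastF (fun ys y => sgn (rdeg y * (x.1 + wdeg ys)) •
      (z.2 * (mulL y x).2) ⊗ₜ[R] word R ys) xs := by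
    rcases List.eq_nil_or_concat xs with rfl | ⟨ys, y, rfl⟩
    · simp
    · rw [List.concat_eq_append] at hxs ⊢
      rw [lastF_concat, lastF_concat]
      have h := hc y (hxs y (by simp))
      have h4 : sgn (rdeg y * ((mulL z x).1 + wdeg ys)) =
          -(sgn (rdeg y * (x.1 + wdeg ys)) * sgn y.1) := by
        rw [← sgn_add, ← sgn_add_one]; congr 1
        simp only [mulL, hz1, rdeg]; grind
      rw [h4]
      simp only [mulL, ← mul_assoc]
      rw [h, smul_mul_assoc]
      simp only [← TensorProduct.smul_tmul', smul_smul, neg_smul]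
  rw [e1, e2, e3, TensorProduct.sub_tmul]
  simp only [sgn_add_one, oddL, mulL, neg_smul, mul_assoc]
  abel

end CartanElem

/-! ### Shuffles with copies of an odd letter -/

section Shuffles

variable {R : Type u} [CommRing R] {A : Type v} [Ring A] [Algebra R A]
variable {M : Type w} [AddCommGroup M]

/-- The sum over all insertions of `k` copies of the letter `z` into a word. -/
def shF {X : Type v} (z : X) : ℕ → (List X → M) → List X → M
  | 0, G, ys => G ys
  | k + 1, G, [] => shF z k (fun L => G (z :: L)) []
  | k + 1, G, y :: ys => shF z k (fun L => G (z :: L)) (y :: ys) +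
      shF z (k + 1) (fun L => G (y :: L)) ys
  termination_by k _ ys => (k, ys.length)

section

variable {X : Type v} (z : X)

theorem shF_zero_left (G : List X → M) (ys) : shF z 0 G ys = G ys := by
  cases ys <;> simp [shF]

theorem shF_succ_nil (k) (G : List X → M) :
    shF z (k + 1) G [] = shF z k (fun L => G (z :: L)) [] := by rw [shF]

theorem shF_succ_cons (k) (G : List X → M) (y ys) : shF z (k + 1) G (y :: ys) =
    shF z k (fun L => G (z :: L)) (y :: ys) + shF z (k + 1) (fun L => G (y :: L)) ys := by rw [shF]

/-- Induction on the number of inserted letters and the length of the word, which follows the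
recursive structure of shuffles. -/
theorem shF_induction {P : ℕ → (List X → M) → List X → Prop}
    (h0 : ∀ G ys, P 0 G ys) (h1 : ∀ k G, P k (fun L => G (z :: L)) [] → P (k + 1) G [])
    (h2 : ∀ k G y ys, P k (fun L => G (z :: L)) (y :: ys) → P (k + 1) (fun L => G (y :: L)) ys →
      P (k + 1) G (y :: ys)) (k G ys) : P k G ys := by
  induction k generalizing G ys with
  | zero => exact h0 G ys
  | succ k ih =>
    induction ys generalizing G with
    | nil => exact h1 k G (ih _ _)
    | cons y ys ih' => exact h2 k G y ys (ih _ _) (ih' _)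

theorem shF_map {N : Type*} [AddCommGroup N] (f : M →+ N) (k) (G : List X → M) (ys) :
    shF z k (fun L => f (G L)) ys = f (shF z k G ys) := by
  refine shF_induction z (P := fun k G ys => shF z k (fun L => f (G L)) ys = f (shF z k G ys))
    (fun G ys => by simp only [shF_zero_left]) (fun k G h => ?_) (fun k G y ys h h' => ?_) k G ys
  · simp only [shF_succ_nil, h]
  · simp only [shF_succ_cons, h, h', map_add]

theorem shF_zsmul (r : ℤ) (k) (G : List X → M) (ys) :
    shF z k (fun L => r • G L) ys = r • shF z k G ys :=
  shF_map z (DistribSMul.toAddMonoidHom M r) k G ys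

theorem shF_zero (k) (ys : List X) : shF z k (fun _ => (0 : M)) ys = 0 := by
  simpa using shF_map z (0 : M →+ M) k (fun _ => 0) ys

theorem shF_add (k) (G H : List X → M) (ys) :
    shF z k (fun L => G L + H L) ys = shF z k G ys + shF z k H ys := by
  induction k generalizing G H ys with
  | zero => simp only [shF_zero_left]
  | succ k ih =>
    induction ys generalizing G H with
    | nil => simp only [shF_succ_nil, ih]
    | cons y ys ih' => simp only [shF_succ_cons, ih, ih']; abel

theorem shF_sub (k) (G H : List X → M) (ys) :
    shF z k (fun L => G L - H L) ys = shF z k G ys - shF z k H ys := by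
  have h := shF_add z k G (fun L => (-1 : ℤ) • H L) ys
  rw [shF_zsmul] at h
  simpa [sub_eq_add_neg] using h

/-- The sum over shuffles only depends on the values on words with letters `z` and letters of the
given word. -/
theorem shF_congr {k} {G H : List X → M} {ys : List X}
    (h : ∀ L, (∀ y ∈ L, y = z ∨ y ∈ ys) → G L = H L) : shF z k G ys = shF z k H ys := by
  induction k generalizing G H ys with
  | zero => simp only [shF_zero_left]; exact h ys fun y hy => .inr hy
  | succ k ih =>
    induction ys generalizing G H with
    | nil =>
      rw [shF_succ_nil, shF_succ_nil]
      exact ih fun L hL => h _ (List.forall_mem_cons.mpr ⟨.inl rfl, hL⟩)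
    | cons y ys ih' =>
      rw [shF_succ_cons, shF_succ_cons]
      congr 1
      · exact ih fun L hL => h _ (List.forall_mem_cons.mpr ⟨.inl rfl, hL⟩)
      · refine ih' fun L hL => h _ (List.forall_mem_cons.mpr ⟨.inr List.mem_cons_self, fun w hw => ?_⟩)
        exact (hL w hw).imp_right (List.mem_cons_of_mem _)

/-- A sum over shuffles which only involves numbers `k - 1` of inserted letters; it is zero for
`k = 0`. -/
def shPred (k : ℕ) (G : List X → M) (ys : List X) : M :=
  match k with
  | 0 => 0
  | k + 1 => shF z k G ys

theorem shPred_succ (k) (G : List X → M) : shPred z (k + 1) G = shF z k G := rfl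

theorem shPred_zero (k) (ys : List X) : shPred z k (fun _ => (0 : M)) ys = 0 := by
  cases k with
  | zero => rfl
  | succ k => exact shF_zero z k ys

theorem shF_cons (k) (G : List X → M) (y ys) : shF z k G (y :: ys) =
    shPred z k (fun L => G (z :: L)) (y :: ys) + shF z k (fun L => G (y :: L)) ys := by
  cases k with
  | zero => simp only [shF_zero_left, shPred, zero_add]
  | succ k => exact shF_succ_cons z k G y ys

theorem shF_headF (k) (f : X → List X → M) (ys) : shF z k (headF f) ys =
    shPred z k (f z) ys + headF (fun y ys => shF z k (f y) ys) ys := by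
  cases ys with
  | nil =>
    cases k with
    | zero => simp [shF_zero_left, shPred]
    | succ k => simp [shF_succ_nil, shPred]
  | cons y ys => simp only [shF_cons, headF_cons]

theorem shF_nil (k) (G : List X → M) : shF z k G [] = G (List.replicate k z) := by
  induction k generalizing G with
  | zero => rw [shF_zero_left]; rfl
  | succ k ih => rw [shF_succ_nil, ih]; rfl

theorem shF_concat (k) (G : List X → M) (ys y) : shF z k G (ys ++ [y]) =
    shPred z k (fun L => G (L ++ [z])) (ys ++ [y]) + shF z k (fun L => G (L ++ [y])) ys := by
  induction k generalizing G ys with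
  | zero => simp [shF_zero_left, shPred]
  | succ k ih =>
    induction ys generalizing G with
    | nil =>
      have h := ih (fun L => G (z :: L)) []
      simp only [List.nil_append] at h
      rw [List.nil_append, shF_succ_cons, h, shF_succ_nil]
      cases k with
      | zero =>
        rw [show (0 + 1) = 1 from rfl, shF_succ_nil]
        simp [shF_zero_left, shPred, add_comm]
      | succ k =>
        simp only [shPred, shF_succ_cons, List.cons_append, shF_nil, List.nil_append,
          ← List.replicate_succ', List.replicate_succ]
        abel
    | cons x xs ih' =>
      have h := ih (fun L => G (z :: L)) (x :: xs)
      rw [List.cons_append, shF_succ_cons, ih', ← List.cons_append, h, shF_succ_cons]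
      cases k with
      | zero => simp [shF_zero_left, shPred]; abel
      | succ k => simp only [shPred, shF_succ_cons, List.cons_append]; abel

theorem shPred_map {N : Type*} [AddCommGroup N] (f : M →+ N) (k) (G : List X → M) (ys) :
    shPred z k (fun L => f (G L)) ys = f (shPred z k G ys) := by
  cases k with
  | zero => simp [shPred]
  | succ k => exact shF_map z f k G ys

theorem shPred_zsmul (r : ℤ) (k) (G : List X → M) (ys) :
    shPred z k (fun L => r • G L) ys = r • shPred z k G ys :=
  shPred_map z (DistribSMul.toAddMonoidHom M r) k G ys

theorem shF_nil_lastF (k) (f : List X → X → M) :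
    shF z k (lastF f) [] = shPred z k (fun L => f L z) [] := by
  cases k with
  | zero => simp [shF_zero_left, shPred]
  | succ k => rw [shF_nil, shPred, shF_nil, List.replicate_succ', lastF_concat]

theorem shF_lastF (k) (f : List X → X → M) (ys) : shF z k (lastF f) ys =
    shPred z k (fun L => f L z) ys + lastF (fun ys y => shF z k (fun L => f L y) ys) ys := by
  rcases List.eq_nil_or_concat ys with rfl | ⟨ys, y, rfl⟩
  · rw [shF_nil_lastF, lastF_nil, add_zero]
  · simp only [List.concat_eq_append, shF_concat, lastF_concat]

theorem shF_splitSum (k) (f : List X → List X → M) (ys) : shF z k (splitSum f) ys =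
    ∑ p ∈ Finset.HasAntidiagonal.antidiagonal k,
      splitSum (fun us vs => shF z p.1 (fun U => shF z p.2 (fun V => f U V) vs) us) ys := by
  induction k generalizing f ys with
  | zero => simp [shF_zero_left]
  | succ k ih =>
    induction ys generalizing f with
    | nil =>
      rw [shF_succ_nil, Finset.Nat.antidiagonal_succ, Finset.sum_cons, Finset.sum_map]
      simp only [splitSum, shF_add, Function.Embedding.prodMap, Function.Embedding.coeFn_mk,
        Prod.map, Function.Embedding.refl_apply, Nat.succ_eq_add_one, shF_zero_left, shF_succ_nil]
      congr 1
      have := ih (fun us vs => f (z :: us) vs) []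
      simpa only [splitSum] using this
    | cons y ys ih' =>
      rw [shF_succ_cons]
      simp only [splitSum, shF_add, ih']
      have := ih (fun us vs => f (z :: us) vs) (y :: ys)
      rw [this]
      have e : ∀ g : ℕ × ℕ → M, ∑ p ∈ Finset.HasAntidiagonal.antidiagonal (k + 1), g p =
          g (0, k + 1) + ∑ p ∈ Finset.HasAntidiagonal.antidiagonal k, g (p.1 + 1, p.2) := by
        intro g
        rw [Finset.Nat.antidiagonal_succ, Finset.sum_cons, Finset.sum_map]
        rfl
      rw [e, e]
      simp only [splitSum, shF_zero_left, shF_succ_nil, shF_succ_cons, splitSum_add,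
        Finset.sum_add_distrib]
      abel

theorem shF_append_cons (k) (G : List X → M) (us x vs) : shF z k G (us ++ x :: vs) =
    ∑ p ∈ Finset.HasAntidiagonal.antidiagonal k,
      shF z p.1 (fun U => shF z p.2 (fun V => G (U ++ x :: V)) vs) us := by
  have e : ∀ k (g : ℕ × ℕ → M), ∑ p ∈ Finset.HasAntidiagonal.antidiagonal (k + 1), g p =
      g (0, k + 1) + ∑ p ∈ Finset.HasAntidiagonal.antidiagonal k, g (p.1 + 1, p.2) := by
    intro k g
    rw [Finset.Nat.antidiagonal_succ, Finset.sum_cons, Finset.sum_map]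
    rfl
  induction k generalizing G us with
  | zero => simp [shF_zero_left]
  | succ k ih =>
    induction us generalizing G with
    | nil =>
      rw [List.nil_append, shF_succ_cons, ← List.nil_append (x :: vs), ih, e]
      simp only [shF_zero_left, shF_succ_nil, List.nil_append, List.cons_append]
      abel
    | cons u us ih' =>
      rw [List.cons_append, shF_succ_cons, ← List.cons_append, ih, ih', e, e]
      simp only [shF_zero_left, shF_succ_cons, List.cons_append, Finset.sum_add_distrib]
      abel

end

/-- Insertion of a letter into a word commutes with shuffles. -/
theorem shF_insOddF {z : ZMod 2 × A} (hz : rdeg z = 0) (w : ZMod 2 × A) (k)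
    (G : List (ZMod 2 × A) → M) (ys) :
    shF z k (insOddF w G) ys = insOddF w (shF z k G) ys := by
  change shF z k (splitSum _) ys = splitSum _ ys
  rw [shF_splitSum]
  simp only [shF_append_cons, ← splitSum_zsmul]
  have key : ∀ k (G : List (ZMod 2 × A) → M) us, shF z k (fun U => sgn (wdeg U) • G U) us =
      sgn (wdeg us) • shF z k G us := by
    intro k G us
    induction k generalizing G us with
    | zero => simp only [shF_zero_left]
    | succ k ih =>
      induction us generalizing G with
      | nil => simp only [shF_succ_nil, wdeg_cons, hz, zero_add, ih]
      | cons u us ih' =>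
        simp only [shF_succ_cons, wdeg_cons, hz, zero_add, sgn_add, ← smul_smul, shF_zsmul, ih,
          ih', smul_add]
  simp only [shF_zsmul, key]
  have h2 : ∀ (s : Finset (ℕ × ℕ)) (f : ℕ × ℕ → List (ZMod 2 × A) → List (ZMod 2 × A) → M),
      ∑ p ∈ s, splitSum (f p) ys = splitSum (fun us vs => ∑ p ∈ s, f p us vs) ys := by
    intro s f
    induction s using Finset.cons_induction with
    | empty => simp [splitSum_zero]
    | cons a s ha ih => simp only [Finset.sum_cons, splitSum_add, ih]
  rw [h2]
  simp only [Finset.smul_sum]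

theorem shF_sgn {z : ZMod 2 × A} (hz : rdeg z = 0) (s : ZMod 2 → ℤ) (k)
    (G : List (ZMod 2 × A) → M) (ys) :
    shF z k (fun L => s (wdeg L) • G L) ys = s (wdeg ys) • shF z k G ys := by
  induction k generalizing G ys s with
  | zero => simp only [shF_zero_left]
  | succ k ih =>
    induction ys generalizing G s with
    | nil => simp only [shF_succ_nil, wdeg_cons, hz, zero_add, ih]
    | cons u us ih' =>
      simp only [shF_succ_cons, wdeg_cons, hz, zero_add, ih]
      rw [ih' fun p => s (rdeg u + p), smul_add]

/-- Rotations of words commute with shuffles. -/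
theorem shF_rotF {z : ZMod 2 × A} (hz : rdeg z = 0) (k)
    (H : List (ZMod 2 × A) → ZMod 2 × A → List (ZMod 2 × A) → M) (x xs) :
    shF z k (rotF H x) xs = rotF (fun zs x ys => ∑ p ∈ Finset.HasAntidiagonal.antidiagonal k,
      shF z p.1 (fun Y => shF z p.2 (fun Z => H Z x Y) zs) ys) x xs := by
  change shF z k (splitSum _) xs = splitSum _ xs
  rw [shF_splitSum]
  have h2 : ∀ (s : Finset (ℕ × ℕ)) (f : ℕ × ℕ → List (ZMod 2 × A) → List (ZMod 2 × A) → M),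
      ∑ p ∈ s, splitSum (f p) xs = splitSum (fun us vs => ∑ p ∈ s, f p us vs) xs := by
    intro s f
    induction s using Finset.cons_induction with
    | empty => simp [splitSum_zero]
    | cons a s ha ih => simp only [Finset.sum_cons, splitSum_add, ih]
  rw [h2]
  refine splitSum_congr fun ys zs _ => ?_
  rw [Finset.smul_sum]
  refine Finset.sum_congr rfl fun p _ => ?_
  have e : (fun U => shF z p.2 (fun V => sgn ((rdeg x + wdeg U) * wdeg V) • H V x U) zs) =
      fun U => sgn ((rdeg x + wdeg U) * wdeg zs) • shF z p.2 (fun V => H V x U) zs := by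
    funext U
    exact shF_sgn hz (fun q => sgn ((rdeg x + wdeg U) * q)) _ _ _
  rw [e, shF_sgn hz (fun q => sgn ((rdeg x + q) * wdeg zs))]

theorem shF_comm {X : Type v} (z : X) (i j) (f : List X → List X → M) (us vs) :
    shF z i (fun U => shF z j (fun V => f U V) vs) us =
      shF z j (fun V => shF z i (fun U => f U V) us) vs := by
  induction i generalizing f us with
  | zero => simp only [shF_zero_left]
  | succ i ih =>
    induction us generalizing f with
    | nil => simp only [shF_succ_nil, ih]
    | cons u us ih' => simp only [shF_succ_cons, ih, ih', shF_add]

/-- Rotations of words commute with shuffles, for functions of the underlying word. -/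
theorem shF_rotF_append {z : ZMod 2 × A} (hz : rdeg z = 0) (k)
    (G : List (ZMod 2 × A) → M) (x xs) :
    shF z k (rotF (fun zs x ys => G (zs ++ x :: ys)) x) xs =
      rotF (fun zs x ys => shF z k G (zs ++ x :: ys)) x xs := by
  rw [shF_rotF hz]
  refine rotF_congr fun ys zs _ => ?_
  rw [shF_append_cons, ← Finset.Nat.sum_antidiagonal_swap]
  refine Finset.sum_congr rfl fun p _ => ?_
  exact shF_comm _ _ _ _ _ _

theorem shF_insOddF_comm (z w : ZMod 2 × A) (k) (f : List (ZMod 2 × A) → List (ZMod 2 × A) → M)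
    (us vs) : shF z k (fun U => insOddF w (fun V => f V U) vs) us =
      insOddF w (fun V => shF z k (f V) us) vs := by
  induction vs generalizing f with
  | nil => simp only [insOddF_nil]
  | cons v vs ih =>
    simp only [insOddF_cons, shF_add, shF_zsmul]
    rw [ih fun V U => f (v :: V) U]

/-- Rotations of words with a letter inserted in front of the marked one commute with shuffles. -/
theorem shF_rotF_insOddF {z : ZMod 2 × A} (hz : rdeg z = 0) (w : ZMod 2 × A) (k)
    (G : List (ZMod 2 × A) → M) (x xs) :
    shF z k (rotF (fun zs x ys => insOddF w (fun Z => G (Z ++ x :: ys)) zs) x) xs =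
      rotF (fun zs x ys => insOddF w (fun Z => shF z k G (Z ++ x :: ys)) zs) x xs := by
  rw [shF_rotF hz]
  refine rotF_congr fun ys zs _ => ?_
  simp only [shF_append_cons z k G]
  have h2 : ∀ (s : Finset (ℕ × ℕ)) (f : ℕ × ℕ → List (ZMod 2 × A) → M),
      insOddF w (fun Z => ∑ p ∈ s, f p Z) zs = ∑ p ∈ s, insOddF w (f p) zs := by
    intro s f
    induction s using Finset.cons_induction with
    | empty => simp [insOddF, splitSum_zero]
    | cons a s ha ih =>
      rw [Finset.sum_cons, ← ih]
      simp only [Finset.sum_cons, insOddF, smul_add, splitSum_add]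
  rw [h2, ← Finset.Nat.sum_antidiagonal_swap]
  refine Finset.sum_congr rfl fun p _ => ?_
  have e : ∀ Y, shF z p.1 (insOddF w fun Z => G (Z ++ x :: Y)) zs =
      insOddF w (shF z p.1 fun Z => G (Z ++ x :: Y)) zs := fun Y => shF_insOddF hz w _ _ _
  have e' : ∀ Z, shF z p.1 (fun U => shF z p.2 (fun V => G (U ++ x :: V)) ys) Z =
      shF z p.2 (fun V => shF z p.1 (fun U => G (U ++ x :: V)) Z) ys := fun Z => shF_comm _ _ _ _ _ _
  exact (congrArg (fun f => shF z p.2 f ys) (funext e)).trans ((shF_insOddF_comm z w p.2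
    (fun Z Y => shF z p.1 (fun Z => G (Z ++ x :: Y)) Z) ys zs).trans
    (congrArg (fun f => insOddF w f zs) (funext fun Z => (e' Z).symm)))

/-- Shuffles commute with the bar differential up to the differential of the inserted letter
`z`. -/
theorem shF_barF {δ : A →ₗ[R] A} {z : ZMod 2 × A} (hz : rdeg z = 0) (hzz : z.2 * z.2 = 0)
    {G : List (ZMod 2 × A) → M} (hG : SlotAdd G) (k) {ys : List (ZMod 2 × A)}
    (hys : ∀ y ∈ ys, SuperComm z y) :
    shF z k (barF δ G) ys = barF δ (shF z k G) ys +
      insOddF (oddL δ z) (shPred z k G) ys := by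
  have hmul : ∀ {G : List (ZMod 2 × A) → M}, SlotAdd G → ∀ L, G (mulL z z :: L) = 0 := by
    intro G hG L
    have h := hG.zero [] (z.1 + z.1) L
    rw [mulL, hzz]
    exact h
  have hmul' : ∀ {G : List (ZMod 2 × A) → M}, SlotAdd G → ∀ {y}, SuperComm z y → ∀ L,
      G (mulL z y :: L) = -sgn (rdeg y) • G (mulL y z :: L) := by
    intro G hG y hy L
    have := hG.sgn_smul [] (y.1 + z.1) y.1 (y.2 * z.2) L
    rw [List.nil_append, List.nil_append] at this
    rw [← sgn_fst]
    simp only [mulL]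
    rw [← this, hy, add_comm]
  induction k generalizing G ys with
  | zero =>
    rw [show shF z 0 G = G from funext fun L => shF_zero_left z G L, shF_zero_left]
    simp [insOddF, shPred, splitSum_zero]
  | succ k ihk =>
    have e1 : ∀ ys, shF z k (fun L => barF δ G (z :: L)) ys =
        shF z k (fun L => G (oddL δ z :: L)) ys -
        shF z k (headF fun c cs => G (mulL z c :: cs)) ys +
        shF z k (barF δ fun L => G (z :: L)) ys := by
      intro ys
      simp only [barF_cons, hz, sgn_zero, one_smul, shF_add, shF_sub]
    induction ys generalizing G with
    | nil =>
      rw [shF_succ_nil, e1, ihk (hG.cons z) (by simp), shF_headF, barF_nil, barF_nil]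
      simp only [hmul hG, insOddF_nil, headF_nil, shPred]
      cases k with
      | zero => simp [shPred, shF_zero_left]
      | succ k => simp [shPred, shF_zero, shF_succ_cons, add_comm]
    | cons y ys ih =>
      have hy := hys y List.mem_cons_self
      have hys' : ∀ w ∈ ys, SuperComm z w := fun w hw => hys w (List.mem_cons_of_mem _ hw)
      have h1 := ih (hG.cons y) hys' (fun ys => by
        simp only [barF_cons, hz, sgn_zero, one_smul, shF_add, shF_sub])
      have h2 := ihk (hG.cons z) hys
      have h3 : (fun L => barF δ G (y :: L)) = fun L => G (oddL δ y :: L) -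
          sgn (rdeg y) • headF (fun c cs => G (mulL y c :: cs)) L +
          sgn (rdeg y) • barF δ (fun L => G (y :: L)) L := by
        funext L; rw [barF_cons]
      rw [shF_succ_cons, e1, h2, h3, shF_headF]
      have h4 : insOddF (oddL δ z) (fun L => shF z k G (y :: L)) ys =
          insOddF (oddL δ z) (fun L => shPred z k (fun L => G (z :: L)) (y :: L)) ys +
            insOddF (oddL δ z) (fun L => shF z k (fun L => G (y :: L)) L) ys := by
        simp only [insOddF, ← splitSum_add, ← smul_add, shF_cons z k G]
      have h5 : shF z k (fun cs => G (mulL z y :: cs)) ys =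
          -(sgn (rdeg y) • shF z k (fun cs => G (mulL y z :: cs)) ys) := by
        rw [show (fun cs => G (mulL z y :: cs)) = fun cs => -sgn (rdeg y) • G (mulL y z :: cs) from
          funext (hmul' hG hy), shF_zsmul, neg_smul]
      simp only [shF_add, shF_sub, shF_zsmul, h1, shF_headF, hmul hG, h5, barF_cons,
        insOddF_cons, shPred_succ, shF_succ_cons, headF_cons, headF_add, barF_add, h4,
        shF_cons z k G (oddL δ z), shPred_zero, smul_add]
      rw [show (fun L => shF z k (fun L => G (y :: L)) L) = shF z k fun L => G (y :: L) from rfl]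
      abel
/-- Inserting one more copy of `z` into the shuffles with `k` copies of `z`, one obtains each
shuffle with `k + 1` copies precisely `k + 1` times. -/
theorem shF_insF (z : ZMod 2 × A) (k) (G : List (ZMod 2 × A) → M) (ys) :
    shF z k (insF z G) ys = (k + 1) • shF z (k + 1) G ys := by
  induction k generalizing G ys with
  | zero =>
    rw [shF_zero_left, zero_add, one_smul]
    induction ys generalizing G with
    | nil => rw [insF_nil, shF_succ_nil, shF_zero_left]
    | cons y ys ih => rw [insF_cons, ih, shF_succ_cons, shF_zero_left]
  | succ k ihk =>
    induction ys generalizing G with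
    | nil =>
      rw [shF_succ_nil]
      simp only [insF_cons, shF_add]
      rw [ihk, shF_succ_nil z (k + 1), shF_succ_nil z k, succ_nsmul' _ (k + 1)]
    | cons y ys ih =>
      rw [shF_succ_cons]
      simp only [insF_cons, shF_add]
      rw [ihk, ih, shF_succ_cons z (k + 1), shF_succ_cons z k, smul_add, smul_add,
        succ_nsmul' _ (k + 1), succ_nsmul' _ (k + 1)]
      simp only [smul_add]
      abel

/-- Shuffles commute with the Hochschild differential up to the differential of the inserted
letter `z`: the products of `z` with the first element from the left and from the right cancel. -/
theorem shF_hochF {δ : A →ₗ[R] A} {z : ZMod 2 × A} (hz1 : z.1 = 1) (hzz : z.2 * z.2 = 0)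
    {F : ZMod 2 × A → List (ZMod 2 × A) → M} (hF : SlotAdd (headF F)) (k) {x : ZMod 2 × A}
    {ys : List (ZMod 2 × A)} (hx : SuperComm z x) (hys : ∀ y ∈ ys, SuperComm z y) :
    shF z k (hochF δ F x) ys = hochF δ (fun x ys => shF z k (F x) ys) x ys +
      sgn (rdeg x) • insOddF (oddL δ z) (shPred z k (F x)) ys := by
  have hz : rdeg z = 0 := by rw [rdeg, hz1, zmod_add_self]
  have hFx : SlotAdd (F x) := fun us p a b vs => hF (x :: us) p a b vs
  have h1 := shF_barF (δ := δ) hz hzz hFx k hys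
  have h2 : hochF δ F x = fun xs => F (oddL δ x) xs -
      sgn (rdeg x) • headF (fun z zs => F (mulL x z) zs) xs + sgn (rdeg x) • barF δ (F x) xs -
      lastF (fun ys y => sgn (rdeg y * (x.1 + wdeg ys)) • F (mulL y x) ys) xs :=
    funext fun xs => hochF_eq δ F x xs
  have h3 : F (mulL z x) = fun L => -sgn (rdeg x) • F (mulL x z) L := by
    funext L
    have := hF.sgn_smul [] (x.1 + z.1) x.1 (x.2 * z.2) L
    rw [List.nil_append, List.nil_append, headF_cons, headF_cons] at this
    rw [← sgn_fst]
    simp only [mulL]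
    rw [← this, hx, add_comm]
  have h4 : lastF (fun ys y => shF z k (fun L => sgn (rdeg y * (x.1 + wdeg L)) • F (mulL y x) L) ys) ys =
      lastF (fun ys y => sgn (rdeg y * (x.1 + wdeg ys)) • shF z k (F (mulL y x)) ys) ys := by
    refine lastF_congr fun us u _ => ?_
    rw [shF_sgn hz (fun p => sgn (rdeg u * (x.1 + p)))]
  rw [h2, hochF_eq]
  simp only [shF_add, shF_sub, shF_zsmul, shF_headF, shF_lastF]
  rw [h1, h4]
  simp only [hz, zero_mul, sgn_zero, one_smul, h3, shPred_zsmul]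
  simp only [neg_smul, smul_add]
  abel

end Shuffles

/-! ### Change of the letters of a word -/

section Transport

theorem splitSum_list_map {X Y M : Type*} [AddCommMonoid M] (j : X → Y) (f : List Y → List Y → M) (xs) :
    splitSum f (xs.map j) = splitSum (fun ys zs => f (ys.map j) (zs.map j)) xs := by
  induction xs generalizing f with
  | nil => rfl
  | cons x xs ih => simp only [List.map_cons, splitSum, ih, List.map_nil]

theorem lastF_list_map {X Y M : Type*} [AddCommGroup M] (j : X → Y) (f : List Y → Y → M) (xs) :
    lastF f (xs.map j) = lastF (fun ys y => f (ys.map j) (j y)) xs := by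
  rcases List.eq_nil_or_concat xs with rfl | ⟨ys, y, rfl⟩
  · rfl
  · simp only [List.concat_eq_append, List.map_append, List.map_cons, List.map_nil, lastF_concat]

theorem headF_list_map {X Y M : Type*} [AddCommGroup M] (j : X → Y) (f : Y → List Y → M) (xs) :
    headF f (xs.map j) = headF (fun y ys => f (j y) (ys.map j)) xs := by
  cases xs <;> rfl

variable {R : Type*} [CommRing R] {A : Type*} [Ring A] [Algebra R A]
variable {R' : Type*} [CommRing R'] {B : Type*} [Ring B] [Algebra R' B]
variable {M : Type*} [AddCommGroup M]
variable {j : ZMod 2 × A → ZMod 2 × B} (hj : ∀ x, (j x).1 = x.1)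

section
include hj

theorem rdeg_transport (x : ZMod 2 × A) : rdeg (j x) = rdeg x := by rw [rdeg, rdeg, hj]

theorem wdeg_transport (xs : List (ZMod 2 × A)) : wdeg (xs.map j) = wdeg xs := by
  induction xs with
  | nil => rfl
  | cons x xs ih => rw [List.map_cons, wdeg_cons, wdeg_cons, ih, rdeg_transport hj]

theorem rotF_transport (H : List (ZMod 2 × B) → ZMod 2 × B → List (ZMod 2 × B) → M) (x xs) :
    rotF H (j x) (xs.map j) = rotF (fun zs x ys => H (zs.map j) (j x) (ys.map j)) x xs := by
  simp only [rotF, splitSum_list_map, wdeg_transport hj, rdeg_transport hj]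

theorem insOddF_transport (w : ZMod 2 × A) (G : List (ZMod 2 × B) → M) (xs) :
    insOddF (j w) G (xs.map j) = insOddF w (fun L => G (L.map j)) xs := by
  simp only [insOddF, splitSum_list_map, wdeg_transport hj, List.map_append, List.map_cons]

theorem hochF_transport {δ : A →ₗ[R] A} {δ' : B →ₗ[R'] B} (hδ : ∀ x, oddL δ' (j x) = j (oddL δ x))
    (hm : ∀ x y, mulL (j x) (j y) = j (mulL x y))
    (F : ZMod 2 × B → List (ZMod 2 × B) → M) (x xs) :
    hochF δ' F (j x) (xs.map j) = hochF δ (fun x xs => F (j x) (xs.map j)) x xs := by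
  have hb : ∀ (G : List (ZMod 2 × B) → M) xs,
      barF δ' G (xs.map j) = barF δ (fun L => G (L.map j)) xs := by
    intro G xs
    induction xs generalizing G with
    | nil => simp
    | cons x xs ih =>
      simp only [List.map_cons, barF_cons, hδ, headF_list_map, hm, rdeg_transport hj, ih]
  simp only [hochF_eq, hδ, headF_list_map, hm, rdeg_transport hj, hb, lastF_list_map,
    wdeg_transport hj, hj]

end

end Transport

/-! ### The letters of words in `A[t,ε]` -/

namespace KoszulAlg

variable {K : Type u} [Field K] {A : Type v} [Ring A] [Algebra K A]
variable (𝒜 : ℤ → Submodule K A) [GradedAlgebra 𝒜]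
variable {M : Type w} [AddCommGroup M]

/-- An element of `A` with parity, seen as an element of `A[t,ε]`. -/
def inclL (x : ZMod 2 × A) : ZMod 2 × KoszulAlg 𝒜 := (x.1, incl 𝒜 x.2)

/-- The element `ε` with its parity. -/
def epsL : ZMod 2 × KoszulAlg 𝒜 := (1, eps 𝒜)

theorem rdeg_epsL : rdeg (epsL 𝒜) = 0 := zmod_add_self 1

@[simp] theorem incl_c (a : A) : (incl 𝒜 a).c = Polynomial.C a := rfl
@[simp] theorem incl_e (a : A) : (incl 𝒜 a).e = 0 := rfl
@[simp] theorem eps_c : (eps 𝒜).c = 0 := rfl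
@[simp] theorem eps_e : (eps 𝒜).e = 1 := rfl
@[simp] theorem depsilon_c (x : KoszulAlg 𝒜) : (depsilon 𝒜 x).c = sigma 𝒜 x.e := rfl
@[simp] theorem depsilon_e (x : KoszulAlg 𝒜) : (depsilon 𝒜 x).e = 0 := rfl

theorem incl_mul (a b : A) : incl 𝒜 (a * b) = incl 𝒜 a * incl 𝒜 b := by
  ext1 <;> simp

theorem eps_mul_eps : eps 𝒜 * eps 𝒜 = 0 := by ext1 <;> simp

theorem depsilon_incl (a : A) : depsilon 𝒜 (incl 𝒜 a) = 0 := by ext1 <;> simp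

theorem depsilon_eps : depsilon 𝒜 (eps 𝒜) = 1 := by ext1 <;> simp

theorem dt_incl (a : A) : dt 𝒜 (incl 𝒜 a) = 0 := by ext1 <;> simp [dt]

theorem dt_eps : dt 𝒜 (eps 𝒜) = 0 := by ext1 <;> simp [dt]

variable {𝒜}

theorem incl_mem {n : ℤ} {a : A} (ha : a ∈ 𝒜 n) : incl 𝒜 a ∈ gr 𝒜 n := by
  intro k
  simp only [incl_c, incl_e, Polynomial.coeff_C, Polynomial.coeff_zero, zero_mem, and_true]
  split_ifs
  exacts [ha, zero_mem _]

theorem isHom_inclL {x : ZMod 2 × A} {n : ℤ} (hx : IsHom 𝒜 x n) : IsHom (gr 𝒜) (inclL 𝒜 x) n :=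
  ⟨hx.1, incl_mem hx.2⟩

theorem isHom_epsL : IsHom (gr 𝒜) (epsL 𝒜) (-1) := by
  refine ⟨by simp only [epsL]; decide, fun k => ?_⟩
  simp only [epsL, eps_c, eps_e, Polynomial.coeff_zero, zero_mem, true_and, Polynomial.coeff_one,
    neg_add_cancel]
  split_ifs
  exacts [SetLike.GradedOne.one_mem, zero_mem _]

theorem homog_inclL {x : ZMod 2 × A} (hx : Homog 𝒜 x) : Homog (gr 𝒜) (inclL 𝒜 x) :=
  let ⟨_, h⟩ := hx; ⟨_, isHom_inclL h⟩

theorem homog_epsL : Homog (gr 𝒜) (epsL 𝒜) := ⟨_, isHom_epsL⟩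

theorem superComm_epsL {y : ZMod 2 × KoszulAlg 𝒜} (hy : Homog (gr 𝒜) y) :
    SuperComm (epsL 𝒜) y := by
  obtain ⟨n, h1, h2⟩ := hy
  ext1
  · simp [epsL, zsmul_c]
  · simp only [epsL, mul_e, eps_c, eps_e, zero_mul, one_mul, zero_add, zsmul_e, mul_one, map_zero,
      mul_zero, add_zero]
    rw [sigma_of_mem 𝒜 fun k => (h2 k).1, h1]

theorem homog_shuffled {L : List (ZMod 2 × KoszulAlg 𝒜)} {xs : List (ZMod 2 × A)}
    (hxs : ∀ y ∈ xs, Homog 𝒜 y) (hL : ∀ y ∈ L, y = epsL 𝒜 ∨ y ∈ xs.map (inclL 𝒜)) :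
    ∀ y ∈ L, Homog (gr 𝒜) y := by
  intro y hy
  rcases hL y hy with rfl | h
  · exact homog_epsL
  · obtain ⟨x, hx, rfl⟩ := List.mem_map.mp h
    exact homog_inclL (hxs x hx)

section DG

variable {D : DGStructure 𝒜} (W : CentralCocycle D)

theorem dKoszul_incl (a : A) : dKoszul W (incl 𝒜 a) = incl 𝒜 (D.d a) := by
  ext k
  · simp only [dKoszul_c, Polynomial.coeff_add, polyMap_coeff, incl_c, incl_e, map_zero, mul_zero,
      Polynomial.coeff_zero, add_zero, Polynomial.coeff_C]
    split_ifs <;> simp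
  · simp [dKoszul_e, polyMap_coeff]

theorem dKoszul_eps : dKoszul W (eps 𝒜) = (Polynomial.X : K[X]) • 1 - incl 𝒜 W.val := by
  ext k
  · rw [sub_eq_add_neg]
    simp [dKoszul_c, polyMap_coeff, tw, sub_eq_add_neg]
  · rw [sub_eq_add_neg]
    simp only [dKoszul_e, polyMap_coeff, add_e, poly_smul_e, one_e, mul_zero, neg_e, incl_e,
      Polynomial.coeff_add, Polynomial.coeff_neg, eps_e, Polynomial.coeff_one, Polynomial.coeff_zero]
    split_ifs <;> simp [D.d_one]

/-- Since `dε = t - W` and letters are taken modulo multiples of the unit, the letter `dε` equals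
`-W`. -/
theorem letter_dKoszul_eps :
    letter K[X] (dKoszul W (eps 𝒜)) = -letter K[X] (incl 𝒜 W.val) := by
  rw [dKoszul_eps, map_sub, map_smul, letter_one, smul_zero, zero_sub]

theorem depsilon_dKoszul (x : KoszulAlg 𝒜) :
    depsilon 𝒜 (dKoszul W x) + dKoszul W (depsilon 𝒜 x) = 0 := by
  ext1
  · simp [dKoszul_c, dKoszul_e, polyMap_sigma]
  · simp [dKoszul_e]

end DG

theorem depsilon_mem (n : ℤ) (x : KoszulAlg 𝒜) (hx : x ∈ gr 𝒜 n) :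
    depsilon 𝒜 x ∈ gr 𝒜 (n + 1) := by
  intro k
  simp only [depsilon_c, depsilon_e, Polynomial.coeff_zero, zero_mem, and_true, sigma_coeff]
  exact gradeInv_mem 𝒜 (hx k).2

theorem depsilon_leibniz (y : ZMod 2 × KoszulAlg 𝒜) (hy : Homog (gr 𝒜) y) :
    IsLeibniz (depsilon 𝒜) y := by
  obtain ⟨n, h1, h2⟩ := hy
  intro b
  ext1
  · simp only [depsilon_c, mul_e, map_add, map_mul, sigma_sigma, add_c, mul_c, zsmul_c]
    rw [sigma_of_mem 𝒜 fun k => (h2 k).1, h1, smul_mul_assoc, add_comm]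
  · simp only [depsilon_e, depsilon_c, add_e, mul_e, zsmul_e, zero_mul, mul_zero, sigma_sigma,
      zero_add, add_zero]
    rw [sigma_of_mem 𝒜 fun k => (h2 k).2, h1, sgn_cast_add_one, neg_smul, neg_mul, smul_mul_assoc,
      neg_add_cancel]

/-! ### The shuffle map -/

variable (𝒜) in
theorem shF_epsL_word (k : ℕ) (as : List (ZMod 2 × A)) :
    shF (epsL 𝒜) k (word K[X]) (as.map (inclL 𝒜)) = epsShuffle 𝒜 k as := by
  have h : ∀ (k) (y : ZMod 2 × KoszulAlg 𝒜) ys, shF (epsL 𝒜) k (fun L => word K[X] (y :: L)) ys =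
      letter K[X] y.2 * shF (epsL 𝒜) k (word K[X]) ys := by
    intro k y ys
    simp only [word_cons]
    exact shF_map _ (AddMonoidHom.mulLeft (letter K[X] y.2)) _ _ _
  induction k generalizing as with
  | zero =>
    rw [shF_zero_left]
    induction as with
    | nil => rw [epsShuffle]; rfl
    | cons a as ih => rw [epsShuffle, List.map_cons, word_cons, ih]; rfl
  | succ k ihk =>
    induction as with
    | nil =>
      rw [epsShuffle, List.map_nil, shF_succ_nil, h, ← ihk]; rfl
    | cons a as ih =>
      rw [epsShuffle, List.map_cons, shF_succ_cons, h, h, ih, ← ihk]; rfl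

/-- The sum of all chains obtained by inserting `k` copies of `ε`, for a function of chains. -/
def shG (k : ℕ) (f : Chains K[X] (KoszulAlg 𝒜) → M) (x : ZMod 2 × A) (xs : List (ZMod 2 × A)) : M :=
  shF (epsL 𝒜) k (fun L => f ((inclL 𝒜 x).2 ⊗ₜ[K[X]] word K[X] L)) (xs.map (inclL 𝒜))

theorem map_shuffle (k : ℕ) (f : Chains K[X] (KoszulAlg 𝒜) →+ M) {x : ZMod 2 × A} {xs}
    (hx : Homog 𝒜 x) (h : ∀ y ∈ xs, Homog 𝒜 y) :
    f (shuffle 𝒜 k (x.2 ⊗ₜ[K] word K xs)) = (-1 : ℤ) ^ k • shG k f x xs := by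
  rw [shuffle, ChainFormula.lift_homog _ hx h, shuffleFormula, map_zsmul, shG, shF_map]
  congr 2
  rw [← shF_epsL_word]
  exact (shF_map _ (TensorProduct.mk K[X] (KoszulAlg 𝒜) (TensorAlgebra K[X]
    (ReducedPart K[X] (KoszulAlg 𝒜))) (incl 𝒜 x.2)).toAddMonoidHom _ _ _).symm

theorem shuffle_tmul (k : ℕ) {x : ZMod 2 × A} {xs}
    (hx : Homog 𝒜 x) (h : ∀ y ∈ xs, Homog 𝒜 y) :
    shuffle 𝒜 k (x.2 ⊗ₜ[K] word K xs) = (-1 : ℤ) ^ k •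
      shF (epsL 𝒜) k (fun L => (inclL 𝒜 x).2 ⊗ₜ[K[X]] word K[X] L) (xs.map (inclL 𝒜)) :=
  map_shuffle k (AddMonoidHom.id _) hx h

section

variable {D : DGStructure 𝒜} (W : CentralCocycle D)

theorem insOddF_dKoszul_eps (p : ZMod 2) (k : ℕ) (b : KoszulAlg 𝒜) (ys) :
    insOddF (p, dKoszul W (eps 𝒜)) (shF (epsL 𝒜) k fun L => b ⊗ₜ[K[X]] word K[X] L) ys =
      -insOddF (p, incl 𝒜 W.val) (shF (epsL 𝒜) k fun L => b ⊗ₜ[K[X]] word K[X] L) ys := by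
  rw [insOddF, insOddF, ← splitSum_neg]
  refine splitSum_congr fun us vs _ => ?_
  rw [← smul_neg, shF_append_cons, shF_append_cons, ← Finset.sum_neg_distrib]
  congr 1
  refine Finset.sum_congr rfl fun i _ => ?_
  have e : ∀ U V, b ⊗ₜ[K[X]] word K[X] (U ++ (p, dKoszul W (eps 𝒜)) :: V) =
      (-1 : ℤ) • b ⊗ₜ[K[X]] word K[X] (U ++ (p, incl 𝒜 W.val) :: V) := by
    intro U V
    simp only [word_append, word_cons, letter_dKoszul_eps, neg_mul, mul_neg, TensorProduct.tmul_neg,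
      neg_smul, one_smul]
  simp only [e, shF_zsmul]
  rw [neg_one_smul]

/-- The shuffle map turns the curvature term into the differential of the inserted copies of `ε`:
each of these contributes the letter `dε = -W`, while products of `ε` with neighbouring letters
cancel. -/
theorem hochschild_shuffle (k : ℕ) (c : Chains K A) :
    (dgStructure W).hochschild (shuffle 𝒜 k c) = shuffle 𝒜 k (D.hochschild c) +
      if k = 0 then 0 else shuffle 𝒜 (k - 1) (lieElem 𝒜 W.val c) := by
  suffices h : (dgStructure W).hochschild.restrictScalars K ∘ₗ shuffle 𝒜 k =
      shuffle 𝒜 k ∘ₗ D.hochschild + if k = 0 then 0 else shuffle 𝒜 (k - 1) ∘ₗ lieElem 𝒜 W.val by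
    have := LinearMap.congr_fun h c
    split_ifs at this ⊢ <;> exact this
  refine chains_ext (𝒜 := 𝒜) fun x xs hx hxs => ?_
  have hx' := homog_inclL hx
  have hxs' : ∀ y ∈ xs.map (inclL 𝒜), Homog (gr 𝒜) y := by
    simp only [List.mem_map]
    rintro _ ⟨y, hy, rfl⟩
    exact homog_inclL (hxs y hy)
  rw [LinearMap.comp_apply, LinearMap.coe_restrictScalars,
    ← LinearMap.toAddMonoidHom_coe, map_shuffle k _ hx hxs]
  set F : ZMod 2 × KoszulAlg 𝒜 → List (ZMod 2 × KoszulAlg 𝒜) → Chains K[X] (KoszulAlg 𝒜) :=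
    fun x xs => x.2 ⊗ₜ[K[X]] word K[X] xs with hF
  have e1 : shG k (dgStructure W).hochschild.toAddMonoidHom x xs =
      shF (epsL 𝒜) k (hochF (dKoszul W) F (inclL 𝒜 x)) (xs.map (inclL 𝒜)) :=
    shF_congr _ fun L hL =>
      (dgStructure W).map_hochschild LinearMap.id hx' (homog_shuffled hxs hL)
  have hδ : ∀ y, oddL (dKoszul W) (inclL 𝒜 y) = inclL 𝒜 (oddL D.d y) := fun y => by
    simp only [oddL, inclL, dKoszul_incl]
  have hm : ∀ y z, mulL (inclL 𝒜 y) (inclL 𝒜 z) = inclL 𝒜 (mulL y z) := fun y z => by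
    simp only [mulL, inclL, incl_mul]
  have hFF : F = fun x xs => x.2 ⊗ₜ[K[X]] word K[X] xs := rfl
  rw [e1, shF_hochF rfl (eps_mul_eps 𝒜) (slotAdd_chain (R := K[X])) k (superComm_epsL hx')
    fun y hy => superComm_epsL (hxs' y hy), hochF_transport (j := inclL 𝒜) (fun _ => rfl) hδ hm,
    smul_add, LinearMap.add_apply]
  congr 1
  · have h1 : ∀ y ys, Homog 𝒜 y → (∀ z ∈ ys, Homog 𝒜 z) →
        (-1 : ℤ) ^ k • shF (epsL 𝒜) k (F (inclL 𝒜 y)) (ys.map (inclL 𝒜)) =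
          shuffle 𝒜 k (y.2 ⊗ₜ[K] word K ys) := fun y ys hy hys => (shuffle_tmul k hy hys).symm
    rw [LinearMap.comp_apply, D.map_hochschild _ hx hxs, ← hochF_congr D.d_mem h1 hx hxs]
    have h2 : ∀ (r : ℤ) (F : ZMod 2 × A → List (ZMod 2 × A) → Chains K[X] (KoszulAlg 𝒜)) x xs,
        hochF D.d (fun x xs => r • F x xs) x xs = r • hochF D.d F x xs := by
      intro r F x xs
      simp only [hochF_eq, headF_zsmul, barF_zsmul, smul_sub, smul_add, smul_comm _ r,
        lastF_zsmul r]
    exact (h2 _ _ _ _).symm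
  · cases k with
    | zero => simp [shPred, insOddF, splitSum_zero]
    | succ k =>
      rw [if_neg (Nat.succ_ne_zero k), LinearMap.comp_apply, Nat.add_sub_cancel,
        map_lieElem _ _ hx hxs 0, shPred_succ]
      have h3 := insOddF_dKoszul_eps W 0 k (inclL 𝒜 x).2 (xs.map (inclL 𝒜))
      have h4 : insOddF (oddL (dKoszul W) (epsL 𝒜)) (shF (epsL 𝒜) k (F (inclL 𝒜 x)))
          (xs.map (inclL 𝒜)) = -insOddF (0, W.val)
            (fun L => shF (epsL 𝒜) k (F (inclL 𝒜 x)) (L.map (inclL 𝒜))) xs := by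
        rw [← insOddF_transport (j := inclL 𝒜) fun _ => rfl]
        rw [show oddL (dKoszul W) (epsL 𝒜) = (0, dKoszul W (eps 𝒜)) from
          Prod.ext (zmod_add_self 1) rfl]
        exact h3
      have h5 : insOddF (0, W.val) (fun L => shuffle 𝒜 k (x.2 ⊗ₜ[K] word K L)) xs =
          insOddF (0, W.val) (fun L => (-1 : ℤ) ^ k •
            shF (epsL 𝒜) k (F (inclL 𝒜 x)) (L.map (inclL 𝒜))) xs := by
        refine splitSum_congr fun ys zs e => ?_
        subst e
        dsimp only
        rw [shuffle_tmul k hx]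
        intro y hy
        rcases List.mem_append.mp hy with h | h
        · exact hxs y (List.mem_append_left _ h)
        · rcases List.mem_cons.mp h with rfl | h
          · exact ⟨0, by simp, W.mem⟩
          · exact hxs y (List.mem_append_right _ h)
      have h6 : insOddF (0, W.val) (fun L => (-1 : ℤ) ^ k •
            shF (epsL 𝒜) k (F (inclL 𝒜 x)) (L.map (inclL 𝒜))) xs = (-1 : ℤ) ^ k •
          insOddF (0, W.val) (fun L => shF (epsL 𝒜) k (F (inclL 𝒜 x)) (L.map (inclL 𝒜))) xs := by
        simp only [insOddF, smul_comm _ ((-1 : ℤ) ^ k)]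
        exact splitSum_zsmul _ _ _
      refine (congrArg (fun c => (-1 : ℤ) ^ (k + 1) • sgn (rdeg x) • c) h4).trans ?_
      rw [h5, h6, pow_succ, smul_comm (sgn (rdeg x))]
      simp

end

end KoszulAlg

/-! ### Compatibility of shuffles with the operators on chains -/

namespace KoszulAlg

variable {K : Type u} [Field K] {A : Type v} [Ring A] [Algebra K A]
variable {𝒜 : ℤ → Submodule K A} [GradedAlgebra 𝒜]

/-- To evaluate the composition of the shuffle map with a linear map, it suffices to know the
latter on words of homogeneous elements. -/
theorem map_shuffle_word {M : Type w} [AddCommGroup M] (k : ℕ)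
    (f : Chains K[X] (KoszulAlg 𝒜) →+ M) {x : ZMod 2 × A} {xs}
    (hx : Homog 𝒜 x) (hxs : ∀ y ∈ xs, Homog 𝒜 y) {G : List (ZMod 2 × KoszulAlg 𝒜) → M}
    (h : ∀ L, (∀ y ∈ L, Homog (gr 𝒜) y) → (∀ y ∈ L, y = epsL 𝒜 ∨ y ∈ xs.map (inclL 𝒜)) →
      f ((inclL 𝒜 x).2 ⊗ₜ[K[X]] word K[X] L) = G L) :
    f (shuffle 𝒜 k (x.2 ⊗ₜ[K] word K xs)) =
      (-1 : ℤ) ^ k • shF (epsL 𝒜) k G (xs.map (inclL 𝒜)) := by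
  rw [map_shuffle k f hx hxs]
  congr 1
  exact shF_congr _ fun L hL => h L (homog_shuffled hxs hL) hL

theorem shuffle_one_tmul (k : ℕ) {xs : List (ZMod 2 × A)} (hxs : ∀ y ∈ xs, Homog 𝒜 y) :
    shuffle 𝒜 k ((1 : A) ⊗ₜ[K] word K xs) = (-1 : ℤ) ^ k • shF (epsL 𝒜) k
      (fun L => (1 : KoszulAlg 𝒜) ⊗ₜ[K[X]] word K[X] L) (xs.map (inclL 𝒜)) := by
  have h := shuffle_tmul k (homog_one (𝒜 := 𝒜)) hxs
  simp only [inclL, incl_one] at h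
  exact h

theorem homog_rot {x : ZMod 2 × A} {xs ys zs : List (ZMod 2 × A)} (hx : Homog 𝒜 x)
    (hxs : ∀ y ∈ xs, Homog 𝒜 y) (e : ys ++ zs = xs) : ∀ y ∈ zs ++ x :: ys, Homog 𝒜 y := by
  subst e
  intro y hy
  rcases List.mem_append.mp hy with h | h
  · exact hxs y (List.mem_append_right _ h)
  · exact List.forall_mem_cons.mpr ⟨hx, fun z hz => hxs z (List.mem_append_left _ hz)⟩ y h

theorem rotF_zsmul {B : Type*} [Ring B] {M : Type*}
    [AddCommGroup M] (r : ℤ) (H : List (ZMod 2 × B) → ZMod 2 × B → List (ZMod 2 × B) → M) (x xs) :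
    rotF (fun zs x ys => r • H zs x ys) x xs = r • rotF H x xs :=
  rotF_map (DistribSMul.toAddMonoidHom M r) H x xs

theorem connes_shuffle (k : ℕ) (c : Chains K A) :
    connes (gr 𝒜) (shuffle 𝒜 k c) = shuffle 𝒜 k (connes 𝒜 c) := by
  suffices h : (connes (gr 𝒜)).restrictScalars K ∘ₗ shuffle 𝒜 k = shuffle 𝒜 k ∘ₗ connes 𝒜 from
    LinearMap.congr_fun h c
  refine chains_ext (𝒜 := 𝒜) fun x xs hx hxs => ?_
  rw [LinearMap.comp_apply, LinearMap.comp_apply, map_connes _ hx hxs, LinearMap.coe_restrictScalars,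
    ← LinearMap.toAddMonoidHom_coe,
    map_shuffle_word k _ hx hxs fun L hL _ => map_connes LinearMap.id (homog_inclL hx) hL]
  simp only [LinearMap.id_apply]
  rw [shF_rotF_append (rdeg_epsL 𝒜) k (fun L => (1 : KoszulAlg 𝒜) ⊗ₜ[K[X]] word K[X] L),
    rotF_transport (j := inclL 𝒜) fun _ => rfl, ← rotF_zsmul]
  refine rotF_congr fun ys zs e => ?_
  rw [shuffle_one_tmul k (homog_rot hx hxs e), List.map_append, List.map_cons]

theorem cyclicElem_shuffle {D : DGStructure 𝒜} (W : CentralCocycle D) (k : ℕ) (c : Chains K A) :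
    cyclicElem (gr 𝒜) (dKoszul W (eps 𝒜)) (shuffle 𝒜 k c) =
      -shuffle 𝒜 k (cyclicElem 𝒜 W.val c) := by
  suffices h : (cyclicElem (gr 𝒜) (dKoszul W (eps 𝒜))).restrictScalars K ∘ₗ shuffle 𝒜 k =
      -(shuffle 𝒜 k ∘ₗ cyclicElem 𝒜 W.val) from LinearMap.congr_fun h c
  refine chains_ext (𝒜 := 𝒜) fun x xs hx hxs => ?_
  rw [LinearMap.neg_apply, LinearMap.comp_apply, LinearMap.comp_apply,
    map_cyclicElem _ _ hx hxs 0, LinearMap.coe_restrictScalars, ← LinearMap.toAddMonoidHom_coe,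
    map_shuffle_word k _ hx hxs fun L hL _ =>
      map_cyclicElem _ LinearMap.id (homog_inclL hx) hL 0]
  simp only [LinearMap.id_apply]
  rw [shF_rotF_insOddF (rdeg_epsL 𝒜) _ k (fun L => (1 : KoszulAlg 𝒜) ⊗ₜ[K[X]] word K[X] L),
    rotF_transport (j := inclL 𝒜) fun _ => rfl, ← rotF_zsmul]
  conv_rhs => rw [← neg_one_zsmul, ← rotF_zsmul]
  refine rotF_congr fun ys zs e => ?_
  have hW : ∀ L bs cs, bs ++ cs = zs → L = (bs ++ (0, W.val) :: cs) ++ x :: ys →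
      ∀ y ∈ L, Homog 𝒜 y := by
    rintro L bs cs rfl rfl y hy
    have hr := homog_rot hx hxs e
    simp only [List.mem_append, List.mem_cons] at hy hr
    rcases hy with (h | rfl | h) | h
    · exact hr y (.inl (.inl h))
    · exact ⟨0, by simp, W.mem⟩
    · exact hr y (.inl (.inr h))
    · exact hr y (.inr h)
  have e1 : insOddF (0, W.val) (fun Z => shuffle 𝒜 k ((1 : A) ⊗ₜ[K] word K (Z ++ x :: ys))) zs =
      insOddF (0, W.val) (fun Z => (-1 : ℤ) ^ k • shF (epsL 𝒜) k
        (fun L => (1 : KoszulAlg 𝒜) ⊗ₜ[K[X]] word K[X] L) ((Z ++ x :: ys).map (inclL 𝒜))) zs := by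
    refine splitSum_congr fun bs cs e' => ?_
    dsimp only
    rw [shuffle_one_tmul k (hW _ bs cs e' rfl)]
  rw [e1]
  simp only [insOddF, splitSum_list_map]
  rw [← splitSum_zsmul, ← splitSum_zsmul]
  refine splitSum_congr fun us vs _ => ?_
  rw [smul_comm, smul_comm (-1 : ℤ), smul_comm (-1 : ℤ), 
    wdeg_transport (j := inclL 𝒜) fun _ => rfl]
  congr 2
  simp only [List.append_assoc, List.cons_append, List.map_append, List.map_cons]
  rw [shF_append_cons, shF_append_cons, Finset.smul_sum]
  refine Finset.sum_congr rfl fun i _ => ?_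
  have e : ∀ U V, (1 : KoszulAlg 𝒜) ⊗ₜ[K[X]] word K[X] (U ++ (0, dKoszul W (eps 𝒜)) :: V) =
      (-1 : ℤ) • (1 : KoszulAlg 𝒜) ⊗ₜ[K[X]] word K[X] (U ++ inclL 𝒜 (0, W.val) :: V) := by
    intro U V
    simp only [inclL, word_append, word_cons, letter_dKoszul_eps, neg_mul, mul_neg,
      TensorProduct.tmul_neg, neg_smul, one_smul]
  simp only [e, shF_zsmul]

theorem iotaElem_shuffle {D : DGStructure 𝒜} (W : CentralCocycle D) (k : ℕ) (c : Chains K A) :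
    iotaElem (gr 𝒜) (dKoszul W (eps 𝒜)) (shuffle 𝒜 k c) =
      (Polynomial.X : K[X]) • shuffle 𝒜 k c - shuffle 𝒜 k (iotaElem 𝒜 W.val c) := by
  suffices h : (iotaElem (gr 𝒜) (dKoszul W (eps 𝒜))).restrictScalars K ∘ₗ shuffle 𝒜 k =
      (LinearMap.lsmul K[X] (Chains K[X] (KoszulAlg 𝒜)) Polynomial.X).restrictScalars K ∘ₗ
        shuffle 𝒜 k - shuffle 𝒜 k ∘ₗ iotaElem 𝒜 W.val from LinearMap.congr_fun h c
  refine chains_ext (𝒜 := 𝒜) fun x xs hx hxs => ?_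
  have hWx : Homog 𝒜 (x.1, W.val * x.2) := by
    obtain ⟨n, h1, h2⟩ := hx
    exact ⟨n, h1, by simpa using SetLike.GradedMul.mul_mem W.mem h2⟩
  have e : iotaElem 𝒜 W.val (x.2 ⊗ₜ[K] word K xs) = (W.val * x.2) ⊗ₜ[K] word K xs :=
    iotaElem_tmul _ _ _
  have e1 : (Polynomial.X : K[X]) • shuffle 𝒜 k (x.2 ⊗ₜ[K] word K xs) =
      (-1 : ℤ) ^ k • shF (epsL 𝒜) k (fun L => (Polynomial.X : K[X]) •
        ((inclL 𝒜 x).2 ⊗ₜ[K[X]] word K[X] L)) (xs.map (inclL 𝒜)) :=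
    map_shuffle_word k (DistribSMul.toAddMonoidHom _ (Polynomial.X : K[X])) hx hxs fun L hL _ => rfl
  have e2 := shuffle_tmul k hWx hxs
  have e3 : iotaElem (gr 𝒜) (dKoszul W (eps 𝒜)) (shuffle 𝒜 k (x.2 ⊗ₜ[K] word K xs)) =
      (-1 : ℤ) ^ k • shF (epsL 𝒜) k (fun L => ((dKoszul W (eps 𝒜)) * (inclL 𝒜 x).2) ⊗ₜ[K[X]]
        word K[X] L) (xs.map (inclL 𝒜)) :=
    map_shuffle_word k (iotaElem (gr 𝒜) (dKoszul W (eps 𝒜))).toAddMonoidHom hx hxs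
      fun L hL _ => iotaElem_tmul _ _ _
  simp only [LinearMap.sub_apply, LinearMap.comp_apply, LinearMap.coe_restrictScalars, e,
    LinearMap.lsmul_apply]
  rw [e1, e2, e3, ← smul_sub, ← shF_sub]
  congr 2
  funext L
  simp only [inclL, incl_mul, dKoszul_eps, sub_mul, smul_mul_assoc, one_mul,
    TensorProduct.sub_tmul, TensorProduct.smul_tmul']

/-- Contraction with `∂_ε` removes one copy of `ε` from a shuffle. -/
theorem iotaDer_shuffle (k : ℕ) (c : Chains K A) :
    iotaDer (gr 𝒜) (depsilon 𝒜) (depsilon_one 𝒜) (shuffle 𝒜 k c) =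
      if k = 0 then 0 else -shuffle 𝒜 (k - 1) c := by
  suffices h : (iotaDer (gr 𝒜) (depsilon 𝒜) (depsilon_one 𝒜)).restrictScalars K ∘ₗ shuffle 𝒜 k =
      if k = 0 then 0 else -shuffle 𝒜 (k - 1) by
    have := LinearMap.congr_fun h c
    split_ifs at this ⊢ <;> exact this
  refine chains_ext (𝒜 := 𝒜) fun x xs hx hxs => ?_
  rw [LinearMap.comp_apply, LinearMap.coe_restrictScalars, ← LinearMap.toAddMonoidHom_coe,
    map_shuffle_word k _ hx hxs fun L hL _ => map_iotaDer _ _ LinearMap.id (homog_inclL hx) hL]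
  rw [shF_lastF, lastF_list_map]
  have e1 : lastF (fun ys y => shF (epsL 𝒜) k (fun L => sgn (rdeg (inclL 𝒜 y) *
      ((inclL 𝒜 x).1 + wdeg L)) • LinearMap.id (R := K[X]) (M := Chains K[X] (KoszulAlg 𝒜)) ((mulL (oddL (depsilon 𝒜) (inclL 𝒜 y))
        (inclL 𝒜 x)).2 ⊗ₜ[K[X]] word K[X] L)) (ys.map (inclL 𝒜))) xs = 0 := by
    refine Eq.trans (lastF_congr (g := fun _ _ => 0) fun ys y _ => ?_) ?_
    · have : ∀ L : List (ZMod 2 × KoszulAlg 𝒜), sgn (rdeg (inclL 𝒜 y) * ((inclL 𝒜 x).1 + wdeg L)) •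
          LinearMap.id (R := K[X]) (M := Chains K[X] (KoszulAlg 𝒜)) ((mulL (oddL (depsilon 𝒜) (inclL 𝒜 y)) (inclL 𝒜 x)).2 ⊗ₜ[K[X]]
            word K[X] L) = 0 := by
        intro L
        simp [mulL, oddL, inclL, depsilon_incl]
      simp only [this, shF_zero]
    · rcases List.eq_nil_or_concat xs with rfl | ⟨ys, y, rfl⟩ <;> simp
  rw [e1, add_zero]
  cases k with
  | zero => simp [shPred]
  | succ k =>
    rw [if_neg (Nat.succ_ne_zero k), LinearMap.neg_apply, Nat.add_sub_cancel, shuffle_tmul k hx hxs,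
      shPred_succ, pow_succ, mul_neg_one, neg_smul]
    congr 3
    funext L
    simp only [rdeg_epsL, zero_mul, sgn_zero, one_smul, LinearMap.id_apply, mulL, oddL]
    simp only [epsL, depsilon_eps, one_mul]

theorem derF_eq_zero {R : Type*} [CommRing R] {B : Type*} [Ring B] [Algebra R B] {M : Type*}
    [AddCommGroup M] {φ : B →ₗ[R] B} {G : List (ZMod 2 × B) → M} {xs : List (ZMod 2 × B)}
    (h : ∀ us u vs, us ++ u :: vs = xs → G (us ++ oddL φ u :: vs) = 0) : derF φ G xs = 0 := by
  rw [derF_eq_elemSum]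
  refine Eq.trans (elemSum_congr fun ys y zs e => ?_) (elemSum_zero xs)
  rw [h ys y zs e, smul_zero]

theorem letter_depsilon_of_shuffled {y : ZMod 2 × KoszulAlg 𝒜} {xs : List (ZMod 2 × A)}
    (h : y = epsL 𝒜 ∨ y ∈ xs.map (inclL 𝒜)) : letter K[X] (depsilon 𝒜 y.2) = 0 := by
  rcases h with rfl | h
  · rw [epsL, depsilon_eps, letter_one]
  · obtain ⟨x, -, rfl⟩ := List.mem_map.mp h
    rw [inclL, depsilon_incl, map_zero]

/-- All letters of a shuffle are killed by `∂_ε`, since `∂_ε` is zero on `A` and maps `ε` to the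
unit. -/
theorem cyclicDer_shuffle (k : ℕ) (c : Chains K A) :
    cyclicDer (gr 𝒜) (depsilon 𝒜) (depsilon_one 𝒜) (shuffle 𝒜 k c) = 0 := by
  suffices h : (cyclicDer (gr 𝒜) (depsilon 𝒜) (depsilon_one 𝒜)).restrictScalars K ∘ₗ
      shuffle 𝒜 k = 0 from LinearMap.congr_fun h c
  refine chains_ext (𝒜 := 𝒜) fun x xs hx hxs => ?_
  rw [LinearMap.comp_apply, LinearMap.coe_restrictScalars, ← LinearMap.toAddMonoidHom_coe,
    map_shuffle_word (G := fun _ => 0) k _ hx hxs, shF_zero, smul_zero, LinearMap.zero_apply]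
  intro L hL hL'
  refine (map_cyclicDer _ _ LinearMap.id (homog_inclL hx) hL).trans
    (Eq.trans (rotF_congr (H' := fun _ _ _ => 0) fun ys zs e => ?_) (rotF_zero _ _))
  refine derF_eq_zero fun us y vs e' => ?_
  subst e'
  have h := letter_depsilon_of_shuffled (hL' y (by rw [← e]; simp))
  simp only [LinearMap.id_apply, word_append, word_cons, oddL, h, zero_mul, mul_zero,
    TensorProduct.tmul_zero]

theorem chainsDt_tmul {x : ZMod 2 × KoszulAlg 𝒜} {xs} (hx : Homog (gr 𝒜) x)
    (hxs : ∀ y ∈ xs, Homog (gr 𝒜) y) : chainsDt 𝒜 (x.2 ⊗ₜ[K[X]] word K[X] xs) =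
      dt 𝒜 x.2 ⊗ₜ[K[X]] word K[X] xs + elemSum (fun ys y zs =>
        x.2 ⊗ₜ[K[X]] (word K[X] ys * letter K[X] (dt 𝒜 y.2) * word K[X] zs)) xs := by
  change (((dtFormula 𝒜).lift (gr 𝒜)) (x.2 ⊗ₜ[K[X]] word K[X] xs)).der = _
  rw [ChainFormula.lift_homog _ hx hxs]
  rfl

theorem chainsDt_const {x : ZMod 2 × KoszulAlg 𝒜} {xs} (hx : Homog (gr 𝒜) x)
    (hxs : ∀ y ∈ xs, Homog (gr 𝒜) y) (hx' : dt 𝒜 x.2 = 0) (hxs' : ∀ y ∈ xs, dt 𝒜 y.2 = 0) :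
    chainsDt 𝒜 (x.2 ⊗ₜ[K[X]] word K[X] xs) = 0 := by
  rw [chainsDt_tmul hx hxs, hx', TensorProduct.zero_tmul, zero_add]
  refine Eq.trans (elemSum_congr fun ys y zs e => ?_) (elemSum_zero xs)
  rw [hxs' y (by simp [← e]), map_zero, mul_zero, zero_mul, TensorProduct.tmul_zero]

theorem chainsDt_shuffle (k : ℕ) (c : Chains K A) : chainsDt 𝒜 (shuffle 𝒜 k c) = 0 := by
  suffices h : chainsDt 𝒜 ∘ₗ shuffle 𝒜 k = 0 from LinearMap.congr_fun h c
  refine chains_ext (𝒜 := 𝒜) fun x xs hx hxs => ?_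
  rw [LinearMap.comp_apply, ← LinearMap.toAddMonoidHom_coe,
    map_shuffle_word (G := fun _ => 0) k _ hx hxs, shF_zero, smul_zero, LinearMap.zero_apply]
  intro L hL hL'
  refine chainsDt_const (homog_inclL hx) hL (dt_incl 𝒜 x.2) fun y hy => ?_
  rcases hL' y hy with rfl | h
  · exact dt_eps 𝒜
  · obtain ⟨x, -, rfl⟩ := List.mem_map.mp h
    exact dt_incl 𝒜 _

theorem hochschild_cyclicOdd_eps {D : DGStructure 𝒜} (W : CentralCocycle D)
    {x : ZMod 2 × KoszulAlg 𝒜} {xs} (hx : Homog (gr 𝒜) x) (hxs : ∀ y ∈ xs, Homog (gr 𝒜) y) :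
    (dgStructure W).hochschild (cyclicOdd (gr 𝒜) (eps 𝒜) (x.2 ⊗ₜ[K[X]] word K[X] xs)) +
        cyclicOdd (gr 𝒜) (eps 𝒜) ((dgStructure W).hochschild (x.2 ⊗ₜ[K[X]] word K[X] xs)) -
      iotaElem (gr 𝒜) (eps 𝒜) (connes (gr 𝒜) (x.2 ⊗ₜ[K[X]] word K[X] xs)) -
      connes (gr 𝒜) (iotaElem (gr 𝒜) (eps 𝒜) (x.2 ⊗ₜ[K[X]] word K[X] xs)) +
      cyclicElem (gr 𝒜) (dKoszul W (eps 𝒜)) (x.2 ⊗ₜ[K[X]] word K[X] xs) =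
      -insF (epsL 𝒜) (fun L => x.2 ⊗ₜ[K[X]] word K[X] L) xs := by
  have aux : ∀ {a b c d e f : Chains K[X] (KoszulAlg 𝒜)}, a + b = c + d - e - f →
      a + b - c - d + e = -f := fun h => by rw [h]; abel
  exact aux ((dgStructure W).hochschild_cyclicOdd (z := epsL 𝒜) homog_epsL rfl
    (fun y hy => superComm_epsL hy) hx hxs)

/-- The homotopy formula for left multiplication with `ε`, on shuffles. -/
theorem hochschild_cyclicOdd_shuffle {D : DGStructure 𝒜} (W : CentralCocycle D) (k : ℕ)
    (c : Chains K A) :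
    (dgStructure W).hochschild (cyclicOdd (gr 𝒜) (eps 𝒜) (shuffle 𝒜 k c)) +
        cyclicOdd (gr 𝒜) (eps 𝒜) ((dgStructure W).hochschild (shuffle 𝒜 k c)) =
      iotaElem (gr 𝒜) (eps 𝒜) (connes (gr 𝒜) (shuffle 𝒜 k c)) +
        connes (gr 𝒜) (iotaElem (gr 𝒜) (eps 𝒜) (shuffle 𝒜 k c)) +
        shuffle 𝒜 k (cyclicElem 𝒜 W.val c) + ((k : K) + 1) • shuffle 𝒜 (k + 1) c := by
  set Φ : Chains K[X] (KoszulAlg 𝒜) →ₗ[K[X]] Chains K[X] (KoszulAlg 𝒜) :=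
    (dgStructure W).hochschild ∘ₗ cyclicOdd (gr 𝒜) (eps 𝒜) +
      cyclicOdd (gr 𝒜) (eps 𝒜) ∘ₗ (dgStructure W).hochschild -
      iotaElem (gr 𝒜) (eps 𝒜) ∘ₗ connes (gr 𝒜) - connes (gr 𝒜) ∘ₗ iotaElem (gr 𝒜) (eps 𝒜) +
      cyclicElem (gr 𝒜) (dKoszul W (eps 𝒜)) with hΦ
  have key : Φ.restrictScalars K ∘ₗ shuffle 𝒜 k = ((k : K) + 1) • shuffle 𝒜 (k + 1) := by
    refine chains_ext (𝒜 := 𝒜) fun x xs hx hxs => ?_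
    rw [LinearMap.comp_apply, LinearMap.coe_restrictScalars]
    refine (map_shuffle_word (G := fun L => (-1 : ℤ) • insF (epsL 𝒜) (fun L =>
      (inclL 𝒜 x).2 ⊗ₜ[K[X]] word K[X] L) L) k Φ.toAddMonoidHom hx hxs
      fun L hL _ => ?_).trans ?_
    · rw [neg_one_smul]
      exact hochschild_cyclicOdd_eps W (homog_inclL hx) hL
    · rw [shF_zsmul, shF_insF, LinearMap.smul_apply, shuffle_tmul (k + 1) hx hxs, smul_smul,
        ← pow_succ, ← Nat.cast_succ, Nat.cast_smul_eq_nsmul]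
      exact smul_comm _ _ _
  have h := LinearMap.congr_fun key c
  simp only [hΦ, LinearMap.comp_apply, LinearMap.coe_restrictScalars, LinearMap.add_apply,
    LinearMap.sub_apply, LinearMap.smul_apply, cyclicElem_shuffle] at h
  rw [← h]
  generalize (dgStructure W).hochschild _ = a
  generalize cyclicOdd (gr 𝒜) (eps 𝒜) _ = b
  abel

end KoszulAlg

/-! ### Differentiation with respect to `t` and the differentials -/

section

variable {R : Type u} [CommRing R] {A : Type v} [Ring A] [Algebra R A]
variable {M : Type w} [AddCommGroup M]

theorem hochF_map {N : Type*} [AddCommGroup N] (g : M →+ N) (δ : A →ₗ[R] A)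
    (F : ZMod 2 × A → List (ZMod 2 × A) → M) (x xs) :
    hochF δ (fun x xs => g (F x xs)) x xs = g (hochF δ F x xs) := by
  simp only [hochF_eq, headF_map, barF_map, map_add, map_sub, map_zsmul, ← lastF_map]

theorem mergeF_eq_zero {G : List (ZMod 2 × A) → M} {xs : List (ZMod 2 × A)}
    (h : ∀ us y z vs, us ++ y :: z :: vs = xs → G (us ++ mulL y z :: vs) = 0) :
    mergeF G xs = 0 := by
  induction xs generalizing G with
  | nil => rfl
  | cons y ys ih =>
    rw [mergeF_cons, ih fun us y' z vs e => h (y :: us) y' z vs (by simp [e]), add_zero]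
    cases ys with
    | nil => simp
    | cons z zs => rw [headF_cons, show G (mulL y z :: zs) = 0 from h [] y z zs rfl, smul_zero]

end

namespace KoszulAlg

variable {K : Type u} [Field K] {A : Type v} [Ring A] [Algebra K A]
variable {𝒜 : ℤ → Submodule K A} [GradedAlgebra 𝒜]

theorem smul_mk_C (k : ℕ) (a b : A) :
    ((Polynomial.X : K[X]) ^ k) • (⟨Polynomial.C a, Polynomial.C b⟩ : KoszulAlg 𝒜) =
      ⟨Polynomial.monomial k a, Polynomial.monomial k b⟩ := by
  ext1 <;> simp [Polynomial.X_pow_mul_C, Polynomial.C_mul_X_pow_eq_monomial]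

/-- The algebra `A[t,ε]` is generated over `K[t]` by the elements `a` and `aε`, with `a`
a homogeneous element of `A`. -/
theorem eq_top_of_mem {P : Submodule K[X] (KoszulAlg 𝒜)} (h₁ : ∀ n, ∀ a ∈ 𝒜 n, incl 𝒜 a ∈ P)
    (h₂ : ∀ n, ∀ a ∈ 𝒜 n, incl 𝒜 a * eps 𝒜 ∈ P) : P = ⊤ := by
  rw [eq_top_iff]
  rintro x -
  have hc : ∀ p : A[X], (⟨p, 0⟩ : KoszulAlg 𝒜) ∈ P := by
    intro p
    induction p using Polynomial.induction_on' with
    | add p q hp hq =>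
      convert add_mem hp hq using 1
      ext1 <;> simp
    | monomial k a =>
      induction a using DirectSum.Decomposition.inductionOn 𝒜 with
      | zero => rw [Polynomial.monomial_zero_right]; exact zero_mem _
      | @homogeneous n a =>
        have := P.smul_mem ((Polynomial.X : K[X]) ^ k) (h₁ n a a.2)
        convert this using 1
        have := smul_mk_C (𝒜 := 𝒜) k (a : A) 0
        simp only [map_zero] at this
        exact this.symm
      | add a b ha hb =>
        convert add_mem ha hb using 1
        ext1 <;> simp
  have he : ∀ p : A[X], (⟨0, p⟩ : KoszulAlg 𝒜) ∈ P := by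
    intro p
    induction p using Polynomial.induction_on' with
    | add p q hp hq =>
      convert add_mem hp hq using 1
      ext1 <;> simp
    | monomial k a =>
      induction a using DirectSum.Decomposition.inductionOn 𝒜 with
      | zero => rw [Polynomial.monomial_zero_right]; exact zero_mem _
      | @homogeneous n a =>
        have := P.smul_mem ((Polynomial.X : K[X]) ^ k) (h₂ n a a.2)
        convert this using 1
        have := smul_mk_C (𝒜 := 𝒜) k 0 (a : A)
        simp only [map_zero] at this
        rw [← this]
        congr 1
        ext1 <;> simp
      | add a b ha hb =>
        convert add_mem ha hb using 1
        ext1 <;> simp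
  convert add_mem (hc x.c) (he x.e) using 1
  ext1 <;> simp

variable (𝒜) in
/-- A letter which is homogeneous and constant in `t`. -/
def IsConst (y : ZMod 2 × KoszulAlg 𝒜) : Prop := Homog (gr 𝒜) y ∧ dt 𝒜 y.2 = 0

theorem dt_mul (x y : KoszulAlg 𝒜) : dt 𝒜 (x * y) = dt 𝒜 x * y + x * dt 𝒜 y := by
  have h : ∀ p : A[X], Polynomial.derivative (sigma 𝒜 p) = sigma 𝒜 (Polynomial.derivative p) :=
    fun p => Polynomial.derivative_map _ _
  ext1
  · simp [dt]
  · simp only [dt, LinearMap.coe_mk, AddHom.coe_mk, mul_e, mul_c, add_e, Polynomial.derivative_add,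
      Polynomial.derivative_mul, h]
    abel

/-- The algebra `A[t,ε]` is spanned over `K[t]` by homogeneous elements which are constant
in `t`. -/
theorem span_isConst :
    Submodule.span K[X] (Prod.snd '' {y : ZMod 2 × KoszulAlg 𝒜 | IsConst 𝒜 y}) = ⊤ := by
  refine eq_top_of_mem (fun n a ha => ?_) (fun n a ha => ?_)
  · have h : IsConst 𝒜 (inclL 𝒜 ((n : ZMod 2), a)) :=
      ⟨homog_inclL ⟨n, rfl, ha⟩, dt_incl 𝒜 a⟩
    exact Submodule.subset_span ⟨_, h, rfl⟩
  · have h : IsConst 𝒜 (mulL (inclL 𝒜 ((n : ZMod 2), a)) (epsL 𝒜)) := by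
      refine ⟨(homog_inclL ⟨n, rfl, ha⟩).mulL homog_epsL, ?_⟩
      simp only [mulL, inclL, epsL, dt_mul, dt_incl, dt_eps, zero_mul, mul_zero, add_zero]
    exact Submodule.subset_span ⟨_, h, rfl⟩

theorem dtFormula_lift_val (c : Chains K[X] (KoszulAlg 𝒜)) :
    ((dtFormula 𝒜).lift (gr 𝒜) c).val = c := by
  let f : Chains K[X] (KoszulAlg 𝒜) →ₗ[K[X]] Chains K[X] (KoszulAlg 𝒜) :=
    { toFun := fun c => ((dtFormula 𝒜).lift (gr 𝒜) c).val
      map_add' := fun x y => by rw [map_add, Jet.add_val]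
      map_smul' := fun r x => by rw [map_smul, Jet.smul_val]; rfl }
  suffices h : f = LinearMap.id from LinearMap.congr_fun h c
  refine chains_ext (𝒜 := gr 𝒜) fun x xs hx hxs => ?_
  change ((dtFormula 𝒜).lift (gr 𝒜) _).val = _
  rw [ChainFormula.lift_homog _ hx hxs]
  rfl

theorem chainsDt_smul (r : K[X]) (c : Chains K[X] (KoszulAlg 𝒜)) :
    chainsDt 𝒜 (r • c) = r • chainsDt 𝒜 c + Polynomial.derivative r • c := by
  change ((dtFormula 𝒜).lift (gr 𝒜) (r • c)).der = _
  rw [map_smul, Jet.smul_der, dtFormula_lift_val]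
  rfl

/-- The commutator of `∂_t` with a `K[t]`-linear operator is `K[t]`-linear, hence can be computed
on words which are constant in `t`. -/
theorem chainsDt_comm {Φ Ψ : Chains K[X] (KoszulAlg 𝒜) →ₗ[K[X]] Chains K[X] (KoszulAlg 𝒜)}
    (h : ∀ x xs, IsConst 𝒜 x → (∀ y ∈ xs, IsConst 𝒜 y) →
      chainsDt 𝒜 (Φ (x.2 ⊗ₜ[K[X]] word K[X] xs)) = Ψ (x.2 ⊗ₜ[K[X]] word K[X] xs))
    (c : Chains K[X] (KoszulAlg 𝒜)) : chainsDt 𝒜 (Φ c) - Φ (chainsDt 𝒜 c) = Ψ c := by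
  have hc : c ∈ (⊤ : Submodule K[X] (Chains K[X] (KoszulAlg 𝒜))) := trivial
  rw [← span_chains_of_span (span_isConst (𝒜 := 𝒜))] at hc
  induction hc using Submodule.span_induction with
  | mem c hc =>
    obtain ⟨x, xs, hx, hxs, rfl⟩ := hc
    rw [h x xs hx hxs, chainsDt_const hx.1 (fun y hy => (hxs y hy).1) hx.2
      (fun y hy => (hxs y hy).2), map_zero, sub_zero]
  | zero => simp only [map_zero, sub_zero]
  | add a b _ _ ha hb => simp only [map_add, ← ha, ← hb]; abel
  | smul r a _ ha =>
    simp only [map_smul, chainsDt_smul, map_add, ← ha, smul_sub]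
    abel

/-- The derivative of a jet, as an additive map. -/
def jetDer {V : Type w} [AddCommGroup V] [Module K[X] V] : Jet V →+ V where
  toFun := Jet.der
  map_zero' := rfl
  map_add' _ _ := rfl

theorem chainsDt_eq (c : Chains K[X] (KoszulAlg 𝒜)) :
    chainsDt 𝒜 c = jetDer (K := K) ((dtFormula 𝒜).lift (gr 𝒜) c) := rfl

theorem chainsDt_connes_const {x : ZMod 2 × KoszulAlg 𝒜} {xs} (hx : IsConst 𝒜 x)
    (hxs : ∀ y ∈ xs, IsConst 𝒜 y) :
    chainsDt 𝒜 (connes (gr 𝒜) (x.2 ⊗ₜ[K[X]] word K[X] xs)) = 0 := by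
  rw [chainsDt_eq, map_connes _ hx.1 fun y hy => (hxs y hy).1, ← rotF_map]
  simp only [← chainsDt_eq]
  refine Eq.trans (rotF_congr (H' := fun _ _ _ => 0) fun ys zs e => ?_) (rotF_zero _ _)
  subst e
  have h : ∀ y ∈ zs ++ x :: ys, IsConst 𝒜 y := by
    intro y hy
    simp only [List.mem_append, List.mem_cons] at hy hxs
    rcases hy with h | rfl | h
    exacts [hxs y (.inr h), hx, hxs y (.inl h)]
  exact chainsDt_const (x := (0, 1)) homog_one (fun y hy => (h y hy).1) (dt_one 𝒜)
    fun y hy => (h y hy).2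

theorem chainsDt_connes (c : Chains K[X] (KoszulAlg 𝒜)) :
    chainsDt 𝒜 (connes (gr 𝒜) c) = connes (gr 𝒜) (chainsDt 𝒜 c) := by
  have h := chainsDt_comm (Φ := connes (gr 𝒜)) (Ψ := 0)
    (fun x xs hx hxs => chainsDt_connes_const hx hxs) c
  exact sub_eq_zero.mp h

theorem IsConst.mulL {x y : ZMod 2 × KoszulAlg 𝒜} (hx : IsConst 𝒜 x) (hy : IsConst 𝒜 y) :
    IsConst 𝒜 (mulL x y) :=
  ⟨hx.1.mulL hy.1, by simp only [NCFourier.mulL, dt_mul, hx.2, hy.2, zero_mul, mul_zero, add_zero]⟩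

theorem dt_dKoszul {D : DGStructure 𝒜} (W : CentralCocycle D) (x : KoszulAlg 𝒜) :
    dt 𝒜 (dKoszul W x) = dKoszul W (dt 𝒜 x) + depsilon 𝒜 x := by
  have h : ∀ p : A[X], Polynomial.derivative (sigma 𝒜 p) = sigma 𝒜 (Polynomial.derivative p) :=
    fun p => Polynomial.derivative_map _ _
  have h' : ∀ p : A[X], Polynomial.derivative (polyMap D.d p) =
      polyMap D.d (Polynomial.derivative p) := by
    intro p
    ext k
    rw [Polynomial.coeff_derivative, polyMap_coeff, polyMap_coeff, Polynomial.coeff_derivative,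
      ← Nat.cast_succ, ← nsmul_eq_mul', ← nsmul_eq_mul', map_nsmul]
  ext1
  · simp only [dt, LinearMap.coe_mk, AddHom.coe_mk, dKoszul_c, add_c, depsilon_c,
      Polynomial.derivative_add, Polynomial.derivative_mul, h, h', tw, Polynomial.derivative_sub,
      Polynomial.derivative_X, Polynomial.derivative_C, sub_zero, one_mul]
    abel
  · simp only [dt, LinearMap.coe_mk, AddHom.coe_mk, dKoszul_e, add_e, depsilon_e, h', add_zero]

/-- The commutator of `∂_t` with the Hochschild differential is the Lie action of `∂_ε`. -/
theorem chainsDt_hochschild {D : DGStructure 𝒜} (W : CentralCocycle D)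
    (c : Chains K[X] (KoszulAlg 𝒜)) :
    chainsDt 𝒜 ((dgStructure W).hochschild c) - (dgStructure W).hochschild (chainsDt 𝒜 c) =
      (lieDerFormula (depsilon 𝒜) (depsilon_one 𝒜)).lift (gr 𝒜) c := by
  refine chainsDt_comm (fun x xs hx hxs => ?_) c
  have hxs' : ∀ y ∈ xs, Homog (gr 𝒜) y := fun y hy => (hxs y hy).1
  rw [chainsDt_eq, (dgStructure W).map_hochschild _ hx.1 hxs', ← hochF_map]
  simp only [← chainsDt_eq]
  have h0 : ∀ x xs, IsConst 𝒜 x → (∀ y ∈ xs, IsConst 𝒜 y) →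
      chainsDt 𝒜 (x.2 ⊗ₜ[K[X]] word K[X] xs) = 0 := fun x xs hx hxs =>
    chainsDt_const hx.1 (fun y hy => (hxs y hy).1) hx.2 fun y hy => (hxs y hy).2
  change hochF (dKoszul W) (fun x xs => chainsDt 𝒜 (x.2 ⊗ₜ[K[X]] word K[X] xs)) x xs = _
  have hd : ∀ y, IsConst 𝒜 y → Homog (gr 𝒜) (oddL (dKoszul W) y) := fun y hy =>
    hy.1.oddL (dgStructure W).d_mem
  have hd' : ∀ y, IsConst 𝒜 y → dt 𝒜 (dKoszul W y.2) = depsilon 𝒜 y.2 := fun y hy => by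
    rw [dt_dKoszul, hy.2, map_zero, zero_add]
  have e1 : chainsDt 𝒜 ((oddL (dKoszul W) x).2 ⊗ₜ[K[X]] word K[X] xs) =
      depsilon 𝒜 x.2 ⊗ₜ[K[X]] word K[X] xs := by
    rw [chainsDt_tmul (hd x hx) hxs', oddL, hd' x hx]
    refine (add_eq_left).mpr ((elemSum_congr fun ys y zs e => ?_).trans (elemSum_zero xs))
    rw [(hxs y (by simp [← e])).2, map_zero, mul_zero, zero_mul, TensorProduct.tmul_zero]
  have e2 : headF (fun z zs => chainsDt 𝒜 ((mulL x z).2 ⊗ₜ[K[X]] word K[X] zs)) xs = 0 := by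
    cases xs with
    | nil => rfl
    | cons z zs =>
      exact h0 _ _ (hx.mulL (hxs z List.mem_cons_self)) fun y hy => hxs y (List.mem_cons_of_mem _ hy)
  have e3 : lastF (fun ys y => sgn (rdeg y * (x.1 + wdeg ys)) •
      chainsDt 𝒜 ((mulL y x).2 ⊗ₜ[K[X]] word K[X] ys)) xs = 0 := by
    rcases List.eq_nil_or_concat xs with rfl | ⟨ys, y, rfl⟩
    · rfl
    · simp only [List.concat_eq_append] at hxs ⊢
      rw [lastF_concat, h0 _ _ ((hxs y (by simp)).mulL hx) fun z hz => hxs z (by simp [hz]),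
        smul_zero]
  have e4 : mergeF (fun L => chainsDt 𝒜 (x.2 ⊗ₜ[K[X]] word K[X] L)) xs = 0 := by
    refine mergeF_eq_zero fun us y z vs e => ?_
    subst e
    refine h0 _ _ hx fun a ha => ?_
    simp only [List.mem_append, List.mem_cons] at ha hxs
    rcases ha with h | rfl | h
    · exact hxs a (.inl h)
    · exact (hxs y (.inr (.inl rfl))).mulL (hxs z (.inr (.inr (.inl rfl))))
    · exact hxs a (.inr (.inr (.inr h)))
  have e5 : derF (dKoszul W) (fun L => chainsDt 𝒜 (x.2 ⊗ₜ[K[X]] word K[X] L)) xs =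
      derF (depsilon 𝒜) (fun L => x.2 ⊗ₜ[K[X]] word K[X] L) xs := by
    rw [derF_eq_elemSum, derF_eq_elemSum]
    refine elemSum_congr fun us y vs e => ?_
    subst e
    simp only [List.mem_append, List.mem_cons] at hxs
    have hy := hxs y (.inr (.inl rfl))
    congr 1
    rw [chainsDt_tmul hx.1, hx.2, TensorProduct.zero_tmul, zero_add, elemSum_append]
    · have z1 : elemSum (fun ys y' zs => x.2 ⊗ₜ[K[X]] (word K[X] ys * letter K[X] (dt 𝒜 y'.2) *
          word K[X] (zs ++ oddL (dKoszul W) y :: vs))) us = 0 := by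
        refine (elemSum_congr fun ys z zs e => ?_).trans (elemSum_zero us)
        rw [(hxs z (.inl (by simp [← e]))).2, map_zero, mul_zero, zero_mul,
          TensorProduct.tmul_zero]
      have z2 : elemSum (fun ys y' zs => x.2 ⊗ₜ[K[X]] (word K[X] (us ++ oddL (dKoszul W) y :: ys) *
          letter K[X] (dt 𝒜 y'.2) * word K[X] zs)) vs = 0 := by
        refine (elemSum_congr fun ys z zs e => ?_).trans (elemSum_zero vs)
        rw [(hxs z (.inr (.inr (by simp [← e])))).2, map_zero, mul_zero, zero_mul,
          TensorProduct.tmul_zero]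
      rw [z1, z2, zero_add, add_zero, oddL, hd' y hy]
      simp only [word_append, word_cons, oddL, mul_assoc]
    · intro z hz
      simp only [List.mem_append, List.mem_cons] at hz
      rcases hz with h | rfl | h
      exacts [(hxs z (.inl h)).1, hd y hy, (hxs z (.inr (.inr h))).1]
  have e6 := map_lieDer (φ := depsilon 𝒜) (hφ := depsilon_one 𝒜) LinearMap.id hx.1 hxs'
  simp only [LinearMap.id_apply] at e6
  rw [hochF_eq, barF, e1, e2, e3, e4, e5, e6]
  simp only [smul_zero, sub_zero]

end KoszulAlg

/-! ### Degrees of the operators -/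

section Degrees

variable {R : Type u} [CommRing R] {A : Type v} [Ring A] [Algebra R A]
variable {M : Type w} [AddCommGroup M] {T : Type*} [SetLike T M] [AddSubgroupClass T M] (s : T)
variable {𝒜 : ℤ → Submodule R A}

theorem ListDeg.cast {xs : List (ZMod 2 × A)} {m n : ℤ} (h : ListDeg 𝒜 xs m) (e : m = n) :
    ListDeg 𝒜 xs n := e ▸ h

theorem ListDeg.insert {us vs : List (ZMod 2 × A)} {z n m} (h : ListDeg 𝒜 (us ++ vs) n)
    (hz : IsHom 𝒜 z m) : ListDeg 𝒜 (us ++ z :: vs) (n + m - 1) := by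
  obtain ⟨k, h1, h2⟩ := listDeg_append.mp h
  exact (h1.append (h2.cons hz)).cast (by ring)

theorem ListDeg.rotate {us vs : List (ZMod 2 × A)} {z n m} (h : ListDeg 𝒜 (us ++ vs) n)
    (hz : IsHom 𝒜 z m) : ListDeg 𝒜 (vs ++ z :: us) (n + m - 1) := by
  obtain ⟨k, h1, h2⟩ := listDeg_append.mp h
  exact ((h2.append (h1.cons hz)).cast (by ring))

theorem lastF_mem {X : Type*} {f : List X → X → M} {xs : List X}
    (h : ∀ ys y, ys ++ [y] = xs → f ys y ∈ s) : lastF f xs ∈ s := by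
  rcases List.eq_nil_or_concat xs with rfl | ⟨ys, y, rfl⟩
  · exact zero_mem s
  · rw [List.concat_eq_append, lastF_concat]
    exact h ys y (List.concat_eq_append).symm

theorem derF_mem {φ : A →ₗ[R] A} (hφ : ∀ n, ∀ a ∈ 𝒜 n, φ a ∈ 𝒜 (n + 1))
    {G : List (ZMod 2 × A) → M} {n : ℤ} (hG : ∀ L, ListDeg 𝒜 L (n + 1) → G L ∈ s) {xs}
    (h : ListDeg 𝒜 xs n) : derF φ G xs ∈ s := by
  induction xs generalizing G n with
  | nil => exact zero_mem s
  | cons y ys ih =>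
    obtain ⟨m, hy, hys⟩ := h
    rw [derF_cons]
    refine add_mem (hG _ ((hys.cons (hy.oddL hφ)).cast (by ring)))
      (zsmul_mem (ih (fun L hL => hG _ ((hL.cons hy).cast (by ring))) hys) _)

variable [GradedAlgebra 𝒜]

theorem mergeF_mem {G : List (ZMod 2 × A) → M} {n : ℤ}
    (hG : ∀ L, ListDeg 𝒜 L (n + 1) → G L ∈ s) {xs} (h : ListDeg 𝒜 xs n) : mergeF G xs ∈ s := by
  induction xs generalizing G n with
  | nil => exact zero_mem s
  | cons y ys ih =>
    obtain ⟨m, hy, hys⟩ := h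
    rw [mergeF_cons]
    refine zsmul_mem (add_mem ?_ (ih (fun L hL => hG _ ((hL.cons hy).cast (by ring))) hys)) _
    cases ys with
    | nil => exact zero_mem s
    | cons z zs =>
      obtain ⟨m', hz, hzs⟩ := hys
      exact hG _ ((hzs.cons (hy.mulL hz)).cast (by ring))

theorem DGStructure.hochschild_mem (D : DGStructure 𝒜) {n : ℤ} {c : Chains R A}
    (hc : c ∈ chainsDeg 𝒜 n) : D.hochschild c ∈ chainsDeg 𝒜 (n + 1) := by
  suffices h : chainsDeg 𝒜 n ≤ (chainsDeg 𝒜 (n + 1)).comap D.hochschild from h hc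
  refine chainsDeg_le fun x xs m k hx hxs hn => ?_
  have e := D.map_hochschild LinearMap.id ⟨m, hx⟩ hxs.homog
  simp only [LinearMap.id_apply] at e
  rw [Submodule.mem_comap, e]
  refine sub_mem ?_ (lastF_mem _ fun ys y e => zsmul_mem ?_ _)
  · have hL : ∀ L, ListDeg 𝒜 L (n - 1 + 1) →
        headF (fun x xs => x.2 ⊗ₜ[R] word R xs) L ∈ chainsDeg 𝒜 (n + 1) := by
      intro L hL
      cases L with
      | nil => exact zero_mem _
      | cons y ys =>
        obtain ⟨m', hy, hys⟩ := hL
        exact mem_chainsDeg hy hys (by ring)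
    have hx' := (hxs.cons hx).cast (show m - 1 + k = n - 1 by rw [← hn]; ring)
    exact sub_mem (derF_mem _ D.d_mem hL hx') (mergeF_mem _ hL hx')
  · subst e
    obtain ⟨k', h1, h2⟩ := listDeg_append.mp hxs
    obtain ⟨m', hy, h3⟩ := h2
    have h4 : k - k' - (m' - 1) = 0 := h3
    exact mem_chainsDeg (hy.mulL hx) h1 (by rw [← hn]; linarith)

theorem connes_mem {n : ℤ} {c : Chains R A} (hc : c ∈ chainsDeg 𝒜 n) :
    connes 𝒜 c ∈ chainsDeg 𝒜 (n - 1) := by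
  suffices h : chainsDeg 𝒜 n ≤ (chainsDeg 𝒜 (n - 1)).comap (connes 𝒜) from h hc
  refine chainsDeg_le fun x xs m k hx hxs hn => ?_
  have e := map_connes LinearMap.id ⟨m, hx⟩ hxs.homog
  simp only [LinearMap.id_apply] at e
  rw [Submodule.mem_comap, e]
  refine splitSum_mem _ fun ys zs e => zsmul_mem ?_ _
  subst e
  exact mem_chainsDeg (x := (0, 1)) isHom_one (hxs.rotate hx) (by rw [← hn]; ring)

theorem lieElem_mem {W : A} (hW : W ∈ 𝒜 0) {n : ℤ} {c : Chains R A}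
    (hc : c ∈ chainsDeg 𝒜 n) : lieElem 𝒜 W c ∈ chainsDeg 𝒜 (n - 1) := by
  suffices h : chainsDeg 𝒜 n ≤ (chainsDeg 𝒜 (n - 1)).comap (lieElem 𝒜 W) from h hc
  refine chainsDeg_le fun x xs m k hx hxs hn => ?_
  have e := map_lieElem W LinearMap.id ⟨m, hx⟩ hxs.homog 0
  simp only [LinearMap.id_apply] at e
  rw [Submodule.mem_comap, e]
  refine zsmul_mem (splitSum_mem _ fun ys zs e => zsmul_mem ?_ _) _
  subst e
  exact mem_chainsDeg hx (hxs.insert (z := (0, W)) ⟨by simp, hW⟩) (by rw [← hn]; ring)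

theorem iotaElem_mem {z : A} {p : ℤ} (hz : z ∈ 𝒜 p) {n : ℤ} {c : Chains R A}
    (hc : c ∈ chainsDeg 𝒜 n) : iotaElem 𝒜 z c ∈ chainsDeg 𝒜 (n + p) := by
  suffices h : chainsDeg 𝒜 n ≤ (chainsDeg 𝒜 (n + p)).comap (iotaElem 𝒜 z) from h hc
  refine chainsDeg_le fun x xs m k hx hxs hn => ?_
  rw [Submodule.mem_comap, iotaElem_tmul]
  exact mem_chainsDeg (x := mulL ((p : ZMod 2), z) x) (IsHom.mulL ⟨rfl, hz⟩ hx) hxs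
    (by rw [← hn]; ring)

theorem cyclicElem_mem {W : A} (hW : W ∈ 𝒜 0) {n : ℤ} {c : Chains R A}
    (hc : c ∈ chainsDeg 𝒜 n) : cyclicElem 𝒜 W c ∈ chainsDeg 𝒜 (n - 2) := by
  suffices h : chainsDeg 𝒜 n ≤ (chainsDeg 𝒜 (n - 2)).comap (cyclicElem 𝒜 W) from h hc
  refine chainsDeg_le fun x xs m k hx hxs hn => ?_
  have e := map_cyclicElem W LinearMap.id ⟨m, hx⟩ hxs.homog 0
  simp only [LinearMap.id_apply] at e
  rw [Submodule.mem_comap, e]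
  refine splitSum_mem _ fun ys zs e => zsmul_mem (splitSum_mem _ fun us vs e' => zsmul_mem ?_ _) _
  subst e e'
  have h := hxs.rotate hx
  rw [List.append_assoc] at h
  dsimp only
  rw [List.append_assoc, List.cons_append]
  exact mem_chainsDeg (x := (0, 1)) isHom_one (h.insert (z := (0, W)) (m := 0) ⟨by simp, hW⟩)
    (by rw [← hn]; ring)

theorem cyclicOdd_mem {z : ZMod 2 × A} {p : ℤ} (hz : IsHom 𝒜 z p) {n : ℤ} {c : Chains R A}
    (hc : c ∈ chainsDeg 𝒜 n) : cyclicOdd 𝒜 z.2 c ∈ chainsDeg 𝒜 (n + p - 2) := by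
  suffices h : chainsDeg 𝒜 n ≤ (chainsDeg 𝒜 (n + p - 2)).comap (cyclicOdd 𝒜 z.2) from h hc
  refine chainsDeg_le fun x xs m k hx hxs hn => ?_
  have e := map_cyclicOdd z LinearMap.id ⟨m, hx⟩ hxs.homog
  simp only [LinearMap.id_apply] at e
  rw [Submodule.mem_comap, e]
  refine splitSum_mem _ fun ys zs e => zsmul_mem (splitSum_mem _ fun us vs e' => ?_) _
  subst e e'
  have h := hxs.rotate hx
  rw [List.append_assoc] at h
  dsimp only
  rw [List.append_assoc, List.cons_append]
  exact mem_chainsDeg (x := (0, 1)) isHom_one (h.insert hz) (by rw [← hn]; ring)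

variable {φ : A →ₗ[R] A} {hφ : φ 1 = 0}

theorem iotaDer_mem (hφ' : ∀ n, ∀ a ∈ 𝒜 n, φ a ∈ 𝒜 (n + 1)) {n : ℤ} {c : Chains R A}
    (hc : c ∈ chainsDeg 𝒜 n) : iotaDer 𝒜 φ hφ c ∈ chainsDeg 𝒜 (n + 2) := by
  suffices h : chainsDeg 𝒜 n ≤ (chainsDeg 𝒜 (n + 2)).comap (iotaDer 𝒜 φ hφ) from h hc
  refine chainsDeg_le fun x xs m k hx hxs hn => ?_
  have e := map_iotaDer φ hφ LinearMap.id ⟨m, hx⟩ hxs.homog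
  simp only [LinearMap.id_apply] at e
  rw [Submodule.mem_comap, e]
  refine lastF_mem _ fun ys y e => zsmul_mem ?_ _
  subst e
  obtain ⟨k', h1, h2⟩ := listDeg_append.mp hxs
  obtain ⟨m', hy, h3⟩ := h2
  have h4 : k - k' - (m' - 1) = 0 := h3
  exact mem_chainsDeg ((hy.oddL hφ').mulL hx) h1 (by rw [← hn]; linarith)

theorem cyclicDer_mem (hφ' : ∀ n, ∀ a ∈ 𝒜 n, φ a ∈ 𝒜 (n + 1)) {n : ℤ} {c : Chains R A}
    (hc : c ∈ chainsDeg 𝒜 n) : cyclicDer 𝒜 φ hφ c ∈ chainsDeg 𝒜 n := by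
  suffices h : chainsDeg 𝒜 n ≤ (chainsDeg 𝒜 n).comap (cyclicDer 𝒜 φ hφ) from h hc
  refine chainsDeg_le fun x xs m k hx hxs hn => ?_
  have e := map_cyclicDer φ hφ LinearMap.id ⟨m, hx⟩ hxs.homog
  simp only [LinearMap.id_apply] at e
  rw [Submodule.mem_comap, e]
  refine splitSum_mem _ fun ys zs e => zsmul_mem ?_ _
  subst e
  obtain ⟨k', h1, h2⟩ := listDeg_append.mp hxs
  refine derF_mem _ hφ' (fun L hL => ?_) h2
  exact mem_chainsDeg (x := (0, 1)) isHom_one (hL.append (h1.cons hx)) (by rw [← hn]; ring)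

end Degrees

section

variable {R : Type u} [CommRing R] {A : Type v} [Ring A] [Algebra R A]
variable {M : Type w} [AddCommGroup M] {T : Type*} [SetLike T M] [AddSubgroupClass T M] (s : T)
variable {𝒜 : ℤ → Submodule R A}

theorem shF_mem {z : ZMod 2 × A} {p : ℤ} (hz : IsHom 𝒜 z p) (k : ℕ) {G : List (ZMod 2 × A) → M}
    {ys : List (ZMod 2 × A)} {n : ℤ} (hG : ∀ L, ListDeg 𝒜 L (n + k * (p - 1)) → G L ∈ s)
    (h : ListDeg 𝒜 ys n) : shF z k G ys ∈ s := by
  induction k generalizing G ys n with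
  | zero => rw [shF_zero_left]; exact hG _ (h.cast (by simp))
  | succ k ihk =>
    induction ys generalizing G n with
    | nil =>
      rw [shF_succ_nil]
      exact ihk (fun L hL => hG _ ((hL.cons hz).cast (by push_cast; ring))) h
    | cons y ys ih =>
      obtain ⟨m, hy, hys⟩ := h
      rw [shF_succ_cons]
      exact add_mem (ihk (n := n) (fun L hL => hG _ ((hL.cons hz).cast (by push_cast; ring)))
        ⟨m, hy, hys⟩) (ih (fun L hL => hG _ ((hL.cons hy).cast (by ring))) hys)

end

namespace KoszulAlg

variable {K : Type u} [Field K] {A : Type v} [Ring A] [Algebra K A]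
variable {𝒜 : ℤ → Submodule K A} [GradedAlgebra 𝒜]

theorem listDeg_map_inclL {xs : List (ZMod 2 × A)} {n : ℤ} (h : ListDeg 𝒜 xs n) :
    ListDeg (gr 𝒜) (xs.map (inclL 𝒜)) n := by
  induction xs generalizing n with
  | nil => exact h
  | cons x xs ih =>
    obtain ⟨m, hx, h⟩ := h
    exact ⟨m, isHom_inclL hx, ih h⟩

theorem shuffle_mem (k : ℕ) {n : ℤ} {c : Chains K A} (hc : c ∈ chainsDeg 𝒜 n) :
    shuffle 𝒜 k c ∈ chainsDeg (gr 𝒜) (n - 2 * k) := by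
  suffices h : chainsDeg 𝒜 n ≤
      ((chainsDeg (gr 𝒜) (n - 2 * k)).restrictScalars K).comap (shuffle 𝒜 k) from h hc
  refine chainsDeg_le fun x xs m j hx hxs hn => ?_
  rw [Submodule.mem_comap, shuffle_tmul k ⟨m, hx⟩ hxs.homog]
  refine zsmul_mem (shF_mem _ isHom_epsL k (fun L hL => ?_) (listDeg_map_inclL hxs)) _
  exact mem_chainsDeg (isHom_inclL hx) hL (by rw [← hn]; ring)

theorem dt_mem {n : ℤ} {x : KoszulAlg 𝒜} (hx : x ∈ gr 𝒜 n) : dt 𝒜 x ∈ gr 𝒜 n := by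
  intro k
  simp only [dt, LinearMap.coe_mk, AddHom.coe_mk, Polynomial.coeff_derivative]
  rw [← Nat.cast_succ, ← nsmul_eq_mul', ← nsmul_eq_mul']
  exact ⟨nsmul_mem (hx _).1 _, nsmul_mem (hx _).2 _⟩

theorem chainsDt_mem {n : ℤ} {c : Chains K[X] (KoszulAlg 𝒜)} (hc : c ∈ chainsDeg (gr 𝒜) n) :
    chainsDt 𝒜 c ∈ chainsDeg (gr 𝒜) n := by
  let S : Submodule K[X] (Chains K[X] (KoszulAlg 𝒜)) :=
    { carrier := {c | c ∈ chainsDeg (gr 𝒜) n ∧ chainsDt 𝒜 c ∈ chainsDeg (gr 𝒜) n}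
      zero_mem' := ⟨zero_mem _, by rw [map_zero]; exact zero_mem _⟩
      add_mem' := fun ha hb => ⟨add_mem ha.1 hb.1, by rw [map_add]; exact add_mem ha.2 hb.2⟩
      smul_mem' := fun r c hc => ⟨Submodule.smul_mem _ _ hc.1, by
        rw [chainsDt_smul]
        exact add_mem (Submodule.smul_mem _ _ hc.2) (Submodule.smul_mem _ _ hc.1)⟩ }
  suffices h : chainsDeg (gr 𝒜) n ≤ S from (h hc).2
  refine chainsDeg_le fun x xs m j hx hxs hn => ⟨mem_chainsDeg hx hxs hn, ?_⟩
  rw [chainsDt_tmul ⟨m, hx⟩ hxs.homog]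
  refine add_mem (mem_chainsDeg (x := (x.1, dt 𝒜 x.2)) ⟨hx.1, dt_mem hx.2⟩ hxs hn)
    (elemSum_mem _ fun ys y zs e => ?_)
  subst e
  obtain ⟨k, h1, l, hy, h2⟩ := listDeg_append.mp hxs
  have h3 := h1.append (h2.cons (x := (y.1, dt 𝒜 y.2)) ⟨hy.1, dt_mem hy.2⟩)
  have h4 := mem_chainsDeg hx h3 (k := n) (by rw [← hn]; ring)
  rwa [word_append, word_cons, ← mul_assoc] at h4

end KoszulAlg

/-! ### Operators on power series in `u` -/

section UPair

variable {K : Type u} [Field K]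
variable {V V' V'' X X' Y : Type*} [AddCommGroup V] [Module K V] [AddCommGroup V'] [Module K V']
  [AddCommGroup V''] [Module K V''] [AddCommGroup X] [Module K X] [AddCommGroup X'] [Module K X']
  [AddCommGroup Y] [Module K Y]

/-- The `u`-linear operator `a + u b` on power series in `u`. -/
def uPair (a b : V →ₗ[K] V') : (ℕ → V) →ₗ[K] (ℕ → V') := uExtend a + uMul K V' ∘ₗ uExtend b

@[simp] theorem uPair_zero (a b : V →ₗ[K] V') (f : ℕ → V) : uPair a b f 0 = a (f 0) := by
  change a (f 0) + 0 = _
  rw [add_zero]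

@[simp] theorem uPair_succ (a b : V →ₗ[K] V') (f : ℕ → V) (i : ℕ) :
    uPair a b f (i + 1) = a (f (i + 1)) + b (f i) := rfl

@[simp] theorem uMul_zero (f : ℕ → V) : uMul K V f 0 = 0 := rfl

@[simp] theorem uMul_succ (f : ℕ → V) (i : ℕ) : uMul K V f (i + 1) = f i := rfl

theorem uPair_uMul (a b : V →ₗ[K] V') (f : ℕ → V) :
    uPair a b (uMul K V f) = uMul K V' (uPair a b f) := by
  funext i
  rcases i with _ | _ | i <;> simp

theorem uExtend_eq_uPair (a : V →ₗ[K] V') : uExtend a = uPair a 0 := by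
  refine LinearMap.ext fun f => funext fun i => ?_
  cases i <;> simp [uExtend]

/-- Two products of operators which are affine in `u` agree if their coefficients of `1`, `u` and `u²`
do. -/
theorem uPair_comp_congr {a b : V' →ₗ[K] V''} {a' b' : V →ₗ[K] V'} {c e : X →ₗ[K] V''}
    {c' e' : V →ₗ[K] X} (h0 : ∀ x, a (a' x) = c (c' x))
    (h1 : ∀ x, a (b' x) + b (a' x) = c (e' x) + e (c' x)) (h2 : ∀ x, b (b' x) = e (e' x))
    (f : ℕ → V) : uPair a b (uPair a' b' f) = uPair c e (uPair c' e' f) := by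
  funext i
  rcases i with _ | _ | i
  · simp [h0]
  · simp only [zero_add, uPair_succ, uPair_zero, map_add, h0, add_assoc, h1]
  · have := h1 (f (i + 1))
    simp only [uPair_succ, map_add, h0, h2]
    rw [add_assoc, ← add_assoc (a _), this]
    abel

/-- The version of `uPair_comp_congr` with two products on each side, subtracted on the left and
added on the right, as in the formula for a chain homotopy. -/
theorem uPair_homotopy {a b : V' →ₗ[K] V''} {a' b' : V →ₗ[K] V'} {c e : X →ₗ[K] V''}
    {c' e' : V →ₗ[K] X} {p r : X' →ₗ[K] V''} {p' r' : V →ₗ[K] X'} {s t : Y →ₗ[K] V''}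
    {s' t' : V →ₗ[K] Y}
    (h0 : ∀ x, a (a' x) - c (c' x) = p (p' x) + s (s' x))
    (h1 : ∀ x, a (b' x) + b (a' x) - (c (e' x) + e (c' x)) =
      p (r' x) + r (p' x) + (s (t' x) + t (s' x)))
    (h2 : ∀ x, b (b' x) - e (e' x) = r (r' x) + t (t' x)) (f : ℕ → V) :
    uPair a b (uPair a' b' f) - uPair c e (uPair c' e' f) =
      uPair p r (uPair p' r' f) + uPair s t (uPair s' t' f) := by
  funext i
  rcases i with _ | _ | i
  · simpa using h0 (f 0)
  · have h := congrArg₂ (· + ·) (h0 (f 1)) (h1 (f 0))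
    simp only [zero_add, uPair_succ, uPair_zero, map_add, Pi.sub_apply, Pi.add_apply]
    convert h using 1 <;> abel
  · have h := congrArg₂ (· + ·) (congrArg₂ (· + ·) (h0 (f (i + 2))) (h1 (f (i + 1)))) (h2 (f i))
    simp only [uPair_succ, map_add, Pi.sub_apply, Pi.add_apply]
    convert h using 1 <;> abel

theorem uPair_mem {deg : ℤ → Submodule K V} {deg' : ℤ → Submodule K V'} {a b : V →ₗ[K] V'} {k : ℤ}
    (ha : ∀ n, ∀ x ∈ deg n, a x ∈ deg' (n + k)) (hb : ∀ n, ∀ x ∈ deg n, b x ∈ deg' (n + k - 2))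
    (n : ℤ) (f : ℕ → V) (hf : f ∈ uDeg deg n) : uPair a b f ∈ uDeg deg' (n + k) := by
  intro i
  cases i with
  | zero => simpa using ha _ _ (hf 0)
  | succ i =>
    rw [uPair_succ]
    have h1 := ha _ _ (hf (i + 1))
    have h2 := hb _ _ (hf i)
    refine add_mem ?_ ?_
    · convert h1 using 2; ring
    · convert h2 using 2; push_cast; ring

theorem uMul_mem {deg : ℤ → Submodule K V} (n : ℤ) (f : ℕ → V) (hf : f ∈ uDeg deg n) :
    uMul K V f ∈ uDeg deg (n + 2) := by
  intro i
  cases i with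
  | zero => exact zero_mem _
  | succ i =>
    rw [uMul_succ]
    convert hf i using 2
    push_cast; ring

end UPair

/-! ### The operators of the two cyclic complexes -/

section Cyclic

variable {K : Type u} [Field K] {A : Type v} [Ring A] [Algebra K A]
variable (𝒜 : ℤ → Submodule K A) [GradedAlgebra 𝒜]
variable {𝒜} {D : DGStructure 𝒜} (W : CentralCocycle D)

theorem qMul_single (k : ℕ) (c : Chains K A) : qMul (Finsupp.single k c) =
    if k = 0 then 0 else Finsupp.single (k - 1) c := by
  ext j
  change (Finsupp.single k c) (j + 1) = _
  cases k with
  | zero => simp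
  | succ k => simp [Finsupp.single_apply]

theorem qDer_single (k : ℕ) (c : Chains K A) :
    qDer (Finsupp.single k c) = Finsupp.single (k + 1) (-((k : K) + 1) • c) := by
  simp [qDer]

theorem qExtend_single (φ : Chains K A →ₗ[K] Chains K A) (k : ℕ) (c : Chains K A) :
    qExtend φ (Finsupp.single k c) = Finsupp.single k (φ c) := by
  simp [qExtend]

theorem qMul_qExtend (φ : Chains K A →ₗ[K] Chains K A) (x : PolarChains K A) :
    qMul (qExtend φ x) = qExtend φ (qMul x) := Finsupp.ext fun _ => rfl

variable (𝒜) in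
/-- The map `SH` on coefficients of powers of `u`. -/
def polarShuffle : PolarChains K A →ₗ[K] Chains K[X] (KoszulAlg 𝒜) :=
  Finsupp.lsum K fun k : ℕ => KoszulAlg.shuffle 𝒜 k

theorem polarShuffle_single (k : ℕ) (c : Chains K A) :
    polarShuffle 𝒜 (Finsupp.single k c) = KoszulAlg.shuffle 𝒜 k c := by
  simp [polarShuffle]

/-- The Hochschild differential of the curved algebra, `d + q L_W`. -/
def curvedHochschild : PolarChains K A →ₗ[K] PolarChains K A :=
  qExtend D.hochschild + qMul ∘ₗ qExtend (lieElem 𝒜 W.val)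

theorem hochschild_polarShuffle (x : PolarChains K A) :
    (KoszulAlg.dgStructure W).hochschild (polarShuffle 𝒜 x) =
      polarShuffle 𝒜 (curvedHochschild W x) := by
  induction x using Finsupp.induction_linear with
  | zero => simp only [map_zero]
  | add x y hx hy => simp only [map_add, hx, hy]
  | single k c =>
    rw [polarShuffle_single, KoszulAlg.hochschild_shuffle, curvedHochschild, LinearMap.add_apply,
      LinearMap.comp_apply, qExtend_single, qExtend_single, qMul_single, map_add,
      polarShuffle_single]
    congr 1
    split_ifs
    · rw [map_zero]
    · rw [polarShuffle_single]

theorem connes_polarShuffle (x : PolarChains K A) :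
    connes (KoszulAlg.gr 𝒜) (polarShuffle 𝒜 x) = polarShuffle 𝒜 (qExtend (connes 𝒜) x) := by
  induction x using Finsupp.induction_linear with
  | zero => simp only [map_zero]
  | add x y hx hy => simp only [map_add, hx, hy]
  | single k c => rw [polarShuffle_single, KoszulAlg.connes_shuffle, qExtend_single,
      polarShuffle_single]

theorem iotaDer_polarShuffle (x : PolarChains K A) :
    iotaDer (KoszulAlg.gr 𝒜) (KoszulAlg.depsilon 𝒜) (KoszulAlg.depsilon_one 𝒜)
      (polarShuffle 𝒜 x) = -polarShuffle 𝒜 (qMul x) := by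
  induction x using Finsupp.induction_linear with
  | zero => simp only [map_zero, neg_zero]
  | add x y hx hy => simp only [map_add, hx, hy, neg_add]
  | single k c =>
    rw [polarShuffle_single, KoszulAlg.iotaDer_shuffle, qMul_single]
    split_ifs
    · rw [map_zero, neg_zero]
    · rw [polarShuffle_single]

theorem cyclicDer_polarShuffle (x : PolarChains K A) :
    cyclicDer (KoszulAlg.gr 𝒜) (KoszulAlg.depsilon 𝒜) (KoszulAlg.depsilon_one 𝒜)
      (polarShuffle 𝒜 x) = 0 := by
  induction x using Finsupp.induction_linear with
  | zero => simp only [map_zero]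
  | add x y hx hy => simp only [map_add, hx, hy, add_zero]
  | single k c => rw [polarShuffle_single, KoszulAlg.cyclicDer_shuffle]

theorem chainsDt_polarShuffle (x : PolarChains K A) :
    KoszulAlg.chainsDt 𝒜 (polarShuffle 𝒜 x) = 0 := by
  induction x using Finsupp.induction_linear with
  | zero => simp only [map_zero]
  | add x y hx hy => simp only [map_add, hx, hy, add_zero]
  | single k c => rw [polarShuffle_single, KoszulAlg.chainsDt_shuffle]

theorem iotaElem_polarShuffle (x : PolarChains K A) :
    iotaElem (KoszulAlg.gr 𝒜) (KoszulAlg.dKoszul W (KoszulAlg.eps 𝒜)) (polarShuffle 𝒜 x) =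
      (Polynomial.X : K[X]) • polarShuffle 𝒜 x - polarShuffle 𝒜 (qExtend (iotaElem 𝒜 W.val) x) := by
  induction x using Finsupp.induction_linear with
  | zero => simp only [map_zero, smul_zero, sub_zero]
  | add x y hx hy => simp only [map_add, hx, hy, smul_add]; abel
  | single k c => rw [polarShuffle_single, KoszulAlg.iotaElem_shuffle, qExtend_single,
      polarShuffle_single]

/-- Left multiplication with `ε` on chains provides a homotopy between `t` and `W`. -/
theorem hochschild_iotaElem_polarShuffle (x : PolarChains K A) :
    (KoszulAlg.dgStructure W).hochschild
        (iotaElem (KoszulAlg.gr 𝒜) (KoszulAlg.eps 𝒜) (polarShuffle 𝒜 x)) +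
      iotaElem (KoszulAlg.gr 𝒜) (KoszulAlg.eps 𝒜) (polarShuffle 𝒜 (curvedHochschild W x)) =
      (Polynomial.X : K[X]) • polarShuffle 𝒜 x - polarShuffle 𝒜 (qExtend (iotaElem 𝒜 W.val) x) := by
  rw [← hochschild_polarShuffle, ← iotaElem_polarShuffle]
  exact (KoszulAlg.dgStructure W).hochschild_iotaElem (z := KoszulAlg.epsL 𝒜) KoszulAlg.homog_epsL
    rfl (fun y hy => KoszulAlg.superComm_epsL hy) (polarShuffle 𝒜 x)

theorem hochschild_cyclicOdd_polarShuffle (x : PolarChains K A) :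
    (KoszulAlg.dgStructure W).hochschild
        (cyclicOdd (KoszulAlg.gr 𝒜) (KoszulAlg.eps 𝒜) (polarShuffle 𝒜 x)) +
      cyclicOdd (KoszulAlg.gr 𝒜) (KoszulAlg.eps 𝒜) (polarShuffle 𝒜 (curvedHochschild W x)) =
      iotaElem (KoszulAlg.gr 𝒜) (KoszulAlg.eps 𝒜) (polarShuffle 𝒜 (qExtend (connes 𝒜) x)) +
        connes (KoszulAlg.gr 𝒜) (iotaElem (KoszulAlg.gr 𝒜) (KoszulAlg.eps 𝒜) (polarShuffle 𝒜 x)) +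
        polarShuffle 𝒜 (qExtend (cyclicElem 𝒜 W.val) x) - polarShuffle 𝒜 (qDer x) := by
  rw [← hochschild_polarShuffle, ← connes_polarShuffle]
  induction x using Finsupp.induction_linear with
  | zero => simp only [map_zero, sub_zero, add_zero]
  | add x y hx hy =>
    simp only [map_add]
    have h := congrArg₂ (· + ·) hx hy
    convert h using 1 <;> abel
  | single k c =>
    rw [polarShuffle_single, KoszulAlg.hochschild_cyclicOdd_shuffle, qExtend_single,
      polarShuffle_single, qDer_single, polarShuffle_single, map_smul, neg_smul, sub_neg_eq_add]

end Cyclic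

/-! ### Injectivity of the shuffle map -/

namespace KoszulAlg

variable {K : Type u} [Field K] {A : Type v} [Ring A] [Algebra K A]
variable (𝒜 : ℤ → Submodule K A) [GradedAlgebra 𝒜]

attribute [local instance] Polynomial.algebra

/-- A linear map `f` on `A`, extended to `A[t,ε]` by `f(ε) = 0` and by `K[t]`-linearity. -/
def coeffMap {S : Type w} [Ring S] [Algebra K S] (f : A →ₗ[K] S) :
    KoszulAlg 𝒜 →ₗ[K[X]] S[X] where
  toFun x := Polynomial.lsum (fun k => (Polynomial.monomial k).restrictScalars K ∘ₗ f) x.c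
  map_add' x y := by simp only [add_c, map_add]
  map_smul' r x := by
    have h : ∀ (p : A[X]) (k : ℕ), (Polynomial.lsum (fun k => (Polynomial.monomial k).restrictScalars
        K ∘ₗ f) p).coeff k = f (p.coeff k) := by
      intro p k
      induction p using Polynomial.induction_on' with
      | add p q hp hq => simp only [map_add, Polynomial.coeff_add, hp, hq]
      | monomial n a =>
        simp only [Polynomial.lsum_apply, LinearMap.comp_apply, LinearMap.coe_restrictScalars]
        rw [Polynomial.sum_monomial_index]
        · simp only [Polynomial.coeff_monomial]; split_ifs <;> simp
        · simp
    ext k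
    rw [Algebra.smul_def (R := K[X]) (A := S[X]), Polynomial.algebraMap_def, RingHom.id_apply, Polynomial.coe_mapRingHom,
      poly_smul_c, h, Polynomial.coeff_mul, Polynomial.coeff_mul, map_sum]
    simp only [Polynomial.coeff_map, ← Algebra.smul_def, map_smul, h]

theorem coeffMap_incl {S : Type w} [Ring S] [Algebra K S] (f : A →ₗ[K] S) (a : A) :
    coeffMap 𝒜 f (incl 𝒜 a) = Polynomial.C (f a) := by
  simp [coeffMap, Polynomial.lsum_apply]

theorem coeffMap_eps {S : Type w} [Ring S] [Algebra K S] (f : A →ₗ[K] S) :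
    coeffMap 𝒜 f (eps 𝒜) = 0 := by
  simp [coeffMap, Polynomial.lsum_apply]

/-- The algebra map from words in `A[t,ε]` to words in `A` (with coefficients in `K[t]`) which
discards all words containing `ε`. -/
def constWord : TensorAlgebra K[X] (ReducedPart K[X] (KoszulAlg 𝒜)) →ₐ[K[X]] (Chains K A)[X] :=
  TensorAlgebra.lift K[X] (descend (coeffMap 𝒜
    ((TensorProduct.mk K A (TensorAlgebra K (ReducedPart K A)) 1) ∘ₗ letter K)) (by
      rw [← incl_one, coeffMap_incl, LinearMap.comp_apply, letter_one, map_zero, map_zero]))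

theorem constWord_letter (x : KoszulAlg 𝒜) : constWord 𝒜 (letter K[X] x) = coeffMap 𝒜
    ((TensorProduct.mk K A (TensorAlgebra K (ReducedPart K A)) 1) ∘ₗ letter K) x := by
  simp [constWord, letter, descend]

theorem constWord_epsShuffle (k : ℕ) (as : List (ZMod 2 × A)) :
    constWord 𝒜 (epsShuffle 𝒜 k as) =
      if k = 0 then Polynomial.C ((1 : A) ⊗ₜ[K] word K as) else 0 := by
  induction as generalizing k with
  | nil => 
    cases k with
    | zero => simp [epsShuffle, word_nil, ← Algebra.TensorProduct.one_def]
    | succ k => simp [epsShuffle, constWord_letter, coeffMap_eps]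
  | cons a as ih =>
    cases k with
    | zero =>
      simp only [epsShuffle, map_mul, constWord_letter, coeffMap_incl, ih, if_true, word_cons,
        ← Polynomial.C_mul, LinearMap.comp_apply, TensorProduct.mk_apply,
        Algebra.TensorProduct.tmul_mul_tmul, mul_one]
    | succ k =>
      simp only [epsShuffle, map_add, map_mul, constWord_letter, coeffMap_eps, zero_mul, ih,
        Nat.succ_ne_zero, if_false, mul_zero, add_zero]

/-- The map from chains of `A[t,ε]` to chains of `A` (with coefficients in `K[t]`) which discards
all words containing `ε`. It is a left inverse to the inclusion. -/
def constPart : Chains K[X] (KoszulAlg 𝒜) →ₗ[K[X]] (Chains K A)[X] :=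
  TensorProduct.lift ((LinearMap.mul K[X] (Chains K A)[X]).compl₁₂
    (coeffMap 𝒜 ((TensorProduct.mk K A (TensorAlgebra K (ReducedPart K A))).flip 1))
    (constWord 𝒜).toLinearMap)

theorem constPart_shuffle (k : ℕ) (c : Chains K A) :
    constPart 𝒜 (shuffle 𝒜 k c) = if k = 0 then Polynomial.C c else 0 := by
  suffices h : (constPart 𝒜).restrictScalars K ∘ₗ shuffle 𝒜 k =
      if k = 0 then (Polynomial.monomial 0).restrictScalars K else 0 by
    have := LinearMap.congr_fun h c
    split_ifs at this ⊢ <;> exact this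
  refine chains_ext (𝒜 := 𝒜) fun x xs hx hxs => ?_
  rw [LinearMap.comp_apply, shuffle, ChainFormula.lift_homog _ hx hxs, shuffleFormula, map_zsmul,
    LinearMap.coe_restrictScalars, constPart, TensorProduct.lift.tmul, LinearMap.compl₁₂_apply,
    coeffMap_incl, AlgHom.toLinearMap_apply, constWord_epsShuffle, LinearMap.mul_apply']
  split_ifs with hk
  · subst hk
    rw [pow_zero, one_smul, ← Polynomial.C_mul, LinearMap.flip_apply, TensorProduct.mk_apply,
      Algebra.TensorProduct.tmul_mul_tmul, mul_one, one_mul]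
    rfl
  · rw [mul_zero, smul_zero, LinearMap.zero_apply]

theorem constPart_polarShuffle (x : PolarChains K A) :
    constPart 𝒜 (polarShuffle 𝒜 x) = Polynomial.C (x 0) := by
  induction x using Finsupp.induction_linear with
  | zero => simp only [map_zero, Finsupp.zero_apply]
  | add x y hx hy => simp only [map_add, hx, hy, Finsupp.add_apply]
  | single k c =>
    rw [polarShuffle_single, constPart_shuffle]
    split_ifs with h
    · rw [h, Finsupp.single_eq_same]
    · rw [Finsupp.single_eq_of_ne (Ne.symm h), map_zero]

variable (K A) in
/-- The zero of the space of polar chains, as the zero of an additive group. As a local instance,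
it helps the unifier with polynomials whose coefficients are polar chains. -/
@[reducible]
def polarZero : Zero (PolarChains K A) := (inferInstance : AddCommGroup (PolarChains K A)).toZero

attribute [local instance] polarZero

/-- The `K[t]`-linear extension of the shuffle map. A polynomial in `t` is represented by the
function which to `m` associates the coefficient of `t^m`. -/
def polyShuffle : (ℕ →₀ PolarChains K A) →ₗ[K] Chains K[X] (KoszulAlg 𝒜) :=
  Finsupp.lsum K fun m : ℕ => (LinearMap.lsmul K[X] (Chains K[X] (KoszulAlg 𝒜))
    (Polynomial.X ^ m)).restrictScalars K ∘ₗ polarShuffle 𝒜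

theorem polyShuffle_single (m : ℕ) (x : PolarChains K A) :
    polyShuffle 𝒜 (Finsupp.single m x) = (Polynomial.X ^ m : K[X]) • polarShuffle 𝒜 x := by
  simp [polyShuffle]

theorem coeff_constPart_polyShuffle (p : ℕ →₀ PolarChains K A) (m : ℕ) :
    (constPart 𝒜 (polyShuffle 𝒜 p)).coeff m = p m 0 := by
  induction p using Finsupp.induction_linear with
  | zero => simp only [map_zero, Finsupp.zero_apply, Polynomial.coeff_zero]
  | add x y hx hy => simp only [map_add, hx, hy, Finsupp.add_apply, Polynomial.coeff_add]
  | single k x =>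
    rw [polyShuffle_single, map_smul, constPart_polarShuffle,
      Algebra.smul_def (R := K[X]) (A := (Chains K A)[X]), Polynomial.algebraMap_def, map_pow,
      Polynomial.coe_mapRingHom, Polynomial.map_X, Polynomial.X_pow_mul_C,
      Polynomial.coeff_C_mul_X_pow, Finsupp.single_apply]
    simp only [eq_comm (a := k)]
    split_ifs <;> rfl

theorem iotaDer_polyShuffle (p : ℕ →₀ PolarChains K A) :
    iotaDer (gr 𝒜) (depsilon 𝒜) (depsilon_one 𝒜) (polyShuffle 𝒜 p) =
      -polyShuffle 𝒜 (Finsupp.mapRange.linearMap qMul p) := by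
  induction p using Finsupp.induction_linear with
  | zero => simp only [map_zero, neg_zero]
  | add x y hx hy => simp only [map_add, hx, hy, neg_add]
  | single k x =>
    rw [polyShuffle_single, map_smul, iotaDer_polarShuffle, Finsupp.mapRange.linearMap_apply,
      Finsupp.mapRange_single, polyShuffle_single, smul_neg]

/-- The shuffle map is injective, since contraction with `∂_ε` reduces the number of copies
of `ε` one by one. -/
theorem polyShuffle_injective : Function.Injective (polyShuffle 𝒜) := by
  rw [injective_iff_map_eq_zero]
  have key : ∀ (k : ℕ) (p : ℕ →₀ PolarChains K A), polyShuffle 𝒜 p = 0 → ∀ m, p m k = 0 := by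
    intro k
    induction k with
    | zero =>
      intro p hp m
      rw [← coeff_constPart_polyShuffle 𝒜 p m, hp, map_zero, Polynomial.coeff_zero]
    | succ k ih =>
      intro p hp m
      have h := iotaDer_polyShuffle 𝒜 p
      rw [hp, map_zero, eq_comm, neg_eq_zero] at h
      exact ih _ h m
  intro p hp
  ext m k
  exact key k p hp m

theorem polarShuffle_injective : Function.Injective (polarShuffle 𝒜) := by
  rw [injective_iff_map_eq_zero]
  intro x hx
  have h := polyShuffle_single 𝒜 0 x
  rw [hx, smul_zero] at h
  exact Finsupp.single_eq_zero.mp ((injective_iff_map_eq_zero _).mp (polyShuffle_injective 𝒜) _ h)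

end KoszulAlg

/-! ### The cyclic complexes and the chain maps between them -/

section Cyclic

variable {K : Type u} [Field K] {A : Type v} [Ring A] [Algebra K A]
variable {𝒜 : ℤ → Submodule K A} [GradedAlgebra 𝒜]
variable {D : DGStructure 𝒜} (W : CentralCocycle D)

theorem cyclicComplexQ_d (f : CyclicQ K A) : (cyclicComplexQ W).d f =
    uPair (curvedHochschild W) (-qExtend (connes 𝒜)) f := by
  funext i
  cases i with
  | zero => rw [uPair_zero]; exact sub_zero _
  | succ i => rw [uPair_succ, LinearMap.neg_apply, ← sub_eq_add_neg]; rfl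

theorem cyclicComplexT_d (f : CyclicT 𝒜) : (cyclicComplexT W).d f =
    uPair ((KoszulAlg.dgStructure W).hochschild.restrictScalars K)
      (-(connes (KoszulAlg.gr 𝒜)).restrictScalars K) f := by
  funext i
  cases i with
  | zero => rw [uPair_zero]; exact sub_zero _
  | succ i => rw [uPair_succ, LinearMap.neg_apply, ← sub_eq_add_neg]; rfl

theorem connectionQ_eq (f : CyclicQ K A) : connectionQ W f =
    uPair (qExtend (iotaElem 𝒜 W.val)) (qDer - qExtend (cyclicElem 𝒜 W.val)) f := by
  funext i
  cases i with
  | zero =>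
    rw [uPair_zero]
    exact (zero_add _).trans (sub_zero _)
  | succ i =>
    rw [uPair_succ, LinearMap.sub_apply]
    refine Eq.trans (b := qDer (f i) + (qExtend (iotaElem 𝒜 W.val) (f (i + 1)) -
      qExtend (cyclicElem 𝒜 W.val) (f i))) rfl ?_
    abel

theorem connectionT_eq (f : CyclicT 𝒜) : connectionT 𝒜 f =
    uPair ((iotaDer (KoszulAlg.gr 𝒜) (KoszulAlg.depsilon 𝒜)
        (KoszulAlg.depsilon_one 𝒜)).restrictScalars K)
      (KoszulAlg.chainsDt 𝒜 - (cyclicDer (KoszulAlg.gr 𝒜) (KoszulAlg.depsilon 𝒜)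
        (KoszulAlg.depsilon_one 𝒜)).restrictScalars K) f := by
  funext i
  cases i with
  | zero =>
    rw [uPair_zero]
    exact (zero_add _).trans (sub_zero _)
  | succ i =>
    rw [uPair_succ, LinearMap.sub_apply]
    refine Eq.trans (b := KoszulAlg.chainsDt 𝒜 (f i) + (iotaDer (KoszulAlg.gr 𝒜)
      (KoszulAlg.depsilon 𝒜) (KoszulAlg.depsilon_one 𝒜) (f (i + 1)) - cyclicDer (KoszulAlg.gr 𝒜)
      (KoszulAlg.depsilon 𝒜) (KoszulAlg.depsilon_one 𝒜) (f i))) rfl ?_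
    rw [LinearMap.coe_restrictScalars, LinearMap.coe_restrictScalars]
    abel

theorem shiftedShuffle_eq (f : CyclicQ K A) :
    shiftedShuffle 𝒜 f = uPair (polarShuffle 𝒜) 0 f := by
  rw [← uExtend_eq_uPair]; rfl

theorem mulQ_eq (f : CyclicQ K A) : mulQ K A f = uPair qMul 0 f := by
  rw [← uExtend_eq_uPair]; rfl

theorem mulT_eq (f : CyclicT 𝒜) : mulT 𝒜 f = uPair ((LinearMap.lsmul K[X]
    (Chains K[X] (KoszulAlg 𝒜)) Polynomial.X).restrictScalars K) 0 f := by
  rw [← uExtend_eq_uPair]; rfl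

theorem shiftedShuffle_injective : Function.Injective (shiftedShuffle (K := K) 𝒜) :=
  fun _ _ h => funext fun i => KoszulAlg.polarShuffle_injective 𝒜 (congrFun h i)

/-! #### Degrees -/

theorem curvedHochschild_mem (n : ℤ) (x : PolarChains K A) (hx : x ∈ polarDeg 𝒜 n) :
    curvedHochschild W x ∈ polarDeg 𝒜 (n + 1) := by
  intro k
  have h1 := D.hochschild_mem (hx k)
  have h2 := lieElem_mem W.mem (hx (k + 1))
  rw [show n + 2 * ((k : ℤ) + 1) + 1 = n + 1 + 2 * ((k : ℤ) + 1) by ring] at h1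
  rw [show n + 2 * (((k + 1 : ℕ) : ℤ) + 1) - 1 = n + 1 + 2 * ((k : ℤ) + 1) by push_cast; ring] at h2
  exact add_mem h1 h2

theorem polarShuffle_mem (n : ℤ) (x : PolarChains K A) (hx : x ∈ polarDeg 𝒜 n) :
    polarShuffle 𝒜 x ∈ chainsDeg (KoszulAlg.gr 𝒜) (n + 2) := by
  rw [polarShuffle, Finsupp.lsum_apply]
  refine sum_mem fun k _ => ?_
  convert KoszulAlg.shuffle_mem k (hx k) using 2
  ring

theorem qExtend_mem {φ : Chains K A →ₗ[K] Chains K A} {j : ℤ}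
    (hφ : ∀ n, ∀ c ∈ chainsDeg 𝒜 n, φ c ∈ chainsDeg 𝒜 (n + j)) (n : ℤ) (x : PolarChains K A)
    (hx : x ∈ polarDeg 𝒜 n) : qExtend φ x ∈ polarDeg 𝒜 (n + j) := by
  intro k
  have h := hφ _ _ (hx k)
  rwa [show n + 2 * ((k : ℤ) + 1) + j = n + j + 2 * ((k : ℤ) + 1) by ring] at h

theorem qMul_mem (n : ℤ) (x : PolarChains K A) (hx : x ∈ polarDeg 𝒜 n) :
    qMul x ∈ polarDeg 𝒜 (n + 2) := by
  intro k
  have h := hx (k + 1)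
  rwa [show n + 2 * (((k + 1 : ℕ) : ℤ) + 1) = n + 2 + 2 * ((k : ℤ) + 1) by push_cast; ring] at h

theorem qDer_apply (x : PolarChains K A) (k : ℕ) :
    qDer x k = if k = 0 then 0 else -(k : K) • x (k - 1) := by
  induction x using Finsupp.induction_linear with
  | zero => simp
  | add x y hx hy =>
    rw [map_add, Finsupp.add_apply, hx, hy, Finsupp.add_apply]
    split_ifs <;> simp
  | single j c =>
    rw [qDer_single]
    cases k with
    | zero => simp [Finsupp.single_apply]
    | succ k =>
      simp only [Finsupp.single_apply, Nat.succ_ne_zero, if_false, Nat.add_sub_cancel,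
        Nat.succ_inj]
      split_ifs with h
      · rw [h, Nat.cast_succ]
      · rw [smul_zero]

theorem qDer_mem (n : ℤ) (x : PolarChains K A) (hx : x ∈ polarDeg 𝒜 n) :
    qDer x ∈ polarDeg 𝒜 (n - 2) := by
  intro k
  rw [qDer_apply]
  split_ifs with hk
  · exact zero_mem _
  · refine Submodule.smul_mem _ _ ?_
    convert hx (k - 1) using 2
    have : ((k - 1 : ℕ) : ℤ) = k - 1 := by have := Nat.pos_of_ne_zero hk; omega
    rw [this]; ring

/-! #### The complexes -/

theorem isComplex_cyclicComplexT : (cyclicComplexT W).IsComplex where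
  u_mem n x hx := uMul_mem n x hx
  d_mem n x hx := by
    rw [cyclicComplexT_d]
    exact uPair_mem (deg := fun n => (chainsDeg (KoszulAlg.gr 𝒜) n).restrictScalars K)
      (deg' := fun n => (chainsDeg (KoszulAlg.gr 𝒜) n).restrictScalars K)
      (fun n x hx => (KoszulAlg.dgStructure W).hochschild_mem hx)
      (fun n x hx => by
        have h := connes_mem (𝒜 := KoszulAlg.gr 𝒜) hx
        rw [show n - 1 = n + 1 - 2 by ring] at h
        exact neg_mem (S := Submodule K[X] _) h) n x hx
  d_u x := by
    rw [cyclicComplexT_d, cyclicComplexT_d]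
    exact uPair_uMul _ _ _
  d_d x := by
    rw [cyclicComplexT_d, cyclicComplexT_d]
    refine (uPair_comp_congr (c := 0) (e := 0) (c' := (0 : _ →ₗ[K] Chains K[X] (KoszulAlg 𝒜)))
      (e' := 0) (fun x => ?_) (fun x => ?_) (fun x => ?_) x).trans ?_
    · exact (KoszulAlg.dgStructure W).hochschild_hochschild x
    · simp [(KoszulAlg.dgStructure W).hochschild_connes]
    · simp [connes_connes]
    · funext i
      cases i <;> simp

theorem isChainMap_mulT : (cyclicComplexT W).IsChainMap (cyclicComplexT W) 0 (mulT 𝒜) where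
  map_mem n x hx := by
    rw [add_zero]
    intro i
    exact Submodule.smul_mem (chainsDeg (KoszulAlg.gr 𝒜) _) Polynomial.X (hx i)
  map_u x := by
    rw [mulT_eq, mulT_eq]
    exact uPair_uMul _ _ _
  map_d x := by
    rw [mulT_eq, mulT_eq, cyclicComplexT_d, cyclicComplexT_d]
    refine uPair_comp_congr (fun x => ?_) (fun x => ?_) (fun x => ?_) x
    all_goals simp

theorem isChainMap_connectionT :
    (cyclicComplexT W).IsChainMap (cyclicComplexT W) 2 (connectionT 𝒜) where
  map_mem n x hx := by
    rw [connectionT_eq]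
    exact uPair_mem (deg := fun n => (chainsDeg (KoszulAlg.gr 𝒜) n).restrictScalars K)
      (deg' := fun n => (chainsDeg (KoszulAlg.gr 𝒜) n).restrictScalars K)
      (fun n x hx => iotaDer_mem KoszulAlg.depsilon_mem hx)
      (fun n x hx => by
        rw [add_sub_cancel_right]
        exact sub_mem (KoszulAlg.chainsDt_mem hx) (cyclicDer_mem KoszulAlg.depsilon_mem hx)) n x hx
  map_u x := by
    rw [connectionT_eq, connectionT_eq]
    exact uPair_uMul _ _ _
  map_d x := by
    rw [connectionT_eq, connectionT_eq, cyclicComplexT_d, cyclicComplexT_d]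
    have hd : ∀ a, KoszulAlg.depsilon 𝒜 ((KoszulAlg.dgStructure W).d a) +
        (KoszulAlg.dgStructure W).d (KoszulAlg.depsilon 𝒜 a) = 0 := KoszulAlg.depsilon_dKoszul W
    refine uPair_comp_congr (fun x => ?_) (fun x => ?_) (fun x => ?_) x
    · exact ((KoszulAlg.dgStructure W).hochschild_iotaDer _ _ KoszulAlg.depsilon_mem
        KoszulAlg.depsilon_leibniz hd x).symm
    · have h1 := (KoszulAlg.dgStructure W).hochschild_cyclicDer (KoszulAlg.depsilon 𝒜)
        (KoszulAlg.depsilon_one 𝒜) KoszulAlg.depsilon_mem KoszulAlg.depsilon_leibniz hd x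
      rw [← KoszulAlg.chainsDt_hochschild W x] at h1
      simp only [LinearMap.neg_apply, LinearMap.sub_apply, LinearMap.coe_restrictScalars, map_neg,
        map_sub]
      rw [← sub_eq_zero] at h1 ⊢
      rw [← h1]
      abel
    · simp only [LinearMap.neg_apply, LinearMap.sub_apply, LinearMap.coe_restrictScalars, map_neg,
        map_sub, KoszulAlg.chainsDt_connes, connes_cyclicDer, cyclicDer_connes, sub_zero, neg_zero]

theorem map_d_shiftedShuffle (x : CyclicQ K A) :
    shiftedShuffle 𝒜 ((cyclicComplexQ W).d x) = (cyclicComplexT W).d (shiftedShuffle 𝒜 x) := by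
  rw [shiftedShuffle_eq, shiftedShuffle_eq, cyclicComplexQ_d, cyclicComplexT_d]
  refine uPair_comp_congr (fun x => ?_) (fun x => ?_) (fun x => ?_) x
  · exact (hochschild_polarShuffle W x).symm
  · simp only [LinearMap.neg_apply, LinearMap.zero_apply, map_neg, map_zero, add_zero, zero_add,
      LinearMap.coe_restrictScalars, connes_polarShuffle]
  · simp

theorem isComplex_cyclicComplexQ : (cyclicComplexQ W).IsComplex where
  u_mem n x hx := uMul_mem n x hx
  d_mem n x hx := by
    rw [cyclicComplexQ_d]
    refine uPair_mem (curvedHochschild_mem W) (fun n x hx => ?_) n x hx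
    rw [show n + 1 - 2 = n + -1 by ring]
    exact neg_mem (qExtend_mem (fun n c hc => connes_mem hc) n x hx)
  d_u x := by
    rw [cyclicComplexQ_d, cyclicComplexQ_d]
    exact uPair_uMul _ _ _
  d_d x := by
    -- The shuffle map is injective, and the identity holds on the side of `A[t,ε]`.
    refine shiftedShuffle_injective (𝒜 := 𝒜) ?_
    rw [map_d_shiftedShuffle, map_d_shiftedShuffle, (isComplex_cyclicComplexT W).d_d, map_zero]

theorem isChainMap_mulQ : (cyclicComplexQ W).IsChainMap (cyclicComplexQ W) 2 (mulQ K A) where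
  map_mem n x hx := by
    rw [mulQ_eq]
    refine uPair_mem qMul_mem (fun n x hx => ?_) n x hx
    exact zero_mem _
  map_u x := by
    rw [mulQ_eq, mulQ_eq]
    exact uPair_uMul _ _ _
  map_d x := by
    rw [mulQ_eq, mulQ_eq, cyclicComplexQ_d, cyclicComplexQ_d]
    refine uPair_comp_congr (fun x => ?_) (fun x => ?_) (fun x => ?_) x
    all_goals simp [curvedHochschild, qMul_qExtend]

theorem isChainMap_shiftedShuffle :
    (cyclicComplexQ W).IsChainMap (cyclicComplexT W) 2 (shiftedShuffle 𝒜) where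
  map_mem n x hx := by
    rw [shiftedShuffle_eq]
    refine uPair_mem (deg' := fun n => (chainsDeg (KoszulAlg.gr 𝒜) n).restrictScalars K)
      polarShuffle_mem (fun n x hx => ?_) n x hx
    exact zero_mem _
  map_u x := by
    rw [shiftedShuffle_eq, shiftedShuffle_eq]
    exact uPair_uMul _ _ _
  map_d x := map_d_shiftedShuffle W x

theorem shiftedShuffle_mulQ : shiftedShuffle 𝒜 ∘ₗ mulQ K A =
    -(connectionT 𝒜) ∘ₗ shiftedShuffle 𝒜 := by
  refine LinearMap.ext fun x => ?_
  have e : shiftedShuffle 𝒜 (mulQ K A x) + connectionT 𝒜 (shiftedShuffle 𝒜 x) = 0 := by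
    rw [shiftedShuffle_eq, shiftedShuffle_eq, mulQ_eq, connectionT_eq]
    funext i
    rcases i with _ | _ | i
    · simp [iotaDer_polarShuffle]
    · simp [iotaDer_polarShuffle, chainsDt_polarShuffle, cyclicDer_polarShuffle]
    · simp [iotaDer_polarShuffle, chainsDt_polarShuffle, cyclicDer_polarShuffle]
  exact eq_neg_of_add_eq_zero_left e

variable (𝒜) in
/-- The chain homotopy which relates `t` and `∇_{u∂_q}`: the shuffle map, followed by the analogue
`ι_ε + u J_ε` for the odd element `ε` of the operator `ι_W - u J_W`. -/
def shuffleHomotopy : CyclicQ K A →ₗ[K] CyclicT 𝒜 :=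
  uPair ((iotaElem (KoszulAlg.gr 𝒜) (KoszulAlg.eps 𝒜)).restrictScalars K ∘ₗ polarShuffle 𝒜)
    ((cyclicOdd (KoszulAlg.gr 𝒜) (KoszulAlg.eps 𝒜)).restrictScalars K ∘ₗ polarShuffle 𝒜)

/-- The homotopy formula. On the coefficients of `1`, `u` and `u²` it amounts to the Cartan formula
for `ε`, combined with the compatibility of the shuffle map with the Hochschild differential, with
`ι_W` and with the cyclic insertion of `W`. -/
theorem shuffleHomotopy_spec (x : CyclicQ K A) :
    mulT 𝒜 (shiftedShuffle 𝒜 x) - shiftedShuffle 𝒜 (connectionQ W x) =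
      (cyclicComplexT W).d (shuffleHomotopy 𝒜 x) +
        shuffleHomotopy 𝒜 ((cyclicComplexQ W).d x) := by
  rw [mulT_eq, shiftedShuffle_eq, shiftedShuffle_eq, connectionQ_eq, cyclicComplexT_d,
    cyclicComplexQ_d, shuffleHomotopy]
  refine uPair_homotopy (fun x => ?_) (fun x => ?_) (fun x => ?_) x
  · exact (hochschild_iotaElem_polarShuffle W x).symm
  · have h := hochschild_cyclicOdd_polarShuffle W x
    simp only [LinearMap.neg_apply, LinearMap.sub_apply, LinearMap.zero_apply, map_neg, map_sub,
      map_zero, add_zero, zero_add, LinearMap.comp_apply, LinearMap.coe_restrictScalars]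
    rw [← sub_eq_zero] at h ⊢
    refine Eq.trans ?_ ((congrArg Neg.neg h).trans neg_zero)
    abel
  · simp only [LinearMap.neg_apply, LinearMap.zero_apply, map_neg, map_zero, sub_zero,
      LinearMap.comp_apply, LinearMap.coe_restrictScalars, connes_cyclicOdd, ← connes_polarShuffle,
      cyclicOdd_connes, neg_zero, add_zero]

theorem homotopic_mulT_connectionQ : (cyclicComplexQ W).Homotopic (cyclicComplexT W) 2
    (mulT 𝒜 ∘ₗ shiftedShuffle 𝒜) (shiftedShuffle 𝒜 ∘ₗ connectionQ W) := by
  refine ⟨shuffleHomotopy 𝒜, fun n x hx => ?_, fun x => uPair_uMul _ _ _, shuffleHomotopy_spec W⟩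
  rw [show n + 2 - 1 = n + 1 by ring]
  refine uPair_mem (deg' := fun n => (chainsDeg (KoszulAlg.gr 𝒜) n).restrictScalars K)
    (fun n x hx => ?_) (fun n x hx => ?_) n x hx
  · have h := iotaElem_mem KoszulAlg.isHom_epsL.2 (polarShuffle_mem n x hx)
    rwa [show n + 2 + -1 = n + 1 by ring] at h
  · have h := cyclicOdd_mem KoszulAlg.isHom_epsL (polarShuffle_mem n x hx)
    rwa [show n + 2 + -1 - 2 = n + 1 - 2 by ring] at h

theorem isChainMap_connectionQ :
    (cyclicComplexQ W).IsChainMap (cyclicComplexQ W) 0 (connectionQ W) where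
  map_mem n x hx := by
    rw [connectionQ_eq]
    refine uPair_mem (fun n x hx => ?_) (fun n x hx => ?_) n x hx
    · exact qExtend_mem (fun n c hc => iotaElem_mem W.mem hc) n x hx
    · rw [add_zero]
      exact sub_mem (qDer_mem n x hx) (qExtend_mem (fun n c hc => cyclicElem_mem W.mem hc) n x hx)
  map_u x := by
    rw [connectionQ_eq, connectionQ_eq]
    exact uPair_uMul _ _ _
  map_d x := by
    -- By the homotopy formula, `SH ∘ ∇` differs from the chain map `t ∘ SH` by `dh + hd`, hence is
    -- a chain map itself; as `SH` is injective, so is `∇`.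
    refine shiftedShuffle_injective (𝒜 := 𝒜) ?_
    have h1 := congrArg (cyclicComplexT W).d (shuffleHomotopy_spec W x)
    have h2 := shuffleHomotopy_spec W ((cyclicComplexQ W).d x)
    rw [map_sub, map_add, (isComplex_cyclicComplexT W).d_d, zero_add,
      ← map_d_shiftedShuffle, ← (isChainMap_mulT W).map_d, ← map_d_shiftedShuffle] at h1
    rw [(isComplex_cyclicComplexQ W).d_d, map_zero, add_zero, ← h1] at h2
    exact sub_right_injective h2

end Cyclic

/-! ### A contracting operator on the chains of `A[t,ε]` -/

theorem sgn_smul_tmul_sgn_smul {R : Type*} [CommRing R] {M N : Type*} [AddCommGroup M] [Module R M]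
    [AddCommGroup N] [Module R N] (p q : ZMod 2) (x : M) (y : N) :
    (sgn p • x) ⊗ₜ[R] (sgn q • y) = sgn (p + q) • (x ⊗ₜ[R] y) := by
  rw [sgn_add]
  rcases sgn_eq_or p with h | h <;> rcases sgn_eq_or q with h' | h' <;>
    simp [h, h', TensorProduct.neg_tmul, TensorProduct.tmul_neg]

/-- The transition matrix of an automaton with three states, which reads elements of `X` and
writes elements of `T`: `p` and `q` describe what happens in states `0` and `1`, with `q` leading to
state `1`; `s` is the passage from these states to state `2`, in which `w` is used. -/
def automatonMatrix {R : Type*} [CommRing R] {X : Type*} [AddCommGroup X] [Module R X] {T : Type*}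
    [AddCommGroup T] [Module R T] (p q s w : X →ₗ[R] T) : X →ₗ[R] Matrix (Fin 3) (Fin 3) T where
  toFun x := !![p x, q x, s x; 0, q x, s x; 0, 0, w x]
  map_add' x y := by
    ext i j
    fin_cases i <;> fin_cases j <;> simp
  map_smul' r x := by
    ext i j
    fin_cases i <;> fin_cases j <;> simp

namespace KoszulAlg

variable {K : Type u} [Field K] {A : Type v} [Ring A] [Algebra K A]
variable {𝒜 : ℤ → Submodule K A} [GradedAlgebra 𝒜]

variable (𝒜) in
/-- There is a linear functional on `A` which equals `1` on the unit, and which vanishes in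
all degrees different from `0`. -/
theorem exists_unitFunctional [Nontrivial A] :
    ∃ l : A →ₗ[K] K, l 1 = 1 ∧ ∀ n : ℤ, n ≠ 0 → ∀ a ∈ 𝒜 n, l a = 0 := by
  obtain ⟨f, hf⟩ := not_forall.mp (mt (Module.forall_dual_apply_eq_zero_iff K (1 : A)).mp
    one_ne_zero)
  have hp := DirectSum.decompose_of_mem_same 𝒜 (SetLike.GradedOne.one_mem (A := 𝒜))
  refine ⟨(f 1)⁻¹ • (f ∘ₗ GradedAlgebra.proj 𝒜 0), ?_, fun n hn a ha => ?_⟩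
  · rw [LinearMap.smul_apply, LinearMap.comp_apply, smul_eq_mul,
      show GradedAlgebra.proj 𝒜 0 1 = 1 from hp, inv_mul_cancel₀ hf]
  · rw [LinearMap.smul_apply, LinearMap.comp_apply,
      show GradedAlgebra.proj 𝒜 0 a = 0 from DirectSum.decompose_of_mem_ne 𝒜 ha hn, map_zero,
      smul_zero]

variable (𝒜) in
/-- The map which replaces a letter `bε` by `l(b)ε`, for a linear functional `l` on `A`, and which
is zero on `A[t]`. -/
def unitE (l : A →ₗ[K] K) : KoszulAlg 𝒜 →ₗ[K[X]] KoszulAlg 𝒜 where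
  toFun x := ⟨0, polyMap (LinearMap.toSpanSingleton K A 1 ∘ₗ l) x.e⟩
  map_add' x y := by ext1 <;> simp
  map_smul' r x := by ext1 <;> simp [polyMap_map_mul]

variable (𝒜) in
/-- The projection to `A[t]`, with a sign `(-1)^{|a|}`. -/
def sgnC : KoszulAlg 𝒜 →ₗ[K[X]] KoszulAlg 𝒜 where
  toFun x := ⟨sigma 𝒜 x.c, 0⟩
  map_add' x y := by ext1 <;> simp
  map_smul' r x := by ext1 <;> simp [sigma_map]

variable (𝒜) in
/-- The element `bε` with its parity, for `b ∈ A`. -/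
def mixL (y : ZMod 2 × A) : ZMod 2 × KoszulAlg 𝒜 := mulL (inclL 𝒜 y) (epsL 𝒜)

variable (𝒜) in
/-- The matrix describing how the automaton which underlies `contractWord` acts on a letter. -/
def contractMatrix (l : A →ₗ[K] K) : KoszulAlg 𝒜 →ₗ[K[X]]
    Matrix (Fin 3) (Fin 3) (TensorAlgebra K[X] (ReducedPart K[X] (KoszulAlg 𝒜))) :=
  automatonMatrix (letter K[X] ∘ₗ unitE 𝒜 l) (-(letter K[X] ∘ₗ sgnC 𝒜))
    (-(LinearMap.mulRight K[X] (letter K[X] (eps 𝒜)) ∘ₗ letter K[X] ∘ₗ depsilon 𝒜)) (letter K[X])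

theorem contractMatrix_one (l : A →ₗ[K] K) : contractMatrix 𝒜 l 1 = 0 := by
  have h1 : unitE 𝒜 l 1 = 0 := by ext1 <;> simp [unitE]
  have h2 : sgnC 𝒜 1 = 1 := by ext1 <;> simp [sgnC]
  ext i j
  fin_cases i <;> fin_cases j <;> simp [contractMatrix, automatonMatrix, h1, h2, letter_one, depsilon_one]

variable (𝒜) in
/-- The action of words on the three states of the automaton. -/
def contractHom (l : A →ₗ[K] K) : TensorAlgebra K[X] (ReducedPart K[X] (KoszulAlg 𝒜)) →ₐ[K[X]]
    Matrix (Fin 3) (Fin 3) (TensorAlgebra K[X] (ReducedPart K[X] (KoszulAlg 𝒜))) :=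
  TensorAlgebra.lift K[X] (descend (contractMatrix 𝒜 l) (contractMatrix_one l))

theorem contractHom_letter (l : A →ₗ[K] K) (x : KoszulAlg 𝒜) :
    contractHom 𝒜 l (letter K[X] x) = contractMatrix 𝒜 l x := by
  simp [contractHom, letter, descend]

theorem contractHom_two (l : A →ₗ[K] K)
    (w : TensorAlgebra K[X] (ReducedPart K[X] (KoszulAlg 𝒜))) :
    contractHom 𝒜 l w 2 0 = 0 ∧ contractHom 𝒜 l w 2 1 = 0 ∧ contractHom 𝒜 l w 2 2 = w := by
  induction w using TensorAlgebra.induction with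
  | algebraMap r => simp [Matrix.algebraMap_matrix_apply]
  | ι m =>
    obtain ⟨x, rfl⟩ := Submodule.Quotient.mk_surjective _ m
    have h := contractHom_letter l x
    rw [show TensorAlgebra.ι K[X] (Submodule.Quotient.mk x) = letter K[X] x from rfl, h]
    simp [contractMatrix, automatonMatrix]
  | mul a b ha hb => simp [Matrix.mul_apply, Fin.sum_univ_three, ha, hb]
  | add a b ha hb => simp [ha, hb]

variable (𝒜) in
/-- The operator on words which reads a word from left to right as an automaton. It starts in
state `0`, in which it reads letters `ε`. On reading letters in `A`, it moves to state `1` and then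
stays there. On reading, in one of these states, a letter `bε`, it replaces that letter by the two
letters `b` and `ε`, and accepts, leaving the rest of the word as it is. -/
def contractWord (l : A →ₗ[K] K) (i : Fin 3) :
    TensorAlgebra K[X] (ReducedPart K[X] (KoszulAlg 𝒜)) →ₗ[K[X]]
      TensorAlgebra K[X] (ReducedPart K[X] (KoszulAlg 𝒜)) where
  toFun w := contractHom 𝒜 l w i 2
  map_add' x y := by simp
  map_smul' r x := by simp

theorem contractWord_one (l : A →ₗ[K] K) {i : Fin 3} (hi : i ≠ 2) : contractWord 𝒜 l i 1 = 0 := by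
  change contractHom 𝒜 l 1 i 2 = 0
  rw [map_one, Matrix.one_apply_ne hi]

theorem contractWord_zero_letter (l : A →ₗ[K] K) (x : KoszulAlg 𝒜) (w) :
    contractWord 𝒜 l 0 (letter K[X] x * w) = letter K[X] (unitE 𝒜 l x) * contractWord 𝒜 l 0 w -
      letter K[X] (sgnC 𝒜 x) * contractWord 𝒜 l 1 w -
      letter K[X] (depsilon 𝒜 x) * (letter K[X] (eps 𝒜) * w) := by
  change contractHom 𝒜 l _ 0 2 = _
  rw [map_mul, contractHom_letter, Matrix.mul_apply, Fin.sum_univ_three, (contractHom_two l w).2.2]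
  simp [contractMatrix, automatonMatrix, contractWord, sub_eq_add_neg]
  exact congrArg₂ (· + ·) (congrArg₂ (· + ·) rfl
      (neg_mul (letter K[X] (sgnC 𝒜 x)) (contractHom 𝒜 l w 1 2)))
    ((neg_mul (letter K[X] (depsilon 𝒜 x) * letter K[X] (eps 𝒜)) w).trans
      (congrArg Neg.neg (mul_assoc _ _ w)))

theorem contractWord_one_letter (l : A →ₗ[K] K) (x : KoszulAlg 𝒜) (w) :
    contractWord 𝒜 l 1 (letter K[X] x * w) = -(letter K[X] (sgnC 𝒜 x) * contractWord 𝒜 l 1 w) -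
      letter K[X] (depsilon 𝒜 x) * (letter K[X] (eps 𝒜) * w) := by
  change contractHom 𝒜 l _ 1 2 = _
  rw [map_mul, contractHom_letter, Matrix.mul_apply, Fin.sum_univ_three, (contractHom_two l w).2.2]
  simp [contractMatrix, automatonMatrix, contractWord, sub_eq_add_neg]
  exact congrArg₂ (· + ·) (neg_mul (letter K[X] (sgnC 𝒜 x)) (contractHom 𝒜 l w 1 2))
    ((neg_mul (letter K[X] (depsilon 𝒜 x) * letter K[X] (eps 𝒜)) w).trans
      (congrArg Neg.neg (mul_assoc _ _ w)))

theorem sgnC_eps : sgnC 𝒜 (eps 𝒜) = 0 := by ext1 <;> simp [sgnC]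

theorem sgnC_incl (a : A) : sgnC 𝒜 (incl 𝒜 a) = incl 𝒜 (gradeInv 𝒜 a) := by
  ext1 <;> simp [sgnC, sigma]

theorem unitE_incl (l : A →ₗ[K] K) (a : A) : unitE 𝒜 l (incl 𝒜 a) = 0 := by
  ext1 <;> simp [unitE]

theorem unitE_mix (l : A →ₗ[K] K) (a : A) :
    unitE 𝒜 l (incl 𝒜 a * eps 𝒜) = incl 𝒜 (l a • 1) * eps 𝒜 := by
  ext k
  · simp [unitE]
  · simp only [unitE, LinearMap.coe_mk, AddHom.coe_mk, polyMap_coeff]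
    simp only [mul_e, incl_e, incl_c, eps_e, eps_c, mul_one, map_zero, mul_zero, add_zero,
      Polynomial.coeff_C, LinearMap.comp_apply, LinearMap.toSpanSingleton_apply]
    split_ifs <;> simp

theorem unitE_eps {l : A →ₗ[K] K} (hl : l 1 = 1) : unitE 𝒜 l (eps 𝒜) = eps 𝒜 := by
  have h := unitE_mix (𝒜 := 𝒜) l 1
  rwa [hl, one_smul, incl_one, one_mul] at h

theorem contractWord_one_eps (l : A →ₗ[K] K) (w) :
    contractWord 𝒜 l 1 (letter K[X] (eps 𝒜) * w) = 0 := by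
  rw [contractWord_one_letter, sgnC_eps, depsilon_eps, letter_one, map_zero, zero_mul, zero_mul,
    neg_zero, sub_zero]

theorem contractWord_zero_eps {l : A →ₗ[K] K} (hl : l 1 = 1) (w) :
    contractWord 𝒜 l 0 (letter K[X] (eps 𝒜) * w) = letter K[X] (eps 𝒜) * contractWord 𝒜 l 0 w := by
  rw [contractWord_zero_letter, sgnC_eps, depsilon_eps, letter_one, map_zero, zero_mul, zero_mul,
    unitE_eps hl, sub_zero, sub_zero]

theorem contractWord_one_incl (l : A →ₗ[K] K) (a : A) (w) :
    contractWord 𝒜 l 1 (letter K[X] (incl 𝒜 a) * w) =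
      -(letter K[X] (incl 𝒜 (gradeInv 𝒜 a)) * contractWord 𝒜 l 1 w) := by
  rw [contractWord_one_letter, sgnC_incl, depsilon_incl, map_zero, zero_mul, sub_zero]

theorem contractWord_zero_incl (l : A →ₗ[K] K) (a : A) (w) :
    contractWord 𝒜 l 0 (letter K[X] (incl 𝒜 a) * w) =
      -(letter K[X] (incl 𝒜 (gradeInv 𝒜 a)) * contractWord 𝒜 l 1 w) := by
  rw [contractWord_zero_letter, sgnC_incl, depsilon_incl, unitE_incl, map_zero, zero_mul, zero_mul,
    sub_zero, zero_sub]

theorem depsilon_mix (a : A) : depsilon 𝒜 (incl 𝒜 a * eps 𝒜) = incl 𝒜 (gradeInv 𝒜 a) := by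
  ext1 <;> simp [depsilon, sigma]

theorem sgnC_mix (a : A) : sgnC 𝒜 (incl 𝒜 a * eps 𝒜) = 0 := by ext1 <;> simp [sgnC]

theorem contractWord_one_mix (l : A →ₗ[K] K) (a : A) (w) :
    contractWord 𝒜 l 1 (letter K[X] (incl 𝒜 a * eps 𝒜) * w) =
      -(letter K[X] (incl 𝒜 (gradeInv 𝒜 a)) * (letter K[X] (eps 𝒜) * w)) := by
  rw [contractWord_one_letter, sgnC_mix, depsilon_mix, map_zero, zero_mul, neg_zero, zero_sub]

theorem contractWord_zero_mix {l : A →ₗ[K] K} {a : A} (ha : l a = 0) (w) :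
    contractWord 𝒜 l 0 (letter K[X] (incl 𝒜 a * eps 𝒜) * w) =
      -(letter K[X] (incl 𝒜 (gradeInv 𝒜 a)) * (letter K[X] (eps 𝒜) * w)) := by
  rw [contractWord_zero_letter, sgnC_mix, depsilon_mix, unitE_mix, ha, zero_smul, map_zero,
    zero_mul, map_zero, zero_mul, zero_mul, sub_zero, zero_sub]

theorem gradeInv_of_homog {R : Type*} [CommRing R] {A : Type*} [Ring A] [Algebra R A]
    {𝒜 : ℤ → Submodule R A} [GradedAlgebra 𝒜] {y : ZMod 2 × A} (hy : Homog 𝒜 y) :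
    gradeInv 𝒜 y.2 = sgn y.1 • y.2 := by
  obtain ⟨n, h1, h2⟩ := hy
  rw [gradeInv_of_mem 𝒜 h2, h1]

theorem neg_letter_incl_gradeInv {y : ZMod 2 × A} (hy : Homog 𝒜 y) (w) :
    -(letter K[X] (incl 𝒜 (gradeInv 𝒜 y.2)) * w) =
      sgn (rdeg y) • (letter K[X] (incl 𝒜 y.2) * w) := by
  rw [gradeInv_of_homog hy, map_zsmul, map_zsmul, smul_mul_assoc, sgn_fst, neg_smul, neg_neg]

/-- The action of `contractWord` on a word in which `bε` is preceded only by letters in `A`. -/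
theorem contractWord_pure_mix {l : A →ₗ[K] K} {b : ZMod 2 × A} (hb : Homog 𝒜 b) (hlb : l b.2 = 0)
    {P : List (ZMod 2 × A)} (hP : ∀ y ∈ P, Homog 𝒜 y) (w) {i : Fin 3} (hi : i ≠ 2) :
    contractWord 𝒜 l i (word K[X] (P.map (inclL 𝒜)) * (letter K[X] (mixL 𝒜 b).2 * w)) =
      sgn (wdeg P + rdeg b) • (word K[X] (P.map (inclL 𝒜)) *
        (letter K[X] (inclL 𝒜 b).2 * (letter K[X] (eps 𝒜) * w))) := by
  have hi' : i = 0 ∨ i = 1 := by revert i; decide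
  induction P generalizing i with
  | nil =>
    rw [List.map_nil, word_nil, one_mul, one_mul, wdeg_nil, zero_add]
    rcases hi' with rfl | rfl
    · exact (contractWord_zero_mix hlb w).trans (neg_letter_incl_gradeInv hb _)
    · exact (contractWord_one_mix l b.2 w).trans (neg_letter_incl_gradeInv hb _)
  | cons p P ih =>
    have h := ih (fun y hy => hP y (List.mem_cons_of_mem _ hy)) (i := 1) (by decide) (Or.inr rfl)
    have h2 : contractWord 𝒜 l i (word K[X] ((p :: P).map (inclL 𝒜)) *
        (letter K[X] (mixL 𝒜 b).2 * w)) = -(letter K[X] (incl 𝒜 (gradeInv 𝒜 p.2)) *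
          contractWord 𝒜 l 1 (word K[X] (P.map (inclL 𝒜)) * (letter K[X] (mixL 𝒜 b).2 * w))) := by
      rw [List.map_cons, word_cons, mul_assoc]
      rcases hi' with rfl | rfl
      · exact contractWord_zero_incl l p.2 _
      · exact contractWord_one_incl l p.2 _
    rw [h2, neg_letter_incl_gradeInv (hP p List.mem_cons_self), h, mul_smul_comm, smul_smul,
      ← sgn_add, wdeg_cons, List.map_cons, word_cons, mul_assoc, add_assoc]
    rfl

theorem word_replicate_eps (j : ℕ) (w : TensorAlgebra K[X] (ReducedPart K[X] (KoszulAlg 𝒜))) :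
    word K[X] (List.replicate (j + 1) (epsL 𝒜)) * w =
      letter K[X] (eps 𝒜) * (word K[X] (List.replicate j (epsL 𝒜)) * w) := by
  rw [List.replicate_succ, word_cons, mul_assoc]; rfl

theorem contractWord_zero_replicate {l : A →ₗ[K] K} (hl : l 1 = 1) (j : ℕ) (w) :
    contractWord 𝒜 l 0 (word K[X] (List.replicate j (epsL 𝒜)) * w) =
      word K[X] (List.replicate j (epsL 𝒜)) * contractWord 𝒜 l 0 w := by
  induction j with
  | zero => rw [List.replicate_zero, word_nil, one_mul, one_mul]
  | succ j ih => rw [word_replicate_eps, contractWord_zero_eps hl, ih, ← word_replicate_eps]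

variable (𝒜) in
/-- The operator on chains which acts by `contractWord` (and a sign, since it has degree `-1`). -/
def contract (l : A →ₗ[K] K) : Chains K[X] (KoszulAlg 𝒜) →ₗ[K[X]] Chains K[X] (KoszulAlg 𝒜) :=
  TensorProduct.map (gradeInv (gr 𝒜)).toLinearMap (contractWord 𝒜 l 0)

theorem contract_tmul (l : A →ₗ[K] K) (a : KoszulAlg 𝒜) (w) :
    contract 𝒜 l (a ⊗ₜ[K[X]] w) = gradeInv (gr 𝒜) a ⊗ₜ[K[X]] contractWord 𝒜 l 0 w :=
  TensorProduct.map_tmul _ _ _ _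

theorem wdeg_replicate_eps (j : ℕ) : wdeg (List.replicate j (epsL 𝒜)) = 0 := by
  induction j with
  | zero => rfl
  | succ j ih => rw [List.replicate_succ, wdeg_cons, ih, rdeg_epsL, add_zero]

/-- The operator splits the first letter `bε` of a suitable word into `b` and `ε`. -/
theorem contract_mix {l : A →ₗ[K] K} (hl : l 1 = 1) {x : ZMod 2 × KoszulAlg 𝒜}
    (hx : Homog (gr 𝒜) x) (j : ℕ) {P : List (ZMod 2 × A)} (hP : ∀ y ∈ P, Homog 𝒜 y)
    {b : ZMod 2 × A} (hb : Homog 𝒜 b) (hlb : l b.2 = 0) (ws : List (ZMod 2 × KoszulAlg 𝒜)) :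
    contract 𝒜 l (x.2 ⊗ₜ[K[X]] word K[X]
        ((List.replicate j (epsL 𝒜) ++ P.map (inclL 𝒜)) ++ mixL 𝒜 b :: ws)) =
      sgn (x.1 + (wdeg (List.replicate j (epsL 𝒜) ++ P.map (inclL 𝒜)) + rdeg b)) •
        (x.2 ⊗ₜ[K[X]] word K[X] ((List.replicate j (epsL 𝒜) ++ P.map (inclL 𝒜)) ++
          inclL 𝒜 b :: epsL 𝒜 :: ws)) := by
  rw [contract_tmul, gradeInv_of_homog hx, word_append, word_append, word_cons, mul_assoc,
    contractWord_zero_replicate hl, contractWord_pure_mix hb hlb hP _ (by decide),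
    wdeg_append, wdeg_replicate_eps, zero_add,
    wdeg_transport (j := inclL 𝒜) fun _ => rfl, word_append, word_append, word_cons, word_cons,
    mul_assoc, mul_smul_comm, sgn_smul_tmul_sgn_smul]
  rfl

end KoszulAlg

/-! ### Reduction of words by the contracting operator -/

theorem append_cons_eq_replicate_append {X : Type*} {e y : X} {j : ℕ} {ys zs Q : List X}
    (h : ys ++ y :: zs = List.replicate j e ++ Q) :
    (∃ i k, j = i + (k + 1) ∧ ys = List.replicate i e ∧ y = e ∧ zs = List.replicate k e ++ Q) ∨
      ∃ Q', Q = Q' ++ y :: zs ∧ ys = List.replicate j e ++ Q' := by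
  induction j generalizing ys with
  | zero => exact Or.inr ⟨ys, h.symm, rfl⟩
  | succ j ih =>
    rw [List.replicate_succ, List.cons_append] at h
    cases ys with
    | nil =>
      rw [List.nil_append] at h
      obtain ⟨rfl, h⟩ := List.cons.inj h
      exact Or.inl ⟨0, j, by omega, rfl, rfl, h⟩
    | cons z ys =>
      rw [List.cons_append] at h
      obtain ⟨rfl, h⟩ := List.cons.inj h
      rcases ih h with ⟨i, k, hj, hys, hy, hzs⟩ | ⟨Q', hQ, hys⟩
      · exact Or.inl ⟨i + 1, k, by omega, by rw [hys]; rfl, hy, hzs⟩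
      · exact Or.inr ⟨Q', hQ, by rw [hys]; rfl⟩

namespace KoszulAlg

/-- A letter of one of three types: `ε`, an element of `A`, or an element `bε` with `b ∈ A`. -/
inductive Cell (A : Type v) : Type v
  | eps : Cell A
  | pur (y : ZMod 2 × A) : Cell A
  | mix (y : ZMod 2 × A) : Cell A

variable {K : Type u} [Field K] {A : Type v} [Ring A] [Algebra K A]
variable {𝒜 : ℤ → Submodule K A} [GradedAlgebra 𝒜]

namespace Cell

variable (𝒜) in
/-- The element of `A[t,ε]` given by a letter. -/
def val : Cell A → ZMod 2 × KoszulAlg 𝒜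
  | eps => epsL 𝒜
  | pur y => inclL 𝒜 y
  | mix y => mixL 𝒜 y

variable (𝒜) in
/-- The condition that the element of `A` which appears in a letter be homogeneous. -/
def IsHomog : Cell A → Prop
  | eps => True
  | pur y => Homog 𝒜 y
  | mix y => Homog 𝒜 y

/-- The number of copies of `ε`. -/
def weight : Cell A → ℕ
  | eps => 1
  | pur _ => 0
  | mix _ => 1

/-- The number of elements of `A`. -/
def size : Cell A → ℕ
  | eps => 0
  | pur _ => 1
  | mix _ => 1

theorem IsHomog.homog {c : Cell A} (hc : c.IsHomog 𝒜) : Homog (gr 𝒜) (c.val 𝒜) := by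
  cases c with
  | eps => exact homog_epsL
  | pur y => exact homog_inclL hc
  | mix y => exact (homog_inclL hc).mulL homog_epsL

end Cell

/-- The total number of copies of `ε` in a word. -/
def listWeight (cs : List (Cell A)) : ℕ := (cs.map Cell.weight).sum

/-- The total number of elements of `A` in a word. -/
def listSize (cs : List (Cell A)) : ℕ := (cs.map Cell.size).sum

theorem eps_mul_incl {y : ZMod 2 × A} (hy : Homog 𝒜 y) :
    eps 𝒜 * incl 𝒜 y.2 = sgn y.1 • (incl 𝒜 y.2 * eps 𝒜) :=
  superComm_epsL (𝒜 := 𝒜) (y := inclL 𝒜 y) (homog_inclL hy)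

theorem letter_mix (l : A →ₗ[K] K) (a : A) : letter K[X] (incl 𝒜 a * eps 𝒜) =
    (Polynomial.C (l a) : K[X]) • letter K[X] (eps 𝒜) +
      letter K[X] (incl 𝒜 (a - l a • 1) * eps 𝒜) := by
  rw [← map_smul, ← map_add]
  congr 1
  rw [map_sub, sub_mul, incl_smul, incl_one, smul_mul_assoc, one_mul, add_sub_cancel]

theorem sub_unit_homog {l : A →ₗ[K] K} (h0 : ∀ n : ℤ, n ≠ 0 → ∀ a ∈ 𝒜 n, l a = 0)
    {y : ZMod 2 × A} (hy : Homog 𝒜 y) : Homog 𝒜 (y.1, y.2 - l y.2 • 1) := by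
  obtain ⟨n, h1, h2⟩ := hy
  refine ⟨n, h1, ?_⟩
  by_cases hn : n = 0
  · subst hn
    exact sub_mem h2 (Submodule.smul_mem _ _ SetLike.GradedOne.one_mem)
  · rw [h0 n hn _ h2, zero_smul, sub_zero]
    exact h2

variable {D : DGStructure 𝒜} (W : CentralCocycle D) (l : A →ₗ[K] K)

/-- A submodule of the chains which contains the words with letters in `A`, preceded by copies of
`ε`; those in which such a sequence of letters (not all equal to `ε`) is followed by another `ε`;
and all chains which agree with the boundary of their contraction modulo the submodule. -/
structure IsAbsorbing (M : Submodule K[X] (Chains K[X] (KoszulAlg 𝒜))) : Prop where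
  split_mem : ∀ a j (P : List (ZMod 2 × A)) w, P ≠ [] → a ⊗ₜ[K[X]]
    (word K[X] (List.replicate j (epsL 𝒜) ++ P.map (inclL 𝒜)) * (letter K[X] (eps 𝒜) * w)) ∈ M
  pure_mem : ∀ (x : ZMod 2 × KoszulAlg 𝒜) j (P : List (ZMod 2 × A)), Homog (gr 𝒜) x →
    (∀ y ∈ P, Homog 𝒜 y) →
    x.2 ⊗ₜ[K[X]] word K[X] (List.replicate j (epsL 𝒜) ++ P.map (inclL 𝒜)) ∈ M
  contract_mem : ∀ c, (dgStructure W).hochschild (contract 𝒜 l c) - c ∈ M → c ∈ M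

variable {W l} {M : Submodule K[X] (Chains K[X] (KoszulAlg 𝒜))}

theorem IsAbsorbing.list_mem (hM : IsAbsorbing W l M) (a j) (P : List (ZMod 2 × A))
    (R L : List (ZMod 2 × KoszulAlg 𝒜)) (hP : P ≠ [])
    (hL : L = (List.replicate j (epsL 𝒜) ++ P.map (inclL 𝒜)) ++ epsL 𝒜 :: R) :
    a ⊗ₜ[K[X]] word K[X] L ∈ M := by
  have h := hM.split_mem a j P (word K[X] R) hP
  rw [hL, word_append, word_cons]
  exact h

theorem word_zero_letter (us vs : List (ZMod 2 × KoszulAlg 𝒜)) {z : ZMod 2 × KoszulAlg 𝒜}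
    (hz : z.2 = 0) : word K[X] (us ++ z :: vs) = 0 := by
  rw [word_append, word_cons, hz, map_zero, zero_mul, mul_zero]

theorem mem_of_mix {a : KoszulAlg 𝒜} {us vs : List (ZMod 2 × KoszulAlg 𝒜)} {b : ZMod 2 × A}
    (h1 : a ⊗ₜ[K[X]] word K[X] (us ++ epsL 𝒜 :: vs) ∈ M)
    (h2 : a ⊗ₜ[K[X]] word K[X] (us ++ mixL 𝒜 (b.1, b.2 - l b.2 • 1) :: vs) ∈ M) :
    a ⊗ₜ[K[X]] word K[X] (us ++ mixL 𝒜 b :: vs) ∈ M := by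
  have h : word K[X] (us ++ mixL 𝒜 b :: vs) =
      (Polynomial.C (l b.2) : K[X]) • word K[X] (us ++ epsL 𝒜 :: vs) +
        word K[X] (us ++ mixL 𝒜 (b.1, b.2 - l b.2 • 1) :: vs) := by
    have := letter_mix (𝒜 := 𝒜) l b.2
    simp only [word_append, word_cons]
    rw [show (mixL 𝒜 b).2 = incl 𝒜 b.2 * eps 𝒜 from rfl, this, add_mul, mul_add, smul_mul_assoc,
      mul_smul_comm]
    rfl
  rw [h, TensorProduct.tmul_add, TensorProduct.tmul_smul]
  exact add_mem (Submodule.smul_mem _ _ h1) h2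

theorem mem_of_eps_mul {a : KoszulAlg 𝒜} {us vs : List (ZMod 2 × KoszulAlg 𝒜)} {b : ZMod 2 × A}
    (hb : Homog 𝒜 b) (h : a ⊗ₜ[K[X]] word K[X] (us ++ mixL 𝒜 b :: vs) ∈ M) :
    a ⊗ₜ[K[X]] word K[X] (us ++ mulL (epsL 𝒜) (inclL 𝒜 b) :: vs) ∈ M := by
  have h' : word K[X] (us ++ mulL (epsL 𝒜) (inclL 𝒜 b) :: vs) =
      sgn b.1 • word K[X] (us ++ mixL 𝒜 b :: vs) := by
    simp only [word_append, word_cons]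
    rw [show (mulL (epsL 𝒜) (inclL 𝒜 b)).2 = sgn b.1 • (mixL 𝒜 b).2 from eps_mul_incl hb,
      map_zsmul, smul_mul_assoc, mul_smul_comm]
  have h2 : a ⊗ₜ[K[X]] (sgn b.1 • word K[X] (us ++ mixL 𝒜 b :: vs)) =
      sgn b.1 • (a ⊗ₜ[K[X]] word K[X] (us ++ mixL 𝒜 b :: vs)) := by
    rcases sgn_eq_or b.1 with e | e <;> simp [e, TensorProduct.tmul_neg]
  rw [h', h2]
  exact zsmul_mem h _

end KoszulAlg

theorem add_add_sub_mem {R : Type*} [Ring R] {V : Type*} [AddCommGroup V] [Module R V]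
    {M : Submodule R V} {x s y : V} (hx : x ∈ M) (hy : y ∈ M) : x + s + y - s ∈ M := by
  rw [add_right_comm, add_sub_cancel_right]
  exact add_mem hx hy

theorem signed_sub_mem {R : Type*} [Ring R] {V : Type*} [AddCommGroup V] [Module R V]
    {M : Submodule R V} {p q : ZMod 2} {x y d m v z : V} (hx : x ∈ M) (hy : y ∈ M) (hd : d ∈ M)
    (hm : m - sgn q • v ∈ M) (hz : z ∈ M) :
    sgn (p + q) • (x - sgn (p + 1) • y + sgn (p + 1) • (d - m) - z) - v ∈ M := by
  have h : sgn (p + q) • (x - sgn (p + 1) • y + sgn (p + 1) • (d - m) - z) - v =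
      sgn (p + q) • (x - sgn (p + 1) • y + sgn (p + 1) • d - z) + sgn q • (m - sgn q • v) := by
    rw [sgn_add_one, sgn_add]
    rcases sgn_eq_or p with e | e <;> rcases sgn_eq_or q with e' | e' <;> rw [e, e'] <;> simp <;>
      abel
  rw [h]
  exact add_mem (zsmul_mem (sub_mem (add_mem (sub_mem hx (zsmul_mem hy _)) (zsmul_mem hd _)) hz) _)
    (zsmul_mem hm _)

namespace KoszulAlg

variable {K : Type u} [Field K] {A : Type v} [Ring A] [Algebra K A]
variable {𝒜 : ℤ → Submodule K A} [GradedAlgebra 𝒜]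
variable {D : DGStructure 𝒜} {W : CentralCocycle D} {l : A →ₗ[K] K}
variable {M : Submodule K[X] (Chains K[X] (KoszulAlg 𝒜))}

theorem tmul_word_neg_letter (a : KoszulAlg 𝒜) (us vs : List (ZMod 2 × KoszulAlg 𝒜))
    {y z : ZMod 2 × KoszulAlg 𝒜} (h : letter K[X] y.2 = -letter K[X] z.2) :
    a ⊗ₜ[K[X]] word K[X] (us ++ y :: vs) = -(a ⊗ₜ[K[X]] word K[X] (us ++ z :: vs)) := by
  rw [word_append, word_cons, h, neg_mul, mul_neg, TensorProduct.tmul_neg, word_append, word_cons]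

/-- The terms of the differential of a split word which involve the differential of one of the
letters. -/
theorem IsAbsorbing.derF_mem (hM : IsAbsorbing W l M) (a : KoszulAlg 𝒜) (j : ℕ)
    (P : List (ZMod 2 × A)) (b : ZMod 2 × A) (ws : List (ZMod 2 × KoszulAlg 𝒜))
    (h : a ⊗ₜ[K[X]] word K[X] ((List.replicate j (epsL 𝒜) ++ P.map (inclL 𝒜)) ++
      inclL 𝒜 b :: inclL 𝒜 (0, W.val) :: ws) ∈ M) :
    derF (dKoszul W) (fun L => a ⊗ₜ[K[X]] word K[X] L)
      ((List.replicate j (epsL 𝒜) ++ P.map (inclL 𝒜)) ++ inclL 𝒜 b :: epsL 𝒜 :: ws) ∈ M := by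
  have hδ : ∀ y : ZMod 2 × A, oddL (dKoszul W) (inclL 𝒜 y) = inclL 𝒜 (oddL D.d y) := fun y =>
    Prod.ext rfl (dKoszul_incl W y.2)
  rw [derF_eq_elemSum, elemSum_append]
  refine add_mem (add_mem (elemSum_mem M fun ys y zs e => zsmul_mem ?_ _) (zsmul_mem ?_ _)) ?_
  · rcases append_cons_eq_replicate_append e with ⟨i, k, -, rfl, rfl, rfl⟩ | ⟨Q, hQ, rfl⟩
    · rw [tmul_word_neg_letter (z := inclL 𝒜 (0, W.val)) _ _ _ (letter_dKoszul_eps W)]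
      refine neg_mem ?_
      cases k with
      | zero =>
        exact hM.list_mem _ i ((0, W.val) :: P ++ [b]) ws _ (by simp) (by simp)
      | succ k =>
        exact hM.list_mem _ i [(0, W.val)]
          ((List.replicate k (epsL 𝒜) ++ P.map (inclL 𝒜)) ++ inclL 𝒜 b :: epsL 𝒜 :: ws) _ (by simp)
          (by simp [List.replicate_succ])
    · obtain ⟨P1, P2, rfl, rfl, h2⟩ := List.map_eq_append_iff.mp hQ
      obtain ⟨p, P3, rfl, rfl, rfl⟩ := List.map_eq_cons_iff.mp h2
      rw [hδ]
      exact hM.list_mem _ j (P1 ++ oddL D.d p :: P3 ++ [b]) ws _ (by simp) (by simp)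
  · rw [hδ]
    exact hM.list_mem _ j (P ++ [oddL D.d b]) ws _ (by simp) (by simp)
  · rw [elemSum]
    refine add_mem (zsmul_mem ?_ _) (elemSum_mem M fun ys y zs e => zsmul_mem ?_ _)
    · have := tmul_word_neg_letter (y := oddL (dKoszul W) (epsL 𝒜)) (z := inclL 𝒜 (0, W.val)) a
        ((List.replicate j (epsL 𝒜) ++ P.map (inclL 𝒜)) ++ [inclL 𝒜 b]) ws (letter_dKoszul_eps W)
      rw [this]
      refine neg_mem ?_
      rwa [List.append_assoc _ [_], List.singleton_append]
    · exact hM.list_mem _ j (P ++ [b]) (ys ++ oddL (dKoszul W) y :: zs) _ (by simp) (by simp)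

/-- The terms of the differential of a split word which involve the product of two consecutive
letters. -/
theorem IsAbsorbing.mergeF_mem (hM : IsAbsorbing W l M) (a : KoszulAlg 𝒜) (j : ℕ)
    {P : List (ZMod 2 × A)} (hP : ∀ y ∈ P, Homog 𝒜 y) {b : ZMod 2 × A} (hb : Homog 𝒜 b)
    {ws : List (Cell A)} (hws : ∀ c ∈ ws, c.IsHomog 𝒜)
    (h1 : ∀ i, j = i + 1 → P = [] → a ⊗ₜ[K[X]] word K[X] (List.replicate i (epsL 𝒜) ++
      mixL 𝒜 b :: epsL 𝒜 :: ws.map (Cell.val 𝒜)) ∈ M)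
    (h2 : ∀ i p P', j = i + 1 → P = p :: P' → a ⊗ₜ[K[X]] word K[X] (List.replicate i (epsL 𝒜) ++
      mixL 𝒜 (p.1, p.2 - l p.2 • 1) :: (P'.map (inclL 𝒜) ++
        inclL 𝒜 b :: epsL 𝒜 :: ws.map (Cell.val 𝒜))) ∈ M)
    (h3 : ∀ w ws', ws = Cell.pur w :: ws' → a ⊗ₜ[K[X]] word K[X]
      ((List.replicate j (epsL 𝒜) ++ P.map (inclL 𝒜)) ++ inclL 𝒜 b ::
        mixL 𝒜 (w.1, w.2 - l w.2 • 1) :: ws'.map (Cell.val 𝒜)) ∈ M) :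
    mergeF (fun L => a ⊗ₜ[K[X]] word K[X] L) ((List.replicate j (epsL 𝒜) ++ P.map (inclL 𝒜)) ++
        inclL 𝒜 b :: epsL 𝒜 :: ws.map (Cell.val 𝒜)) -
      sgn (wdeg (List.replicate j (epsL 𝒜) ++ P.map (inclL 𝒜)) + rdeg b) •
        (a ⊗ₜ[K[X]] word K[X] ((List.replicate j (epsL 𝒜) ++ P.map (inclL 𝒜)) ++
          mixL 𝒜 b :: ws.map (Cell.val 𝒜))) ∈ M := by
  have hm : ∀ y z : ZMod 2 × A, mulL (inclL 𝒜 y) (inclL 𝒜 z) = inclL 𝒜 (mulL y z) := fun y z =>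
    Prod.ext rfl (incl_mul 𝒜 y.2 z.2).symm
  rw [mergeF_eq_elemSum, elemSum_append, elemSum]
  simp only [headF_cons, List.nil_append]
  refine add_add_sub_mem (elemSum_mem M fun ys y zs e => zsmul_mem ?_ _)
    (add_mem (zsmul_mem ?_ _) (elemSum_mem M fun ys y zs e => zsmul_mem ?_ _))
  · rcases append_cons_eq_replicate_append e with ⟨i, k, rfl, rfl, rfl, rfl⟩ | ⟨Q, hQ, rfl⟩
    · cases k with
      | zero =>
        cases P with
        | nil => exact mem_of_eps_mul hb (h1 i rfl rfl)
        | cons p P =>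
          refine mem_of_eps_mul (hP p List.mem_cons_self) (mem_of_mix (l := l) ?_ ?_)
          · exact hM.list_mem _ (i + 1) (P ++ [b]) (ws.map (Cell.val 𝒜)) _ (by simp)
              (by simp [List.replicate_succ'])
          · have := h2 i p P rfl rfl
            exact this
      | succ k =>
        rw [List.replicate_succ, List.cons_append, List.cons_append, headF_cons,
          word_zero_letter _ _ (eps_mul_eps 𝒜), TensorProduct.tmul_zero]
        exact zero_mem _
    · obtain ⟨P1, P2, rfl, rfl, h2⟩ := List.map_eq_append_iff.mp hQ
      obtain ⟨p, P3, rfl, rfl, rfl⟩ := List.map_eq_cons_iff.mp h2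
      cases P3 with
      | nil =>
        rw [List.map_nil, List.nil_append, headF_cons, hm]
        exact hM.list_mem _ j (P1 ++ [mulL p b]) (ws.map (Cell.val 𝒜)) _ (by simp) (by simp)
      | cons q P3 =>
        rw [List.map_cons, List.cons_append, headF_cons, hm]
        exact hM.list_mem _ j (P1 ++ mulL p q :: P3 ++ [b]) (ws.map (Cell.val 𝒜)) _ (by simp)
          (by simp)
  · rcases ws with _ | ⟨c | w | w, ws⟩
    · exact zero_mem _
    · rw [List.map_cons, headF_cons, word_zero_letter _ _ (eps_mul_eps 𝒜), TensorProduct.tmul_zero]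
      exact zero_mem _
    · have hw : Homog 𝒜 w := hws _ List.mem_cons_self
      rw [List.map_cons, headF_cons]
      refine mem_of_eps_mul hw (mem_of_mix (l := l) ?_ ?_)
      · exact hM.list_mem _ j (P ++ [b]) (ws.map (Cell.val 𝒜)) _ (by simp) (by simp)
      · have := h3 w ws rfl
        rwa [List.append_assoc _ [_], List.singleton_append]
    · have hw : Homog 𝒜 w := hws _ List.mem_cons_self
      have h0 : (mulL (epsL 𝒜) (Cell.val 𝒜 (Cell.mix w))).2 = 0 := by
        change eps 𝒜 * (incl 𝒜 w.2 * eps 𝒜) = 0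
        rw [← mul_assoc, eps_mul_incl hw, smul_mul_assoc, mul_assoc, eps_mul_eps, mul_zero,
          smul_zero]
      rw [List.map_cons, headF_cons, word_zero_letter _ _ h0, TensorProduct.tmul_zero]
      exact zero_mem _
  · cases zs with
    | nil => exact zero_mem _
    | cons z zs =>
      exact hM.list_mem _ j (P ++ [b]) (ys ++ mulL y z :: zs) _ (by simp) (by simp)

/-- If a word contains a letter `bε` which is preceded only by copies of `ε` and then by letters in
`A`, then it lies in the submodule, provided that this is true for certain simpler words. The
contraction replaces `bε` by `b|ε`, up to sign. In the differential of the outcome, the product of `b`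
with `ε` gives back the original word, and the hypotheses concern other terms: in `h0`, the
differential is applied to `ε`; in `h1` and `h2`, the last of the initial copies of `ε` is multiplied
with `b` or with the first letter of `P`; in `h3`, the letter `ε` is multiplied with the next one; in
`h4`, the first element is multiplied with `b`. The remaining terms always lie in the submodule. -/
theorem IsAbsorbing.mix_mem (hM : IsAbsorbing W l M) (hl : l 1 = 1) {x : ZMod 2 × KoszulAlg 𝒜}
    (hx : Homog (gr 𝒜) x) (j : ℕ) {P : List (ZMod 2 × A)} (hP : ∀ y ∈ P, Homog 𝒜 y)
    {b : ZMod 2 × A} (hb : Homog 𝒜 b) (hlb : l b.2 = 0)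
    {ws : List (Cell A)} (hws : ∀ c ∈ ws, c.IsHomog 𝒜)
    (h0 : x.2 ⊗ₜ[K[X]] word K[X] ((List.replicate j (epsL 𝒜) ++ P.map (inclL 𝒜)) ++
      inclL 𝒜 b :: inclL 𝒜 (0, W.val) :: ws.map (Cell.val 𝒜)) ∈ M)
    (h1 : ∀ i, j = i + 1 → P = [] → x.2 ⊗ₜ[K[X]] word K[X] (List.replicate i (epsL 𝒜) ++
      mixL 𝒜 b :: epsL 𝒜 :: ws.map (Cell.val 𝒜)) ∈ M)
    (h2 : ∀ i p P', j = i + 1 → P = p :: P' → x.2 ⊗ₜ[K[X]] word K[X] (List.replicate i (epsL 𝒜) ++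
      mixL 𝒜 (p.1, p.2 - l p.2 • 1) :: (P'.map (inclL 𝒜) ++
        inclL 𝒜 b :: epsL 𝒜 :: ws.map (Cell.val 𝒜))) ∈ M)
    (h3 : ∀ w ws', ws = Cell.pur w :: ws' → x.2 ⊗ₜ[K[X]] word K[X]
      ((List.replicate j (epsL 𝒜) ++ P.map (inclL 𝒜)) ++ inclL 𝒜 b ::
        mixL 𝒜 (w.1, w.2 - l w.2 • 1) :: ws'.map (Cell.val 𝒜)) ∈ M)
    (h4 : j = 0 → P = [] → (mulL x (inclL 𝒜 b)).2 ⊗ₜ[K[X]]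
      word K[X] (epsL 𝒜 :: ws.map (Cell.val 𝒜)) ∈ M) :
    x.2 ⊗ₜ[K[X]] word K[X] ((List.replicate j (epsL 𝒜) ++ P.map (inclL 𝒜)) ++
      mixL 𝒜 b :: ws.map (Cell.val 𝒜)) ∈ M := by
  have hL : ∀ y ∈ (List.replicate j (epsL 𝒜) ++ P.map (inclL 𝒜)) ++
      inclL 𝒜 b :: epsL 𝒜 :: ws.map (Cell.val 𝒜), Homog (gr 𝒜) y := by
    intro y hy
    simp only [List.mem_append, List.mem_replicate, List.mem_map, List.mem_cons] at hy
    rcases hy with (⟨-, rfl⟩ | ⟨p, hp, rfl⟩) | rfl | rfl | ⟨c, hc, rfl⟩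
    exacts [homog_epsL, homog_inclL (hP p hp), homog_inclL hb, homog_epsL, (hws c hc).homog]
  refine hM.contract_mem _ ?_
  rw [contract_mix hl hx j hP hb hlb, map_zsmul,
    show (dgStructure W).hochschild _ = _ from
      (dgStructure W).map_hochschild LinearMap.id hx hL, hochF_eq, barF]
  have hd := hM.derF_mem x.2 j P b (ws.map (Cell.val 𝒜)) h0
  have hm := hM.mergeF_mem x.2 j hP hb hws h1 h2 h3
  set us := List.replicate j (epsL 𝒜) ++ P.map (inclL 𝒜) with hus
  have t1 : (oddL (dKoszul W) x).2 ⊗ₜ[K[X]] word K[X]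
      (us ++ inclL 𝒜 b :: epsL 𝒜 :: ws.map (Cell.val 𝒜)) ∈ M :=
    hM.list_mem _ j (P ++ [b]) (ws.map (Cell.val 𝒜)) _ (by simp) (by simp [hus])
  have t2 : headF (fun z zs => (mulL x z).2 ⊗ₜ[K[X]] word K[X] zs)
      (us ++ inclL 𝒜 b :: epsL 𝒜 :: ws.map (Cell.val 𝒜)) ∈ M := by
    rw [hus]
    cases j with
    | zero =>
      cases P with
      | nil => exact h4 rfl rfl
      | cons p P =>
        exact hM.list_mem _ 0 (P ++ [b]) (ws.map (Cell.val 𝒜)) _ (by simp) (by simp)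
    | succ j =>
      exact hM.list_mem _ j (P ++ [b]) (ws.map (Cell.val 𝒜)) _ (by simp) (by simp)
  have t3 : lastF (fun ys y => sgn (rdeg y * (x.1 + wdeg ys)) • ((mulL y x).2 ⊗ₜ[K[X]]
      word K[X] ys)) (us ++ inclL 𝒜 b :: epsL 𝒜 :: ws.map (Cell.val 𝒜)) ∈ M := by
    rcases List.eq_nil_or_concat ws with rfl | ⟨ws, c, rfl⟩
    · rw [show us ++ inclL 𝒜 b :: epsL 𝒜 :: [].map (Cell.val 𝒜) = (us ++ [inclL 𝒜 b]) ++ [epsL 𝒜]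
        by simp, lastF_concat]
      refine zsmul_mem ?_ _
      rw [hus, List.append_assoc, ← List.map_singleton, ← List.map_append]
      exact hM.pure_mem _ j (P ++ [b]) (homog_epsL.mulL hx) (by
        intro y hy
        rcases List.mem_append.mp hy with hy | hy
        exacts [hP y hy, List.mem_singleton.mp hy ▸ hb])
    · rw [show us ++ inclL 𝒜 b :: epsL 𝒜 :: (ws.concat c).map (Cell.val 𝒜) =
        (us ++ inclL 𝒜 b :: epsL 𝒜 :: ws.map (Cell.val 𝒜)) ++ [c.val 𝒜] by simp, lastF_concat]
      exact zsmul_mem (hM.list_mem _ j (P ++ [b]) (ws.map (Cell.val 𝒜)) _ (by simp)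
        (by simp [hus])) _
  exact signed_sub_mem t1 t2 hd hm t3

end KoszulAlg

namespace KoszulAlg

section Lists

variable {A : Type v}

theorem listWeight_cons (c : Cell A) (cs) : listWeight (c :: cs) = c.weight + listWeight cs := by
  simp [listWeight]

theorem listWeight_append (cs ds : List (Cell A)) :
    listWeight (cs ++ ds) = listWeight cs + listWeight ds := by
  simp [listWeight]

theorem listWeight_replicate (j : ℕ) : listWeight (List.replicate j (Cell.eps : Cell A)) = j := by
  simp [listWeight, Cell.weight]

theorem listWeight_pur (P : List (ZMod 2 × A)) : listWeight (P.map Cell.pur) = 0 := by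
  induction P with
  | nil => rfl
  | cons p P ih => rw [List.map_cons, listWeight_cons, ih]; rfl

theorem listSize_cons (c : Cell A) (cs) : listSize (c :: cs) = c.size + listSize cs := by
  simp [listSize]

theorem listSize_append (cs ds : List (Cell A)) :
    listSize (cs ++ ds) = listSize cs + listSize ds := by
  simp [listSize]

theorem listSize_replicate (j : ℕ) : listSize (List.replicate j (Cell.eps : Cell A)) = 0 := by
  simp [listSize, Cell.size]

theorem listSize_pur (P : List (ZMod 2 × A)) : listSize (P.map Cell.pur) = P.length := by
  induction P with
  | nil => rfl
  | cons p P ih =>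
    rw [List.map_cons, listSize_cons, ih, List.length_cons, add_comm]; rfl

/-- Every word is of the form `ε^j a₁ … a_i …` with `aᵢ ∈ A`, where the rest is either empty, or
starts with `ε` (and then `i > 0`), or with an element `bε`. -/
theorem exists_pure_prefix (cs : List (Cell A)) : ∃ j P rest,
    cs = (List.replicate j Cell.eps ++ P.map Cell.pur) ++ rest ∧
      (rest = [] ∨ (P ≠ [] ∧ ∃ ws, rest = Cell.eps :: ws) ∨ ∃ b ws, rest = Cell.mix b :: ws) := by
  induction cs with
  | nil => exact ⟨0, [], [], rfl, Or.inl rfl⟩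
  | cons c cs ih =>
    obtain ⟨j, P, rest, hcs, h⟩ := ih
    cases c with
    | eps => exact ⟨j + 1, P, rest, by rw [hcs]; rfl, h⟩
    | mix b => exact ⟨0, [], _, rfl, Or.inr (Or.inr ⟨b, cs, rfl⟩)⟩
    | pur p =>
      cases j with
      | zero =>
        refine ⟨0, p :: P, rest, by rw [hcs]; rfl, ?_⟩
        rcases h with h | ⟨-, h⟩ | h
        exacts [Or.inl h, Or.inr (Or.inl ⟨List.cons_ne_nil _ _, h⟩), Or.inr (Or.inr h)]
      | succ j =>
        exact ⟨0, [p], cs, rfl, Or.inr (Or.inl ⟨List.cons_ne_nil _ _, _, hcs⟩)⟩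

end Lists

variable {K : Type u} [Field K] {A : Type v} [Ring A] [Algebra K A]
variable {𝒜 : ℤ → Submodule K A} [GradedAlgebra 𝒜]
variable {D : DGStructure 𝒜} {W : CentralCocycle D} {l : A →ₗ[K] K}
variable {M : Submodule K[X] (Chains K[X] (KoszulAlg 𝒜))}

theorem map_val_prefix (j : ℕ) (P : List (ZMod 2 × A)) (cs : List (Cell A)) :
    ((List.replicate j Cell.eps ++ P.map Cell.pur) ++ cs).map (Cell.val 𝒜) =
      (List.replicate j (epsL 𝒜) ++ P.map (inclL 𝒜)) ++ cs.map (Cell.val 𝒜) := by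
  rw [List.map_append, List.map_append, List.map_replicate, List.map_map]
  rfl

theorem isHomog_prefix {j : ℕ} {P : List (ZMod 2 × A)} {cs : List (Cell A)} :
    (∀ c ∈ (List.replicate j Cell.eps ++ P.map Cell.pur) ++ cs, c.IsHomog 𝒜) ↔
      (∀ y ∈ P, Homog 𝒜 y) ∧ ∀ c ∈ cs, c.IsHomog 𝒜 := by
  constructor
  · intro h
    refine ⟨fun y hy => h (Cell.pur y) ?_, fun c hc => h c (List.mem_append_right _ hc)⟩
    exact List.mem_append_left _ (List.mem_append_right _ (List.mem_map_of_mem hy))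
  · rintro ⟨h1, h2⟩ c hc
    rcases List.mem_append.mp hc with hc | hc
    · rcases List.mem_append.mp hc with hc | hc
      · rw [List.eq_of_mem_replicate hc]; trivial
      · obtain ⟨y, hy, rfl⟩ := List.mem_map.mp hc
        exact h1 y hy
    · exact h2 c hc

theorem isHomog_cons {c : Cell A} {cs : List (Cell A)} :
    (∀ d ∈ c :: cs, d.IsHomog 𝒜) ↔ c.IsHomog 𝒜 ∧ ∀ d ∈ cs, d.IsHomog 𝒜 := List.forall_mem_cons

theorem homog_W : Homog 𝒜 ((0 : ZMod 2), W.val) := ⟨0, by simp, W.mem⟩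

/-- By induction on the number of copies of `ε`, then on the number of elements of `A`, then on
the number of copies of `ε` in the beginning, and then on the length, all words lie in the
submodule. -/
theorem IsAbsorbing.cells_mem (hM : IsAbsorbing W l M) (hl : l 1 = 1)
    (h0 : ∀ n : ℤ, n ≠ 0 → ∀ a ∈ 𝒜 n, l a = 0) (a b : ℕ) : ∀ (x : ZMod 2 × KoszulAlg 𝒜)
    (cs : List (Cell A)), Homog (gr 𝒜) x → (∀ c ∈ cs, c.IsHomog 𝒜) → listWeight cs = a →
      listSize cs = b → x.2 ⊗ₜ[K[X]] word K[X] (cs.map (Cell.val 𝒜)) ∈ M := by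
  induction a using Nat.strong_induction_on generalizing b with
  | _ a iha =>
  induction b using Nat.strong_induction_on with
  | _ b ihb =>
  -- the words covered by the two outer inductions
  have low : ∀ (x : ZMod 2 × KoszulAlg 𝒜) (cs : List (Cell A)), Homog (gr 𝒜) x →
      (∀ c ∈ cs, c.IsHomog 𝒜) → (listWeight cs < a ∨ listWeight cs = a ∧ listSize cs < b) →
      x.2 ⊗ₜ[K[X]] word K[X] (cs.map (Cell.val 𝒜)) ∈ M := by
    intro x cs hx hcs h
    rcases h with h | ⟨h, h'⟩
    · exact iha _ h _ x cs hx hcs rfl rfl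
    · exact ihb _ h' x cs hx hcs h rfl
  -- the words of the given size whose first letter outside `A` and different from `ε` is `yε`
  have key : ∀ (j n : ℕ) (x : ZMod 2 × KoszulAlg 𝒜) (P : List (ZMod 2 × A)) (y : ZMod 2 × A)
      (ws : List (Cell A)), Homog (gr 𝒜) x → (∀ z ∈ P, Homog 𝒜 z) → Homog 𝒜 y → l y.2 = 0 →
      (∀ c ∈ ws, c.IsHomog 𝒜) → ws.length = n → j + (1 + listWeight ws) = a →
      P.length + (1 + listSize ws) = b →
      x.2 ⊗ₜ[K[X]] word K[X] ((List.replicate j (epsL 𝒜) ++ P.map (inclL 𝒜)) ++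
        mixL 𝒜 y :: ws.map (Cell.val 𝒜)) ∈ M := by
    intro j
    induction j using Nat.strong_induction_on with
    | _ j ihj =>
    intro n
    induction n using Nat.strong_induction_on with
    | _ n ihn =>
    intro x P y ws hx hP hy hly hws hn ha hb
    have hl0 : ∀ z : ZMod 2 × A, l (z.2 - l z.2 • 1) = 0 := fun z => by
      rw [map_sub, map_smul, hl, smul_eq_mul, mul_one, sub_self]
    refine hM.mix_mem hl hx j hP hy hly hws ?_ ?_ ?_ ?_ ?_
    · have h := low x ((List.replicate j Cell.eps ++ P.map Cell.pur) ++
        Cell.pur y :: Cell.pur (0, W.val) :: ws) hx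
        (isHomog_prefix.mpr ⟨hP, isHomog_cons.mpr ⟨hy, isHomog_cons.mpr ⟨homog_W, hws⟩⟩⟩) (by
          simp only [listWeight_append, listWeight_cons, listWeight_replicate, listWeight_pur,
            Cell.weight]
          omega)
      rwa [map_val_prefix] at h
    · rintro i rfl rfl
      have h := ihj i (by omega) _ x [] y (Cell.eps :: ws) hx (by simp) hy hly
        (isHomog_cons.mpr ⟨trivial, hws⟩) rfl
        (by simp only [listWeight_cons, Cell.weight]; omega)
        (by simp only [listSize_cons, Cell.size, List.length_nil] at hb ⊢; omega)
      rw [List.map_nil, List.append_nil] at h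
      exact h
    · rintro i p P' rfl rfl
      have h := ihj i (by omega) _ x [] (p.1, p.2 - l p.2 • 1)
        ((List.replicate 0 Cell.eps ++ P'.map Cell.pur) ++ Cell.pur y :: Cell.eps :: ws) hx (by simp)
        (sub_unit_homog h0 (hP p List.mem_cons_self)) (hl0 p)
        (isHomog_prefix.mpr ⟨fun z hz => hP z (List.mem_cons_of_mem _ hz),
          isHomog_cons.mpr ⟨hy, isHomog_cons.mpr ⟨trivial, hws⟩⟩⟩) rfl
        (by
          simp only [listWeight_append, listWeight_cons, listWeight_replicate, listWeight_pur,
            Cell.weight]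
          omega)
        (by
          simp only [listSize_append, listSize_cons, listSize_replicate, listSize_pur,
            Cell.size, List.length_nil, List.length_cons] at hb ⊢
          omega)
      rw [map_val_prefix, List.map_nil, List.append_nil, List.replicate_zero, List.nil_append] at h
      exact h
    · rintro w ws' rfl
      obtain ⟨hw, hws'⟩ := isHomog_cons.mp hws
      have h := ihn ws'.length (by rw [← hn]; simp) x (P ++ [y]) (w.1, w.2 - l w.2 • 1) ws' hx
        (by
          intro z hz
          rcases List.mem_append.mp hz with hz | hz
          exacts [hP z hz, List.mem_singleton.mp hz ▸ hy])
        (sub_unit_homog h0 hw) (hl0 w) hws' rfl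
        (by simp only [listWeight_cons, Cell.weight] at ha; omega)
        (by
          simp only [listSize_cons, Cell.size, List.length_append, List.length_singleton] at hb ⊢
          omega)
      rw [List.map_append, List.map_singleton, ← List.append_assoc, List.append_assoc _ [_],
        List.singleton_append] at h
      exact h
    · rintro rfl rfl
      refine low (mulL x (inclL 𝒜 y)) (Cell.eps :: ws) (hx.mulL (homog_inclL hy))
        (isHomog_cons.mpr ⟨trivial, hws⟩) (Or.inr ⟨?_, ?_⟩)
      · simp only [listWeight_cons, Cell.weight]; omega
      · simp only [listSize_cons, Cell.size, List.length_nil] at hb ⊢; omega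
  intro x cs hx hcs ha hb
  obtain ⟨j, P, rest, rfl, h⟩ := exists_pure_prefix cs
  obtain ⟨hP, hrest⟩ := isHomog_prefix.mp hcs
  rw [map_val_prefix]
  simp only [listWeight_append, listWeight_replicate, listWeight_pur, add_zero] at ha
  simp only [listSize_append, listSize_replicate, listSize_pur, zero_add] at hb
  rcases h with rfl | ⟨hne, ws, rfl⟩ | ⟨y, ws, rfl⟩
  · rw [List.map_nil, List.append_nil]
    exact hM.pure_mem x j P hx hP
  · exact hM.list_mem _ j P (ws.map (Cell.val 𝒜)) _ hne rfl
  · obtain ⟨hy, hws⟩ := isHomog_cons.mp hrest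
    rw [listWeight_cons] at ha
    rw [listSize_cons] at hb
    refine mem_of_mix (l := l) ?_ ?_
    · have h := low x ((List.replicate j Cell.eps ++ P.map Cell.pur) ++ Cell.eps :: ws) hx
        (isHomog_prefix.mpr ⟨hP, isHomog_cons.mpr ⟨trivial, hws⟩⟩) (by
          simp only [listWeight_append, listWeight_cons, listWeight_replicate, listWeight_pur,
            listSize_append, listSize_cons, listSize_replicate, listSize_pur, Cell.weight,
            Cell.size] at ha hb ⊢
          omega)
      rwa [map_val_prefix] at h
    · exact key j _ x P (y.1, y.2 - l y.2 • 1) ws hx hP (sub_unit_homog h0 hy)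
        (by rw [map_sub, map_smul, hl, smul_eq_mul, mul_one, sub_self]) hws rfl ha hb

/-- An absorbing submodule contains all chains. -/
theorem IsAbsorbing.eq_top (hM : IsAbsorbing W l M) (hl : l 1 = 1)
    (h0 : ∀ n : ℤ, n ≠ 0 → ∀ a ∈ 𝒜 n, l a = 0) : M = ⊤ := by
  have hS : Submodule.span K[X] (Prod.snd ''
      {y : ZMod 2 × KoszulAlg 𝒜 | ∃ c : Cell A, c.IsHomog 𝒜 ∧ y = c.val 𝒜}) = ⊤ :=
    eq_top_of_mem
      (fun n a ha => Submodule.subset_span ⟨_, ⟨Cell.pur ((n : ZMod 2), a), ⟨n, rfl, ha⟩, rfl⟩, rfl⟩)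
      (fun n a ha => Submodule.subset_span ⟨_, ⟨Cell.mix ((n : ZMod 2), a), ⟨n, rfl, ha⟩, rfl⟩, rfl⟩)
  rw [eq_top_iff, ← span_chains_of_span hS, Submodule.span_le]
  rintro _ ⟨x, xs, ⟨c, hc, rfl⟩, hxs, rfl⟩
  obtain ⟨cs, hcs, rfl⟩ : ∃ cs : List (Cell A), (∀ c ∈ cs, c.IsHomog 𝒜) ∧
      xs = cs.map (Cell.val 𝒜) := by
    induction xs with
    | nil => exact ⟨[], by simp, rfl⟩
    | cons y ys ih =>
      obtain ⟨cs, h1, rfl⟩ := ih fun z hz => hxs z (List.mem_cons_of_mem _ hz)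
      obtain ⟨d, hd, rfl⟩ := hxs y List.mem_cons_self
      exact ⟨d :: cs, isHomog_cons.mpr ⟨hd, h1⟩, rfl⟩
  exact hM.cells_mem hl h0 _ _ _ _ hc.homog hcs rfl rfl

end KoszulAlg

/-! ### The contraction and shuffles -/

theorem gradeInv_gradeInv_apply {R : Type*} [CommRing R] {A : Type*} [Ring A] [Algebra R A]
    (𝒜 : ℤ → Submodule R A) [GradedAlgebra 𝒜] (a : A) : gradeInv 𝒜 (gradeInv 𝒜 a) = a := by
  induction a using DirectSum.Decomposition.inductionOn 𝒜 with
  | zero => simp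
  | @homogeneous n a =>
    rw [gradeInv_of_mem 𝒜 a.2, map_zsmul, gradeInv_of_mem 𝒜 a.2, smul_smul, sgn_mul_self,
      one_smul]
  | add a b ha hb => simp only [map_add, ha, hb]

namespace KoszulAlg

variable {K : Type u} [Field K] {A : Type v} [Ring A] [Algebra K A]
variable {𝒜 : ℤ → Submodule K A} [GradedAlgebra 𝒜]
variable {l : A →ₗ[K] K}

local notation "TW" => TensorAlgebra K[X] (ReducedPart K[X] (KoszulAlg 𝒜))

/-- The contraction annihilates all words which consist of letters in `A` and copies of `ε`, and in
particular shuffles. -/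
theorem contractWord_epsShuffle (hl : l 1 = 1) (k : ℕ) (as : List (ZMod 2 × A)) :
    contractWord 𝒜 l 0 (epsShuffle 𝒜 k as) = 0 ∧ contractWord 𝒜 l 1 (epsShuffle 𝒜 k as) = 0 := by
  induction as generalizing k with
  | nil =>
    induction k with
    | zero =>
      rw [epsShuffle]
      exact ⟨contractWord_one (i := 0) l (by decide), contractWord_one (i := 1) l (by decide)⟩
    | succ k ih =>
      rw [epsShuffle, contractWord_zero_eps hl, contractWord_one_eps, ih.1, mul_zero]
      exact ⟨rfl, rfl⟩
  | cons a as ih =>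
    induction k with
    | zero =>
      rw [epsShuffle, contractWord_zero_incl, contractWord_one_incl, (ih 0).2, mul_zero, neg_zero]
      exact ⟨rfl, rfl⟩
    | succ k ihk =>
      rw [epsShuffle, map_add, map_add, contractWord_zero_incl, contractWord_one_incl,
        (ih (k + 1)).2, contractWord_zero_eps hl, contractWord_one_eps, ihk.1, mul_zero, mul_zero,
        neg_zero, add_zero]
      exact ⟨rfl, rfl⟩

theorem polarShuffle_induction {N : Submodule K[X] (Chains K[X] (KoszulAlg 𝒜))}
    (h : ∀ k (x : ZMod 2 × A) xs, Homog 𝒜 x → (∀ y ∈ xs, Homog 𝒜 y) →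
      incl 𝒜 x.2 ⊗ₜ[K[X]] epsShuffle 𝒜 k xs ∈ N) (p : PolarChains K A) :
    polarShuffle 𝒜 p ∈ N := by
  induction p using Finsupp.induction_linear with
  | zero => rw [map_zero]; exact zero_mem _
  | add x y hx hy => rw [map_add]; exact add_mem hx hy
  | single k c =>
    rw [polarShuffle_single]
    have hc : c ∈ (⊤ : Submodule K (Chains K A)) := Submodule.mem_top
    rw [← span_chains_homog 𝒜] at hc
    induction hc using Submodule.span_induction with
    | zero => rw [map_zero]; exact zero_mem _
    | add x y _ _ hx hy => rw [map_add]; exact add_mem hx hy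
    | smul r x _ hx =>
      rw [map_smul, ← algebraMap_smul K[X] r]
      exact Submodule.smul_mem _ _ hx
    | mem c hc =>
      obtain ⟨x, xs, hx, hxs, rfl⟩ := hc
      rw [shuffle, ChainFormula.lift_homog _ hx hxs]
      exact zsmul_mem (h k x xs hx hxs) _

theorem incl_tmul_epsShuffle (k : ℕ) {x : ZMod 2 × A} {xs} (hx : Homog 𝒜 x)
    (hxs : ∀ y ∈ xs, Homog 𝒜 y) : incl 𝒜 x.2 ⊗ₜ[K[X]] epsShuffle 𝒜 k xs =
      (-1 : ℤ) ^ k • polarShuffle 𝒜 (Finsupp.single k (x.2 ⊗ₜ[K] word K xs)) := by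
  rw [polarShuffle_single, shuffle, ChainFormula.lift_homog _ hx hxs]
  change _ = (-1 : ℤ) ^ k • ((-1 : ℤ) ^ k • (incl 𝒜 x.2 ⊗ₜ[K[X]] epsShuffle 𝒜 k xs))
  rw [smul_smul, ← mul_pow, neg_one_mul, neg_neg, one_pow, one_smul]

theorem contract_polarShuffle (hl : l 1 = 1) (p : PolarChains K A) :
    contract 𝒜 l (polarShuffle 𝒜 p) = 0 := by
  refine LinearMap.mem_ker.mp (polarShuffle_induction (fun k x xs _ _ => ?_) p)
  rw [LinearMap.mem_ker, contract_tmul, (contractWord_epsShuffle hl k xs).1,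
    TensorProduct.tmul_zero]

theorem contract_iotaElem_polarShuffle (hl : l 1 = 1) (p : PolarChains K A) :
    contract 𝒜 l (iotaElem (gr 𝒜) (eps 𝒜) (polarShuffle 𝒜 p)) = 0 := by
  refine LinearMap.mem_ker.mp (polarShuffle_induction
    (N := LinearMap.ker (contract 𝒜 l ∘ₗ iotaElem (gr 𝒜) (eps 𝒜))) (fun k x xs _ _ => ?_) p)
  rw [LinearMap.mem_ker, LinearMap.comp_apply, iotaElem_tmul, contract_tmul,
    (contractWord_epsShuffle hl k xs).1, TensorProduct.tmul_zero]

theorem contractWord_pure_eps {P : List (ZMod 2 × A)} (w : TW) :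
    contractWord 𝒜 l 1 (word K[X] (P.map (inclL 𝒜)) * (letter K[X] (eps 𝒜) * w)) = 0 := by
  induction P with
  | nil => rw [List.map_nil, word_nil, one_mul, contractWord_one_eps]
  | cons p P ih =>
    rw [List.map_cons, word_cons, mul_assoc, show (inclL 𝒜 p).2 = incl 𝒜 p.2 from rfl,
      contractWord_one_incl, ih, mul_zero, neg_zero]

/-- Split words are annihilated by the contraction. -/
theorem contract_split (hl : l 1 = 1) (a : KoszulAlg 𝒜) (j : ℕ) {P : List (ZMod 2 × A)} (w : TW)
    (hP : P ≠ []) : contract 𝒜 l (a ⊗ₜ[K[X]]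
      (word K[X] (List.replicate j (epsL 𝒜) ++ P.map (inclL 𝒜)) * (letter K[X] (eps 𝒜) * w))) =
      0 := by
  obtain ⟨p, P, rfl⟩ := List.exists_cons_of_ne_nil hP
  rw [contract_tmul, word_append, mul_assoc, contractWord_zero_replicate hl, List.map_cons,
    word_cons, mul_assoc, show (inclL 𝒜 p).2 = incl 𝒜 p.2 from rfl, contractWord_zero_incl,
    contractWord_pure_eps, mul_zero, neg_zero, mul_zero, TensorProduct.tmul_zero]

theorem exists_contractWord_eq (hl : l 1 = 1) {P : List (ZMod 2 × A)} (w : TW) (hP : P ≠ []) :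
    ∃ v, contractWord 𝒜 l 0 v = word K[X] (P.map (inclL 𝒜)) * (letter K[X] (eps 𝒜) * w) ∧
      contractWord 𝒜 l 1 v = word K[X] (P.map (inclL 𝒜)) * (letter K[X] (eps 𝒜) * w) := by
  induction P with
  | nil => exact absurd rfl hP
  | cons p P ih =>
    cases P with
    | nil =>
      -- The letter `p` may be changed by a multiple of the unit, so that the functional vanishes.
      set c := gradeInv 𝒜 p.2 - l (gradeInv 𝒜 p.2) • 1 with hc
      have h1 : l c = 0 := by
        rw [hc, map_sub, map_smul, hl, smul_eq_mul, mul_one, sub_self]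
      have h2 : letter K[X] (incl 𝒜 (gradeInv 𝒜 c)) = letter K[X] (incl 𝒜 p.2) := by
        rw [hc, map_sub, map_smul, map_one, gradeInv_gradeInv_apply, map_sub, incl_smul, incl_one,
          map_sub, map_smul, letter_one, smul_zero, sub_zero]
      refine ⟨-(letter K[X] (incl 𝒜 c * eps 𝒜) * w), ?_, ?_⟩
      · rw [map_neg, contractWord_zero_mix h1, neg_neg, h2, List.map_singleton, word_cons, word_nil,
          mul_one]
        rfl
      · rw [map_neg, contractWord_one_mix, neg_neg, h2, List.map_singleton, word_cons, word_nil,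
          mul_one]
        rfl
    | cons q P =>
      obtain ⟨v, -, h⟩ := ih (List.cons_ne_nil _ _)
      refine ⟨-(letter K[X] (incl 𝒜 (gradeInv 𝒜 p.2)) * v), ?_, ?_⟩
      · rw [map_neg, contractWord_zero_incl, neg_neg, h, gradeInv_gradeInv_apply,
          List.map_cons (l := q :: P), word_cons (R := K[X]) (x := inclL 𝒜 p), mul_assoc]
        rfl
      · rw [map_neg, contractWord_one_incl, neg_neg, h, gradeInv_gradeInv_apply,
          List.map_cons (l := q :: P), word_cons (R := K[X]) (x := inclL 𝒜 p), mul_assoc]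
        rfl

/-- Split words lie in the image of the contraction. -/
theorem exists_contract_eq (hl : l 1 = 1) (a : KoszulAlg 𝒜) (j : ℕ) {P : List (ZMod 2 × A)}
    (w : TW) (hP : P ≠ []) : ∃ c, contract 𝒜 l c = a ⊗ₜ[K[X]]
      (word K[X] (List.replicate j (epsL 𝒜) ++ P.map (inclL 𝒜)) * (letter K[X] (eps 𝒜) * w)) := by
  obtain ⟨v, hv, -⟩ := exists_contractWord_eq (𝒜 := 𝒜) hl w hP
  refine ⟨gradeInv (gr 𝒜) a ⊗ₜ[K[X]] (word K[X] (List.replicate j (epsL 𝒜)) * v), ?_⟩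
  rw [contract_tmul, gradeInv_gradeInv_apply, contractWord_zero_replicate hl, hv, word_append,
    mul_assoc]

theorem sgnC_unitE (x : KoszulAlg 𝒜) : sgnC 𝒜 (unitE 𝒜 l x) = 0 := by
  ext1 <;> simp [sgnC, unitE]

theorem unitE_sgnC (x : KoszulAlg 𝒜) : unitE 𝒜 l (sgnC 𝒜 x) = 0 := by
  ext1 <;> simp [sgnC, unitE]

theorem depsilon_sgnC (x : KoszulAlg 𝒜) : depsilon 𝒜 (sgnC 𝒜 x) = 0 := by
  ext1 <;> simp [sgnC]

theorem depsilon_depsilon (x : KoszulAlg 𝒜) : depsilon 𝒜 (depsilon 𝒜 x) = 0 := by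
  ext1 <;> simp

theorem unitE_depsilon (x : KoszulAlg 𝒜) : unitE 𝒜 l (depsilon 𝒜 x) = 0 := by
  ext1 <;> simp [unitE]

theorem letter_depsilon_unitE (x : KoszulAlg 𝒜) :
    letter K[X] (depsilon 𝒜 (unitE 𝒜 l x)) = 0 := by
  have h : LinearMap.ker (letter K[X] ∘ₗ depsilon 𝒜 ∘ₗ unitE 𝒜 l) = ⊤ := by
    refine eq_top_of_mem (fun n a _ => ?_) fun n a _ => ?_ <;>
      rw [LinearMap.mem_ker, LinearMap.comp_apply, LinearMap.comp_apply]
    · rw [unitE_incl, map_zero, map_zero]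
    · rw [unitE_mix, depsilon_mix, map_smul, map_one, incl_smul, incl_one, map_smul, letter_one,
        smul_zero]
  exact LinearMap.mem_ker.mp (h ▸ Submodule.mem_top : x ∈ LinearMap.ker _)

theorem contractWord_contractWord (w : TW) :
    contractWord 𝒜 l 0 (contractWord 𝒜 l 0 w) = 0 ∧
      contractWord 𝒜 l 1 (contractWord 𝒜 l 1 w) = 0 := by
  have h1 : ∀ (x : KoszulAlg 𝒜) (v : TW), contractWord 𝒜 l 1 (letter K[X] (sgnC 𝒜 x) * v) =
      -(letter K[X] (sgnC 𝒜 (sgnC 𝒜 x)) * contractWord 𝒜 l 1 v) := fun x v => by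
    rw [contractWord_one_letter, depsilon_sgnC, map_zero, zero_mul, sub_zero]
  have h1' : ∀ (x : KoszulAlg 𝒜) (v : TW), contractWord 𝒜 l 0 (letter K[X] (sgnC 𝒜 x) * v) =
      -(letter K[X] (sgnC 𝒜 (sgnC 𝒜 x)) * contractWord 𝒜 l 1 v) := fun x v => by
    rw [contractWord_zero_letter, depsilon_sgnC, unitE_sgnC, map_zero, zero_mul, zero_mul, sub_zero,
      zero_sub]
  have h2 : ∀ (x : KoszulAlg 𝒜) (v : TW), contractWord 𝒜 l 1 (letter K[X] (depsilon 𝒜 x) *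
      (letter K[X] (eps 𝒜) * v)) = 0 := fun x v => by
    rw [contractWord_one_letter, depsilon_depsilon, contractWord_one_eps, map_zero, zero_mul,
      mul_zero, sub_zero, neg_zero]
  have h2' : ∀ (x : KoszulAlg 𝒜) (v : TW), contractWord 𝒜 l 0 (letter K[X] (depsilon 𝒜 x) *
      (letter K[X] (eps 𝒜) * v)) = 0 := fun x v => by
    rw [contractWord_zero_letter, depsilon_depsilon, contractWord_one_eps, unitE_depsilon, map_zero,
      zero_mul, zero_mul, mul_zero, sub_zero, sub_zero]
  have h3 : ∀ (x : KoszulAlg 𝒜) (v : TW), contractWord 𝒜 l 0 (letter K[X] (unitE 𝒜 l x) * v) =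
      letter K[X] (unitE 𝒜 l (unitE 𝒜 l x)) * contractWord 𝒜 l 0 v := fun x v => by
    rw [contractWord_zero_letter, sgnC_unitE, letter_depsilon_unitE, map_zero, zero_mul, zero_mul,
      sub_zero, sub_zero]
  have hw : w ∈ (⊤ : Submodule K[X] TW) := Submodule.mem_top
  rw [← span_word_homog (gr 𝒜)] at hw
  induction hw using Submodule.span_induction with
  | zero => simp only [map_zero, and_self]
  | add x y _ _ hx hy => simp only [map_add, hx.1, hx.2, hy.1, hy.2, add_zero, and_self]
  | smul r x _ hx => simp only [map_smul, hx.1, hx.2, smul_zero, and_self]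
  | mem w hw =>
    obtain ⟨xs, -, rfl⟩ := hw
    induction xs with
    | nil => simp only [word_nil, contractWord_one l (by decide : (0 : Fin 3) ≠ 2),
        contractWord_one l (by decide : (1 : Fin 3) ≠ 2), map_zero, and_self]
    | cons x xs ih =>
      rw [word_cons, contractWord_zero_letter, contractWord_one_letter, map_sub, map_sub, map_sub,
        map_neg, h1, h1', h2, h2', h3, ih.1, ih.2]
      simp only [mul_zero, neg_zero, sub_zero, and_self]

theorem contract_contract (c : Chains K[X] (KoszulAlg 𝒜)) :
    contract 𝒜 l (contract 𝒜 l c) = 0 := by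
  induction c using TensorProduct.induction_on with
  | zero => simp only [map_zero]
  | tmul a w => rw [contract_tmul, contract_tmul, (contractWord_contractWord w).1,
      TensorProduct.tmul_zero]
  | add x y hx hy => rw [map_add, map_add, hx, hy, add_zero]

theorem epsShuffle_succ_mem {N : Submodule K[X] TW} (hN : ∀ (P : List (ZMod 2 × A)) w,
    word K[X] (P.map (inclL 𝒜)) * (letter K[X] (eps 𝒜) * w) ∈ N) (k : ℕ)
    (as : List (ZMod 2 × A)) : epsShuffle 𝒜 (k + 1) as ∈ N := by
  induction as generalizing N with
  | nil =>
    have := hN [] (epsShuffle 𝒜 k [])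
    rw [epsShuffle]
    rwa [List.map_nil, word_nil, one_mul] at this
  | cons a as ih =>
    rw [epsShuffle]
    refine add_mem ?_ ?_
    · have := hN [] (epsShuffle 𝒜 k (a :: as))
      rwa [List.map_nil, word_nil, one_mul] at this
    · refine ih (N := N.comap (LinearMap.mulLeft K[X] (letter K[X] (incl 𝒜 a.2)))) fun P w => ?_
      have := hN (a :: P) w
      rwa [List.map_cons, word_cons, mul_assoc] at this

/-- Modulo split words, the shuffle of `ε^k` into a word is given by putting `ε^k` in front. -/
theorem epsShuffle_sub_mem {N : Submodule K[X] TW} (hN : ∀ j (P : List (ZMod 2 × A)) w, P ≠ [] →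
    word K[X] (List.replicate j (epsL 𝒜) ++ P.map (inclL 𝒜)) * (letter K[X] (eps 𝒜) * w) ∈ N)
    (k : ℕ) (as : List (ZMod 2 × A)) :
    epsShuffle 𝒜 k as - word K[X] (List.replicate k (epsL 𝒜) ++ as.map (inclL 𝒜)) ∈ N := by
  induction k generalizing N with
  | zero =>
    have h : epsShuffle 𝒜 0 as = word K[X] (as.map (inclL 𝒜)) := by
      induction as with
      | nil => rw [epsShuffle, List.map_nil, word_nil]
      | cons a as ih => rw [epsShuffle, ih, List.map_cons, word_cons]; rfl
    rw [h, List.replicate_zero, List.nil_append, sub_self]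
    exact zero_mem _
  | succ k ih =>
    have h := ih (N := N.comap (LinearMap.mulLeft K[X] (letter K[X] (eps 𝒜)))) fun j P w hP => by
      have := hN (j + 1) P w hP
      rwa [List.replicate_succ, List.cons_append, word_cons, mul_assoc] at this
    rw [Submodule.mem_comap, LinearMap.mulLeft_apply, mul_sub] at h
    cases as with
    | nil =>
      rwa [epsShuffle, List.replicate_succ, List.cons_append, word_cons]
    | cons a as =>
      rw [epsShuffle, List.replicate_succ, List.cons_append, word_cons, add_sub_right_comm]
      refine add_mem h (epsShuffle_succ_mem
        (N := N.comap (LinearMap.mulLeft K[X] (letter K[X] (incl 𝒜 a.2)))) (fun P w => ?_) k as)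
      have := hN 0 (a :: P) w (List.cons_ne_nil _ _)
      rwa [List.replicate_zero, List.nil_append, List.map_cons, word_cons, mul_assoc] at this

/-- A submodule which contains all split words, as well as the image of the shuffle map and its
product with `ε`, contains the words with letters in `A` preceded by copies of `ε`. -/
theorem pure_mem_of_polarShuffle_mem {M : Submodule K[X] (Chains K[X] (KoszulAlg 𝒜))}
    (h1 : ∀ p, polarShuffle 𝒜 p ∈ M)
    (h2 : ∀ p, iotaElem (gr 𝒜) (eps 𝒜) (polarShuffle 𝒜 p) ∈ M)
    (h3 : ∀ a j (P : List (ZMod 2 × A)) w, P ≠ [] → a ⊗ₜ[K[X]] (word K[X]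
      (List.replicate j (epsL 𝒜) ++ P.map (inclL 𝒜)) * (letter K[X] (eps 𝒜) * w)) ∈ M)
    (b : KoszulAlg 𝒜) (j : ℕ) {P : List (ZMod 2 × A)} (hP : ∀ y ∈ P, Homog 𝒜 y) :
    b ⊗ₜ[K[X]] word K[X] (List.replicate j (epsL 𝒜) ++ P.map (inclL 𝒜)) ∈ M := by
  have key : ∀ b : KoszulAlg 𝒜, b ⊗ₜ[K[X]] epsShuffle 𝒜 j P ∈ M →
      b ⊗ₜ[K[X]] word K[X] (List.replicate j (epsL 𝒜) ++ P.map (inclL 𝒜)) ∈ M := by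
    intro b hb
    have h := epsShuffle_sub_mem (N := M.comap (TensorProduct.mk K[X] _ _ b))
      (fun j P w hP => h3 b j P w hP) j P
    rw [Submodule.mem_comap, map_sub] at h
    have h' := sub_mem hb h
    rwa [TensorProduct.mk_apply, TensorProduct.mk_apply, sub_sub_cancel] at h'
  have htop : M.comap ((TensorProduct.mk K[X] (KoszulAlg 𝒜) _).flip
      (word K[X] (List.replicate j (epsL 𝒜) ++ P.map (inclL 𝒜)))) = ⊤ := by
    refine eq_top_of_mem (fun n a ha => key _ ?_) fun n a ha => key _ ?_
    · have hx : Homog 𝒜 ((n : ZMod 2), a) := ⟨n, rfl, ha⟩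
      have h := incl_tmul_epsShuffle j hx hP
      exact h ▸ zsmul_mem (h1 _) _
    · have hx : Homog 𝒜 ((n : ZMod 2), a) := ⟨n, rfl, ha⟩
      have h := congrArg (iotaElem (gr 𝒜) (eps 𝒜)) (incl_tmul_epsShuffle j hx hP)
      rw [iotaElem_tmul, eps_mul_incl hx, map_zsmul] at h
      have h4 : sgn (n : ZMod 2) • ((sgn (n : ZMod 2) • (incl 𝒜 a * eps 𝒜)) ⊗ₜ[K[X]]
          epsShuffle 𝒜 j P) ∈ M := zsmul_mem (h ▸ zsmul_mem (h2 _) _) _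
      have h5 := sgn_smul_tmul_sgn_smul (R := K[X]) (n : ZMod 2) 0 (incl 𝒜 a * eps 𝒜)
        (epsShuffle 𝒜 j P)
      rw [sgn_zero, one_smul, add_zero] at h5
      rwa [h5, smul_smul, sgn_mul_self, one_smul] at h4
  exact (htop ▸ Submodule.mem_top : b ∈ M.comap _)

end KoszulAlg

/-! ### Retraction onto the shuffles -/

section Retract

variable {R : Type u} [CommRing R] {V : Type v} [AddCommGroup V] [Module R V]
variable (d s : V →ₗ[R] V) (Z : Submodule R V)

/-- The chain map `1 - (ds + sd)`, for an operator `s` on a complex with differential `d`. -/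
def homotopyMap : V →ₗ[R] V := LinearMap.id - (d ∘ₗ s + s ∘ₗ d)

theorem homotopyMap_apply (y : V) : homotopyMap d s y = y - (d (s y) + s (d y)) := rfl

variable {d s Z}

theorem iterate_homotopyMap_of_mem (hZ : ∀ z ∈ Z, d z ∈ Z) (hs : ∀ z ∈ Z, s z = 0) (N : ℕ) {z : V}
    (hz : z ∈ Z) : (homotopyMap d s)^[N] z = z := by
  refine Function.iterate_fixed ?_ N
  rw [homotopyMap_apply, hs z hz, hs _ (hZ z hz), map_zero, add_zero, sub_zero]

variable (d s) in
/-- The elements which are mapped to `Z` by some iterate of `1 - (ds + sd)`, if `Z` is a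
subcomplex annihilated by `s`. -/
def attracted (hZ : ∀ z ∈ Z, d z ∈ Z) (hs : ∀ z ∈ Z, s z = 0) : Submodule R V where
  carrier := {y | ∃ N, (homotopyMap d s)^[N] y ∈ Z}
  zero_mem' := ⟨0, zero_mem _⟩
  add_mem' := by
    rintro x y ⟨M, hx⟩ ⟨N, hy⟩
    refine ⟨N + M, ?_⟩
    rw [iterate_map_add, Function.iterate_add_apply, add_comm N M, Function.iterate_add_apply _ M N,
      iterate_homotopyMap_of_mem hZ hs N hx, iterate_homotopyMap_of_mem hZ hs M hy]
    exact add_mem hx hy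
  smul_mem' := by
    rintro r x ⟨N, hx⟩
    refine ⟨N, ?_⟩
    have h : (homotopyMap d s)^[N] (r • x) = r • (homotopyMap d s)^[N] x := by
      rw [← Module.End.coe_pow, map_smul]
    rw [h]
    exact Z.smul_mem r hx

theorem mem_attracted_of_mem (hZ : ∀ z ∈ Z, d z ∈ Z) (hs : ∀ z ∈ Z, s z = 0) {z : V} (hz : z ∈ Z) :
    z ∈ attracted d s hZ hs := ⟨0, hz⟩

theorem mem_attracted_of_homotopyMap (hZ : ∀ z ∈ Z, d z ∈ Z) (hs : ∀ z ∈ Z, s z = 0) {y : V}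
    (hy : homotopyMap d s y ∈ attracted d s hZ hs) : y ∈ attracted d s hZ hs := by
  obtain ⟨N, hN⟩ := hy
  exact ⟨N + 1, hN⟩

/-- A cocycle which is mapped to `Z` by an iterate of `1 - (ds + sd)` is cohomologous to an element
of `Z`. -/
theorem exists_eq_add_of_attracted (hd : ∀ y, d (d y) = 0) {N : ℕ} {y : V}
    (hN : (homotopyMap d s)^[N] y ∈ Z) (hy : d y = 0) : ∃ z ∈ Z, ∃ v, y = z + d v := by
  induction N generalizing y with
  | zero => exact ⟨y, hN, 0, by rw [map_zero, add_zero]⟩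
  | succ N ih =>
    obtain ⟨z, hz, v, h⟩ := ih (y := homotopyMap d s y) hN (by
      rw [homotopyMap_apply, hy, map_zero, add_zero, map_sub, hd, hy, sub_zero])
    refine ⟨z, hz, v + s y, ?_⟩
    rw [map_add, ← add_assoc, ← h, homotopyMap_apply, hy, map_zero, add_zero, sub_add_cancel]

/-- If an iterate of `1 - (ds + sd)` maps `y` to `Z`, and `dy` lies in `Z`, then `dy` is the
differential of an element of `Z`: the iterates commute with `d` and are the identity on `Z`. -/
theorem exists_eq_of_attracted (hd : ∀ y, d (d y) = 0) (hZ : ∀ z ∈ Z, d z ∈ Z)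
    (hs : ∀ z ∈ Z, s z = 0) {N : ℕ} {y : V} (hN : (homotopyMap d s)^[N] y ∈ Z) (hy : d y ∈ Z) :
    ∃ z ∈ Z, d y = d z := by
  refine ⟨_, hN, ?_⟩
  have h : Function.Semiconj d (homotopyMap d s) (homotopyMap d s) := fun x => by
    rw [homotopyMap_apply, homotopyMap_apply, map_sub, map_add, hd, hd, map_zero, zero_add,
      add_zero]
  rw [h.iterate_right N y, iterate_homotopyMap_of_mem hZ hs N hy]

end Retract

namespace KoszulAlg

variable {K : Type u} [Field K] {A : Type v} [Ring A] [Algebra K A]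
variable (𝒜 : ℤ → Submodule K A) [GradedAlgebra 𝒜]

attribute [local instance] polarZero

theorem smul_polyShuffle_mem (r : K[X]) (p : ℕ →₀ PolarChains K A) :
    ∃ q, r • polyShuffle 𝒜 p = polyShuffle 𝒜 q := by
  suffices h : r • polyShuffle 𝒜 p ∈ LinearMap.range (polyShuffle 𝒜) from
    let ⟨q, hq⟩ := h; ⟨q, hq.symm⟩
  induction p using Finsupp.induction_linear with
  | zero => rw [map_zero, smul_zero]; exact zero_mem _
  | add x y hx hy => rw [map_add, smul_add]; exact add_mem hx hy
  | single m x =>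
    induction r using Polynomial.induction_on' with
    | add r s hr hs => rw [add_smul]; exact add_mem hr hs
    | monomial n a =>
      refine ⟨Finsupp.single (n + m) (a • x), ?_⟩
      rw [polyShuffle_single, polyShuffle_single, map_smul, smul_smul,
        ← Polynomial.C_mul_X_pow_eq_monomial, mul_assoc, ← pow_add, mul_comm, mul_smul,
        ← algebraMap_smul K[X] a, Polynomial.C_eq_algebraMap]

/-- The sum of the `K[t]`-submodule spanned by the image of the shuffle map, and of its product
with `ε`. -/
def shuffleSpan : Submodule K[X] (Chains K[X] (KoszulAlg 𝒜)) where
  carrier := {z | ∃ p q, z = polyShuffle 𝒜 p + iotaElem (gr 𝒜) (eps 𝒜) (polyShuffle 𝒜 q)}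
  zero_mem' := ⟨0, 0, by simp only [map_zero, add_zero]⟩
  add_mem' := by
    rintro _ _ ⟨p, q, rfl⟩ ⟨p', q', rfl⟩
    exact ⟨p + p', q + q', by simp only [map_add]; abel⟩
  smul_mem' := by
    rintro r _ ⟨p, q, rfl⟩
    obtain ⟨p', hp⟩ := smul_polyShuffle_mem 𝒜 r p
    obtain ⟨q', hq⟩ := smul_polyShuffle_mem 𝒜 r q
    exact ⟨p', q', by rw [smul_add, hp, ← map_smul, hq]⟩

variable {𝒜}

theorem polyShuffle_zero (x : PolarChains K A) :
    polyShuffle 𝒜 (Finsupp.single 0 x) = polarShuffle 𝒜 x := by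
  rw [polyShuffle_single, pow_zero, one_smul]

/-- A `K[t]`-linear map which vanishes on the image of the shuffle map vanishes on the subspace
spanned by it. -/
theorem map_polyShuffle_eq_zero {M : Type*} [AddCommGroup M] [Module K[X] M]
    {f : Chains K[X] (KoszulAlg 𝒜) →ₗ[K[X]] M} (hf : ∀ x, f (polarShuffle 𝒜 x) = 0)
    (p : ℕ →₀ PolarChains K A) : f (polyShuffle 𝒜 p) = 0 := by
  induction p using Finsupp.induction_linear with
  | zero => rw [map_zero, map_zero]
  | add x y hx hy => rw [map_add, map_add, hx, hy, add_zero]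
  | single m x => rw [polyShuffle_single, map_smul, hf, smul_zero]

variable {D : DGStructure 𝒜} (W : CentralCocycle D)

/-- The map `t - W` on polynomials in `t`. -/
def shiftSub : (ℕ →₀ PolarChains K A) →ₗ[K] (ℕ →₀ PolarChains K A) :=
  Finsupp.lsum K fun m : ℕ =>
    (Finsupp.lsingle (m + 1) : PolarChains K A →ₗ[K] (ℕ →₀ PolarChains K A)) +
      Finsupp.lsingle m ∘ₗ (-qExtend (iotaElem 𝒜 W.val))

theorem shiftSub_single (m : ℕ) (x : PolarChains K A) : shiftSub W (Finsupp.single m x) =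
    Finsupp.single (m + 1) x - Finsupp.single m (qExtend (iotaElem 𝒜 W.val) x) := by
  rw [shiftSub, Finsupp.lsum_single, LinearMap.add_apply, LinearMap.comp_apply, LinearMap.neg_apply,
    map_neg, sub_eq_add_neg]
  rfl

theorem shiftSub_succ (p : ℕ →₀ PolarChains K A) (m : ℕ) :
    shiftSub W p (m + 1) = p m - qExtend (iotaElem 𝒜 W.val) (p (m + 1)) := by
  induction p using Finsupp.induction_linear with
  | zero => simp only [map_zero, Finsupp.zero_apply, sub_zero]
  | add x y hx hy => simp only [map_add, Finsupp.add_apply, hx, hy]; abel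
  | single k x =>
    rw [shiftSub_single, Finsupp.sub_apply, Finsupp.single_apply, Finsupp.single_apply,
      Finsupp.single_apply, Finsupp.single_apply]
    simp only [Nat.add_right_cancel_iff]
    congr 1
    split_ifs <;> simp only [map_zero]

/-- Division by `t - W`. -/
theorem exists_eq_shiftSub_add (p : ℕ →₀ PolarChains K A) :
    ∃ r x, p = shiftSub W r + Finsupp.single 0 x := by
  induction p using Finsupp.induction_linear with
  | zero => exact ⟨0, 0, by simp only [map_zero, Finsupp.single_zero, add_zero]⟩
  | add p q hp hq =>
    obtain ⟨r, x, hr⟩ := hp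
    obtain ⟨s, y, hs⟩ := hq
    exact ⟨r + s, x + y, by rw [hr, hs, map_add, Finsupp.single_add]; abel⟩
  | single m y =>
    induction m generalizing y with
    | zero => exact ⟨0, y, by rw [map_zero, zero_add]⟩
    | succ m ih =>
      obtain ⟨r, x, h⟩ := ih (qExtend (iotaElem 𝒜 W.val) y)
      refine ⟨r + Finsupp.single m y, x, ?_⟩
      rw [map_add, shiftSub_single, h]
      abel

/-- Division by `t - W` is unique. -/
theorem eq_zero_of_shiftSub_add {r : ℕ →₀ PolarChains K A} {x : PolarChains K A}
    (h : shiftSub W r + Finsupp.single 0 x = 0) : r = 0 ∧ x = 0 := by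
  have hr : ∀ m, r (m + 1) = 0 → r m = 0 := fun m hm => by
    have := DFunLike.congr_fun h (m + 1)
    rwa [Finsupp.add_apply, shiftSub_succ, hm, map_zero, sub_zero, Finsupp.single_apply,
      if_neg (Nat.succ_ne_zero m).symm, add_zero, Finsupp.zero_apply] at this
  obtain ⟨N, hN⟩ : ∃ N, ∀ m, N ≤ m → r m = 0 := by
    obtain ⟨N, hN⟩ := r.support.bddAbove
    refine ⟨N + 1, fun m hm => by_contra fun h => ?_⟩
    have := hN (Finsupp.mem_support_iff.mpr h)
    omega
  have h0 : r = 0 := by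
    refine Finsupp.ext fun m => ?_
    obtain hm | hm := le_total N m
    · exact hN m hm
    · exact Nat.decreasingInduction (motive := fun k _ => r k = 0) (fun k _ hk => hr k hk)
        (hN N le_rfl) hm
  refine ⟨h0, ?_⟩
  rwa [h0, map_zero, zero_add, Finsupp.single_eq_zero] at h

/-- The extension of the curved Hochschild differential to polynomials in `t`. -/
abbrev curvedPoly : (ℕ →₀ PolarChains K A) →ₗ[K] (ℕ →₀ PolarChains K A) :=
  Finsupp.mapRange.linearMap (curvedHochschild W)

theorem hochschild_polyShuffle (p : ℕ →₀ PolarChains K A) :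
    (dgStructure W).hochschild (polyShuffle 𝒜 p) = polyShuffle 𝒜 (curvedPoly W p) := by
  induction p using Finsupp.induction_linear with
  | zero => simp only [map_zero]
  | add x y hx hy => simp only [map_add, hx, hy]
  | single m x =>
    rw [polyShuffle_single, map_smul, hochschild_polarShuffle, curvedPoly,
      Finsupp.mapRange.linearMap_apply, Finsupp.mapRange_single, polyShuffle_single]

theorem hochschild_iotaElem_polyShuffle (p : ℕ →₀ PolarChains K A) :
    (dgStructure W).hochschild (iotaElem (gr 𝒜) (eps 𝒜) (polyShuffle 𝒜 p)) =
      polyShuffle 𝒜 (shiftSub W p) -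
        iotaElem (gr 𝒜) (eps 𝒜) (polyShuffle 𝒜 (curvedPoly W p)) := by
  induction p using Finsupp.induction_linear with
  | zero => simp only [map_zero, sub_zero]
  | add x y hx hy => simp only [map_add, hx, hy]; abel
  | single m x =>
    rw [curvedPoly, Finsupp.mapRange.linearMap_apply, Finsupp.mapRange_single, polyShuffle_single,
      polyShuffle_single, map_smul, map_smul, map_smul, shiftSub_single, map_sub,
      polyShuffle_single, polyShuffle_single, pow_succ, mul_smul, ← smul_sub, ← smul_sub,
      eq_sub_of_add_eq (hochschild_iotaElem_polarShuffle W x)]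

theorem hochschild_mem_shuffleSpan {z : Chains K[X] (KoszulAlg 𝒜)} (hz : z ∈ shuffleSpan 𝒜) :
    (dgStructure W).hochschild z ∈ shuffleSpan 𝒜 := by
  obtain ⟨p, q, rfl⟩ := hz
  refine ⟨curvedPoly W p + shiftSub W q, -curvedPoly W q, ?_⟩
  rw [map_add, hochschild_polyShuffle, hochschild_iotaElem_polyShuffle]
  simp only [map_add, map_neg]
  abel

theorem contract_of_mem_shuffleSpan {l : A →ₗ[K] K} (hl : l 1 = 1)
    {z : Chains K[X] (KoszulAlg 𝒜)} (hz : z ∈ shuffleSpan 𝒜) : contract 𝒜 l z = 0 := by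
  obtain ⟨p, q, rfl⟩ := hz
  rw [map_add, map_polyShuffle_eq_zero (contract_polarShuffle hl),
    ← LinearMap.comp_apply, map_polyShuffle_eq_zero (contract_iotaElem_polarShuffle hl), add_zero]

variable (𝒜) in
/-- The projection to `A[t]`. -/
def constC : KoszulAlg 𝒜 →ₗ[K[X]] KoszulAlg 𝒜 where
  toFun x := ⟨x.c, 0⟩
  map_add' x y := by ext1 <;> simp
  map_smul' r x := by ext1 <;> simp

variable (𝒜) in
/-- The projection of chains `a₀(a₁|…|a_l)` induced by the projection of `a₀` to `A[t]`. -/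
def headC : Chains K[X] (KoszulAlg 𝒜) →ₗ[K[X]] Chains K[X] (KoszulAlg 𝒜) :=
  TensorProduct.map (constC 𝒜) LinearMap.id

theorem headC_polyShuffle (p : ℕ →₀ PolarChains K A) :
    headC 𝒜 (polyShuffle 𝒜 p) = polyShuffle 𝒜 p := by
  refine sub_eq_zero.mp (map_polyShuffle_eq_zero (f := headC 𝒜 - LinearMap.id)
    (fun x => LinearMap.mem_ker.mp (polarShuffle_induction (fun k x xs _ _ => ?_) x)) p)
  rw [LinearMap.mem_ker, LinearMap.sub_apply, headC, TensorProduct.map_tmul, LinearMap.id_apply,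
    LinearMap.id_apply]
  exact sub_self _

theorem headC_iotaElem_polyShuffle (p : ℕ →₀ PolarChains K A) :
    headC 𝒜 (iotaElem (gr 𝒜) (eps 𝒜) (polyShuffle 𝒜 p)) = 0 := by
  refine map_polyShuffle_eq_zero (f := headC 𝒜 ∘ₗ iotaElem (gr 𝒜) (eps 𝒜))
    (fun x => LinearMap.mem_ker.mp (polarShuffle_induction (fun k x xs _ _ => ?_) x)) p
  rw [LinearMap.mem_ker, LinearMap.comp_apply, iotaElem_tmul, headC, TensorProduct.map_tmul,
    show constC 𝒜 (eps 𝒜 * incl 𝒜 x.2) = 0 by ext1 <;> simp [constC, eps, incl],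
    TensorProduct.zero_tmul]

theorem eq_zero_of_polyShuffle_add {p q : ℕ →₀ PolarChains K A}
    (h : polyShuffle 𝒜 p + iotaElem (gr 𝒜) (eps 𝒜) (polyShuffle 𝒜 q) = 0) : p = 0 := by
  have h1 := congrArg (headC 𝒜) h
  rw [map_add, headC_polyShuffle, headC_iotaElem_polyShuffle, add_zero, map_zero] at h1
  exact (injective_iff_map_eq_zero _).mp (polyShuffle_injective 𝒜) _ h1

/-- Every chain of `A[t,ε]` is mapped to the span of the shuffles by some iterate of the chain
map associated to the contraction. -/
theorem exists_iterate_mem_shuffleSpan [Nontrivial A] : ∃ s : Chains K[X] (KoszulAlg 𝒜) →ₗ[K[X]]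
    Chains K[X] (KoszulAlg 𝒜), (∀ z ∈ shuffleSpan 𝒜, s z = 0) ∧
      ∀ y, ∃ N, (homotopyMap (dgStructure W).hochschild s)^[N] y ∈ shuffleSpan 𝒜 := by
  obtain ⟨l, hl, h0⟩ := exists_unitFunctional 𝒜
  have hZ : ∀ z ∈ shuffleSpan 𝒜, (dgStructure W).hochschild z ∈ shuffleSpan 𝒜 :=
    fun z => hochschild_mem_shuffleSpan W
  have hs : ∀ z ∈ shuffleSpan 𝒜, contract 𝒜 l z = 0 := fun z => contract_of_mem_shuffleSpan hl
  set G := attracted (dgStructure W).hochschild (contract 𝒜 l) hZ hs with hG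
  -- The chains which are mapped to `G` by the contraction are all chains.
  have h1 : G.comap (contract 𝒜 l) = ⊤ := by
    have hsplit : ∀ a j (P : List (ZMod 2 × A)) w, P ≠ [] → a ⊗ₜ[K[X]] (word K[X]
        (List.replicate j (epsL 𝒜) ++ P.map (inclL 𝒜)) * (letter K[X] (eps 𝒜) * w)) ∈
          G.comap (contract 𝒜 l) := fun a j P w hP => by
      rw [Submodule.mem_comap, contract_split hl a j w hP]
      exact zero_mem _
    refine IsAbsorbing.eq_top (W := W) ⟨hsplit, fun x j P _ hP => pure_mem_of_polarShuffle_mem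
      (fun p => ?_) (fun p => ?_) hsplit x.2 j hP, fun c hc => ?_⟩ hl h0
    · rw [Submodule.mem_comap, contract_polarShuffle hl]
      exact zero_mem _
    · rw [Submodule.mem_comap, contract_iotaElem_polarShuffle hl]
      exact zero_mem _
    · rw [Submodule.mem_comap, map_sub] at hc
      refine mem_attracted_of_homotopyMap hZ hs ?_
      rw [homotopyMap_apply, contract_contract, map_zero, zero_add, ← neg_sub]
      exact neg_mem hc
  have h1' : ∀ y, contract 𝒜 l y ∈ G := fun y => (h1 ▸ Submodule.mem_top : y ∈ G.comap _)
  -- The same argument can now be applied to `G` itself.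
  have h2 : G = ⊤ := by
    have hsplit : ∀ a j (P : List (ZMod 2 × A)) w, P ≠ [] → a ⊗ₜ[K[X]] (word K[X]
        (List.replicate j (epsL 𝒜) ++ P.map (inclL 𝒜)) * (letter K[X] (eps 𝒜) * w)) ∈ G :=
      fun a j P w hP => by
        obtain ⟨c, hc⟩ := exists_contract_eq hl a j w hP
        exact hc ▸ h1' c
    refine IsAbsorbing.eq_top (W := W) ⟨hsplit, fun x j P _ hP => pure_mem_of_polarShuffle_mem
      (fun p => mem_attracted_of_mem hZ hs ⟨Finsupp.single 0 p, 0, ?_⟩)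
      (fun p => mem_attracted_of_mem hZ hs ⟨0, Finsupp.single 0 p, ?_⟩) hsplit x.2 j hP,
      fun c hc => mem_attracted_of_homotopyMap hZ hs ?_⟩ hl h0
    · rw [polyShuffle_zero, map_zero, map_zero, add_zero]
    · rw [polyShuffle_zero, map_zero, zero_add]
    · have h := sub_mem (neg_mem hc) (h1' ((dgStructure W).hochschild c))
      rwa [neg_sub, sub_sub] at h
  exact ⟨_, hs, fun y => (h2 ▸ Submodule.mem_top : y ∈ G)⟩

/-- Division by `t - W` on the span of the shuffles, where `t - W` is the differential of `ε` and
hence is homotopic to zero. -/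
theorem exists_eq_of_mem_shuffleSpan {z : Chains K[X] (KoszulAlg 𝒜)} (hz : z ∈ shuffleSpan 𝒜) :
    ∃ x q v, z = polarShuffle 𝒜 x + iotaElem (gr 𝒜) (eps 𝒜) (polyShuffle 𝒜 q) +
      (dgStructure W).hochschild v := by
  obtain ⟨p, q, rfl⟩ := hz
  obtain ⟨r, x, rfl⟩ := exists_eq_shiftSub_add W p
  refine ⟨x, q + curvedPoly W r, iotaElem (gr 𝒜) (eps 𝒜) (polyShuffle 𝒜 r), ?_⟩
  rw [hochschild_iotaElem_polyShuffle, map_add, polyShuffle_zero]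
  simp only [map_add]
  abel

/-- If the differential of a sum of a shuffle without powers of `t` and of `ε`-multiples of shuffles is
a shuffle without powers of `t`, then the `ε`-multiples vanish, because multiplication with `t - W`
is injective modulo elements without powers of `t`. -/
theorem eq_of_hochschild_eq_polarShuffle {x x' : PolarChains K A} {q : ℕ →₀ PolarChains K A}
    (h : (dgStructure W).hochschild
      (polarShuffle 𝒜 x + iotaElem (gr 𝒜) (eps 𝒜) (polyShuffle 𝒜 q)) = polarShuffle 𝒜 x') :
    q = 0 ∧ curvedHochschild W x = x' := by
  rw [map_add, hochschild_polarShuffle, hochschild_iotaElem_polyShuffle] at h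
  have h1 : polyShuffle 𝒜 (shiftSub W q + Finsupp.single 0 (curvedHochschild W x - x')) +
      iotaElem (gr 𝒜) (eps 𝒜) (polyShuffle 𝒜 (-curvedPoly W q)) = 0 := by
    rw [map_add, polyShuffle_zero, map_sub, ← h, map_neg, map_neg]
    abel
  obtain ⟨h2, h3⟩ := eq_zero_of_shiftSub_add W (eq_zero_of_polyShuffle_add h1)
  exact ⟨h2, sub_eq_zero.mp h3⟩

/-- Every Hochschild cocycle of `A[t,ε]` is cohomologous to the shuffle of a cocycle. -/
theorem exists_polarShuffle_sub_eq [Nontrivial A] {y : Chains K[X] (KoszulAlg 𝒜)}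
    (hy : (dgStructure W).hochschild y = 0) : ∃ x v, curvedHochschild W x = 0 ∧
      polarShuffle 𝒜 x - y = (dgStructure W).hochschild v := by
  obtain ⟨s, -, hN⟩ := exists_iterate_mem_shuffleSpan W
  have hd := (dgStructure W).hochschild_hochschild
  obtain ⟨N, hN⟩ := hN y
  obtain ⟨z, hz, v, rfl⟩ := exists_eq_add_of_attracted hd hN hy
  obtain ⟨x, q, v', rfl⟩ := exists_eq_of_mem_shuffleSpan W hz
  rw [map_add, hd, add_zero, map_add, hd, add_zero, ← map_zero (polarShuffle 𝒜)] at hy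
  obtain ⟨rfl, hx⟩ := eq_of_hochschild_eq_polarShuffle W hy
  refine ⟨x, -(v' + v), hx, ?_⟩
  rw [map_zero, map_zero, map_neg, map_add]
  abel

/-- If the shuffle of a chain is a Hochschild coboundary, then so is that chain. -/
theorem exists_curvedHochschild_eq [Nontrivial A] {x : PolarChains K A}
    {y : Chains K[X] (KoszulAlg 𝒜)} (hy : (dgStructure W).hochschild y = polarShuffle 𝒜 x) :
    ∃ x', curvedHochschild W x' = x := by
  obtain ⟨s, hs, hN⟩ := exists_iterate_mem_shuffleSpan W
  have hd := (dgStructure W).hochschild_hochschild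
  obtain ⟨N, hN⟩ := hN y
  have hx : polarShuffle 𝒜 x ∈ shuffleSpan 𝒜 :=
    ⟨Finsupp.single 0 x, 0, by rw [polyShuffle_zero, map_zero, map_zero, add_zero]⟩
  obtain ⟨z, hz, h⟩ := exists_eq_of_attracted hd (fun z => hochschild_mem_shuffleSpan W) hs hN
    (hy ▸ hx)
  obtain ⟨x', q, v, rfl⟩ := exists_eq_of_mem_shuffleSpan W hz
  rw [hy, map_add, hd, add_zero] at h
  exact ⟨x', (eq_of_hochschild_eq_polarShuffle W h.symm).2⟩

end KoszulAlg

/-! ### Homogeneous components -/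

section DegProj

variable {R : Type*} [Ring R] {V : Type*} [AddCommGroup V] [Module R V]
variable {R' : Type*} [Ring R'] {V' : Type*} [AddCommGroup V'] [Module R' V']

/-- The maps `π n` are the projections to the pieces of a graded module. -/
structure IsDegProj (deg : ℤ → Submodule R V) (π : ℤ → V →ₗ[R] V) : Prop where
  of_mem : ∀ n, ∀ x ∈ deg n, π n x = x
  of_mem_ne : ∀ m n, m ≠ n → ∀ x ∈ deg m, π n x = 0
  induction : ∀ N : AddSubgroup V, (∀ n, ∀ x ∈ deg n, x ∈ N) → ∀ x, x ∈ N

variable {deg : ℤ → Submodule R V} {π : ℤ → V →ₗ[R] V} {deg' : ℤ → Submodule R' V'}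
  {π' : ℤ → V' →ₗ[R'] V'}

theorem IsDegProj.mem (h : IsDegProj deg π) (n : ℤ) (x : V) : π n x ∈ deg n := by
  refine h.induction ((deg n).toAddSubgroup.comap (π n).toAddMonoidHom) (fun m x hx => ?_) x
  change π n x ∈ deg n
  obtain rfl | hm := eq_or_ne m n
  · rwa [h.of_mem m x hx]
  · rw [h.of_mem_ne m n hm x hx]
    exact zero_mem _

/-- A homogeneous map commutes with the projections. -/
theorem IsDegProj.map (h : IsDegProj deg π) (h' : IsDegProj deg' π') (f : V →+ V') (k : ℤ)
    (hf : ∀ n, ∀ x ∈ deg n, f x ∈ deg' (n + k)) (n : ℤ) (x : V) :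
    π' (n + k) (f x) = f (π n x) := by
  refine h.induction (((π' (n + k)).toAddMonoidHom.comp f).eqLocus
    (f.comp (π n).toAddMonoidHom)) (fun m x hx => ?_) x
  change π' (n + k) (f x) = f (π n x)
  obtain rfl | hm := eq_or_ne m n
  · rw [h.of_mem m x hx, h'.of_mem _ _ (hf m x hx)]
  · rw [h.of_mem_ne m n hm x hx, map_zero,
      h'.of_mem_ne _ _ (fun e => hm (add_right_cancel e)) _ (hf m x hx)]

end DegProj

section Chains

variable {R : Type u} [CommRing R] {A : Type v} [Ring A] [Algebra R A]
variable (𝒜 : ℤ → Submodule R A) [GradedAlgebra 𝒜]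

/-- The map which to `a` of degree `n` associates `f(a) T^{n+s}`, where `T` is a formal variable. -/
def markDeg {S : Type w} [Ring S] [Algebra R S] (f : A →ₗ[R] S) (s : ℤ) :
    A →ₗ[R] AddMonoidAlgebra S ℤ :=
  (DirectSum.toModule R ℤ _ fun n =>
    AddMonoidAlgebra.lsingle (n + s) ∘ₗ f ∘ₗ (𝒜 n).subtype) ∘ₗ
    (DirectSum.decomposeLinearEquiv 𝒜).toLinearMap

theorem markDeg_of_mem {S : Type w} [Ring S] [Algebra R S] (f : A →ₗ[R] S) (s : ℤ) {n : ℤ} {a : A}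
    (ha : a ∈ 𝒜 n) : markDeg 𝒜 f s a = AddMonoidAlgebra.single (n + s) (f a) := by
  have h : DirectSum.decompose 𝒜 a = DirectSum.lof R ℤ (fun i => 𝒜 i) n ⟨a, ha⟩ :=
    DirectSum.decompose_of_mem 𝒜 ha
  rw [markDeg, LinearMap.comp_apply, LinearEquiv.coe_coe, DirectSum.decomposeLinearEquiv_apply, h,
    DirectSum.toModule_lof]
  rfl

/-- The algebra map which multiplies words of degree `n` with `T^n`, where `T` is a formal
variable. -/
def markWord : TensorAlgebra R (ReducedPart R A) →ₐ[R] AddMonoidAlgebra (Chains R A) ℤ :=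
  TensorAlgebra.lift R (descend
    (markDeg 𝒜 (TensorProduct.mk R A (TensorAlgebra R (ReducedPart R A)) 1 ∘ₗ letter R) (-1)) (by
      rw [markDeg_of_mem 𝒜 _ _ (SetLike.GradedOne.one_mem (A := 𝒜)), LinearMap.comp_apply,
        letter_one, map_zero, AddMonoidAlgebra.single_zero]))

variable {𝒜} in
theorem markWord_word {xs : List (ZMod 2 × A)} {n : ℤ} (h : ListDeg 𝒜 xs n) :
    markWord 𝒜 (word R xs) = AddMonoidAlgebra.single n ((1 : A) ⊗ₜ[R] word R xs) := by
  induction xs generalizing n with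
  | nil =>
    obtain rfl : n = 0 := h
    rw [word_nil, map_one]
    rfl
  | cons x xs ih =>
    obtain ⟨m, hx, hxs⟩ := h
    have h1 : markWord 𝒜 (letter R x.2) =
        AddMonoidAlgebra.single (m + -1) ((1 : A) ⊗ₜ[R] letter R x.2) := by
      refine Eq.trans ?_ (markDeg_of_mem 𝒜 (TensorProduct.mk R A (TensorAlgebra R (ReducedPart R A)) 1
        ∘ₗ letter R) (-1) hx.2)
      simp [markWord, letter, descend]
    rw [word_cons, map_mul, h1, ih hxs, AddMonoidAlgebra.single_mul_single,
      Algebra.TensorProduct.tmul_mul_tmul, one_mul]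
    congr 1
    ring

/-- The map which multiplies chains of degree `n` with `T^n`, where `T` is a formal variable. -/
def markChains : Chains R A →ₗ[R] AddMonoidAlgebra (Chains R A) ℤ :=
  TensorProduct.lift ((LinearMap.mul R (AddMonoidAlgebra (Chains R A) ℤ)).compl₁₂
    (markDeg 𝒜 ((TensorProduct.mk R A (TensorAlgebra R (ReducedPart R A))).flip 1) 0)
    (markWord 𝒜).toLinearMap)

variable {𝒜} in
theorem markChains_of_mem {n : ℤ} {c : Chains R A} (hc : c ∈ chainsDeg 𝒜 n) :
    markChains 𝒜 c = AddMonoidAlgebra.single n c := by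
  suffices h : chainsDeg 𝒜 n ≤ LinearMap.eqLocus (markChains 𝒜) (AddMonoidAlgebra.lsingle n) from
    h hc
  refine chainsDeg_le fun x xs m k hx hxs hn => ?_
  change markChains 𝒜 _ = AddMonoidAlgebra.single n _
  rw [markChains, TensorProduct.lift.tmul, LinearMap.compl₁₂_apply, markDeg_of_mem 𝒜 _ _ hx.2,
    AlgHom.toLinearMap_apply, markWord_word hxs, LinearMap.mul_apply',
    AddMonoidAlgebra.single_mul_single, LinearMap.flip_apply, TensorProduct.mk_apply,
    Algebra.TensorProduct.tmul_mul_tmul, one_mul, mul_one, add_zero, hn]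

/-- The projection of chains to the part of degree `n`. -/
def chainsProj (n : ℤ) : Chains R A →ₗ[R] Chains R A :=
  Finsupp.lapply n ∘ₗ (AddMonoidAlgebra.coeffLinearEquiv R).toLinearMap ∘ₗ markChains 𝒜

theorem isDegProj_chains : IsDegProj (chainsDeg 𝒜) (chainsProj 𝒜) where
  of_mem n c hc := by
    change (markChains 𝒜 c).coeff n = c
    rw [markChains_of_mem hc, AddMonoidAlgebra.coeff_single, Finsupp.single_eq_same]
  of_mem_ne m n hm c hc := by
    change (markChains 𝒜 c).coeff n = 0
    rw [markChains_of_mem hc, AddMonoidAlgebra.coeff_single, Finsupp.single_eq_of_ne hm.symm]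
  induction N hN c := by
    have h : ⨆ n, chainsDeg 𝒜 n = ⊤ := by
      rw [eq_top_iff, ← span_chains_homog 𝒜, Submodule.span_le]
      rintro _ ⟨x, xs, ⟨m, hx⟩, hxs, rfl⟩
      obtain ⟨n, hn⟩ := exists_listDeg hxs
      exact Submodule.mem_iSup_of_mem (m + n) (mem_chainsDeg hx hn rfl)
    exact Submodule.iSup_induction (motive := (· ∈ N)) _ (h ▸ Submodule.mem_top : c ∈ ⨆ n, chainsDeg 𝒜 n) hN
      N.zero_mem fun x y => N.add_mem (x := x) (y := y)

end Chains

section Polar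

variable {K : Type u} [Field K] {A : Type v} [Ring A] [Algebra K A]
variable (𝒜 : ℤ → Submodule K A) [GradedAlgebra 𝒜]

/-- The projection of polar chains to the part of degree `n`. -/
def polarProj (n : ℤ) : PolarChains K A →ₗ[K] PolarChains K A :=
  Finsupp.lsum K fun k : ℕ => Finsupp.lsingle k ∘ₗ chainsProj 𝒜 (n + 2 * ((k : ℤ) + 1))

theorem polarProj_single (n : ℤ) (k : ℕ) (c : Chains K A) :
    polarProj 𝒜 n (Finsupp.single k c) =
      Finsupp.single k (chainsProj 𝒜 (n + 2 * ((k : ℤ) + 1)) c) := by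
  simp [polarProj]

theorem polarProj_apply (n : ℤ) (x : PolarChains K A) (k : ℕ) :
    polarProj 𝒜 n x k = chainsProj 𝒜 (n + 2 * ((k : ℤ) + 1)) (x k) := by
  induction x using Finsupp.induction_linear with
  | zero => simp only [map_zero, Finsupp.zero_apply]
  | add x y hx hy => simp only [map_add, Finsupp.add_apply, hx, hy]
  | single j c =>
    rw [polarProj_single]
    obtain rfl | h := eq_or_ne j k
    · rw [Finsupp.single_eq_same, Finsupp.single_eq_same]
    · rw [Finsupp.single_eq_of_ne h.symm, Finsupp.single_eq_of_ne h.symm, map_zero]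

theorem isDegProj_polar : IsDegProj (polarDeg 𝒜) (polarProj 𝒜) where
  of_mem n x hx := Finsupp.ext fun k => by
    rw [polarProj_apply, (isDegProj_chains 𝒜).of_mem _ _ (hx k)]
  of_mem_ne m n hm x hx := Finsupp.ext fun k => by
    rw [polarProj_apply, (isDegProj_chains 𝒜).of_mem_ne _ _ (fun h => hm (add_right_cancel h)) _
      (hx k), Finsupp.zero_apply]
  induction N hN x := by
    induction x using Finsupp.induction_linear with
    | zero => exact N.zero_mem
    | add x y hx hy => exact N.add_mem hx hy
    | single k c =>
      refine (isDegProj_chains 𝒜).induction (N.comap (Finsupp.singleAddHom k))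
        (fun n c hc => hN (n - 2 * ((k : ℤ) + 1)) _ fun j => ?_) c
      change Finsupp.single k c j ∈ _
      obtain rfl | h := eq_or_ne k j
      · rwa [Finsupp.single_eq_same, sub_add_cancel]
      · rw [Finsupp.single_eq_of_ne h.symm]
        exact zero_mem _

variable {𝒜} {D : DGStructure 𝒜} (W : CentralCocycle D)

theorem polarShuffle_polarProj (n : ℤ) (x : PolarChains K A) :
    polarShuffle 𝒜 (polarProj 𝒜 n x) =
      chainsProj (KoszulAlg.gr 𝒜) (n + 2) (polarShuffle 𝒜 x) :=
  ((isDegProj_polar 𝒜).map (isDegProj_chains (KoszulAlg.gr 𝒜))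
    (polarShuffle 𝒜).toAddMonoidHom 2 polarShuffle_mem n x).symm

theorem curvedHochschild_polarProj (n : ℤ) (x : PolarChains K A) :
    curvedHochschild W (polarProj 𝒜 n x) = polarProj 𝒜 (n + 1) (curvedHochschild W x) :=
  ((isDegProj_polar 𝒜).map (isDegProj_polar 𝒜)
    (curvedHochschild W).toAddMonoidHom 1 (curvedHochschild_mem W) n x).symm

theorem hochschild_chainsProj {R : Type*} [CommRing R] {A : Type*} [Ring A] [Algebra R A]
    {𝒜 : ℤ → Submodule R A} [GradedAlgebra 𝒜] (D : DGStructure 𝒜) (n : ℤ) (c : Chains R A) :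
    D.hochschild (chainsProj 𝒜 n c) = chainsProj 𝒜 (n + 1) (D.hochschild c) :=
  ((isDegProj_chains 𝒜).map (isDegProj_chains 𝒜)
    D.hochschild.toAddMonoidHom 1 (fun _ _ h => D.hochschild_mem h) n c).symm

/-- The version of `exists_polarShuffle_sub_eq` for homogeneous cocycles. -/
theorem exists_mem_polarShuffle_sub_eq [Nontrivial A] {n : ℤ} {y : Chains K[X] (KoszulAlg 𝒜)}
    (hn : y ∈ chainsDeg (KoszulAlg.gr 𝒜) (n + 2))
    (hy : (KoszulAlg.dgStructure W).hochschild y = 0) :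
    ∃ x ∈ polarDeg 𝒜 n, ∃ v ∈ chainsDeg (KoszulAlg.gr 𝒜) (n + 1), curvedHochschild W x = 0 ∧
      polarShuffle 𝒜 x - y = (KoszulAlg.dgStructure W).hochschild v := by
  obtain ⟨x, v, hx, h⟩ := KoszulAlg.exists_polarShuffle_sub_eq W hy
  refine ⟨polarProj 𝒜 n x, (isDegProj_polar 𝒜).mem n x, chainsProj (KoszulAlg.gr 𝒜) (n + 1) v,
    (isDegProj_chains _).mem _ v, ?_, ?_⟩
  · rw [curvedHochschild_polarProj, hx, map_zero]
  · rw [hochschild_chainsProj, ← h, map_sub, polarShuffle_polarProj, add_assoc, one_add_one_eq_two,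
      (isDegProj_chains _).of_mem _ y hn]

/-- The version of `exists_curvedHochschild_eq` for homogeneous cocycles. -/
theorem exists_mem_curvedHochschild_eq [Nontrivial A] {n : ℤ} {x : PolarChains K A}
    (hn : x ∈ polarDeg 𝒜 n) {y : Chains K[X] (KoszulAlg 𝒜)}
    (hy : (KoszulAlg.dgStructure W).hochschild y = polarShuffle 𝒜 x) :
    ∃ x' ∈ polarDeg 𝒜 (n - 1), curvedHochschild W x' = x := by
  obtain ⟨x', hx⟩ := KoszulAlg.exists_curvedHochschild_eq W hy
  refine ⟨polarProj 𝒜 (n - 1) x', (isDegProj_polar 𝒜).mem _ x', ?_⟩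
  rw [curvedHochschild_polarProj, hx, sub_add_cancel, (isDegProj_polar 𝒜).of_mem n x hn]

end Polar

/-! ### The reduction `u = 0` -/

section Reduction

variable {K : Type u} [Field K] {V : Type v} [AddCommGroup V] [Module K V]
variable {deg : ℤ → Submodule K V}

theorem mem_map_uMul_iff {n : ℤ} {f : ℕ → V} :
    f ∈ (uDeg deg (n - 2)).map (uMul K V) ↔ f ∈ uDeg deg n ∧ f 0 = 0 := by
  refine ⟨?_, fun ⟨hf, h0⟩ => ⟨fun i => f (i + 1), fun i => ?_, funext fun i => ?_⟩⟩
  · rintro ⟨g, hg, rfl⟩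
    have h := uMul_mem _ g hg
    rw [sub_add_cancel] at h
    exact ⟨h, uMul_zero g⟩
  · have h := hf (i + 1)
    rwa [show n - 2 * ((i + 1 : ℕ) : ℤ) = n - 2 - 2 * (i : ℤ) by push_cast; ring] at h
  · cases i with
    | zero => rw [uMul_zero, h0]
    | succ i => rfl

theorem single_mem_uDeg {n : ℤ} {x : V} (hx : x ∈ deg n) : Pi.single 0 x ∈ uDeg deg n := by
  intro i
  cases i with
  | zero => simpa using hx
  | succ i => simp

variable {C : UComplex K (ℕ → V)}

/-- Being a cocycle in the reduction `u = 0` is a condition on the coefficient of `u⁰`. -/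
theorem mem_redCocycles_iff (hC : C.IsComplex) (hdeg : C.deg = uDeg deg) (hu : C.u = uMul K V)
    {n : ℤ} {f : ℕ → V} : f ∈ C.redCocycles n ↔ f ∈ uDeg deg n ∧ C.d f 0 = 0 := by
  have h := hC.d_mem n f
  rw [UComplex.redCocycles, Submodule.mem_inf, Submodule.mem_comap, hdeg, hu,
    show n - 1 = n + 1 - 2 by ring, mem_map_uMul_iff]
  rw [hdeg] at h
  exact ⟨fun h' => ⟨h'.1, h'.2.2⟩, fun h' => ⟨h'.1, h h'.1, h'.2⟩⟩

/-- Being a coboundary in the reduction `u = 0` is a condition on the coefficient of `u⁰`. -/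
theorem mem_redCoboundaries_iff (hC : C.IsComplex) (hdeg : C.deg = uDeg deg) (hu : C.u = uMul K V)
    {δ : V →ₗ[K] V} (hδ : ∀ f, C.d f 0 = δ (f 0)) {n : ℤ} {f : ℕ → V} :
    f ∈ C.redCoboundaries n ↔ f ∈ uDeg deg n ∧ ∃ x ∈ deg (n - 1), f 0 = δ x := by
  have h := hC.d_mem (n - 1)
  rw [sub_add_cancel] at h
  rw [UComplex.redCoboundaries, Submodule.mem_sup, hu]
  simp only [hdeg, mem_map_uMul_iff] at h ⊢
  constructor
  · rintro ⟨_, ⟨g, hg, rfl⟩, k, ⟨hk, h0⟩, rfl⟩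
    refine ⟨add_mem (h g hg) hk, g 0, by simpa using hg 0, ?_⟩
    rw [Pi.add_apply, h0, add_zero, hδ]
  · rintro ⟨hf, x, hx, h0⟩
    have hx' := single_mem_uDeg hx
    refine ⟨C.d (Pi.single 0 x), ⟨_, hx', rfl⟩, f - C.d (Pi.single 0 x),
      ⟨sub_mem hf (h _ hx'), ?_⟩, add_sub_cancel _ _⟩
    rw [Pi.sub_apply, hδ, Pi.single_eq_same, h0, sub_self]

end Reduction

section Cyclic

variable {K : Type u} [Field K] {A : Type v} [Ring A] [Algebra K A]
variable {𝒜 : ℤ → Submodule K A} [GradedAlgebra 𝒜]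
variable {D : DGStructure 𝒜} (W : CentralCocycle D)

theorem cyclicComplexQ_d_zero (f : CyclicQ K A) :
    (cyclicComplexQ W).d f 0 = curvedHochschild W (f 0) := by
  rw [cyclicComplexQ_d, uPair_zero]

theorem cyclicComplexT_d_zero (f : CyclicT 𝒜) : (cyclicComplexT W).d f 0 =
    ((KoszulAlg.dgStructure W).hochschild.restrictScalars K) (f 0) := by
  rw [cyclicComplexT_d, uPair_zero]

theorem isFilteredQuasiIso_shiftedShuffle [Nontrivial A] :
    (cyclicComplexQ W).IsFilteredQuasiIso (cyclicComplexT W) 2 (shiftedShuffle 𝒜) where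
  chainMap := isChainMap_shiftedShuffle W
  injective n f hf h := by
    rw [mem_redCocycles_iff (isComplex_cyclicComplexQ W) rfl rfl] at hf
    rw [mem_redCoboundaries_iff (deg := fun n => (chainsDeg (KoszulAlg.gr 𝒜) n).restrictScalars K)
      (isComplex_cyclicComplexT W) rfl rfl (cyclicComplexT_d_zero W)] at h
    rw [mem_redCoboundaries_iff (isComplex_cyclicComplexQ W) rfl rfl (cyclicComplexQ_d_zero W)]
    obtain ⟨-, y, -, hy⟩ := h
    have h0 : f 0 ∈ polarDeg 𝒜 n := by simpa using hf.1 0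
    obtain ⟨x, hx, h⟩ := exists_mem_curvedHochschild_eq W h0 (y := y) hy.symm
    exact ⟨hf.1, x, hx, h.symm⟩
  surjective n g hg := by
    rw [mem_redCocycles_iff (deg := fun n => (chainsDeg (KoszulAlg.gr 𝒜) n).restrictScalars K)
      (isComplex_cyclicComplexT W) rfl rfl, cyclicComplexT_d_zero] at hg
    have h0 : g 0 ∈ chainsDeg (KoszulAlg.gr 𝒜) (n + 2) := by simpa using hg.1 0
    obtain ⟨x, hx, v, hv, h1, h2⟩ := exists_mem_polarShuffle_sub_eq W h0 hg.2
    have hx' : Pi.single 0 x ∈ uDeg (polarDeg 𝒜) n := single_mem_uDeg hx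
    refine ⟨Pi.single 0 x, ?_, ?_⟩
    · rw [mem_redCocycles_iff (isComplex_cyclicComplexQ W) rfl rfl, cyclicComplexQ_d_zero,
        Pi.single_eq_same]
      exact ⟨hx', h1⟩
    · rw [mem_redCoboundaries_iff (deg := fun n => (chainsDeg (KoszulAlg.gr 𝒜) n).restrictScalars K)
      (isComplex_cyclicComplexT W) rfl rfl (cyclicComplexT_d_zero W)]
      refine ⟨sub_mem ((isChainMap_shiftedShuffle W).map_mem n _ hx') hg.1, v, ?_, ?_⟩
      · rwa [show n + 2 - 1 = n + 1 by ring]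
      · rw [Pi.sub_apply, shiftedShuffle_eq, uPair_zero, Pi.single_eq_same]
        exact h2

end Cyclic

end NCFourier

end

theorem mainTheorem3 {K : Type*} [Field K] {A : Type*} [Ring A] [Nontrivial A] [Algebra K A]
    (𝒜 : ℤ → Submodule K A) [GradedAlgebra 𝒜]
    (D : NCFourier.DGStructure 𝒜) (W : NCFourier.CentralCocycle D) :
    -- both sides are complexes over `K[u]`, and the maps involved are chain maps
    (NCFourier.cyclicComplexQ W).IsComplex ∧
    (NCFourier.cyclicComplexT W).IsComplex ∧
    (NCFourier.cyclicComplexQ W).IsChainMap (NCFourier.cyclicComplexQ W) 2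
      (NCFourier.mulQ K A) ∧
    (NCFourier.cyclicComplexQ W).IsChainMap (NCFourier.cyclicComplexQ W) 0
      (NCFourier.connectionQ W) ∧
    (NCFourier.cyclicComplexT W).IsChainMap (NCFourier.cyclicComplexT W) 0
      (NCFourier.mulT 𝒜) ∧
    (NCFourier.cyclicComplexT W).IsChainMap (NCFourier.cyclicComplexT W) 2
      (NCFourier.connectionT 𝒜) ∧
    -- the shifted shuffle map is a filtered quasi-isomorphism of degree `2`
    (NCFourier.cyclicComplexQ W).IsFilteredQuasiIso (NCFourier.cyclicComplexT W) 2
      (NCFourier.shiftedShuffle 𝒜) ∧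
    -- the strictly commutative diagram
    NCFourier.shiftedShuffle 𝒜 ∘ₗ NCFourier.mulQ K A =
      -(NCFourier.connectionT 𝒜) ∘ₗ NCFourier.shiftedShuffle 𝒜 ∧
    -- the homotopy commutative diagram
    (NCFourier.cyclicComplexQ W).Homotopic (NCFourier.cyclicComplexT W) 2
      (NCFourier.mulT 𝒜 ∘ₗ NCFourier.shiftedShuffle 𝒜)
      (NCFourier.shiftedShuffle 𝒜 ∘ₗ NCFourier.connectionQ W) := by
  open NCFourier in
  exact ⟨isComplex_cyclicComplexQ W, isComplex_cyclicComplexT W, isChainMap_mulQ W,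
    isChainMap_connectionQ W, isChainMap_mulT W, isChainMap_connectionT W,
    isFilteredQuasiIso_shiftedShuffle W, shiftedShuffle_mulQ, homotopic_mulT_connectionQ W⟩
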